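/- **Conventions.** $\mathfrak h$ is the upper half plane, $L_\tau=\mathbb Z\tau+\mathbb Z$, $\boldsymbol e(x)=e^{2\pi i x}$, $q=\boldsymbol e(\tau)$. With $\sum^e_{a,b}=\lim_{M\to\infty}\sum_{a=-M}^{M}\lim_{N\to\infty}\sum_{b=-N}^{N}$ (Eisenstein summation), put $$E_k(\tau,z)=\sum_{a,b\in\mathbb Z}^{e}\frac1{(z+a\tau+b)^k}\ (k\ge1),\qquad e_k(\tau)=\sum^{e}_{(a,b)\ne(0,0)}\frac1{(a\tau+b)^k}\ (k\geq 2),\qquad \wp=E_2-e_2,\quad \wp'=\partial_z\wp=-2E_3,$$ $$\theta(\tau,z)=\sum_{\nu\in\mathbb Z+\frac12}(-1)^{\lfloor\nu\rfloor}\boldsymbol e(\nu z)\,q^{\nu^2/2},\qquad \Theta(\tau,z)=\frac{\theta(\tau,z)}{\frac1{2\pi i}\partial_z\theta(\tau,0)}.$$ For $k\in\mathbb Z$, $m\in\mathbb Q$, $\gamma=\begin{pmatrix}a&b\\c&d\end{pmatrix}\in\mathrm{SL}_2(\mathbb Z)$ and $X=(\lambda,\mu)\in\mathbb R^2$ let $$(\phi|_{k,m}\gamma)(\tau,z)=(c\tau+d)^{-k}\boldsymbol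 e\Bigl(\tfrac{-c\,m z^2}{c\tau+d}\Bigr)\phi\Bigl(\tfrac{a\tau+b}{c\tau+d},\tfrac z{c\tau+d}\Bigr),\qquad (\phi|_mX)(\tau,z)=\boldsymbol e(m(\lambda+\mu)^2)\,\boldsymbol e(m\lambda(\lambda\tau+2z))\,\phi(\tau,z+\lambda\tau+\mu).$$ A function $f$ on $\mathfrak h$ has *moderate growth at* $i\infty$ if for all $C>0$ one has $f(x+iy)=O(e^{Cy})$ as $y\to\infty$, uniformly for $x$ in bounded sets; $\mathrm{Hol}_0(\mathfrak h)$ is the ring of holomorphic $f$ on $\mathfrak h$ such that $\tau\mapsto f(\gamma\tau)$ has moderate growth at $i\infty$ for all $\gamma\in\mathrm{SL}_2(\mathbb Z)$. For a meromorphic function $\phi$ on $\mathfrak h\times\mathbb C$, call $X=(\lambda,\mu)\in\mathbb R^2$ a *constant pole* of $\phi$ if $\lambda\tau+\mu$ is a pole of $\phi(\tau,\cdot)$ for all $\tau\in\mathfrak h$ outside a discrete closed set. A meromorphic function $\phi$ on $\mathfrak h\times \mathbb C$ is called * *strictly meromorphic with respect to $m$* ($\phi\in\mathrm{Mer}_1^{m}$)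 if for every $X\in\mathbb R^2$ either $X$ is a constant pole, or $\tau\mapsto(\phi|_mX)(\tau,0)$ is in $\mathrm{Hol}_0(\mathfrak h)$; * *weakly strictly meromorphic* ($\phi\in\mathrm{Mer}_1^{\rm wk}$) if for every $X=(\lambda,\mu)\in\mathbb R^2$ that is not a constant pole, $\tau\mapsto\phi(\tau,\lambda\tau+\mu)$ is holomorphic on $\mathfrak h$ and, if $\lambda=0$, of moderate growth at $i\infty$. (One has $\mathrm{Mer}^m_1\subset\mathrm{Mer}^{\rm wk}_1$ for all $m$.) A *Jacobi form* of weight $k$, index $m$ and analytic type $\mathcal C$ is a $\phi\in\mathcal C$ with $(\phi|_{k,m}\gamma)|_mX=\phi$ for all $\gamma\in\mathrm{SL}_2(\mathbb Z)$, $X\in\mathbb Z^2$. A *quasi-Jacobi form* of weight $k$, index $m$ and type $\mathcal C$ is the constant term $\phi_{00}$ of a finite sum $\Phi=\sum_{i,j}\phi_{ij}\,\nu^i\xi^j$ with $\phi_{ij}\in\mathcal C$, $\nu(\tau)=\frac1{2i\,\mathrm{Im}\,\tau}$, $\xi(\tau,z)=\frac{\mathrm{Im}\,z}{\mathrm{Im}\,\tau}$,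 for which $(\Phi|_{k,m}\gamma)|_mX=\Phi$ for all $\gamma\in\mathrm{SL}_2(\mathbb Z)$, $X\in\mathbb Z^2$. A form *has its poles in the lattice* if it is holomorphic at all $(\tau,z)$ with $z\notin L_\tau$. Below, $\mathbb C[f_1,\dots,f_r]$ is the $\mathbb C$-algebra of functions generated by $f_1,\dots,f_r$. **Proposition.** Let $m\in\frac12\mathbb Z_{\ge0}$ and let $\phi$ be a Jacobi form of index $m$, some weight $k\in\mathbb Z$ and type $\mathrm{Mer}_1^m$, with its poles in the lattice. Then $$\phi\in\mathbb C[\wp,\wp',e_4]\,\Theta^{2m}.$$ The same holds more generally if $\phi$ is of type $\mathrm{Mer}^{\rm wk}_1$. **Consequence.** Let $J^0$ and $\widetilde J^0$ be the sums, over all weights $k\in\mathbb Z$ and all indices $m\in\mathbb Q_{\ge0}$, of the spaces of Jacobi forms, respectively quasi-Jacobi forms, of type $\mathrm{Mer}^{\rm wk}_1$ with their poles in the lattice. Then $$J^0=\mathbb C[E_2-e_2,E_3,e_4,\Theta],\qquad \widetilde J^0=\mathbb C[E_1,E_2,E_3,e_2,e_4,\Theta].$$ Moreover, the sums over all weights of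 the spaces of Jacobi forms, respectively quasi-Jacobi forms, of index $0$ and type $\mathrm{Mer}_1^0$ with their poles in the lattice are $\mathbb C[E_2-e_2,E_3,e_4]$ and $\mathbb C[E_1,E_2,E_3,e_2,e_4]$. -/

import Mathlib

open UpperHalfPlane hiding I
open Filter Topology
open Complex (I)

noncomputable section

namespace JacobiForms

/-- `e(x) = exp(2πix)`. -/
def ex (x : ℂ) : ℂ := Complex.exp (2 * Real.pi * I * x)

/-- The lattice `L_τ = ℤτ + ℤ`. -/
def lattice (τ : ℍ) : Set ℂ := {z | ∃ a b : ℤ, z = a * (τ : ℂ) + b}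

/-! ### Meromorphic functions on `ℍ × ℂ` -/

/-- `φ` as a function of two complex variables (only its values on `Im > 0` matter). -/
def uncurried (φ : ℍ → ℂ → ℂ) : ℂ × ℂ → ℂ := fun p => φ (ofComplex p.1) p.2

/-- `φ` is holomorphic in two variables around `(τ, z)`. -/
def HolAt (φ : ℍ → ℂ → ℂ) (τ : ℍ) (z : ℂ) : Prop :=
  AnalyticAt ℂ (uncurried φ) ((τ : ℂ), z)

/-- Meromorphic functions of two variables on `ℍ × ℂ`: locally quotients `g / h` of holomorphic
functions, `h` not locally zero. A meromorphic function is represented by the unique function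
that takes the correct value at every point where the meromorphic function is holomorphic,
and the value `0` at all other points (poles and points of indeterminacy). -/
structure IsMeromorphic (φ : ℍ → ℂ → ℂ) : Prop where
  quotient : ∀ (τ : ℍ) (z : ℂ), ∃ g h : ℂ × ℂ → ℂ,
    AnalyticAt ℂ g ((τ : ℂ), z) ∧ AnalyticAt ℂ h ((τ : ℂ), z) ∧
    (∃ᶠ p in 𝓝 ((τ : ℂ), z), h p ≠ 0) ∧
    ∀ᶠ p in 𝓝 ((τ : ℂ), z), h p ≠ 0 → uncurried φ p = g p / h p
  removable : ∀ (τ : ℍ) (z : ℂ), (∃ g h : ℂ × ℂ → ℂ,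
    AnalyticAt ℂ g ((τ : ℂ), z) ∧ AnalyticAt ℂ h ((τ : ℂ), z) ∧
    (∃ᶠ p in 𝓝 ((τ : ℂ), z), h p ≠ 0) ∧
    ∀ᶠ p in 𝓝 ((τ : ℂ), z), h p ≠ 0 → uncurried φ p = g p) → HolAt φ τ z
  zero_of_not_hol : ∀ (τ : ℍ) (z : ℂ), ¬ HolAt φ τ z → φ τ z = 0

/-- All points `(τ, z)` at which `φ` is not holomorphic satisfy `z ∈ L_τ`. -/
def PolesInLattice (φ : ℍ → ℂ → ℂ) : Prop :=
  ∀ (τ : ℍ) (z : ℂ), z ∉ lattice τ → HolAt φ τ z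

/-- `z = λτ + μ` is a pole of `φ(τ, ·)` for all `τ` outside a discrete closed subset of `ℍ`. -/
def GenericPole (φ : ℍ → ℂ → ℂ) (l u : ℝ) : Prop :=
  ∀ᶠ τ : ℍ in codiscrete ℍ, meromorphicOrderAt (φ τ) (l * (τ : ℂ) + u) < 0

/-! ### Growth -/

/-- `f` is holomorphic on the upper half plane. -/
def HolOnH (f : ℍ → ℂ) : Prop :=
  DifferentiableOn ℂ (fun w : ℂ => f (ofComplex w)) {w : ℂ | 0 < w.im}

/-- For all `C > 0`, `f (x + iy) = O(exp(Cy))` as `y → ∞`, uniformly for `x` in bounded sets. -/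
def ModerateAtInfty (f : ℍ → ℂ) : Prop :=
  ∀ C > (0 : ℝ), ∀ A : ℝ, ∃ K Y : ℝ, ∀ x y : ℝ, |x| ≤ A → Y ≤ y →
    ‖f (ofComplex ((x : ℂ) + (y : ℂ) * I))‖ ≤ K * Real.exp (C * y)

/-- The ring `Hol₀(ℍ)` of holomorphic functions of moderate growth at all cusps. -/
def Hol0 (f : ℍ → ℂ) : Prop :=
  HolOnH f ∧ ∀ γ : Matrix.SpecialLinearGroup (Fin 2) ℤ, ModerateAtInfty (fun τ => f (γ • τ))

/-! ### The slash action -/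

/-- `cτ + d`. -/
def cocycle (γ : Matrix.SpecialLinearGroup (Fin 2) ℤ) (τ : ℍ) : ℂ :=
  ((γ.1 1 0 : ℤ) : ℂ) * (τ : ℂ) + ((γ.1 1 1 : ℤ) : ℂ)

/-- The modular slash operator of weight `k` and index `m`. -/
def slashMod (k : ℤ) (m : ℚ) (γ : Matrix.SpecialLinearGroup (Fin 2) ℤ) (φ : ℍ → ℂ → ℂ) :
    ℍ → ℂ → ℂ := fun τ z =>
  cocycle γ τ ^ (-k) * ex (-((γ.1 1 0 : ℤ) : ℂ) * ((m : ℂ) * z ^ 2) / cocycle γ τ) *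
    φ (γ • τ) (z / cocycle γ τ)

/-- The elliptic slash operator of index `m` at `X = (λ, μ)`. -/
def slashEll (m : ℚ) (l u : ℝ) (φ : ℍ → ℂ → ℂ) : ℍ → ℂ → ℂ := fun τ z =>
  ex ((m : ℂ) * ((l : ℂ) + u) ^ 2) * ex ((m : ℂ) * (l * (l * (τ : ℂ) + 2 * z))) *
    φ τ (z + l * (τ : ℂ) + u)

/-- The action of `(γ, (λ, μ)) ∈ SL₂(ℤ) ⋉ ℤ²` of weight `k` and index `m`. -/
def slash (k : ℤ) (m : ℚ) (γ : Matrix.SpecialLinearGroup (Fin 2) ℤ) (l u : ℤ)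
    (φ : ℍ → ℂ → ℂ) : ℍ → ℂ → ℂ :=
  slashEll m (l : ℝ) (u : ℝ) (slashMod k m γ φ)

/-! ### Strictly meromorphic functions -/

/-- `Mer₁^m`: the poles are constant in `τ`, and `(φ|_m X)(τ, 0)` is holomorphic on `ℍ` and of
moderate growth at all cusps, for every real `X = (λ, μ)` that is not a pole. -/
def StrictlyMer (m : ℚ) (φ : ℍ → ℂ → ℂ) : Prop :=
  IsMeromorphic φ ∧ ∀ l u : ℝ,
    GenericPole φ l u ∨ Hol0 (fun τ => slashEll m l u φ τ 0)

/-- The weak variant (the growth condition of weak Jacobi forms): the poles are constant in `τ`,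
`φ(τ, λτ + μ)` is holomorphic on `ℍ` for every real `(λ, μ)` that is not a pole, and
`φ(τ, μ)` is of moderate growth as `τ → i∞` for every real `μ` that is not a pole. -/
def WeakStrictlyMer (φ : ℍ → ℂ → ℂ) : Prop :=
  IsMeromorphic φ ∧
  (∀ l u : ℝ, GenericPole φ l u ∨ HolOnH (fun τ => φ τ (l * (τ : ℂ) + u))) ∧
  ∀ u : ℝ, GenericPole φ 0 u ∨ ModerateAtInfty (fun τ => φ τ (u : ℂ))

/-! ### Jacobi forms and quasi-Jacobi forms of rank one -/

/-- Jacobi forms of analytic type `T`, weight `k` and index `m`. -/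
def IsJacobi (T : (ℍ → ℂ → ℂ) → Prop) (k : ℤ) (m : ℚ) (φ : ℍ → ℂ → ℂ) : Prop :=
  T φ ∧ ∀ (γ : Matrix.SpecialLinearGroup (Fin 2) ℤ) (l u : ℤ), slash k m γ l u φ = φ

/-- `ν(τ) = 1 / (2i Im τ)`. -/
def nu (τ : ℍ) : ℂ := 1 / (2 * I * (τ.im : ℂ))

/-- `ξ(τ, z) = Im z / Im τ`. -/
def xi (τ : ℍ) (z : ℂ) : ℂ := (z.im : ℂ) / (τ.im : ℂ)

/-- The polynomial `∑_{i,j ≤ d} a_{ij} ν^i ξ^j`. -/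
def almostSum (d : ℕ) (a : ℕ → ℕ → ℍ → ℂ → ℂ) : ℍ → ℂ → ℂ := fun τ z =>
  ∑ i ∈ Finset.range (d + 1), ∑ j ∈ Finset.range (d + 1), a i j τ z * nu τ ^ i * xi τ z ^ j

/-- All coefficients `a_{ij}` are holomorphic around `(τ, z)`. -/
def AllHolAt (d : ℕ) (a : ℕ → ℕ → ℍ → ℂ → ℂ) (τ : ℍ) (z : ℂ) : Prop :=
  ∀ i ≤ d, ∀ j ≤ d, HolAt (a i j) τ z

/-- Quasi-Jacobi forms of analytic type `T`, weight `k` and index `m`: the constant terms of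
almost Jacobi forms, i.e. of polynomials in `ν` and `ξ` with coefficients of type `T` that are
invariant under the Jacobi group. The invariance is an identity wherever both sides are defined. -/
def IsQuasiJacobi (T : (ℍ → ℂ → ℂ) → Prop) (k : ℤ) (m : ℚ) (φ : ℍ → ℂ → ℂ) : Prop :=
  ∃ (d : ℕ) (a : ℕ → ℕ → ℍ → ℂ → ℂ),
    (∀ i ≤ d, ∀ j ≤ d, T (a i j)) ∧
    (∀ (γ : Matrix.SpecialLinearGroup (Fin 2) ℤ) (l u : ℤ) (τ : ℍ) (z : ℂ),
      AllHolAt d a τ z →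
      AllHolAt d a (γ • τ) ((z + l * (τ : ℂ) + u) / cocycle γ τ) →
      slash k m γ l u (almostSum d a) τ z = almostSum d a τ z) ∧
    a 0 0 = φ

/-! ### Eisenstein series and the theta function -/

/-- The Kronecker–Eisenstein series `E_k(τ, z)`, by Eisenstein summation. -/
def E (k : ℕ) (τ : ℍ) (z : ℂ) : ℂ :=
  ∑'[SummationFilter.symmetricIcc ℤ] a : ℤ, ∑'[SummationFilter.symmetricIcc ℤ] b : ℤ,
    1 / (z + a * (τ : ℂ) + b) ^ k

/-- The Eisenstein series `e_k(τ)`, by Eisenstein summation, constant in `z`. -/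
def eis (k : ℕ) (τ : ℍ) (_z : ℂ) : ℂ :=
  ∑'[SummationFilter.symmetricIcc ℤ] a : ℤ, ∑'[SummationFilter.symmetricIcc ℤ] b : ℤ,
    if a = 0 ∧ b = 0 then 0 else 1 / ((a : ℂ) * (τ : ℂ) + b) ^ k

/-- The Weierstrass function `℘ = E₂ - e₂`. -/
def wp (τ : ℍ) (z : ℂ) : ℂ := E 2 τ z - eis 2 τ z

/-- `℘' = ∂℘/∂z`. -/
def wp' (τ : ℍ) (z : ℂ) : ℂ := deriv (wp τ) z

/-- The Jacobi theta series `∑_{ν ∈ ℤ + 1/2} (-1)^⌊ν⌋ e(νz) q^{ν²/2}`, with `ν = n + 1/2`. -/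
def theta (τ : ℍ) (z : ℂ) : ℂ :=
  ∑' n : ℤ, (-1 : ℂ) ^ n * ex (((n : ℂ) + 1 / 2) * z) *
    ex (((n : ℂ) + 1 / 2) ^ 2 / 2 * (τ : ℂ))

/-- `Θ(τ, z) = θ(τ, z) / θ'(τ, 0)`, where `θ' = (2πi)⁻¹ ∂θ/∂z`. -/
def Theta (τ : ℍ) (z : ℂ) : ℂ :=
  theta τ z / ((2 * Real.pi * I)⁻¹ * deriv (theta τ) 0)

/-! ### Functions with poles in the lattice -/

/-- The open set of all `(τ, z) ∈ ℍ × ℂ` with `z ∉ L_τ`. A meromorphic function with poles in the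
lattice is determined by its restriction to this set, on which it is holomorphic. -/
def OffLattice : Type := {p : ℍ × ℂ // p.2 ∉ lattice p.1}

/-- Restriction to `z ∉ L_τ`. -/
def res (φ : ℍ → ℂ → ℂ) : OffLattice → ℂ := fun p => φ p.1.1 p.1.2

/-- The sum over all weights `k ∈ ℤ` and all indices `m ∈ S` of the spaces of forms with poles in
the lattice, for a notion of form `J`. -/
def latticeForms (J : ℤ → ℚ → (ℍ → ℂ → ℂ) → Prop) (S : Set ℚ) : Submodule ℂ (OffLattice → ℂ) :=
  Submodule.span ℂ
    {f | ∃ (k : ℤ) (m : ℚ) (φ : ℍ → ℂ → ℂ), m ∈ S ∧ J k m φ ∧ PolesInLattice φ ∧ f = res φ}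

/-- The algebra `ℂ[s]` generated by a set of functions. -/
def genAlg (s : Set (OffLattice → ℂ)) : Subalgebra ℂ (OffLattice → ℂ) := Algebra.adjoin ℂ s

end JacobiForms

end

open JacobiForms

open JacobiForms
open scoped Manifold MatrixGroups ModularForm

/-! ### Functions of two complex variables -/

/-! Θ has weight -1 and index 1/2 and vanishes only on the lattice, so dividing a Jacobi form of
index N/2 by Θ^N gives a function ψ of index 0: elliptic in z, modular of weight k + N, holomorphic
off the lattice. The order of its pole along z = 0 is bounded uniformly in τ. Near a generic τ this
comes from a local quotient representation, and it spreads over the connected half plane by Cauchy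
integrals (`ExtendsAt.of_isPreconnected`, `exists_leadAt`).

The leading Laurent coefficient of ψ at z = 0 is weakly modular. Subtracting this coefficient times
℘^j or E₃ ℘^i lowers the pole order. Simple poles do not occur, and a form without a pole is
constant in z by Liouville. Hence ψ is a polynomial Σ A_j ℘^j + E₃ Σ B_j ℘^j with weakly modular
coefficients (`IsEll.exists_repr`). At real z = u the function ℘(τ, u) tends to π²/sin²(πu) - π²/3
as τ → i∞, which is injective on (0, 1/2). The growth condition at real points therefore passes to
the A_j and B_j by inverting a Vandermonde matrix, with parity in z separating the two families
(`moderateAtInfty_repr`). The coefficients are thus modular forms of level one, that is, polynomials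
in E₄ and E₆, and the Weierstrass cubic expresses E₆ through ℘, ℘' and E₄ (`exists_E_six`). If 2m is
not an integer, the translations by 1 and τ act incompatibly and the form is zero.

Conversely, the generators have bounded poles and the required growth (`Tame`). Products of
generators inherit this, and their normalized representatives `holExtend` are genuine forms. At
lattice points where the singularity is removable, growth comes from the maximum principle.

For quasi-Jacobi forms, ν and ξ are algebraically independent over holomorphic functions
(`eq_zero_of_nu_xi`), so invariance is an identity of polynomials in two free variables X, Y.
Evaluating it where the transformed variables vanish leaves only the constant term. Interpolation at
enough such points shows that all coefficients have their poles in the lattice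
(`AlmostInv.polesInLattice`). In the variables e₂ - 2πiν and E₁ + 2πiξ the group acts by scaling, so
the new coefficients are invariant of index m and the first part applies to them. Setting ν = ξ = 0
writes the constant term as a polynomial in e₂ and E₁ over these coefficients
(`AlmostInv.slashInv_jacobiCoeff`, `constantTerm_eq`). -/

/-- Everything is moved into the Banach algebra of continuous functions on the parameter interval of
the circle. There s ↦ k(s, ·) is analytic as a vector-valued Cauchy integral, the kernel is an
inverse in the algebra, and integration is a continuous linear functional. Joint analyticity is then
that of a composition. -/
theorem analyticAt_circleIntegral_param {c w₀ : ℂ} {R r : ℝ} (hR : 0 < R) (hr : 0 < r)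
    {k : ℂ → ℂ → ℂ}
    (hk : ContinuousOn (Function.uncurry k) (Metric.closedBall c R ×ˢ Metric.sphere w₀ r))
    (hd : ∀ t ∈ Metric.sphere w₀ r, DifferentiableOn ℂ (fun s => k s t) (Metric.ball c R))
    {p : ℂ × ℂ} (hp : p ∈ Metric.ball c R ×ˢ Metric.ball w₀ r) :
    AnalyticAt ℂ (fun q : ℂ × ℂ => ∮ t in C(w₀, r), (t - q.2)⁻¹ * k q.1 t) p := by
  have h2pi : (0 : ℝ) ≤ 2 * Real.pi := by positivity
  let X := Set.Icc (0 : ℝ) (2 * Real.pi)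
  have hcirc : ∀ x : ℝ, circleMap w₀ r x ∈ Metric.sphere w₀ r := fun x =>
    circleMap_mem_sphere w₀ hr.le x
  let K : C(Metric.closedBall c R × X, ℂ) :=
    ⟨fun q => k q.1 (circleMap w₀ r q.2), by
      have h1 : Continuous fun q : Metric.closedBall c R × X =>
        ((q.1 : ℂ), circleMap w₀ r (q.2 : ℝ)) := by fun_prop
      exact hk.comp_continuous h1 fun q => ⟨q.1.2, hcirc _⟩⟩
  -- The value 0 outside the closed ball is a default; only values inside are used.
  let Fs : ℂ → C(X, ℂ) := fun s =>
    open Classical in if h : s ∈ Metric.closedBall c R then K.curry ⟨s, h⟩ else 0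
  have hFs : ContinuousOn Fs (Metric.closedBall c R) := by
    rw [continuousOn_iff_continuous_domRestrict]
    have : (Metric.closedBall c R).domRestrict Fs = K.curry := by
      ext s x
      simp only [Set.domRestrict_apply, Fs, dif_pos s.2]
    rw [this]
    exact K.curry.continuous
  have hFs_apply : ∀ s ∈ Metric.closedBall c R, ∀ x : X, Fs s x = k s (circleMap w₀ r x) := by
    intro s hs x
    simp only [Fs, dif_pos hs]
    rfl
  lift R to NNReal using hR.le
  have hCI : CircleIntegrable Fs c R :=
    (hFs.mono Metric.sphere_subset_closedBall).circleIntegrable hR.le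
  -- On the open ball this agrees with `Fs`, by the scalar Cauchy formula at each point of the
  -- circle; analyticity in `w` is now automatic.
  let G : ℂ → C(X, ℂ) := fun w => (2 * Real.pi * I : ℂ)⁻¹ • ∮ z in C(c, R), (z - w)⁻¹ • Fs z
  have hG : AnalyticAt ℂ G p.1 := by
    have h := hasFPowerSeriesOn_cauchy_integral hCI (by exact_mod_cast hR)
    refine h.analyticAt_of_mem ?_
    simpa [Metric.eball_coe] using hp.1
  have hG_apply : ∀ s ∈ Metric.ball c R, ∀ x : X, G s x = k s (circleMap w₀ r x) := by
    intro s hs x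
    have h1 : (∮ z in C(c, R), (z - s)⁻¹ • Fs z) x
        = ∮ z in C(c, R), (z - s)⁻¹ • k z (circleMap w₀ r x) := by
      have hint : CircleIntegrable (fun z => (z - s)⁻¹ • Fs z) c R := by
        refine ContinuousOn.circleIntegrable hR.le (ContinuousOn.fun_smul ?_
          (hFs.mono Metric.sphere_subset_closedBall))
        refine ContinuousOn.inv₀ (by fun_prop) fun z hz h0 => ?_
        rw [sub_eq_zero] at h0
        subst h0
        rw [Metric.mem_sphere] at hz
        rw [Metric.mem_ball] at hs
        linarith
      have h2 := ContinuousLinearMap.intervalIntegral_comp_comm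
        (ContinuousMap.evalCLM ℂ x : C(X, ℂ) →L[ℂ] ℂ) hint.out
      simp only [circleIntegral]
      rw [ContinuousMap.evalCLM_apply] at h2
      rw [← h2]
      refine intervalIntegral.integral_congr fun θ _ => ?_
      simp only [ContinuousMap.evalCLM_apply, ContinuousMap.smul_apply]
      rw [hFs_apply _ (Metric.sphere_subset_closedBall (circleMap_mem_sphere c hR.le θ))]
    have h3 : DiffContOnCl ℂ (fun z => k z (circleMap w₀ r x)) (Metric.ball c R) := by
      refine ⟨hd _ (hcirc x), ?_⟩
      rw [closure_ball _ hR.ne']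
      exact hk.comp (by fun_prop : ContinuousOn (fun z : ℂ => (z, circleMap w₀ r x)) _)
        fun z hz => ⟨hz, hcirc x⟩
    simp only [G, ContinuousMap.smul_apply, h1]
    rw [h3.circleIntegral_sub_inv_smul hs, smul_smul, inv_mul_cancel₀ Complex.two_pi_I_ne_zero,
      one_smul]
  -- the kernel
  let a : C(X, ℂ) := ⟨fun x => circleMap w₀ r x, by fun_prop⟩
  let A : ℂ → C(X, ℂ) := fun w => a - w • (1 : C(X, ℂ))
  have hA : ∀ w ∈ Metric.ball w₀ r, ∀ x : X, A w x ≠ 0 := by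
    intro w hw x h0
    have h0' : circleMap w₀ r x - w * 1 = 0 := by simpa [A, a] using h0
    rw [mul_one, sub_eq_zero] at h0'
    have := hcirc x
    rw [h0'] at this
    rw [Metric.mem_sphere] at this
    rw [Metric.mem_ball] at hw
    linarith
  have hAunit : ∀ w ∈ Metric.ball w₀ r, IsUnit (A w) := fun w hw =>
    (ContinuousMap.isUnit_iff_forall_ne_zero _).2 (hA w hw)
  have hAan : AnalyticAt ℂ (fun w => Ring.inverse (A w)) p.2 := by
    have h1 : AnalyticAt ℂ (Ring.inverse : C(X, ℂ) → C(X, ℂ)) (A p.2) := by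
      have := analyticAt_inverse (𝕜 := ℂ) (hAunit p.2 hp.2).unit
      simpa using this
    refine h1.comp (f := A) ?_
    exact analyticAt_const.sub (analyticAt_id.smul analyticAt_const)
  have hAinv : ∀ w ∈ Metric.ball w₀ r, ∀ x : X,
      Ring.inverse (A w) x = (circleMap w₀ r x - w)⁻¹ := by
    intro w hw x
    have h1 : (A w * Ring.inverse (A w)) x = 1 := by
      rw [Ring.mul_inverse_cancel _ (hAunit w hw)]; rfl
    rw [ContinuousMap.mul_apply] at h1
    have h2 : A w x = circleMap w₀ r x - w := by simp [A, a]
    rw [h2] at h1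
    exact eq_inv_of_mul_eq_one_right h1
  let Λ : C(X, ℂ) →L[ℂ] ℂ := LinearMap.mkContinuous
    { toFun := fun h => ∫ θ in (0 : ℝ)..(2 * Real.pi),
        deriv (circleMap w₀ r) θ * Set.IccExtend h2pi h θ
      map_add' := by
        intro f g
        rw [← intervalIntegral.integral_add]
        · refine intervalIntegral.integral_congr fun θ _ => ?_
          simp [Set.IccExtend, mul_add]
        all_goals
          refine Continuous.intervalIntegrable ?_ _ _
          simp only [deriv_circleMap]
          exact Continuous.mul (by fun_prop) (Continuous.Icc_extend' (map_continuous _))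
      map_smul' := by
        intro m f
        rw [RingHom.id_apply, smul_eq_mul, ← intervalIntegral.integral_const_mul]
        refine intervalIntegral.integral_congr fun θ _ => ?_
        simp [Set.IccExtend]
        ring }
    (r * |2 * Real.pi - 0|) (by
      intro h
      have := intervalIntegral.norm_integral_le_of_norm_le_const (a := 0) (b := 2 * Real.pi)
        (f := fun θ => deriv (circleMap w₀ r) θ * Set.IccExtend h2pi h θ) (C := r * ‖h‖) ?_
      · simp only [LinearMap.coe_mk, AddHom.coe_mk]
        linarith
      · intro θ _
        rw [norm_mul]
        have h1 : ‖deriv (circleMap w₀ r) θ‖ = r := by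
          simp [deriv_circleMap, abs_of_pos hr]
        rw [h1]
        gcongr
        exact h.norm_coe_le_norm _)
  have hfin : AnalyticAt ℂ (fun q : ℂ × ℂ => Λ (Ring.inverse (A q.2) * G q.1)) p := by
    have h1 : AnalyticAt ℂ (fun q : ℂ × ℂ => Ring.inverse (A q.2)) p :=
      AnalyticAt.fun_comp (g := fun w => Ring.inverse (A w)) hAan analyticAt_snd
    have h2 : AnalyticAt ℂ (fun q : ℂ × ℂ => G q.1) p := AnalyticAt.fun_comp (g := G) hG analyticAt_fst
    exact (Λ.analyticAt _).fun_comp (h1.mul h2)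
  refine hfin.congr ?_
  have hopen : Metric.ball c (R : ℝ) ×ˢ Metric.ball w₀ r ∈ 𝓝 p :=
    (Metric.isOpen_ball.prod Metric.isOpen_ball).mem_nhds hp
  filter_upwards [hopen] with q hq
  change (∫ θ in (0 : ℝ)..(2 * Real.pi), deriv (circleMap w₀ r) θ *
    Set.IccExtend h2pi (Ring.inverse (A q.2) * G q.1) θ) = _
  rw [circleIntegral]
  refine intervalIntegral.integral_congr fun θ hθ => ?_
  rw [Set.uIcc_of_le h2pi] at hθ
  rw [smul_eq_mul, Set.IccExtend_of_mem h2pi _ hθ, ContinuousMap.mul_apply, hAinv _ hq.2, hG_apply _ hq.1]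

theorem exists_closedBall_prod_subset {U : Set (ℂ × ℂ)} {p : ℂ × ℂ} (hU : U ∈ 𝓝 p) :
    ∃ R > 0, Metric.closedBall p.1 R ×ˢ Metric.closedBall p.2 R ⊆ U := by
  obtain ⟨R, hR, h⟩ := Metric.nhds_basis_closedBall.mem_iff.1 hU
  exact ⟨R, hR, by rwa [closedBall_prod_same]⟩

/-- Cauchy's formula in the second variable writes `f` near `p` as a circle integral with parameter.
-/
theorem analyticAt_of_differentiableOn₂ {f : ℂ × ℂ → ℂ} {U : Set (ℂ × ℂ)} (hU : IsOpen U)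
    (hf : DifferentiableOn ℂ f U) {p : ℂ × ℂ} (hp : p ∈ U) : AnalyticAt ℂ f p := by
  obtain ⟨R, hR, hsub⟩ := exists_closedBall_prod_subset (hU.mem_nhds hp)
  have hfst : ∀ t ∈ Metric.closedBall p.2 R,
      DifferentiableOn ℂ (fun s => f (s, t)) (Metric.closedBall p.1 R) := fun t ht =>
    hf.comp (by fun_prop) fun s hs => hsub ⟨hs, ht⟩
  have hsnd : ∀ s ∈ Metric.closedBall p.1 R,
      DifferentiableOn ℂ (fun t => f (s, t)) (Metric.closedBall p.2 R) := fun s hs =>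
    hf.comp (by fun_prop) fun t ht => hsub ⟨hs, ht⟩
  have h := analyticAt_circleIntegral_param (k := fun s t => f (s, t)) hR hR
    (hf.continuousOn.mono ((Set.prod_mono le_rfl Metric.sphere_subset_closedBall).trans hsub))
    (fun t ht => (hfst t (Metric.sphere_subset_closedBall ht)).mono Metric.ball_subset_closedBall)
    (p := p) ⟨Metric.mem_ball_self hR, Metric.mem_ball_self hR⟩
  have h' := (analyticAt_const (v := (2 * Real.pi * I : ℂ)⁻¹)).mul h
  refine h'.congr ?_
  have hopen : Metric.ball p.1 R ×ˢ Metric.ball p.2 R ∈ 𝓝 p :=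
    (Metric.isOpen_ball.prod Metric.isOpen_ball).mem_nhds
      ⟨Metric.mem_ball_self hR, Metric.mem_ball_self hR⟩
  filter_upwards [hopen] with q hq
  have h1 : DiffContOnCl ℂ (fun t => f (q.1, t)) (Metric.ball p.2 R) :=
    (hsnd _ (Metric.ball_subset_closedBall hq.1)).diffContOnCl_ball le_rfl
  have h2 := h1.circleIntegral_sub_inv_smul hq.2
  simp only [smul_eq_mul] at h2
  simp only [Pi.mul_apply, h2]
  rw [← mul_assoc, inv_mul_cancel₀ Complex.two_pi_I_ne_zero, one_mul]

/-! ### Extension across z = 0 and division by powers of z -/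

/-- `ψ`, defined for `z ≠ 0`, extends holomorphically across the point `(τ, 0)`. -/
def ExtendsAt (ψ : ℂ × ℂ → ℂ) (τ : ℂ) : Prop :=
  ∃ G : ℂ × ℂ → ℂ, AnalyticAt ℂ G (τ, 0) ∧ ∀ᶠ p in 𝓝 (τ, (0 : ℂ)), p.2 ≠ 0 → G p = ψ p

theorem ExtendsAt.eventually {ψ : ℂ × ℂ → ℂ} {τ : ℂ} (h : ExtendsAt ψ τ) :
    ∀ᶠ s in 𝓝 τ, ExtendsAt ψ s := by
  obtain ⟨G, hG, he⟩ := h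
  have h1 : ∀ᶠ p in 𝓝 (τ, (0 : ℂ)), AnalyticAt ℂ G p ∧ ∀ᶠ q in 𝓝 p, q.2 ≠ 0 → G q = ψ q :=
    hG.eventually_analyticAt.and he.eventually_nhds
  have h2 : Tendsto (fun s : ℂ => (s, (0 : ℂ))) (𝓝 τ) (𝓝 (τ, 0)) :=
    (by fun_prop : Continuous fun s : ℂ => (s, (0 : ℂ))).tendsto τ
  filter_upwards [h2.eventually h1] with s hs
  exact ⟨G, hs.1, hs.2⟩

/-- Cauchy's formula after the removable singularity at 0 has been filled in by `g 0`. -/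
theorem circleIntegral_eq_of_differentiableOn_punctured {φ g : ℂ → ℂ} {r : ℝ}
    (hφ : DifferentiableOn ℂ φ (Metric.closedBall 0 r \ {0}))
    (hg : AnalyticAt ℂ g 0) (he : ∀ᶠ z in 𝓝 (0 : ℂ), z ≠ 0 → g z = φ z)
    {w : ℂ} (hw : w ∈ Metric.ball (0 : ℂ) r) (hw0 : w ≠ 0) :
    (∮ t in C(0, r), (t - w)⁻¹ * φ t) = 2 * Real.pi * I * φ w := by
  have hr : 0 < r := Metric.pos_of_mem_ball hw
  set φ' : ℂ → ℂ := Function.update φ 0 (g 0)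
  have hne : ∀ z, z ≠ 0 → φ' z = φ z := fun z hz => Function.update_of_ne hz _ _
  have h0 : φ' =ᶠ[𝓝 0] g := by
    filter_upwards [he] with z hz
    by_cases h : z = 0
    · simp [φ', h]
    · rw [hne z h, hz h]
  have hd : DifferentiableOn ℂ φ' (Metric.closedBall 0 r) := by
    intro z hz
    by_cases h : z = 0
    · subst h
      exact (hg.congr h0.symm).differentiableAt.differentiableWithinAt
    · have h1 := hφ z ⟨hz, h⟩
      have h2 : φ' =ᶠ[𝓝[Metric.closedBall 0 r] z] φ := by
        filter_upwards [mem_nhdsWithin_of_mem_nhds (isOpen_ne.mem_nhds h)] with y hy using hne y hy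
      have h3 : DifferentiableWithinAt ℂ φ (Metric.closedBall 0 r) z := by
        refine h1.mono_of_mem_nhdsWithin ?_
        exact inter_mem_nhdsWithin _ (isOpen_ne.mem_nhds h)
      exact h3.congr_of_eventuallyEq h2 (hne z h)
  have h2 := (hd.diffContOnCl_ball le_rfl).circleIntegral_sub_inv_smul hw
  simp only [smul_eq_mul] at h2
  rw [hne w hw0] at h2
  rw [← h2]
  refine circleIntegral.integral_congr hr.le fun z hz => ?_
  rw [hne z]
  rintro rfl
  simp [hr.ne] at hz

/-- The set of good parameters is open, so it suffices that it is closed in `V`. At a limit point,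
the Cauchy integral over a small circle in z is jointly analytic. It equals ψ for parameters near a
good one, and the identity theorem in the parameter extends the equality to the whole ball. -/
theorem ExtendsAt.of_isPreconnected {ψ : ℂ × ℂ → ℂ} {V : Set ℂ}
    (hc : IsPreconnected V)
    (h : ∀ s ∈ V, ∀ᶠ p in 𝓝 (s, (0 : ℂ)), p.2 ≠ 0 → AnalyticAt ℂ ψ p)
    {τ₁ : ℂ} (h₁ : τ₁ ∈ V) (hext : ExtendsAt ψ τ₁) : ∀ s ∈ V, ExtendsAt ψ s := by
  have hopen : IsOpen {s | ExtendsAt ψ s} := isOpen_iff_mem_nhds.2 fun s hs => hs.eventually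
  refine hc.subset_of_closure_inter_subset hopen ⟨τ₁, h₁, hext⟩ ?_
  rintro s ⟨hs, hsV⟩
  obtain ⟨r, hr, hsub⟩ := exists_closedBall_prod_subset (h s hsV)
  simp only at hsub
  have hsp : ∀ a b : ℂ, a ∈ Metric.closedBall s r → b ∈ Metric.closedBall 0 r → b ≠ 0 →
      AnalyticAt ℂ ψ (a, b) := fun a b ha hb hb0 => hsub (Set.mk_mem_prod ha hb) hb0
  have hsphere : ∀ t ∈ Metric.sphere (0 : ℂ) r, t ≠ 0 := by
    rintro t ht rfl
    simp [hr.ne] at ht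
  have hslice : ∀ b ∈ Metric.closedBall (0 : ℂ) r, b ≠ 0 →
      AnalyticOnNhd ℂ (fun a => ψ (a, b)) (Metric.closedBall s r) := fun b hb hb0 a ha =>
    AnalyticAt.fun_comp (g := ψ) (hsp a b ha hb hb0) (analyticAt_id.prod analyticAt_const)
  have hG : ∀ {p : ℂ × ℂ}, p ∈ Metric.ball s r ×ˢ Metric.ball 0 r → _ := fun {p} =>
    analyticAt_circleIntegral_param (p := p) (c := s) (w₀ := 0) (k := fun a b => ψ (a, b)) hr hr
    (fun q hq => (hsp q.1 q.2 hq.1 (Metric.sphere_subset_closedBall hq.2)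
      (hsphere _ hq.2)).continuousAt.continuousWithinAt)
    (fun t ht => ((hslice t (Metric.sphere_subset_closedBall ht)
      (hsphere _ ht)).mono Metric.ball_subset_closedBall).differentiableOn)
  set F : ℂ × ℂ → ℂ := fun q => ∮ t in C(0, r), (t - q.2)⁻¹ * ψ (q.1, t) with hF
  refine ⟨fun q => (2 * Real.pi * I : ℂ)⁻¹ * F q,
    analyticAt_const.mul (hG ⟨Metric.mem_ball_self hr, Metric.mem_ball_self hr⟩), ?_⟩
  have hbox : Metric.ball s r ×ˢ Metric.ball (0 : ℂ) r ∈ 𝓝 (s, (0 : ℂ)) :=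
    (Metric.isOpen_ball.prod Metric.isOpen_ball).mem_nhds
      ⟨Metric.mem_ball_self hr, Metric.mem_ball_self hr⟩
  filter_upwards [hbox] with q hq hq0
  obtain ⟨s', hs'b, hs'⟩ : ∃ s' ∈ Metric.ball s r, ExtendsAt ψ s' := by
    obtain ⟨x, hx1, hx2⟩ := mem_closure_iff_nhds.1 hs _ (Metric.ball_mem_nhds s hr)
    exact ⟨x, hx1, hx2⟩
  have hF1 : AnalyticOnNhd ℂ (fun a => (2 * Real.pi * I : ℂ)⁻¹ * F (a, q.2)) (Metric.ball s r) :=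
    fun a ha => analyticAt_const.mul
      (AnalyticAt.fun_comp (g := F) (hG ⟨ha, hq.2⟩) (analyticAt_id.prod analyticAt_const))
  have hF2 : AnalyticOnNhd ℂ (fun a => ψ (a, q.2)) (Metric.ball s r) :=
    (hslice q.2 (Metric.ball_subset_closedBall hq.2) hq0).mono Metric.ball_subset_closedBall
  have heq : (fun a => (2 * Real.pi * I : ℂ)⁻¹ * F (a, q.2)) =ᶠ[𝓝 s'] fun a => ψ (a, q.2) := by
    filter_upwards [hs'.eventually, Metric.isOpen_ball.mem_nhds hs'b] with a ha hab
    obtain ⟨g, hg, hge⟩ := ha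
    have := circleIntegral_eq_of_differentiableOn_punctured (φ := fun z => ψ (a, z))
      (g := fun z => g (a, z)) (r := r)
      (fun z hz => ((AnalyticAt.fun_comp (g := ψ) (hsp a z (Metric.ball_subset_closedBall hab)
        hz.1 hz.2) (analyticAt_const.prod analyticAt_id)).differentiableAt).differentiableWithinAt)
      (AnalyticAt.fun_comp (g := g) hg (analyticAt_const.prod analyticAt_id))
      (((by fun_prop : Continuous fun z : ℂ => (a, z)).tendsto 0).eventually hge) hq.2 hq0
    simp only [hF, this]
    rw [← mul_assoc, inv_mul_cancel₀ Complex.two_pi_I_ne_zero, one_mul]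
  exact hF1.eqOn_of_preconnected_of_eventuallyEq hF2
    (convex_ball s r).isPreconnected hs'b heq hq.1

/-- A holomorphic function of two variables vanishing on `z = 0` is divisible by `z`. -/
theorem AnalyticAt.exists_eq_snd_mul {f : ℂ × ℂ → ℂ} {τ : ℂ} (hf : AnalyticAt ℂ f (τ, 0))
    (h0 : ∀ᶠ s in 𝓝 τ, f (s, 0) = 0) :
    ∃ g : ℂ × ℂ → ℂ, AnalyticAt ℂ g (τ, 0) ∧ ∀ᶠ p in 𝓝 (τ, (0 : ℂ)), f p = p.2 * g p := by
  have h0' : ∀ᶠ p : ℂ × ℂ in 𝓝 (τ, (0 : ℂ)), f (p.1, 0) = 0 :=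
    (continuous_fst.tendsto (τ, (0 : ℂ))).eventually h0
  obtain ⟨r, hr, hsub⟩ := exists_closedBall_prod_subset (hf.eventually_analyticAt.and h0')
  simp only at hsub
  have hsp : ∀ a b : ℂ, a ∈ Metric.closedBall τ r → b ∈ Metric.closedBall 0 r →
      AnalyticAt ℂ f (a, b) := fun a b ha hb => (hsub (Set.mk_mem_prod ha hb)).1
  have hz : ∀ a ∈ Metric.closedBall τ r, f (a, 0) = 0 := fun a ha =>
    (hsub (Set.mk_mem_prod ha (Metric.mem_closedBall_self hr.le))).2
  have hsphere : ∀ t ∈ Metric.sphere (0 : ℂ) r, t ≠ 0 := by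
    rintro t ht rfl
    simp [hr.ne] at ht
  -- The quotient is produced as the Cauchy integral of f(a, b)/b, which is regular on the circle;
  -- on each slice it is the divided slope at 0.
  have hG := analyticAt_circleIntegral_param (c := τ) (w₀ := 0) (k := fun a b => f (a, b) / b) hr hr
    (by
      refine ContinuousOn.div ?_ (by fun_prop) fun q hq => hsphere _ hq.2
      exact fun q hq => (hsp q.1 q.2 hq.1
        (Metric.sphere_subset_closedBall hq.2)).continuousAt.continuousWithinAt)
    (fun t ht => DifferentiableOn.div_const (fun a ha => ((hsp a t (Metric.ball_subset_closedBall ha)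
      (Metric.sphere_subset_closedBall ht)).along_fst).differentiableAt.differentiableWithinAt) _)
    (p := (τ, 0)) ⟨Metric.mem_ball_self hr, Metric.mem_ball_self hr⟩
  refine ⟨_, (analyticAt_const (v := (2 * Real.pi * I : ℂ)⁻¹)).mul hG, ?_⟩
  have hbox : Metric.ball τ r ×ˢ Metric.ball (0 : ℂ) r ∈ 𝓝 (τ, (0 : ℂ)) :=
    (Metric.isOpen_ball.prod Metric.isOpen_ball).mem_nhds
      ⟨Metric.mem_ball_self hr, Metric.mem_ball_self hr⟩
  filter_upwards [hbox] with q hq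
  have hq1 := Metric.ball_subset_closedBall hq.1
  by_cases hq0 : q.2 = 0
  · rw [hq0, zero_mul, ← hz _ hq1, ← hq0]
  have hsl : ∀ z ∈ Metric.closedBall (0 : ℂ) r, AnalyticAt ℂ (fun z => f (q.1, z)) z := fun z hz =>
    AnalyticAt.fun_comp (g := f) (hsp q.1 z hq1 hz) (analyticAt_const.prod analyticAt_id)
  have hds : DifferentiableOn ℂ (dslope (fun z => f (q.1, z)) 0) (Metric.closedBall 0 r) :=
    (Complex.differentiableOn_dslope (Metric.closedBall_mem_nhds _ hr)).2
      fun z hz => (hsl z hz).differentiableAt.differentiableWithinAt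
  have h2 := (hds.diffContOnCl_ball le_rfl).circleIntegral_sub_inv_smul hq.2
  have hdv : ∀ z : ℂ, z ≠ 0 → dslope (fun z => f (q.1, z)) 0 z = f (q.1, z) / z := by
    intro z hz0
    rw [dslope_of_ne _ hz0, slope_def_field, hz _ hq1, sub_zero, sub_zero]
  have h3 : (∮ t in C(0, r), (t - q.2)⁻¹ * (f (q.1, t) / t)) =
      2 * Real.pi * I * (f (q.1, q.2) / q.2) := by
    rw [← hdv _ hq0, ← smul_eq_mul (2 * Real.pi * I : ℂ), ← h2]
    refine circleIntegral.integral_congr hr.le fun z hz => ?_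
    rw [smul_eq_mul, hdv z (hsphere z hz)]
  simp only [Pi.mul_apply, h3]
  field_simp

/-- Induction on the vanishing order in z on the slice at τ. If `h (s, 0)` is nonzero for s
arbitrarily close to τ, exponent 0 works there; otherwise `h` is divisible by z and the order drops.
The order at τ itself may exceed the generic one, so only nearby points are reached. -/
theorem frequently_eq_snd_pow_mul {n : ℕ} : ∀ {h : ℂ × ℂ → ℂ} {τ : ℂ}, AnalyticAt ℂ h (τ, 0) →
    analyticOrderAt (fun z => h (τ, z)) 0 = n →
    ∃ᶠ s in 𝓝 τ, ∃ (N : ℕ) (u : ℂ × ℂ → ℂ), AnalyticAt ℂ u (s, 0) ∧ u (s, 0) ≠ 0 ∧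
      ∀ᶠ p in 𝓝 (s, (0 : ℂ)), h p = p.2 ^ N * u p := by
  induction n with
  | zero =>
    intro h τ hh hn
    refine Eventually.frequently ?_
    have hne : h (τ, 0) ≠ 0 := by
      have := (AnalyticAt.fun_comp (g := h) (f := fun z : ℂ => (τ, z)) (x := 0) hh
        (analyticAt_const.prod analyticAt_id)).analyticOrderAt_eq_zero.1 (by exact_mod_cast hn)
      exact this
    have h2 : Tendsto (fun s : ℂ => (s, (0 : ℂ))) (𝓝 τ) (𝓝 (τ, 0)) :=
      (by fun_prop : Continuous fun s : ℂ => (s, (0 : ℂ))).tendsto τ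
    filter_upwards [h2.eventually hh.eventually_analyticAt,
      h2.eventually (hh.continuousAt.eventually_ne hne)] with s hs hs'
    exact ⟨0, h, hs, hs', by simp⟩
  | succ n ih =>
    intro h τ hh hn
    have h2 : Tendsto (fun s : ℂ => (s, (0 : ℂ))) (𝓝 τ) (𝓝 (τ, 0)) :=
      (by fun_prop : Continuous fun s : ℂ => (s, (0 : ℂ))).tendsto τ
    by_cases hfr : ∃ᶠ s in 𝓝 τ, h (s, 0) ≠ 0
    · refine (hfr.and_eventually (h2.eventually hh.eventually_analyticAt)).mono ?_
      rintro s ⟨hs, hs'⟩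
      exact ⟨0, h, hs', hs, by simp⟩
    · rw [not_frequently] at hfr
      obtain ⟨g, hg, hge⟩ := hh.exists_eq_snd_mul (by simpa using hfr)
      have hsl : AnalyticAt ℂ (fun z => g (τ, z)) 0 :=
        AnalyticAt.fun_comp (g := g) (f := fun z : ℂ => (τ, z)) hg
          (analyticAt_const.prod analyticAt_id)
      have hord : analyticOrderAt (fun z => g (τ, z)) 0 = n := by
        have he : (fun z => h (τ, z)) =ᶠ[𝓝 0] ((fun z => z) * fun z => g (τ, z)) :=
          ((by fun_prop : Continuous fun z : ℂ => (τ, z)).tendsto 0).eventually hge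
        have hidan : AnalyticAt ℂ (fun z : ℂ => z) 0 := analyticAt_id
        have hid : analyticOrderAt (fun z : ℂ => z) 0 = 1 := by
          rw [show (1 : ℕ∞) = ((1 : ℕ) : ℕ∞) by rfl, hidan.analyticOrderAt_eq_natCast]
          exact ⟨fun _ => 1, analyticAt_const, one_ne_zero, by simp⟩
        rw [analyticOrderAt_congr he, analyticOrderAt_mul hidan hsl, hid] at hn
        revert hn
        generalize analyticOrderAt (fun z => g (τ, z)) 0 = e
        intro hn
        induction e using ENat.recTopCoe with
        | top => exact absurd hn.symm (ENat.natCast_ne_top _)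
        | coe m =>
          norm_cast at hn ⊢
          omega
      refine ((ih hg hord).and_eventually (h2.eventually hge.eventually_nhds)).mono ?_
      rintro s ⟨⟨N, u, hu, hu0, hue⟩, hs⟩
      refine ⟨N + 1, u, hu, hu0, ?_⟩
      filter_upwards [hue, hs] with p hp hp'
      rw [hp', hp]
      ring

/-- A nonzero holomorphic function of two variables is, near some points `(s, 0)`, a power of `z`
times a nonvanishing function. -/
theorem exists_eq_snd_pow_mul {h : ℂ × ℂ → ℂ} {τ : ℂ} (hh : AnalyticAt ℂ h (τ, 0))
    (hne : ∃ᶠ p in 𝓝 (τ, (0 : ℂ)), h p ≠ 0) :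
    ∃ᶠ s in 𝓝 τ, ∃ (N : ℕ) (u : ℂ × ℂ → ℂ), AnalyticAt ℂ u (s, 0) ∧ u (s, 0) ≠ 0 ∧
      ∀ᶠ p in 𝓝 (s, (0 : ℂ)), h p = p.2 ^ N * u p := by
  intro hcon
  rw [← eventually_eventually_nhds] at hcon
  obtain ⟨r, hr, hsub⟩ := exists_closedBall_prod_subset (hh.eventually_analyticAt.and
    ((continuous_fst.tendsto (τ, (0 : ℂ))).eventually hcon))
  simp only at hsub
  have hbox : Metric.ball τ r ×ˢ Metric.ball (0 : ℂ) r ∈ 𝓝 (τ, (0 : ℂ)) :=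
    (Metric.isOpen_ball.prod Metric.isOpen_ball).mem_nhds
      ⟨Metric.mem_ball_self hr, Metric.mem_ball_self hr⟩
  -- On the slice through a point with `h ≠ 0` the vanishing order at 0 is finite, so the previous
  -- induction applies at `s`.
  obtain ⟨⟨s, w⟩, hp, hs, hw⟩ := (hne.and_eventually hbox).exists
  have hs' := Metric.ball_subset_closedBall hs
  have han : ∀ z ∈ Metric.ball (0 : ℂ) r, AnalyticAt ℂ (fun z => h (s, z)) z := fun z hz =>
    AnalyticAt.fun_comp (g := h) (f := fun z : ℂ => (s, z))
      (hsub (Set.mk_mem_prod hs' (Metric.ball_subset_closedBall hz))).1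
      (analyticAt_const.prod analyticAt_id)
  have hord : analyticOrderAt (fun z => h (s, z)) 0 ≠ ⊤ := by
    intro htop
    rw [analyticOrderAt_eq_top] at htop
    have := AnalyticOnNhd.eqOn_zero_of_preconnected_of_eventuallyEq_zero (fun z hz => han z hz)
      (convex_ball (0 : ℂ) r).isPreconnected (Metric.mem_ball_self hr) htop hw
    exact hp this
  obtain ⟨n, hn⟩ := ENat.ne_top_iff_exists.1 hord
  exact frequently_eq_snd_pow_mul (hsub (Set.mk_mem_prod hs' (Metric.mem_closedBall_self hr.le))).1
    hn.symm (hsub (Set.mk_mem_prod hs' (Metric.mem_closedBall_self hr.le))).2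

/-! ### The lattice and elliptic functions -/

/-- The real coordinate `ξ` of `z = ξτ + η`. -/
noncomputable def latX (τ : ℍ) (z : ℂ) : ℝ := z.im / τ.im

/-- The real coordinate `η` of `z = ξτ + η`. -/
noncomputable def latY (τ : ℍ) (z : ℂ) : ℝ := z.re - z.im / τ.im * τ.re

theorem latX_mul_add_latY (τ : ℍ) (z : ℂ) : (latX τ z : ℂ) * τ + latY τ z = z := by
  have h := τ.im_ne_zero
  apply Complex.ext
  · simp [latX, latY]
  · simp [latX, latY, h]

@[simp] theorem latX_add (τ : ℍ) (z : ℂ) (l u : ℝ) : latX τ (z + l * τ + u) = latX τ z + l := by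
  have h := τ.im_ne_zero
  simp [latX]
  field_simp

@[simp] theorem latY_add (τ : ℍ) (z : ℂ) (l u : ℝ) : latY τ (z + l * τ + u) = latY τ z + u := by
  have h := τ.im_ne_zero
  simp [latY]
  field_simp
  ring

theorem latX_real (τ : ℍ) (l u : ℝ) : latX τ (l * τ + u) = l := by
  have := latX_add τ 0 l u
  simpa [latX] using this

theorem latY_real (τ : ℍ) (l u : ℝ) : latY τ (l * τ + u) = u := by
  have := latY_add τ 0 l u
  simpa [latY] using this

theorem mem_lattice_iff {τ : ℍ} {z : ℂ} :
    z ∈ lattice τ ↔ latX τ z ∈ Set.range ((↑) : ℤ → ℝ) ∧ latY τ z ∈ Set.range ((↑) : ℤ → ℝ) := by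
  constructor
  · rintro ⟨a, b, rfl⟩
    refine ⟨⟨a, ?_⟩, ⟨b, ?_⟩⟩
    · simpa using (latX_real τ a b).symm
    · simpa using (latY_real τ a b).symm
  · rintro ⟨⟨a, ha⟩, ⟨b, hb⟩⟩
    refine ⟨a, b, ?_⟩
    rw [← latX_mul_add_latY τ z, ← ha, ← hb]
    simp

theorem real_mem_lattice_iff {τ : ℍ} {l u : ℝ} : (l * τ + u : ℂ) ∈ lattice τ ↔
    l ∈ Set.range ((↑) : ℤ → ℝ) ∧ u ∈ Set.range ((↑) : ℤ → ℝ) := by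
  rw [mem_lattice_iff, latX_real, latY_real]

theorem add_mem_lattice_iff {τ : ℍ} {z w : ℂ} (hw : w ∈ lattice τ) :
    z + w ∈ lattice τ ↔ z ∈ lattice τ := by
  obtain ⟨a, b, rfl⟩ := hw
  constructor
  · rintro ⟨c, d, h⟩
    refine ⟨c - a, d - b, ?_⟩
    push_cast
    linear_combination h
  · rintro ⟨c, d, rfl⟩
    exact ⟨c + a, d + b, by push_cast; ring⟩

theorem zero_mem_lattice (τ : ℍ) : (0 : ℂ) ∈ lattice τ := ⟨0, 0, by simp⟩

theorem coe_mem_lattice (τ : ℍ) : (τ : ℂ) ∈ lattice τ := ⟨1, 0, by simp⟩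

theorem int_mem_lattice (τ : ℍ) (a b : ℤ) : (a * τ + b : ℂ) ∈ lattice τ := ⟨a, b, rfl⟩

theorem one_mem_lattice (τ : ℍ) : (1 : ℂ) ∈ lattice τ := ⟨0, 1, by simp⟩

theorem neg_mem_lattice_iff {τ : ℍ} {z : ℂ} : -z ∈ lattice τ ↔ z ∈ lattice τ := by
  constructor
  · rintro ⟨c, d, h⟩
    exact ⟨-c, -d, by push_cast; linear_combination -h⟩
  · rintro ⟨c, d, rfl⟩
    exact ⟨-c, -d, by push_cast; ring⟩

/-- The open set of pairs `(τ, z)` with `Im τ > 0` and `z ∉ L_τ`. -/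
def offLat : Set (ℂ × ℂ) := {p | 0 < p.1.im ∧ p.2 ∉ lattice (ofComplex p.1)}

theorem mem_offLat {τ : ℍ} {z : ℂ} : ((τ : ℂ), z) ∈ offLat ↔ z ∉ lattice τ := by
  simp [offLat, τ.im_pos]

theorem isClosed_range_intCast_real : IsClosed (Set.range ((↑) : ℤ → ℝ)) :=
  Int.isClosedEmbedding_coe_real.isClosed_range

theorem isOpen_imPos : IsOpen {p : ℂ × ℂ | 0 < p.1.im} :=
  isOpen_lt continuous_const (Complex.continuous_im.comp continuous_fst)

theorem continuousOn_latX :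
    ContinuousOn (fun p : ℂ × ℂ => latX (ofComplex p.1) p.2) {p | 0 < p.1.im} := by
  have : ContinuousOn (fun p : ℂ × ℂ => p.2.im / p.1.im) {p | 0 < p.1.im} :=
    ContinuousOn.div (by fun_prop) (by fun_prop) fun p hp => ne_of_gt hp
  refine this.congr fun p hp => ?_
  simp only [latX]
  rw [UpperHalfPlane.im, ofComplex_apply_of_im_pos hp]

theorem continuousOn_latY :
    ContinuousOn (fun p : ℂ × ℂ => latY (ofComplex p.1) p.2) {p | 0 < p.1.im} := by
  have h1 : ContinuousOn (fun p : ℂ × ℂ => p.2.im / p.1.im) {p | 0 < p.1.im} :=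
    ContinuousOn.div (by fun_prop) (by fun_prop) fun p hp => ne_of_gt hp
  have : ContinuousOn (fun p : ℂ × ℂ => p.2.re - p.2.im / p.1.im * p.1.re) {p | 0 < p.1.im} :=
    ContinuousOn.sub (by fun_prop) (h1.mul (by fun_prop))
  refine this.congr fun p hp => ?_
  simp only [latY]
  rw [UpperHalfPlane.im, UpperHalfPlane.re, ofComplex_apply_of_im_pos hp]

theorem isOpen_offLat : IsOpen offLat := by
  have hX := continuousOn_latX.isOpen_inter_preimage isOpen_imPos
    isClosed_range_intCast_real.isOpen_compl
  have hY := continuousOn_latY.isOpen_inter_preimage isOpen_imPos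
    isClosed_range_intCast_real.isOpen_compl
  convert hX.union hY using 1
  ext p
  simp only [offLat, mem_lattice_iff, Set.mem_ofPred_eq, Set.mem_union, Set.mem_inter_iff,
    Set.mem_preimage, Set.mem_compl_iff]
  tauto

theorem isOpen_compl_lattice (τ : ℍ) : IsOpen (lattice τ)ᶜ := by
  have h : (lattice τ)ᶜ = (fun z : ℂ => ((τ : ℂ), z)) ⁻¹' offLat := by
    ext z
    simp [mem_offLat]
  rw [h]
  exact isOpen_offLat.preimage (by fun_prop)

theorem eventually_mem_offLat {τ : ℂ} (hτ : 0 < τ.im) :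
    ∀ᶠ p in 𝓝 (τ, (0 : ℂ)), p.2 ≠ 0 → p ∈ offLat := by
  have hmem : (τ, (0 : ℂ)) ∈ {p : ℂ × ℂ | 0 < p.1.im} := hτ
  have hX := (continuousOn_latX.continuousAt (isOpen_imPos.mem_nhds hmem)).tendsto
  have hY := (continuousOn_latY.continuousAt (isOpen_imPos.mem_nhds hmem)).tendsto
  simp only [latX, latY, Complex.zero_im, Complex.zero_re, zero_div, zero_mul, sub_zero] at hX hY
  have h1 : Metric.ball (0 : ℝ) 1 ∈ 𝓝 (0 : ℝ) := Metric.ball_mem_nhds _ one_pos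
  filter_upwards [isOpen_imPos.mem_nhds hmem, hX.eventually h1, hY.eventually h1]
    with p hp hpX hpY hp0
  refine ⟨hp, fun hmem => hp0 ?_⟩
  rw [mem_lattice_iff] at hmem
  obtain ⟨⟨a, ha⟩, ⟨b, hb⟩⟩ := hmem
  have key : ∀ (n : ℤ) (x : ℝ), x ∈ Metric.ball (0 : ℝ) 1 → (n : ℝ) = x → x = 0 := by
    rintro n x hx rfl
    simp only [Metric.mem_ball, dist_zero_right, Real.norm_eq_abs] at hx
    have : |n| < 1 := by exact_mod_cast hx
    rw [Int.abs_lt_one_iff] at this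
    simp [this]
  have hx := key a _ hpX ha
  have hy := key b _ hpY hb
  have := latX_mul_add_latY (ofComplex p.1) p.2
  have hx' : latX (ofComplex p.1) p.2 = 0 := hx
  have hy' : latY (ofComplex p.1) p.2 = 0 := hy
  rw [hx', hy'] at this
  simpa using this.symm

theorem eventually_notMem_lattice (τ : ℍ) : ∀ᶠ z in 𝓝[≠] (0 : ℂ), z ∉ lattice τ := by
  rw [eventually_nhdsWithin_iff]
  have h := eventually_mem_offLat τ.im_pos
  filter_upwards [((by fun_prop : Continuous fun z : ℂ => ((τ : ℂ), z)).tendsto 0).eventually h]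
    with z hz hz0
  exact mem_offLat.1 (hz hz0)

theorem periodic_lattice {τ : ℍ} {f : ℂ → ℂ} (h1 : ∀ z ∉ lattice τ, f (z + 1) = f z)
    (hτ : ∀ z ∉ lattice τ, f (z + τ) = f z) (a b : ℤ) :
    ∀ z ∉ lattice τ, f (z + (a * τ + b)) = f z := by
  have key : ∀ (w : ℂ), w ∈ lattice τ → (∀ z ∉ lattice τ, f (z + w) = f z) →
      ∀ (n : ℤ), ∀ z ∉ lattice τ, f (z + n * w) = f z := by
    intro w hw h n
    have hmul : ∀ m : ℤ, (m : ℂ) * w ∈ lattice τ := by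
      obtain ⟨c, d, rfl⟩ := hw
      exact fun m => ⟨m * c, m * d, by push_cast; ring⟩
    induction n using Int.induction_on with
    | zero => simp
    | succ n ih =>
      intro z hz
      have := h (z + n * w) (by
        have := hmul n
        rw [Int.cast_natCast] at this
        rwa [add_mem_lattice_iff this])
      push_cast
      rw [show z + ((n : ℂ) + 1) * w = z + n * w + w by ring, this]
      simpa using ih z hz
    | pred n ih =>
      intro z hz
      have hz' : z + ((-n - 1 : ℤ) : ℂ) * w ∉ lattice τ := by
        rw [add_mem_lattice_iff (hmul _)]; exact hz
      have := h _ hz'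
      rw [← this, ← ih z hz]
      congr 1
      push_cast
      ring
  intro z hz
  have h2 := key 1 (one_mem_lattice τ) h1 b z hz
  have h3 := key τ (coe_mem_lattice τ) hτ a (z + b) (by
    rw [add_mem_lattice_iff (w := (b : ℂ)) ⟨0, b, by simp⟩]; exact hz)
  rw [mul_one] at h2
  rw [← h2, ← h3]
  congr 1
  ring

/-- An elliptic function that is holomorphic off the lattice and bounded near the origin is
constant. -/
theorem elliptic_const {τ : ℍ} {f : ℂ → ℂ} (hd : ∀ z ∉ lattice τ, DifferentiableAt ℂ f z)
    (h1 : ∀ z ∉ lattice τ, f (z + 1) = f z) (hτ : ∀ z ∉ lattice τ, f (z + τ) = f z)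
    (hb : f =O[𝓝[≠] 0] (fun _ => (1 : ℂ))) : ∃ c, ∀ z ∉ lattice τ, f z = c := by
  have hper := periodic_lattice h1 hτ
  have hdn : ∀ᶠ z in 𝓝[≠] (0 : ℂ), DifferentiableAt ℂ f z :=
    (eventually_notMem_lattice τ).mono hd
  -- Riemann's removable singularity theorem.
  have hlim : Tendsto f (𝓝[≠] 0) (𝓝 (limUnder (𝓝[≠] 0) f)) := by
    refine Complex.tendsto_limUnder_of_differentiable_on_punctured_nhds_of_bounded_under hdn ?_
    obtain ⟨C, hC⟩ := hb.bound
    refine ⟨C + ‖f 0‖, ?_⟩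
    rw [eventually_map]
    filter_upwards [hC] with z hz
    have := norm_sub_le (f z) (f 0)
    simp only [norm_one, mul_one] at hz
    linarith
  set c₀ := limUnder (𝓝[≠] 0) f
  classical
  -- Every lattice point receives the limit at 0. Periodicity then carries differentiability from 0
  -- to the whole lattice, and boundedness from a closed period parallelogram to the plane, so
  -- Liouville applies.
  set g : ℂ → ℂ := fun z => if z ∈ lattice τ then c₀ else f z with hg
  have hg0 : g =ᶠ[𝓝 0] Function.update f 0 c₀ := by
    have := eventually_notMem_lattice τ
    rw [eventually_nhdsWithin_iff] at this
    filter_upwards [this] with z hz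
    by_cases h : z = 0
    · simp [hg, h, zero_mem_lattice]
    · rw [Function.update_of_ne h, hg]
      simp [hz h]
  have hgd0 : DifferentiableAt ℂ g 0 := by
    have : AnalyticAt ℂ (Function.update f 0 c₀) 0 := by
      refine Complex.analyticAt_of_differentiable_on_punctured_nhds_of_continuousAt ?_ ?_
      · filter_upwards [hdn, self_mem_nhdsWithin] with z hz hz0
        refine hz.congr_of_eventuallyEq ?_
        filter_upwards [isOpen_ne.mem_nhds hz0] with y hy using Function.update_of_ne hy _ _
      · rw [continuousAt_update_same]
        exact hlim
    exact (this.congr hg0.symm).differentiableAt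
  have hgper : ∀ (a b : ℤ) (z : ℂ), g (z + (a * τ + b)) = g z := by
    intro a b z
    by_cases hz : z ∈ lattice τ
    · have : z + (a * τ + b) ∈ lattice τ := (add_mem_lattice_iff (int_mem_lattice τ a b)).2 hz
      simp only [hg, if_pos hz, if_pos this]
    · have : z + (a * τ + b) ∉ lattice τ := by
        rwa [add_mem_lattice_iff (int_mem_lattice τ a b)]
      simp only [hg, if_neg hz, if_neg this, hper a b z hz]
  have hgd : Differentiable ℂ g := by
    intro z
    by_cases hz : z ∈ lattice τ
    · obtain ⟨a, b, rfl⟩ := hz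
      have h2 : g = fun y => g (y - (a * τ + b)) := by
        funext y
        have := hgper a b (y - (a * τ + b))
        rw [sub_add_cancel] at this
        exact this
      rw [h2]
      refine DifferentiableAt.comp (g := g) _ ?_ (by fun_prop)
      simpa using hgd0
    · refine (hd z hz).congr_of_eventuallyEq ?_
      filter_upwards [(isOpen_compl_lattice τ).mem_nhds hz] with y hy
      simp only [hg]
      rw [if_neg hy]
  have hbdd : Bornology.IsBounded (Set.range g) := by
    have hK : IsCompact ((fun p : ℝ × ℝ => (p.1 * τ + p.2 : ℂ)) ''
        (Set.Icc 0 1 ×ˢ Set.Icc 0 1)) :=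
      (isCompact_Icc.prod isCompact_Icc).image (by fun_prop)
    refine (hK.image hgd.continuous).isBounded.subset ?_
    rintro _ ⟨z, rfl⟩
    refine ⟨_, ⟨(Int.fract (latX τ z), Int.fract (latY τ z)),
      ⟨⟨Int.fract_nonneg _, (Int.fract_lt_one _).le⟩,
        ⟨Int.fract_nonneg _, (Int.fract_lt_one _).le⟩⟩, rfl⟩, ?_⟩
    rw [← hgper ⌊latX τ z⌋ ⌊latY τ z⌋]
    congr 1
    conv_rhs => rw [← latX_mul_add_latY τ z]
    have e1 := congrArg (fun x : ℝ => (x : ℂ)) (Int.fract_add_floor (latX τ z))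
    have e2 := congrArg (fun x : ℝ => (x : ℂ)) (Int.fract_add_floor (latY τ z))
    push_cast at e1 e2
    linear_combination (τ : ℂ) * e1 + e2
  refine ⟨g 0, fun z hz => ?_⟩
  have := hgd.apply_eq_apply_of_bounded hbdd z 0
  rw [← this]
  simp only [hg]
  rw [if_neg hz]

/-! ### The cotangent series -/

theorem sum_Icc_neg_succ {M : Type*} [AddCommMonoid M] (f : ℤ → M) (N : ℕ) :
    ∑ n ∈ Finset.Icc (-((N + 1 : ℕ) : ℤ)) ((N + 1 : ℕ) : ℤ), f n =
      (∑ n ∈ Finset.Icc (-(N : ℤ)) N, f n) + (f (N + 1) + f (-(N + 1))) := by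
  have h : Finset.Icc (-((N + 1 : ℕ) : ℤ)) ((N + 1 : ℕ) : ℤ) =
      insert ((N : ℤ) + 1) (insert (-((N : ℤ) + 1)) (Finset.Icc (-(N : ℤ)) N)) := by
    ext x
    simp only [Finset.mem_Icc, Finset.mem_insert]
    push_cast
    omega
  rw [h, Finset.sum_insert, Finset.sum_insert]
  · rw [← add_assoc, add_comm]
  · simp
  · simp only [Finset.mem_insert, Finset.mem_Icc]
    omega

theorem tendstoLocallyUniformlyOn_logDeriv {F : ℕ → ℂ → ℂ} {f : ℂ → ℂ} {U : Set ℂ} (hU : IsOpen U)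
    (hF : TendstoLocallyUniformlyOn F f atTop U) (hd : ∀ n, DifferentiableOn ℂ (F n) U)
    (hne : ∀ z ∈ U, f z ≠ 0) :
    TendstoLocallyUniformlyOn (fun n => logDeriv (F n)) (logDeriv f) atTop U := by
  have hf : DifferentiableOn ℂ f U := hF.differentiableOn (.of_forall hd) hU
  exact (hF.deriv (.of_forall hd) hU).div₀ hF (hf.deriv hU).continuousOn hf.continuousOn hne

/-- `π cot (π w)`. -/
noncomputable def piCot (w : ℂ) : ℂ := Real.pi * Complex.cot (Real.pi * w)

theorem isOpen_integerComplement : IsOpen Complex.integerComplement :=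
  Complex.isOpen_compl_range_intCast

/-- Logarithmic derivative of Euler's sine product. Its n-th factor pairs the poles ±n, hence the
symmetric partial sums. -/
theorem tendstoLocallyUniformlyOn_piCot :
    TendstoLocallyUniformlyOn (fun (N : ℕ) (w : ℂ) => ∑ b ∈ Finset.Icc (-(N : ℤ)) N, 1 / (w + b))
      piCot atTop Complex.integerComplement := by
  have h1 := HasProdLocallyUniformlyOn_euler_sin_prod.tendstoLocallyUniformlyOn_finsetRange
  have h2 := tendstoLocallyUniformlyOn_logDeriv isOpen_integerComplement h1
    (fun n => by
      simp only [sineTerm]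
      fun_prop) (fun z hz => by
      have := Complex.integerComplement.ne_zero hz
      have h3 := sin_pi_mul_ne_zero hz
      have h4 : (Real.pi : ℂ) ≠ 0 := by exact_mod_cast Real.pi_ne_zero
      positivity)
  have h3 : TendstoLocallyUniformlyOn (fun (_ : ℕ) (w : ℂ) => 1 / w) (fun w => 1 / w) atTop
      Complex.integerComplement := fun u hu x _ =>
    ⟨Set.univ, univ_mem, .of_forall fun _ y _ => refl_mem_uniformity hu⟩
  refine ((h3.add h2).congr fun N w hw => ?_).congr_right fun w hw => ?_
  · simp only [Pi.add_apply]
    rw [logDeriv_prod_sineTerm_eq_sum_cotTerm hw]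
    induction N with
    | zero => simp
    | succ N ih =>
      rw [sum_Icc_neg_succ, ← ih, Finset.sum_range_succ, cotTerm]
      push_cast
      ring
  · simp only [Pi.add_apply]
    rw [logDeriv_sin_div_eq_cot hw, piCot]
    ring

theorem differentiableOn_piCot : DifferentiableOn ℂ piCot Complex.integerComplement := by
  refine tendstoLocallyUniformlyOn_piCot.differentiableOn (.of_forall fun N => ?_)
    isOpen_integerComplement
  refine DifferentiableOn.fun_sum fun b _ => DifferentiableOn.div (by fun_prop) (by fun_prop)
    fun w hw => Complex.integerComplement_add_ne_zero hw b

theorem hasDerivAt_one_div_add_pow {w : ℂ} (hw : w ∈ Complex.integerComplement) (b : ℤ) (k : ℕ) :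
    HasDerivAt (fun w : ℂ => 1 / (w + b) ^ k) (-k * (1 / (w + b) ^ (k + 1))) w := by
  have h := Complex.integerComplement_add_ne_zero hw b
  have h1 : HasDerivAt (fun w : ℂ => (w + b) ^ k) (k * (w + b) ^ (k - 1) * 1) w :=
    ((hasDerivAt_id w).add_const (b : ℂ)).pow k
  have h2 := h1.inv (pow_ne_zero k h)
  simp only [one_div]
  refine h2.congr_deriv ?_
  rcases k with _ | k
  · simp
  · rw [Nat.add_sub_cancel]
    field_simp
    ring

theorem eqOn_deriv_sum_one_div (N : ℕ) (k : ℕ) :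
    Set.EqOn (deriv fun w : ℂ => ∑ b ∈ Finset.Icc (-(N : ℤ)) N, 1 / (w + b) ^ k)
      (fun w => -k * ∑ b ∈ Finset.Icc (-(N : ℤ)) N, 1 / (w + b) ^ (k + 1))
      Complex.integerComplement := by
  intro w hw
  have := HasDerivAt.fun_sum (u := Finset.Icc (-(N : ℤ)) N)
    fun b _ => hasDerivAt_one_div_add_pow hw b k
  rw [this.deriv]
  exact (Finset.mul_sum ..).symm

theorem tendstoLocallyUniformlyOn_deriv_piCot :
    TendstoLocallyUniformlyOn
      (fun (N : ℕ) (w : ℂ) => -∑ b ∈ Finset.Icc (-(N : ℤ)) N, 1 / (w + b) ^ 2)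
      (deriv piCot) atTop Complex.integerComplement := by
  have h := tendstoLocallyUniformlyOn_piCot.deriv (.of_forall fun N =>
    DifferentiableOn.fun_sum fun b _ => DifferentiableOn.div (by fun_prop) (by fun_prop)
    fun w hw => Complex.integerComplement_add_ne_zero hw b) isOpen_integerComplement
  refine h.congr fun N w hw => ?_
  have := eqOn_deriv_sum_one_div N 1 hw
  simp only [pow_one, Nat.cast_one, neg_mul, one_mul] at this
  exact this

theorem tendstoLocallyUniformlyOn_deriv_deriv_piCot :
    TendstoLocallyUniformlyOn
      (fun (N : ℕ) (w : ℂ) => 2 * ∑ b ∈ Finset.Icc (-(N : ℤ)) N, 1 / (w + b) ^ 3)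
      (deriv (deriv piCot)) atTop Complex.integerComplement := by
  have h := tendstoLocallyUniformlyOn_deriv_piCot.deriv (.of_forall fun N =>
    DifferentiableOn.fun_neg (DifferentiableOn.fun_sum fun b _ => DifferentiableOn.div
      (by fun_prop) (by fun_prop)
    fun w hw => pow_ne_zero _ (Complex.integerComplement_add_ne_zero hw b)))
    isOpen_integerComplement
  refine h.congr fun N w hw => ?_
  have := eqOn_deriv_sum_one_div N 2 hw
  simp only [Function.comp_apply, deriv.fun_neg, this]
  push_cast
  ring

theorem add_mul_mem_integerComplement {τ : ℍ} {z : ℂ} (hz : z ∉ lattice τ) (a : ℤ) :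
    z + a * τ ∈ Complex.integerComplement := by
  rw [Complex.mem_integerComplement_iff]
  rintro ⟨n, hn⟩
  exact hz ⟨-a, n, by push_cast; linear_combination -hn⟩

open SummationFilter in
-- The inner Eisenstein sums are the partial fractions of π cot and of its derivatives, obtained by
-- differentiating termwise.
theorem tsum_one_div_pow_eq {τ : ℍ} {z : ℂ} (hz : z ∉ lattice τ) (a : ℤ) :
    (∑'[symmetricIcc ℤ] b : ℤ, 1 / (z + a * (τ : ℂ) + b) ^ 1 = piCot (z + a * τ)) ∧
    (∑'[symmetricIcc ℤ] b : ℤ, 1 / (z + a * (τ : ℂ) + b) ^ 2 = -deriv piCot (z + a * τ)) ∧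
    (∑'[symmetricIcc ℤ] b : ℤ, 1 / (z + a * (τ : ℂ) + b) ^ 3 =
      deriv (deriv piCot) (z + a * τ) / 2) := by
  have hw := add_mul_mem_integerComplement hz a
  refine ⟨HasSum.tsum_eq (hasSum_symmetricIcc_iff.2 ?_),
    HasSum.tsum_eq (hasSum_symmetricIcc_iff.2 ?_), HasSum.tsum_eq (hasSum_symmetricIcc_iff.2 ?_)⟩
  · simpa using tendstoLocallyUniformlyOn_piCot.tendsto_at hw
  · simpa using (tendstoLocallyUniformlyOn_deriv_piCot.tendsto_at hw).neg
  · simpa using (tendstoLocallyUniformlyOn_deriv_deriv_piCot.tendsto_at hw).div_const 2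

/-! ### The product expansion of the theta function -/

theorem ex_add (x y : ℂ) : ex (x + y) = ex x * ex y := by
  rw [ex, ex, ex, ← Complex.exp_add, mul_add]

theorem ex_neg (x : ℂ) : ex (-x) = (ex x)⁻¹ := by rw [ex, ex, ← Complex.exp_neg, mul_neg]

theorem ex_sub (x y : ℂ) : ex (x - y) = ex x / ex y := by
  rw [sub_eq_add_neg, ex_add, ex_neg, div_eq_mul_inv]

theorem ex_ne_zero (x : ℂ) : ex x ≠ 0 := Complex.exp_ne_zero _

@[simp] theorem ex_zero : ex 0 = 1 := by simp [ex]

@[simp] theorem ex_int (n : ℤ) : ex n = 1 := by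
  rw [ex, mul_comm]
  exact Complex.exp_int_mul_two_pi_mul_I n

@[simp] theorem ex_one : ex 1 = 1 := by simpa using ex_int 1

theorem ex_nat_mul (n : ℕ) (x : ℂ) : ex (n * x) = ex x ^ n := by
  rw [ex, ex, ← Complex.exp_nat_mul]
  ring_nf

theorem ex_eq_one_iff {x : ℂ} : ex x = 1 ↔ ∃ n : ℤ, x = n := by
  rw [ex, Complex.exp_eq_one_iff]
  refine exists_congr fun n => ?_
  have := Complex.two_pi_I_ne_zero
  rw [mul_comm, mul_left_inj' this]

theorem norm_ex (x : ℂ) : ‖ex x‖ = Real.exp (-(2 * Real.pi * x.im)) := by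
  rw [ex, Complex.norm_exp]
  simp

theorem differentiable_ex : Differentiable ℂ ex := by
  unfold ex
  fun_prop

theorem hasDerivAt_ex (x : ℂ) : HasDerivAt ex (2 * Real.pi * I * ex x) x := by
  have h : HasDerivAt (fun x : ℂ => 2 * Real.pi * I * x) (2 * Real.pi * I) x := by
    simpa using (hasDerivAt_id x).const_mul (2 * Real.pi * I : ℂ)
  exact h.cexp.congr_deriv (mul_comm _ _)

theorem norm_ex_coe_lt_one (τ : ℍ) : ‖ex τ‖ < 1 := by
  rw [norm_ex, Real.exp_lt_one_iff, neg_neg_iff_pos]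
  have := τ.im_pos
  rw [UpperHalfPlane.coe_im]
  positivity

theorem piCot_eq (w : ℂ) : piCot w = -(Real.pi * I * (1 + ex w) / (1 - ex w)) := by
  rw [piCot, Complex.cot_pi_eq_exp_ratio, ex, div_mul_eq_div_div, add_comm]
  rw [Complex.div_I]
  ring

/-- The `n`-th factor of the product expansion of the theta function. -/
noncomputable def thetaFactor (τ : ℍ) (n : ℕ) (z : ℂ) : ℂ :=
  (1 - ex ((n + 1 : ℕ) * τ + z)) * (1 - ex ((n + 1 : ℕ) * τ - z))

/-- The product expansion of the theta function, up to a factor depending on `τ`. -/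
noncomputable def thetaProd (τ : ℍ) (z : ℂ) : ℂ :=
  Complex.sin (Real.pi * z) * ∏' n, thetaFactor τ n z

theorem differentiable_thetaFactor (τ : ℍ) (n : ℕ) : Differentiable ℂ (thetaFactor τ n) := by
  unfold thetaFactor ex
  fun_prop

/-- The form 1 + f_n, with f_n dominated by a geometric series, is what the convergence and
nonvanishing criteria for products require. -/
theorem thetaFactor_eq (τ : ℍ) (n : ℕ) (z : ℂ) : thetaFactor τ n z =
    1 + (-(ex τ ^ (n + 1) * ex z) - ex τ ^ (n + 1) * ex (-z) + ex τ ^ (n + 1) * ex τ ^ (n + 1)) := by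
  rw [thetaFactor, ex_add, sub_eq_add_neg ((n + 1 : ℕ) * (τ : ℂ)), ex_add, ex_nat_mul, ex_neg]
  have := ex_ne_zero z
  field_simp
  ring

theorem norm_thetaFactor_sub_one_le (τ : ℍ) (n : ℕ) (z : ℂ) :
    ‖-(ex τ ^ (n + 1) * ex z) - ex τ ^ (n + 1) * ex (-z) + ex τ ^ (n + 1) * ex τ ^ (n + 1)‖ ≤
      (‖ex z‖ + ‖ex (-z)‖ + 1) * ‖ex τ‖ ^ (n + 1) := by
  have h1 : ‖ex τ‖ ^ (n + 1) ≤ 1 := pow_le_one₀ (norm_nonneg _) (norm_ex_coe_lt_one τ).le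
  have h2 := norm_add_le (-(ex τ ^ (n + 1) * ex z) - ex τ ^ (n + 1) * ex (-z))
    (ex τ ^ (n + 1) * ex τ ^ (n + 1))
  have h3 := norm_sub_le (-(ex τ ^ (n + 1) * ex z)) (ex τ ^ (n + 1) * ex (-z))
  simp only [norm_neg, norm_mul, norm_pow] at h2 h3
  nlinarith [norm_nonneg (ex τ ^ (n + 1)), norm_pow (ex τ) (n + 1)]

theorem summable_norm_ex_pow (τ : ℍ) (C : ℝ) : Summable fun n : ℕ => C * ‖ex τ‖ ^ (n + 1) :=
  ((summable_nat_add_iff 1).2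
    (summable_geometric_of_lt_one (norm_nonneg _) (norm_ex_coe_lt_one τ))).mul_left C

theorem hasProdLocallyUniformlyOn_thetaFactor (τ : ℍ) :
    HasProdLocallyUniformlyOn (thetaFactor τ) (fun z => ∏' n, thetaFactor τ n z) Set.univ := by
  refine hasProdLocallyUniformlyOn_of_forall_compact isOpen_univ fun K _ hK => ?_
  obtain ⟨C, hC⟩ := hK.exists_bound_of_continuousOn
    (f := fun z => (‖ex z‖ + ‖ex (-z)‖ + 1 : ℝ)) (by
      have := differentiable_ex.continuous
      fun_prop)
  have h := Summable.hasProdUniformlyOn_nat_one_add (K := K) hK (summable_norm_ex_pow τ C)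
    (f := fun n z => -(ex τ ^ (n + 1) * ex z) - ex τ ^ (n + 1) * ex (-z) +
      ex τ ^ (n + 1) * ex τ ^ (n + 1))
    (.of_forall fun n z hz => (norm_thetaFactor_sub_one_le τ n z).trans
      (mul_le_mul_of_nonneg_right ((le_abs_self _).trans (hC z hz)) (by positivity)))
    (fun n => by
      have := differentiable_ex.continuous
      fun_prop)
  simpa only [← thetaFactor_eq] using h

theorem tendstoLocallyUniformlyOn_thetaProd (τ : ℍ) :
    TendstoLocallyUniformlyOn
      (fun (N : ℕ) z => Complex.sin (Real.pi * z) * ∏ n ∈ Finset.range N, thetaFactor τ n z)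
      (thetaProd τ) atTop Set.univ := by
  have h1 := (hasProdLocallyUniformlyOn_thetaFactor τ).tendstoLocallyUniformlyOn_finsetRange
  have h3 : TendstoLocallyUniformlyOn (fun (_ : ℕ) (w : ℂ) => Complex.sin (Real.pi * w))
      (fun w => Complex.sin (Real.pi * w)) atTop Set.univ := fun u hu x _ =>
    ⟨Set.univ, univ_mem, .of_forall fun _ y _ => refl_mem_uniformity hu⟩
  have h4 : DifferentiableOn ℂ (fun z => ∏' n, thetaFactor τ n z) Set.univ :=
    h1.differentiableOn (.of_forall fun N => by
      have := differentiable_thetaFactor τ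
      exact (Differentiable.fun_finsetProd fun n _ => this n).differentiableOn) isOpen_univ
  exact h3.mul₀ h1 (by fun_prop) h4.continuousOn

theorem differentiable_partial_thetaProd (τ : ℍ) (N : ℕ) : Differentiable ℂ
    (fun z => Complex.sin (Real.pi * z) * ∏ n ∈ Finset.range N, thetaFactor τ n z) := by
  have := Differentiable.fun_finsetProd (u := Finset.range N)
    fun n _ => differentiable_thetaFactor τ n
  fun_prop

theorem differentiable_thetaProd (τ : ℍ) : Differentiable ℂ (thetaProd τ) := by
  rw [← differentiableOn_univ]
  exact (tendstoLocallyUniformlyOn_thetaProd τ).differentiableOn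
    (.of_forall fun N => (differentiable_partial_thetaProd τ N).differentiableOn) isOpen_univ

theorem thetaFactor_ne_zero_iff (τ : ℍ) (n : ℕ) (z : ℂ) : thetaFactor τ n z ≠ 0 ↔
    ex ((n + 1 : ℕ) * τ + z) ≠ 1 ∧ ex ((n + 1 : ℕ) * τ - z) ≠ 1 := by
  rw [thetaFactor, mul_ne_zero_iff, sub_ne_zero, sub_ne_zero, ne_comm, ne_comm (a := (1 : ℂ))]

theorem thetaFactor_ne_zero {τ : ℍ} {z : ℂ} (hz : z ∉ lattice τ) (n : ℕ) :
    thetaFactor τ n z ≠ 0 := by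
  rw [thetaFactor_ne_zero_iff]
  refine ⟨fun h => ?_, fun h => ?_⟩
  · obtain ⟨m, hm⟩ := ex_eq_one_iff.1 h
    exact hz ⟨-(n + 1 : ℕ), m, by push_cast at hm ⊢; linear_combination hm⟩
  · obtain ⟨m, hm⟩ := ex_eq_one_iff.1 h
    exact hz ⟨(n + 1 : ℕ), -m, by push_cast at hm ⊢; linear_combination -hm⟩

theorem thetaFactor_zero_ne_zero (τ : ℍ) (n : ℕ) : thetaFactor τ n 0 ≠ 0 := by
  rw [thetaFactor_ne_zero_iff, add_zero, sub_zero, and_self, ex_nat_mul]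
  intro h
  have := congrArg norm h
  rw [norm_pow, norm_one] at this
  exact (pow_lt_one₀ (norm_nonneg _) (norm_ex_coe_lt_one τ) (Nat.succ_ne_zero n)).ne this

theorem tprod_thetaFactor_ne_zero {τ : ℍ} {z : ℂ} (h : ∀ n, thetaFactor τ n z ≠ 0) :
    ∏' n, thetaFactor τ n z ≠ 0 := by
  simp_rw [thetaFactor_eq] at h ⊢
  refine tprod_one_add_ne_zero_of_summable h ?_
  exact Summable.of_nonneg_of_le (fun _ => norm_nonneg _)
    (fun n => norm_thetaFactor_sub_one_le τ n z) (summable_norm_ex_pow τ _)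

theorem mem_integerComplement_of_notMem {τ : ℍ} {z : ℂ} (hz : z ∉ lattice τ) :
    z ∈ Complex.integerComplement := by
  simpa using add_mul_mem_integerComplement hz 0

theorem thetaProd_ne_zero {τ : ℍ} {z : ℂ} (hz : z ∉ lattice τ) : thetaProd τ z ≠ 0 :=
  mul_ne_zero (sin_pi_mul_ne_zero (mem_integerComplement_of_notMem hz))
    (tprod_thetaFactor_ne_zero (thetaFactor_ne_zero hz))

theorem logDeriv_sin_pi (z : ℂ) : logDeriv (fun z => Complex.sin (Real.pi * z)) z = piCot z := by
  have h : HasDerivAt (fun z => Complex.sin (Real.pi * z))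
      (Complex.cos (Real.pi * z) * (Real.pi * 1)) z :=
    ((hasDerivAt_id z).const_mul (Real.pi : ℂ)).csin
  rw [logDeriv_apply, h.deriv, piCot, Complex.cot_eq_cos_div_sin]
  ring

/-- Each of the two factors contributes a cotangent up to a constant ∓πi, and these constants cancel
within the pair. -/
theorem logDeriv_thetaFactor {τ : ℍ} {z : ℂ} (hz : z ∉ lattice τ) (n : ℕ) :
    logDeriv (thetaFactor τ n) z =
      piCot (z + ((n + 1 : ℤ) : ℂ) * τ) + piCot (z + ((-(n + 1) : ℤ) : ℂ) * τ) := by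
  obtain ⟨h1, h2⟩ := (thetaFactor_ne_zero_iff τ n z).1 (thetaFactor_ne_zero hz n)
  set A := ex ((n + 1 : ℕ) * τ + z) with hA
  set B := ex ((n + 1 : ℕ) * τ - z) with hB
  have hA0 : (1 : ℂ) - A ≠ 0 := sub_ne_zero.2 h1.symm
  have hB0 : (1 : ℂ) - B ≠ 0 := sub_ne_zero.2 h2.symm
  have hBne : B ≠ 0 := ex_ne_zero _
  have hB0' : B - 1 ≠ 0 := sub_ne_zero.2 h2
  have d1 : HasDerivAt (fun z : ℂ => 1 - ex ((n + 1 : ℕ) * τ + z)) (-(2 * Real.pi * I * A)) z := by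
    have := (hasDerivAt_ex ((n + 1 : ℕ) * τ + z)).comp z
      ((hasDerivAt_id z).const_add ((n + 1 : ℕ) * (τ : ℂ)))
    exact (this.const_sub 1).congr_deriv (by rw [mul_one])
  have d2 : HasDerivAt (fun z : ℂ => 1 - ex ((n + 1 : ℕ) * τ - z)) (2 * Real.pi * I * B) z := by
    have := (hasDerivAt_ex ((n + 1 : ℕ) * τ - z)).comp z
      ((hasDerivAt_id z).const_sub ((n + 1 : ℕ) * (τ : ℂ)))
    exact (this.const_sub 1).congr_deriv (by rw [mul_neg_one, neg_neg])
  have e1 : ex (z + ((n + 1 : ℤ) : ℂ) * τ) = A := by rw [hA]; congr 1; push_cast; ring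
  have e2 : ex (z + ((-(n + 1) : ℤ) : ℂ) * τ) = B⁻¹ := by
    rw [hB, ← ex_neg]; congr 1; push_cast; ring
  rw [piCot_eq, piCot_eq, e1, e2]
  unfold thetaFactor
  rw [logDeriv_apply, (d1.fun_mul d2).deriv]
  rw [← hA, ← hB]
  have : (1 : ℂ) - B⁻¹ = (B - 1) / B := by field_simp
  rw [this]
  have : (1 : ℂ) + B⁻¹ = (B + 1) / B := by field_simp
  rw [this]
  field_simp
  ring

theorem logDeriv_partial_thetaProd {τ : ℍ} {z : ℂ} (hz : z ∉ lattice τ) (N : ℕ) :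
    logDeriv (fun z => Complex.sin (Real.pi * z) * ∏ n ∈ Finset.range N, thetaFactor τ n z) z =
      ∑ a ∈ Finset.Icc (-(N : ℤ)) N, piCot (z + a * τ) := by
  have hf := fun n => thetaFactor_ne_zero hz n
  have hd := fun n => differentiable_thetaFactor τ n
  rw [logDeriv_mul (f := fun z => Complex.sin (Real.pi * z)) _ (sin_pi_mul_ne_zero (mem_integerComplement_of_notMem hz))
    (Finset.prod_ne_zero_iff.2 fun n _ => hf n) (by fun_prop)
    (Differentiable.fun_finsetProd (u := Finset.range N) fun n _ => hd n).differentiableAt,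
    logDeriv_sin_pi, logDeriv_prod (fun n _ => hf n) (fun n _ => (hd n).differentiableAt)]
  induction N with
  | zero => simp
  | succ N ih =>
    rw [sum_Icc_neg_succ, ← ih, Finset.sum_range_succ, logDeriv_thetaFactor hz, add_assoc]

/-- The outer Eisenstein sum is the logarithmic derivative of the theta product: symmetric partial
sums correspond to partial products. This gives `E 1`, and its derivatives give `E 2` and `E 3`. -/
theorem tendstoLocallyUniformlyOn_sum_piCot (τ : ℍ) :
    TendstoLocallyUniformlyOn
      (fun (N : ℕ) z => ∑ a ∈ Finset.Icc (-(N : ℤ)) N, piCot (z + a * τ))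
      (logDeriv (thetaProd τ)) atTop (lattice τ)ᶜ :=
  (tendstoLocallyUniformlyOn_logDeriv (isOpen_compl_lattice τ)
    ((tendstoLocallyUniformlyOn_thetaProd τ).mono (Set.subset_univ _))
    (fun N => (differentiable_partial_thetaProd τ N).differentiableOn)
    (fun _ hz => thetaProd_ne_zero hz)).congr fun N _ hz => logDeriv_partial_thetaProd hz N

theorem hasDerivAt_comp_add {f : ℂ → ℂ} (hf : DifferentiableOn ℂ f Complex.integerComplement)
    {τ : ℍ} {z : ℂ} (hz : z ∉ lattice τ) (a : ℤ) :
    HasDerivAt (fun z => f (z + a * τ)) (deriv f (z + a * τ)) z := by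
  have h := (hf.differentiableAt (isOpen_integerComplement.mem_nhds
    (add_mul_mem_integerComplement hz a))).hasDerivAt
  have := h.comp z ((hasDerivAt_id z).add_const ((a : ℂ) * τ))
  rw [mul_one] at this
  exact this

theorem tendstoLocallyUniformlyOn_sum_deriv {f : ℂ → ℂ} {τ : ℍ} {g : ℂ → ℂ}
    (hf : DifferentiableOn ℂ f Complex.integerComplement)
    (h : TendstoLocallyUniformlyOn
      (fun (N : ℕ) z => ∑ a ∈ Finset.Icc (-(N : ℤ)) N, f (z + a * τ)) g atTop (lattice τ)ᶜ) :
    TendstoLocallyUniformlyOn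
      (fun (N : ℕ) z => ∑ a ∈ Finset.Icc (-(N : ℤ)) N, deriv f (z + a * τ)) (deriv g) atTop
      (lattice τ)ᶜ := by
  have hd : ∀ (N : ℕ), ∀ z ∈ (lattice τ)ᶜ,
      HasDerivAt (fun z => ∑ a ∈ Finset.Icc (-(N : ℤ)) N, f (z + a * τ))
        (∑ a ∈ Finset.Icc (-(N : ℤ)) N, deriv f (z + a * τ)) z := fun N z hz =>
    HasDerivAt.fun_sum fun a _ => hasDerivAt_comp_add hf hz a
  exact (h.deriv (.of_forall fun N z hz => (hd N z hz).differentiableAt.differentiableWithinAt)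
    (isOpen_compl_lattice τ)).congr fun N z hz => (hd N z hz).deriv

open SummationFilter in
theorem E_one_eq {τ : ℍ} {z : ℂ} (hz : z ∉ lattice τ) : E 1 τ z = logDeriv (thetaProd τ) z := by
  rw [E]
  simp_rw [fun a => (tsum_one_div_pow_eq hz a).1]
  exact HasSum.tsum_eq (hasSum_symmetricIcc_iff.2
    ((tendstoLocallyUniformlyOn_sum_piCot τ).tendsto_at hz))

open SummationFilter in
theorem E_two_eq {τ : ℍ} {z : ℂ} (hz : z ∉ lattice τ) :
    E 2 τ z = -deriv (logDeriv (thetaProd τ)) z := by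
  rw [E]
  simp_rw [fun a => (tsum_one_div_pow_eq hz a).2.1]
  refine HasSum.tsum_eq (hasSum_symmetricIcc_iff.2 ?_)
  have := ((tendstoLocallyUniformlyOn_sum_deriv differentiableOn_piCot
    (tendstoLocallyUniformlyOn_sum_piCot τ)).tendsto_at hz).neg
  simpa only [Finset.sum_neg_distrib] using this

open SummationFilter in
theorem E_three_eq {τ : ℍ} {z : ℂ} (hz : z ∉ lattice τ) :
    E 3 τ z = deriv (deriv (logDeriv (thetaProd τ))) z / 2 := by
  rw [E]
  simp_rw [fun a => (tsum_one_div_pow_eq hz a).2.2]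
  refine HasSum.tsum_eq (hasSum_symmetricIcc_iff.2 ?_)
  have := ((tendstoLocallyUniformlyOn_sum_deriv
    (differentiableOn_piCot.deriv isOpen_integerComplement)
    (tendstoLocallyUniformlyOn_sum_deriv differentiableOn_piCot
    (tendstoLocallyUniformlyOn_sum_piCot τ))).tendsto_at hz).div_const 2
  simpa only [Finset.sum_div] using this

/-! ### Holomorphy in two variables -/

theorem uncurried_coe (φ : ℍ → ℂ → ℂ) (τ : ℍ) (z : ℂ) : uncurried φ ((τ : ℂ), z) = φ τ z := by
  simp [uncurried]

theorem JacobiForms.HolAt.congr {φ ψ : ℍ → ℂ → ℂ} {τ : ℍ} {z : ℂ} (h : HolAt φ τ z)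
    (he : ∀ᶠ p in 𝓝 ((τ : ℂ), z), φ (ofComplex p.1) p.2 = ψ (ofComplex p.1) p.2) : HolAt ψ τ z :=
  AnalyticAt.congr h he

theorem JacobiForms.HolAt.add {φ ψ : ℍ → ℂ → ℂ} {τ : ℍ} {z : ℂ} (h : HolAt φ τ z) (h' : HolAt ψ τ z) :
    HolAt (fun τ z => φ τ z + ψ τ z) τ z := AnalyticAt.add h h'

theorem JacobiForms.HolAt.sub {φ ψ : ℍ → ℂ → ℂ} {τ : ℍ} {z : ℂ} (h : HolAt φ τ z) (h' : HolAt ψ τ z) :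
    HolAt (fun τ z => φ τ z - ψ τ z) τ z := AnalyticAt.sub h h'

theorem JacobiForms.HolAt.mul {φ ψ : ℍ → ℂ → ℂ} {τ : ℍ} {z : ℂ} (h : HolAt φ τ z) (h' : HolAt ψ τ z) :
    HolAt (fun τ z => φ τ z * ψ τ z) τ z := AnalyticAt.mul h h'

theorem JacobiForms.HolAt.neg {φ : ℍ → ℂ → ℂ} {τ : ℍ} {z : ℂ} (h : HolAt φ τ z) :
    HolAt (fun τ z => -φ τ z) τ z := AnalyticAt.neg h

theorem JacobiForms.HolAt.pow {φ : ℍ → ℂ → ℂ} {τ : ℍ} {z : ℂ} (h : HolAt φ τ z) (n : ℕ) :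
    HolAt (fun τ z => φ τ z ^ n) τ z := AnalyticAt.pow h n

theorem JacobiForms.HolAt.div {φ ψ : ℍ → ℂ → ℂ} {τ : ℍ} {z : ℂ} (h : HolAt φ τ z) (h' : HolAt ψ τ z)
    (h0 : ψ τ z ≠ 0) : HolAt (fun τ z => φ τ z / ψ τ z) τ z :=
  AnalyticAt.div h h' (by rw [← uncurried_coe ψ] at h0; exact h0)

theorem JacobiForms.HolAt.const (c : ℂ) (τ : ℍ) (z : ℂ) : HolAt (fun _ _ => c) τ z := analyticAt_const

theorem JacobiForms.HolAt.snd (τ : ℍ) (z : ℂ) : HolAt (fun _ z => z) τ z := analyticAt_snd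

theorem eventually_imPos {τ : ℍ} {z : ℂ} : ∀ᶠ p : ℂ × ℂ in 𝓝 ((τ : ℂ), z), 0 < p.1.im :=
  isOpen_imPos.mem_nhds τ.im_pos

theorem JacobiForms.HolAt.of_fst {f : ℍ → ℂ} {τ : ℍ} (hf : AnalyticAt ℂ (fun w : ℂ => f (ofComplex w)) τ)
    (z : ℂ) : HolAt (fun τ _ => f τ) τ z :=
  AnalyticAt.fun_comp (g := fun w : ℂ => f (ofComplex w)) (f := fun p : ℂ × ℂ => p.1)
    (x := ((τ : ℂ), z)) hf analyticAt_fst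

theorem JacobiForms.HolAt.fst (τ : ℍ) (z : ℂ) : HolAt (fun τ _ => (τ : ℂ)) τ z := by
  refine (analyticAt_fst : AnalyticAt ℂ (fun p : ℂ × ℂ => p.1) ((τ : ℂ), z)).congr ?_
  filter_upwards [eventually_imPos] with p hp
  simp [uncurried, ofComplex_apply_of_im_pos hp]

theorem JacobiForms.HolAt.comp {f : ℂ → ℂ} {φ : ℍ → ℂ → ℂ} {τ : ℍ} {z : ℂ} (hf : Differentiable ℂ f)
    (h : HolAt φ τ z) : HolAt (fun τ z => f (φ τ z)) τ z :=
  AnalyticAt.fun_comp (g := f) (hf.analyticAt _) h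

theorem JacobiForms.HolAt.along_snd {φ : ℍ → ℂ → ℂ} {τ : ℍ} {z : ℂ} (h : HolAt φ τ z) :
    AnalyticAt ℂ (φ τ) z := by
  have := AnalyticAt.along_snd h
  simpa only [uncurried, ofComplex_apply] using this

theorem JacobiForms.HolAt.along_fst {φ : ℍ → ℂ → ℂ} {τ : ℍ} {z : ℂ} (h : HolAt φ τ z) :
    AnalyticAt ℂ (fun w : ℂ => φ (ofComplex w) z) τ := AnalyticAt.along_fst h

theorem JacobiForms.HolAt.eventually {φ : ℍ → ℂ → ℂ} {τ : ℍ} {z : ℂ} (h : HolAt φ τ z) :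
    ∀ᶠ p in 𝓝 ((τ : ℂ), z), HolAt φ (ofComplex p.1) p.2 := by
  filter_upwards [AnalyticAt.eventually_analyticAt h, eventually_imPos] with p hp hp'
  rw [HolAt, ofComplex_apply_of_im_pos hp']
  exact hp

theorem AnalyticAt.deriv_snd {F : ℂ × ℂ → ℂ} {p : ℂ × ℂ} (h : AnalyticAt ℂ F p) :
    AnalyticAt ℂ (fun q : ℂ × ℂ => deriv (fun z => F (q.1, z)) q.2) p := by
  have h1 : AnalyticAt ℂ (fun q => fderiv ℂ F q (0, 1)) p :=
    (ContinuousLinearMap.apply ℂ ℂ ((0, 1) : ℂ × ℂ)).analyticAt _ |>.fun_comp h.fderiv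
  refine h1.congr ?_
  filter_upwards [h.eventually_analyticAt] with q hq
  have h2 : HasDerivAt (fun z : ℂ => (q.1, z)) ((0 : ℂ), (1 : ℂ)) q.2 :=
    (hasDerivAt_const q.2 q.1).prodMk (hasDerivAt_id q.2)
  exact (hq.differentiableAt.hasFDerivAt.comp_hasDerivAt q.2 h2).deriv.symm

theorem JacobiForms.HolAt.deriv {φ : ℍ → ℂ → ℂ} {τ : ℍ} {z : ℂ} (h : HolAt φ τ z) :
    HolAt (fun τ z => deriv (φ τ) z) τ z := AnalyticAt.deriv_snd h

theorem JacobiForms.HolAt.of_differentiableOn {φ : ℍ → ℂ → ℂ}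
    (h : DifferentiableOn ℂ (uncurried φ) {p | 0 < p.1.im}) (τ : ℍ) (z : ℂ) : HolAt φ τ z :=
  analyticAt_of_differentiableOn₂ isOpen_imPos h τ.im_pos

/-! ### The theta function -/

theorem theta_eq (τ : ℍ) (z : ℂ) : theta τ z =
    ex (z / 2 + τ / 8) * jacobiTheta₂ (z + τ / 2 + 1 / 2) τ := by
  rw [theta, jacobiTheta₂, ← tsum_mul_left]
  refine tsum_congr fun n => ?_
  have h : (-1 : ℂ) ^ n = Complex.exp (Real.pi * I * n) := by
    rw [mul_comm, Complex.exp_int_mul, Complex.exp_pi_mul_I]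
  rw [h, ex, ex, ex, jacobiTheta₂_term, ← Complex.exp_add, ← Complex.exp_add, ← Complex.exp_add]
  congr 1
  ring

theorem holAt_theta (τ : ℍ) (z : ℂ) : HolAt theta τ z := by
  refine HolAt.of_differentiableOn (fun p hp => ?_) τ z
  have h1 := (hasFDerivAt_jacobiTheta₂ (p.2 + p.1 / 2 + 1 / 2) hp).differentiableAt
  have h2 : DifferentiableAt ℂ
      (fun p : ℂ × ℂ => jacobiTheta₂ (p.2 + p.1 / 2 + 1 / 2) p.1) p :=
    DifferentiableAt.comp (g := fun p : ℂ × ℂ => jacobiTheta₂ p.1 p.2)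
      (f := fun p : ℂ × ℂ => (p.2 + p.1 / 2 + 1 / 2, p.1)) p h1 (by fun_prop)
  have h3 : DifferentiableAt ℂ (fun p : ℂ × ℂ =>
      ex (p.2 / 2 + p.1 / 8) * jacobiTheta₂ (p.2 + p.1 / 2 + 1 / 2) p.1) p := by
    refine DifferentiableAt.mul ?_ h2
    unfold ex
    fun_prop
  refine (h3.congr_of_eventuallyEq ?_).differentiableWithinAt
  filter_upwards [isOpen_imPos.mem_nhds hp] with q hq
  rw [uncurried, theta_eq, ofComplex_apply_of_im_pos hq]

theorem ex_half : ex (1 / 2) = -1 := by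
  rw [ex, ← Complex.exp_pi_mul_I]
  congr 1
  ring

theorem ex_half_add (x : ℂ) : ex (1 / 2 + x) = -ex x := by
  rw [ex_add, ex_half, neg_one_mul]

theorem theta_add_one (τ : ℍ) (z : ℂ) : theta τ (z + 1) = -theta τ z := by
  rw [theta_eq, theta_eq, show z + 1 + τ / 2 + 1 / 2 = (z + τ / 2 + 1 / 2) + 1 by ring,
    jacobiTheta₂_add_left, show (z + 1) / 2 + (τ : ℂ) / 8 = (z / 2 + τ / 8) + 1 / 2 by ring,
    ex_add _ (1 / 2), ex_half]
  ring

theorem theta_add_coe (τ : ℍ) (z : ℂ) : theta τ (z + τ) = -(ex (-τ / 2 - z) * theta τ z) := by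
  rw [theta_eq, theta_eq, show z + τ + τ / 2 + 1 / 2 = (z + τ / 2 + 1 / 2) + (τ : ℂ) by ring,
    jacobiTheta₂_add_left', ← mul_assoc, ← mul_assoc, ← neg_mul]
  congr 1
  have h : Complex.exp (-Real.pi * I * (τ + 2 * (z + τ / 2 + 1 / 2))) = ex (-τ - z - 1 / 2) := by
    rw [ex]; congr 1; ring
  have h2 := ex_half_add (-τ / 2 - z + (z / 2 + τ / 8) - 1)
  rw [ex_sub, ex_one, div_one, ex_add (-τ / 2 - z)] at h2
  rw [h, ← ex_add, ← h2]
  congr 1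
  ring

theorem theta_neg (τ : ℍ) (z : ℂ) : theta τ (-z) = -theta τ z := by
  have h1 := theta_eq τ (-z)
  rw [show -z + (τ : ℂ) / 2 + 1 / 2 = -(z - τ / 2 - 1 / 2) by ring, jacobiTheta₂_neg_left] at h1
  have h2 := jacobiTheta₂_add_left' (z - τ / 2 - 1 / 2 + 1) τ
  rw [show z - (τ : ℂ) / 2 - 1 / 2 + 1 + τ = z + τ / 2 + 1 / 2 by ring, jacobiTheta₂_add_left] at h2
  rw [h1, theta_eq, h2, ← mul_assoc, ← neg_mul]
  congr 1
  have h : Complex.exp (-Real.pi * I * (τ + 2 * (z - τ / 2 - 1 / 2 + 1))) = ex (-z - 1 / 2) := by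
    rw [ex]; congr 1; ring
  have h2 := ex_half_add (-z / 2 + τ / 8 - 1)
  rw [ex_sub, ex_one, div_one] at h2
  rw [h, ← ex_add, ← neg_neg (ex (-z / 2 + τ / 8)), ← h2]
  congr 2
  ring

theorem theta_zero (τ : ℍ) : theta τ 0 = 0 := by
  have h := theta_neg τ 0
  rw [neg_zero] at h
  exact self_eq_neg.1 h

theorem sin_pi_eq (w : ℂ) : Complex.sin (Real.pi * w) = ex (w / 2) * (1 - ex (-w)) / (2 * I) := by
  rw [mul_sub, mul_one, ← ex_add, show w / 2 + -w = -(w / 2) by ring, Complex.sin, ex, ex]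
  rw [show 2 * Real.pi * I * (w / 2) = Real.pi * w * I by ring,
    show 2 * Real.pi * I * -(w / 2) = -(Real.pi * w) * I by ring]
  have := Complex.I_ne_zero
  field_simp
  rw [Complex.I_sq]
  ring

theorem sin_pi_eq' (w : ℂ) :
    Complex.sin (Real.pi * w) = -(ex (-w / 2) * (1 - ex w) / (2 * I)) := by
  have h := sin_pi_eq (-w)
  rw [mul_neg, Complex.sin_neg, neg_neg] at h
  rw [← h, neg_neg]

theorem tendsto_ex_nat_mul_add (τ : ℍ) (z : ℂ) :
    Tendsto (fun n : ℕ => 1 - ex (n * τ + z)) atTop (𝓝 1) := by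
  have h := tendsto_pow_atTop_nhds_zero_of_norm_lt_one (norm_ex_coe_lt_one τ)
  have h2 := (h.mul_const (ex z)).const_sub 1
  simp only [zero_mul, sub_zero] at h2
  refine h2.congr fun n => ?_
  rw [ex_add, ex_nat_mul]

theorem tendsto_prod_thetaFactor (τ : ℍ) (z : ℂ) :
    Tendsto (fun N => ∏ n ∈ Finset.range N, thetaFactor τ n z) atTop
      (𝓝 (∏' n, thetaFactor τ n z)) :=
  (hasProdLocallyUniformlyOn_thetaFactor τ).tendstoLocallyUniformlyOn_finsetRange.tendsto_at
    (Set.mem_univ z)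

/-- Translation by τ shifts the two families of factors by one index in opposite directions. The
finite products telescope, and the boundary factors at index N tend to 1. -/
theorem tprod_thetaFactor_add_coe (τ : ℍ) (z : ℂ) :
    (∏' n, thetaFactor τ n (z + τ)) * (1 - ex (z + τ)) =
      (∏' n, thetaFactor τ n z) * (1 - ex (-z)) := by
  have key : ∀ N : ℕ, (∏ n ∈ Finset.range N, thetaFactor τ n (z + τ)) *
      ((1 - ex (z + τ)) * (1 - ex (N * τ + -z))) =
      (∏ n ∈ Finset.range N, thetaFactor τ n z) *
        ((1 - ex ((N + 1 : ℕ) * τ + z)) * (1 - ex (-z))) := by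
    intro N
    induction N with
    | zero =>
      simp only [Finset.range_zero, Finset.prod_empty, one_mul, Nat.cast_zero, zero_mul, zero_add,
        Nat.cast_one]
      rw [add_comm z]
    | succ N ih =>
      rw [Finset.prod_range_succ, Finset.prod_range_succ, thetaFactor, thetaFactor]
      rw [show ((N + 1 : ℕ) : ℂ) * τ + (z + τ) = (N + 1 + 1 : ℕ) * τ + z by push_cast; ring,
        show ((N + 1 : ℕ) : ℂ) * τ - (z + τ) = N * τ + -z by push_cast; ring,
        sub_eq_add_neg (((N + 1 : ℕ) : ℂ) * τ)]
      linear_combination (1 - ex (((N + 1 + 1 : ℕ) : ℂ) * τ + z)) *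
        (1 - ex (((N + 1 : ℕ) : ℂ) * τ + -z)) * ih
  have h1 := (tendsto_prod_thetaFactor τ (z + τ)).mul
    ((tendsto_const_nhds (x := 1 - ex (z + τ))).mul (tendsto_ex_nat_mul_add τ (-z)))
  have h2 := (tendsto_prod_thetaFactor τ z).mul
    (((tendsto_ex_nat_mul_add τ z).comp (tendsto_add_atTop_nat 1)).mul
      (tendsto_const_nhds (x := 1 - ex (-z))))
  have := tendsto_nhds_unique h1 (h2.congr fun N => (key N).symm)
  rwa [mul_one, one_mul] at this

theorem thetaProd_add_coe (τ : ℍ) (z : ℂ) :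
    thetaProd τ (z + τ) = -(ex (-τ / 2 - z) * thetaProd τ z) := by
  have h := tprod_thetaFactor_add_coe τ z
  rw [thetaProd, thetaProd, sin_pi_eq', sin_pi_eq]
  have h2 : ex (-(z + τ) / 2) = ex (-τ / 2 - z) * ex (z / 2) := by
    rw [← ex_add]; congr 1; ring
  rw [h2]
  linear_combination -(ex (-τ / 2 - z) * ex (z / 2) / (2 * I)) * h

theorem thetaProd_add_one (τ : ℍ) (z : ℂ) : thetaProd τ (z + 1) = -thetaProd τ z := by
  have h : ∀ n, thetaFactor τ n (z + 1) = thetaFactor τ n z := fun n => by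
    rw [thetaFactor, thetaFactor, ← add_assoc, ← sub_sub, ex_add _ 1, ex_sub _ 1, ex_one, mul_one,
      div_one]
  rw [thetaProd, thetaProd, mul_add, mul_one, Complex.sin_add_pi]
  simp_rw [h]
  ring

theorem thetaProd_zero (τ : ℍ) : thetaProd τ 0 = 0 := by simp [thetaProd]

theorem deriv_thetaProd_zero (τ : ℍ) : deriv (thetaProd τ) 0 ≠ 0 := by
  have hd : DifferentiableAt ℂ (fun z => ∏' n, thetaFactor τ n z) 0 :=
    ((hasProdLocallyUniformlyOn_thetaFactor τ).tendstoLocallyUniformlyOn_finsetRange.differentiableOn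
      (.of_forall fun N => (Differentiable.fun_finsetProd fun n _ =>
        differentiable_thetaFactor τ n).differentiableOn) isOpen_univ).differentiableAt univ_mem
  have h1 : HasDerivAt (fun z => Complex.sin (Real.pi * z))
      (Complex.cos (Real.pi * 0) * (Real.pi * 1)) 0 :=
    ((hasDerivAt_id (0 : ℂ)).const_mul (Real.pi : ℂ)).csin
  have h2 := h1.fun_mul hd.hasDerivAt
  have h3 : deriv (thetaProd τ) 0 = Real.pi * ∏' n, thetaFactor τ n 0 := by
    have := h2.deriv
    simp only [mul_zero, Complex.cos_zero, Complex.sin_zero, one_mul, zero_mul, add_zero,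
      mul_one] at this
    exact this
  rw [h3]
  exact mul_ne_zero (by exact_mod_cast Real.pi_ne_zero)
    (tprod_thetaFactor_ne_zero (thetaFactor_zero_ne_zero τ))

/-- A quotient of slopes at a common zero; it provides the boundedness needed in `elliptic_const`.
-/
theorem isBigO_div_of_deriv_ne_zero {f g : ℂ → ℂ} (hf : DifferentiableAt ℂ f 0)
    (hg : DifferentiableAt ℂ g 0) (hf0 : f 0 = 0) (hg0 : g 0 = 0) (hg' : deriv g 0 ≠ 0) :
    Tendsto (fun z => f z / g z) (𝓝[≠] 0) (𝓝 (deriv f 0 / deriv g 0)) := by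
  have h1 := hasDerivAt_iff_tendsto_slope.1 hf.hasDerivAt
  have h2 := hasDerivAt_iff_tendsto_slope.1 hg.hasDerivAt
  refine (h1.div h2 hg').congr' ?_
  filter_upwards [self_mem_nhdsWithin] with z hz
  have hz0 : z ≠ 0 := hz
  simp only [slope_def_field, hf0, hg0, sub_zero, Pi.div_apply]
  field_simp

theorem differentiable_theta (τ : ℍ) : Differentiable ℂ (theta τ) := fun z =>
  (HolAt.along_snd (holAt_theta τ z)).differentiableAt

theorem dense_compl_lattice (τ : ℍ) : Dense (lattice τ)ᶜ := by
  have h : lattice τ = Set.range fun p : ℤ × ℤ => (p.1 * τ + p.2 : ℂ) := by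
    ext z
    simp [lattice, eq_comm]
  have hc : (lattice τ).Countable := by
    rw [h]
    exact Set.countable_range _
  exact hc.dense_compl ℂ

/-- The triple product up to a factor depending on τ. Both sides have the same quasi-periods, and
the quotient is bounded at 0 because the product has a simple zero there and θ vanishes. The factor
need not be computed, since Θ is normalized by its derivative. -/
theorem exists_theta_eq_mul (τ : ℍ) : ∃ c : ℂ, ∀ z, theta τ z = c * thetaProd τ z := by
  obtain ⟨c, hc⟩ := elliptic_const (τ := τ) (f := fun z => theta τ z / thetaProd τ z)
    (fun z hz => (differentiable_theta τ z).div (differentiable_thetaProd τ z)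
      (thetaProd_ne_zero hz))
    (fun z _ => by rw [theta_add_one, thetaProd_add_one, neg_div_neg_eq])
    (fun z _ => by
      rw [theta_add_coe, thetaProd_add_coe, neg_div_neg_eq, mul_div_mul_left _ _ (ex_ne_zero _)])
    ((isBigO_div_of_deriv_ne_zero (differentiable_theta τ 0) (differentiable_thetaProd τ 0)
      (theta_zero τ) (thetaProd_zero τ) (deriv_thetaProd_zero τ)).isBigO_one ℂ)
  refine ⟨c, fun z => ?_⟩
  have := Continuous.ext_on (dense_compl_lattice τ) (differentiable_theta τ).continuous
    ((continuous_const (y := c)).mul (differentiable_thetaProd τ).continuous) (fun z hz => by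
      change theta τ z = c * thetaProd τ z
      rw [← hc z hz, div_mul_cancel₀ _ (thetaProd_ne_zero hz)])
  exact congrFun this z

/-! ### Nonvanishing of θ and basic properties of Θ -/

theorem integral_exp_two_pi_int (n : ℤ) :
    ∫ x : ℝ in (0 : ℝ)..1, Complex.exp (2 * Real.pi * I * n * x) = if n = 0 then 1 else 0 := by
  split_ifs with h
  · simp [h]
  · have hc : (2 * Real.pi * I * n : ℂ) ≠ 0 := by
      simp [h, Real.pi_ne_zero]
    rw [integral_exp_mul_complex hc]
    have : Complex.exp (2 * Real.pi * I * n * (1 : ℝ)) = 1 := by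
      rw [Complex.ofReal_one, mul_one, mul_comm]
      exact Complex.exp_int_mul_two_pi_mul_I n
    rw [this]
    simp

/-- Only the constant Fourier term survives. This is the cheapest way to see that θ is not
identically zero. -/
theorem integral_jacobiTheta₂ (τ : ℍ) : ∫ x : ℝ in (0 : ℝ)..1, jacobiTheta₂ x τ = 1 := by
  have hs : Summable fun n : ℤ => jacobiTheta₂_term n 0 τ :=
    (summable_jacobiTheta₂_term_iff 0 τ).2 τ.im_pos
  have hnorm : ∀ (n : ℤ) (x : ℝ), ‖jacobiTheta₂_term n x τ‖ = ‖jacobiTheta₂_term n 0 τ‖ := by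
    intro n x
    simp [norm_jacobiTheta₂_term]
  have h := intervalIntegral.hasSum_integral_of_dominated_convergence (a := 0) (b := 1)
    (μ := MeasureTheory.volume) (F := fun (n : ℤ) (x : ℝ) => jacobiTheta₂_term n x τ)
    (f := fun x : ℝ => jacobiTheta₂ x τ)
    (fun n _ => ‖jacobiTheta₂_term n 0 τ‖)
    (fun n => Continuous.aestronglyMeasurable (by unfold jacobiTheta₂_term; fun_prop))
    (fun n => .of_forall fun x _ => (hnorm n x).le)
    (.of_forall fun x _ => hs.norm)
    (by simp)
    (.of_forall fun x _ => hasSum_jacobiTheta₂_term x τ.im_pos)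
  refine h.unique ?_
  have h2 : ∀ n : ℤ, ∫ x : ℝ in (0 : ℝ)..1, jacobiTheta₂_term n x τ = if n = 0 then 1 else 0 := by
    intro n
    simp_rw [jacobiTheta₂_term, Complex.exp_add]
    rw [intervalIntegral.integral_mul_const, integral_exp_two_pi_int]
    split_ifs with h0 <;> simp [h0]
  simp_rw [h2]
  exact hasSum_ite_eq 0 1

theorem exists_theta_ne_zero (τ : ℍ) : ∃ z, theta τ z ≠ 0 := by
  by_contra! h
  have : ∀ z, jacobiTheta₂ z τ = 0 := fun z => by
    have h1 := h (z - τ / 2 - 1 / 2)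
    rw [theta_eq, show z - (τ : ℂ) / 2 - 1 / 2 + τ / 2 + 1 / 2 = z by ring] at h1
    exact (mul_eq_zero.1 h1).resolve_left (ex_ne_zero _)
  simpa [this] using integral_jacobiTheta₂ τ

theorem Theta_eq (τ : ℍ) (z : ℂ) :
    Theta τ z = 2 * Real.pi * I * thetaProd τ z / deriv (thetaProd τ) 0 := by
  obtain ⟨c, hc⟩ := exists_theta_eq_mul τ
  have hc0 : c ≠ 0 := by
    rintro rfl
    obtain ⟨z, hz⟩ := exists_theta_ne_zero τ
    exact hz (by rw [hc, zero_mul])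
  have hd : deriv (theta τ) 0 = c * deriv (thetaProd τ) 0 := by
    rw [show theta τ = fun z => c * thetaProd τ z from funext hc, deriv_const_mul_field]
  have := Complex.two_pi_I_ne_zero
  have := deriv_thetaProd_zero τ
  rw [Theta, hd, hc]
  field_simp

theorem deriv_theta_zero (τ : ℍ) : deriv (theta τ) 0 ≠ 0 := by
  intro h
  obtain ⟨c, hc⟩ := exists_theta_eq_mul τ
  have hd : deriv (theta τ) 0 = c * deriv (thetaProd τ) 0 := by
    rw [show theta τ = fun z => c * thetaProd τ z from funext hc, deriv_const_mul_field]
  rw [h, zero_eq_mul] at hd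
  obtain ⟨z, hz⟩ := exists_theta_ne_zero τ
  exact hz (by rw [hc, hd.resolve_right (deriv_thetaProd_zero τ), zero_mul])

theorem holAt_Theta (τ : ℍ) (z : ℂ) : HolAt Theta τ z := by
  have h : HolAt (fun τ _ => (2 * Real.pi * I)⁻¹ * deriv (theta τ) 0) τ z := by
    have h1 := (HolAt.along_fst (HolAt.deriv (holAt_theta τ 0)))
    exact HolAt.of_fst (f := fun τ => (2 * Real.pi * I)⁻¹ * deriv (theta τ) 0)
      (analyticAt_const.mul h1) z
  exact (holAt_theta τ z).div h
    (mul_ne_zero (inv_ne_zero Complex.two_pi_I_ne_zero) (deriv_theta_zero _))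

theorem differentiable_Theta (τ : ℍ) : Differentiable ℂ (Theta τ) := fun z =>
  (HolAt.along_snd (holAt_Theta τ z)).differentiableAt

theorem Theta_ne_zero {τ : ℍ} {z : ℂ} (hz : z ∉ lattice τ) : Theta τ z ≠ 0 := by
  rw [Theta_eq]
  exact div_ne_zero (mul_ne_zero Complex.two_pi_I_ne_zero (thetaProd_ne_zero hz))
    (deriv_thetaProd_zero τ)

theorem Theta_add_one (τ : ℍ) (z : ℂ) : Theta τ (z + 1) = -Theta τ z := by
  rw [Theta, Theta, theta_add_one, neg_div]

theorem Theta_add_coe (τ : ℍ) (z : ℂ) : Theta τ (z + τ) = -(ex (-τ / 2 - z) * Theta τ z) := by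
  rw [Theta, Theta, theta_add_coe, neg_div, mul_div_assoc]

theorem Theta_zero (τ : ℍ) : Theta τ 0 = 0 := by rw [Theta, theta_zero, zero_div]

theorem deriv_Theta_zero (τ : ℍ) : deriv (Theta τ) 0 = 2 * Real.pi * I := by
  have : Theta τ = fun z => theta τ z / ((2 * Real.pi * I)⁻¹ * deriv (theta τ) 0) := rfl
  rw [this, deriv_div_const]
  have := deriv_theta_zero τ
  have := Complex.two_pi_I_ne_zero
  field_simp

theorem logDeriv_Theta (τ : ℍ) : logDeriv (Theta τ) = logDeriv (thetaProd τ) := by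
  have h : Theta τ = fun z => 2 * Real.pi * I / deriv (thetaProd τ) 0 * thetaProd τ z := by
    funext z
    rw [Theta_eq]
    ring
  funext z
  rw [h]
  exact logDeriv_const_mul z _
    (div_ne_zero Complex.two_pi_I_ne_zero (deriv_thetaProd_zero τ))

theorem E_one_eq_logDeriv {τ : ℍ} {z : ℂ} (hz : z ∉ lattice τ) :
    E 1 τ z = logDeriv (Theta τ) z := by rw [E_one_eq hz, logDeriv_Theta]

theorem E_two_eq_deriv {τ : ℍ} {z : ℂ} (hz : z ∉ lattice τ) :
    E 2 τ z = -deriv (logDeriv (Theta τ)) z := by rw [E_two_eq hz, logDeriv_Theta]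

theorem E_three_eq_deriv {τ : ℍ} {z : ℂ} (hz : z ∉ lattice τ) :
    E 3 τ z = deriv (deriv (logDeriv (Theta τ))) z / 2 := by rw [E_three_eq hz, logDeriv_Theta]

/-! ### Modular transformation of the lattice and of Θ -/

open Matrix.SpecialLinearGroup in
theorem cocycle_ne_zero (γ : Matrix.SpecialLinearGroup (Fin 2) ℤ) (τ : ℍ) : cocycle γ τ ≠ 0 := by
  have := denom_ne_zero γ τ
  rwa [ModularGroup.denom_apply] at this

theorem cocycle_eq_denom (γ : Matrix.SpecialLinearGroup (Fin 2) ℤ) (τ : ℍ) :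
    cocycle γ τ = denom γ τ := by rw [ModularGroup.denom_apply]; rfl

theorem smul_coe_mul_cocycle (γ : Matrix.SpecialLinearGroup (Fin 2) ℤ) (τ : ℍ) :
    ((γ • τ : ℍ) : ℂ) * cocycle γ τ = (γ.1 0 0 : ℤ) * τ + (γ.1 0 1 : ℤ) := by
  have h := coe_specialLinearGroup_apply γ τ
  have h0 := cocycle_ne_zero γ τ
  simp only [cocycle, algebraMap_int_eq, eq_intCast, Complex.ofReal_intCast] at h h0 ⊢
  rw [h, div_mul_cancel₀ _ h0]

theorem det_eq (γ : Matrix.SpecialLinearGroup (Fin 2) ℤ) :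
    γ.1 0 0 * γ.1 1 1 - γ.1 0 1 * γ.1 1 0 = 1 := by
  rw [← Matrix.det_fin_two, γ.2]

theorem det_eq' (γ : Matrix.SpecialLinearGroup (Fin 2) ℤ) :
    ((γ.1 0 0 : ℤ) : ℂ) * (γ.1 1 1 : ℤ) - (γ.1 0 1 : ℤ) * (γ.1 1 0 : ℤ) = 1 := by
  exact_mod_cast congrArg (Int.cast : ℤ → ℂ) (det_eq γ)

theorem one_div_cocycle (γ : Matrix.SpecialLinearGroup (Fin 2) ℤ) (τ : ℍ) :
    1 / cocycle γ τ = (-γ.1 1 0 : ℤ) * ((γ • τ : ℍ) : ℂ) + (γ.1 0 0 : ℤ) := by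
  have h0 := cocycle_ne_zero γ τ
  rw [div_eq_iff h0]
  have h := smul_coe_mul_cocycle γ τ
  rw [add_mul, mul_assoc, h, cocycle]
  push_cast
  linear_combination -(det_eq' γ)

theorem coe_div_cocycle (γ : Matrix.SpecialLinearGroup (Fin 2) ℤ) (τ : ℍ) :
    τ / cocycle γ τ = (γ.1 1 1 : ℤ) * ((γ • τ : ℍ) : ℂ) + (-γ.1 0 1 : ℤ) := by
  have h0 := cocycle_ne_zero γ τ
  rw [div_eq_iff h0]
  have h := smul_coe_mul_cocycle γ τ
  rw [add_mul, mul_assoc, h, cocycle]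
  push_cast
  linear_combination -(τ : ℂ) * (det_eq' γ)

theorem div_cocycle_mem_lattice_iff (γ : Matrix.SpecialLinearGroup (Fin 2) ℤ) (τ : ℍ) (z : ℂ) :
    z / cocycle γ τ ∈ lattice (γ • τ) ↔ z ∈ lattice τ := by
  have h0 := cocycle_ne_zero γ τ
  constructor
  · rintro ⟨m, n, h⟩
    rw [div_eq_iff h0, add_mul, mul_assoc, smul_coe_mul_cocycle, cocycle] at h
    exact ⟨m * γ.1 0 0 + n * γ.1 1 0, m * γ.1 0 1 + n * γ.1 1 1, by rw [h]; push_cast; ring⟩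
  · rintro ⟨m, n, rfl⟩
    refine ⟨m * γ.1 1 1 + n * -γ.1 1 0, m * -γ.1 0 1 + n * γ.1 0 0, ?_⟩
    have h1 := one_div_cocycle γ τ
    have h2 := coe_div_cocycle γ τ
    rw [add_div, mul_div_assoc, h2, div_eq_mul_one_div, h1]
    push_cast
    ring

/-- The sign (-1)^(l+u) is written as an exponential so that it can be merged with the other
exponential factors later. -/
theorem theta_lattice (τ : ℍ) (l u : ℤ) (z : ℂ) : Theta τ (z + (l * τ + u)) =
    ex ((l + u) / 2) * ex (-(l ^ 2 * τ / 2) - l * z) * Theta τ z := by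
  have hu : ∀ (u : ℤ) (z : ℂ), Theta τ (z + u) = ex (u / 2) * Theta τ z := by
    intro u
    induction u using Int.induction_on with
    | zero => intro z; simp [ex_zero]
    | succ n ih =>
      intro z
      have := ex_half_add (n / 2)
      push_cast at ih ⊢
      rw [← add_assoc, Theta_add_one, ih, show ((n : ℂ) + 1) / 2 = 1 / 2 + n / 2 by ring, this,
        neg_mul]
    | pred n ih =>
      intro z
      have h1 := Theta_add_one τ (z + (-n - 1))
      rw [show z + (-(n : ℂ) - 1) + 1 = z + -n by ring] at h1
      have := ex_half_add ((-n - 1) / 2)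
      push_cast at ih ⊢
      rw [ih, show (-(n : ℂ)) / 2 = 1 / 2 + (-n - 1) / 2 by ring, this, neg_mul, neg_inj] at h1
      exact h1.symm
  have hl : ∀ (l : ℤ) (z : ℂ), Theta τ (z + l * τ) =
      ex (l / 2) * ex (-(l ^ 2 * τ / 2) - l * z) * Theta τ z := by
    intro l
    induction l using Int.induction_on with
    | zero => intro z; simp [ex_zero]
    | succ n ih =>
      intro z
      have h1 := ex_half_add (n / 2)
      push_cast at ih ⊢
      rw [show z + (n + 1) * (τ : ℂ) = (z + n * τ) + τ by ring, Theta_add_coe, ih,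
        show ((n : ℂ) + 1) / 2 = 1 / 2 + n / 2 by ring, h1,
        show -(((n : ℂ) + 1) ^ 2 * τ / 2) - (n + 1) * z =
          (-τ / 2 - (z + n * τ)) + (-((n : ℂ) ^ 2 * τ / 2) - n * z) by ring, ex_add]
      ring
    | pred n ih =>
      intro z
      have h1 := Theta_add_coe τ (z + (-n - 1) * τ)
      rw [show z + (-(n : ℂ) - 1) * τ + τ = z + -n * τ by ring] at h1
      have h2 := ex_half_add ((-n - 1) / 2)
      push_cast at ih ⊢
      rw [ih, show (-(n : ℂ)) / 2 = 1 / 2 + (-n - 1) / 2 by ring, h2, 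
        show -((-(n : ℂ)) ^ 2 * τ / 2) - -n * z = (-τ / 2 - (z + (-n - 1) * τ)) +
          (-((-(n : ℂ) - 1) ^ 2 * τ / 2) - (-n - 1) * z) by ring, ex_add] at h1
      refine mul_left_cancel₀ (ex_ne_zero (-τ / 2 - (z + (-n - 1) * τ))) ?_
      linear_combination h1
  rw [← add_assoc, hu, hl, add_div, ex_add]
  ring

theorem ex_half_int_of_odd {n : ℤ} (h : Odd n) : ex ((n : ℂ) / 2) = -1 := by
  obtain ⟨m, rfl⟩ := h
  rw [show (((2 * m + 1 : ℤ) : ℂ) / 2) = 1 / 2 + m by push_cast; ring, ex_half_add, ex_int]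

/-- The expression is even only when `a` and `c` are both even, which the determinant excludes. It
governs the sign picked up in `Theta_smul`. -/
theorem odd_of_det {a b c d : ℤ} (h : a * d - b * c = 1) : Odd (a - c - c * a) := by
  by_contra hcon
  rw [Int.not_odd_iff_even] at hcon
  rcases Int.even_or_odd a with ha | ha <;> rcases Int.even_or_odd c with hc | hc
  · have : Even (a * d - b * c) := (ha.mul_right d).sub (hc.mul_left b)
    rw [h] at this
    exact Int.not_even_one this
  all_goals
    rcases ha with ⟨x, rfl⟩
    rcases hc with ⟨y, rfl⟩
    rcases hcon with ⟨w, hw⟩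
    ring_nf at hw
    omega

/-- The modular transformation of `Θ`. -/
theorem Theta_smul (γ : Matrix.SpecialLinearGroup (Fin 2) ℤ) (τ : ℍ) (z : ℂ) :
    ex (-((γ.1 1 0 : ℤ) * z ^ 2 / (2 * cocycle γ τ))) *
      (cocycle γ τ * Theta (γ • τ) (z / cocycle γ τ)) = Theta τ z := by
  set J := cocycle γ τ with hJ
  have h0 : J ≠ 0 := cocycle_ne_zero γ τ
  set σ := γ • τ with hσ
  -- `G` will have the quasi-periods of `Theta τ`, because 1/J and τ/J are lattice vectors for `σ`.
  -- The quotient is then a constant, and equal derivatives at 0 make it 1.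
  set G : ℂ → ℂ := fun z => ex (-((γ.1 1 0 : ℤ) * z ^ 2 / (2 * J))) * (J * Theta σ (z / J)) with hG
  have hodd : ex ((γ.1 0 0 : ℂ) / 2 - γ.1 1 0 / 2 - γ.1 1 0 * γ.1 0 0 / 2) = -1 := by
    rw [← ex_half_int_of_odd (odd_of_det (det_eq γ))]
    congr 1
    push_cast
    ring
  have hodd' : ex ((γ.1 1 1 : ℂ) / 2 - γ.1 0 1 / 2 - γ.1 0 1 * γ.1 1 1 / 2) = -1 := by
    rw [← ex_half_int_of_odd (odd_of_det (a := γ.1 1 1) (c := γ.1 0 1) (b := γ.1 1 0)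
      (d := γ.1 0 0) (by linear_combination det_eq γ))]
    congr 1
    push_cast
    ring
  have e1 := one_div_cocycle γ τ
  have e2 := coe_div_cocycle γ τ
  rw [← hJ, ← hσ] at e1 e2
  have hG1 : ∀ z, G (z + 1) = -G z := by
    intro z
    simp only [hG]
    rw [add_div, e1, theta_lattice, ← neg_one_mul (ex _ * _), ← hodd]
    simp only [← mul_assoc]
    rw [mul_right_comm _ J, mul_right_comm _ J, ← ex_add, ← ex_add, ← ex_add]
    congr 3
    have hc : ((γ.1 1 0 : ℤ) : ℂ) / J = (γ.1 1 0 : ℤ) * (γ.1 0 0 : ℤ) - (γ.1 1 0 : ℤ) ^ 2 * σ := by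
      rw [div_eq_mul_one_div, e1]; push_cast; ring
    push_cast
    have : ((γ.1 1 0 : ℤ) : ℂ) * (z + 1) ^ 2 / (2 * J) = (γ.1 1 0 : ℤ) * z ^ 2 / (2 * J) +
      (γ.1 1 0 : ℤ) * (z / J) + (γ.1 1 0 : ℤ) / J / 2 := by field_simp; ring
    rw [this, hc]
    ring
  have hGτ : ∀ z, G (z + τ) = -(ex (-τ / 2 - z) * G z) := by
    intro z
    simp only [hG]
    rw [add_div, e2, theta_lattice, ← neg_one_mul (ex _ * _), ← hodd']
    simp only [← mul_assoc]
    rw [mul_right_comm _ J, mul_right_comm _ J, ← ex_add, ← ex_add, ← ex_add, ← ex_add]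
    congr 3
    have hσ2 : (σ : ℂ) * J = (γ.1 0 0 : ℤ) * τ + (γ.1 0 1 : ℤ) := smul_coe_mul_cocycle γ τ
    have hJ2 : J = (γ.1 1 0 : ℤ) * τ + (γ.1 1 1 : ℤ) := rfl
    have hdet := det_eq' γ
    push_cast
    have hσ3 : (σ : ℂ) = ((γ.1 0 0 : ℤ) * τ + (γ.1 0 1 : ℤ)) / J := by
      rw [eq_div_iff h0, hσ2]
    rw [hσ3]
    field_simp
    rw [hJ2]
    linear_combination -(τ : ℂ) * ((γ.1 1 1 : ℤ) : ℂ) * hdet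
  have hGd : Differentiable ℂ G := by
    have := differentiable_Theta σ
    have h2 := differentiable_ex
    intro z
    exact ((h2 _).comp z (by fun_prop)).mul
      ((differentiableAt_const _).mul ((this _).comp z (by fun_prop)))
  have hG0 : G 0 = 0 := by simp [hG, Theta_zero]
  have hGd0 : deriv G 0 = 2 * Real.pi * I := by
    have h1 : HasDerivAt (fun z : ℂ => Theta σ (z / J)) (2 * Real.pi * I * (1 / J)) 0 := by
      have h2 : HasDerivAt (Theta σ) (2 * Real.pi * I) (0 / J) := by
        rw [zero_div, ← deriv_Theta_zero σ]
        exact (differentiable_Theta σ 0).hasDerivAt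
      exact h2.comp 0 ((hasDerivAt_id (0 : ℂ)).div_const J)
    have h3 : DifferentiableAt ℂ (fun z : ℂ => ex (-((γ.1 1 0 : ℤ) * z ^ 2 / (2 * J)))) 0 :=
      (differentiable_ex _).comp 0 (by fun_prop)
    have h4 := (h3.hasDerivAt.fun_mul (h1.const_mul J)).deriv
    have h5 : Theta σ (0 / J) = 0 := by rw [zero_div, Theta_zero]
    rw [hG, h4, h5]
    simp [ex_zero]
    field_simp
  have hlim := isBigO_div_of_deriv_ne_zero (hGd 0) (differentiable_Theta τ 0) hG0 (Theta_zero τ)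
    (by rw [deriv_Theta_zero]; exact Complex.two_pi_I_ne_zero)
  obtain ⟨c, hc⟩ := elliptic_const (τ := τ) (f := fun z => G z / Theta τ z)
    (fun z hz => (hGd z).div (differentiable_Theta τ z) (Theta_ne_zero hz))
    (fun z _ => by rw [hG1, Theta_add_one, neg_div_neg_eq])
    (fun z _ => by
      rw [hGτ, Theta_add_coe, neg_div_neg_eq, mul_div_mul_left _ _ (ex_ne_zero _)])
    (hlim.isBigO_one ℂ)
  have hc1 : c = 1 := by
    rw [hGd0, deriv_Theta_zero, div_self Complex.two_pi_I_ne_zero] at hlim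
    refine tendsto_nhds_unique (tendsto_const_nhds.congr' ?_) hlim
    filter_upwards [eventually_notMem_lattice τ] with z hz
    exact (hc z hz).symm
  have := Continuous.ext_on (dense_compl_lattice τ) hGd.continuous
    (differentiable_Theta τ).continuous (fun z hz => by
      have := hc z hz
      rw [hc1, div_eq_one_iff_eq (Theta_ne_zero hz)] at this
      exact this)
  exact congrFun this z

/-! ### Transformation of `E₁`, `E₂`, `E₃` -/

theorem hasDerivAt_Theta (τ : ℍ) (z : ℂ) : HasDerivAt (Theta τ) (deriv (Theta τ) z) z :=
  (differentiable_Theta τ z).hasDerivAt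

theorem eventually_notMem_lattice_of_notMem {τ : ℍ} {z : ℂ} (hz : z ∉ lattice τ) :
    ∀ᶠ w in 𝓝 z, w ∉ lattice τ := (isOpen_compl_lattice τ).mem_nhds hz

theorem analyticAt_logDeriv_Theta {τ : ℍ} {z : ℂ} (hz : z ∉ lattice τ) :
    AnalyticAt ℂ (logDeriv (Theta τ)) z :=
  AnalyticAt.div ((differentiable_Theta τ).analyticAt z).deriv
    ((differentiable_Theta τ).analyticAt z) (Theta_ne_zero hz)

theorem hasDerivAt_E_one {τ : ℍ} {z : ℂ} (hz : z ∉ lattice τ) :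
    HasDerivAt (E 1 τ) (-E 2 τ z) z := by
  rw [E_two_eq_deriv hz, neg_neg]
  refine (analyticAt_logDeriv_Theta hz).differentiableAt.hasDerivAt.congr_of_eventuallyEq ?_
  filter_upwards [eventually_notMem_lattice_of_notMem hz] with w hw
  exact E_one_eq_logDeriv hw

theorem hasDerivAt_E_two {τ : ℍ} {z : ℂ} (hz : z ∉ lattice τ) :
    HasDerivAt (E 2 τ) (-2 * E 3 τ z) z := by
  rw [E_three_eq_deriv hz]
  have h := (analyticAt_logDeriv_Theta hz).deriv.differentiableAt.hasDerivAt.neg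
  rw [show -2 * (deriv (deriv (logDeriv (Theta τ))) z / 2) =
    -deriv (deriv (logDeriv (Theta τ))) z by ring]
  refine h.congr_of_eventuallyEq ?_
  filter_upwards [eventually_notMem_lattice_of_notMem hz] with w hw
  exact E_two_eq_deriv hw

theorem wp'_eq {τ : ℍ} {z : ℂ} (hz : z ∉ lattice τ) : wp' τ z = -2 * E 3 τ z :=
  ((hasDerivAt_E_two hz).sub_const _).deriv

/-- Logarithmic derivative of the quasi-periodicity of Θ; the exponent is linear in z with slope -l.
-/
theorem E_one_lattice {τ : ℍ} {z : ℂ} (hz : z ∉ lattice τ) (l u : ℤ) :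
    E 1 τ (z + (l * τ + u)) = E 1 τ z - 2 * Real.pi * I * l := by
  have hz' : z + (l * τ + u) ∉ lattice τ :=
    fun h => hz ((add_mem_lattice_iff (int_mem_lattice τ l u)).1 h)
  rw [E_one_eq_logDeriv hz, E_one_eq_logDeriv hz', logDeriv_apply, logDeriv_apply]
  have h1 : HasDerivAt (fun w => Theta τ (w + (l * τ + u))) (deriv (Theta τ) (z + (l * τ + u))) z :=
    (hasDerivAt_Theta τ _).comp_add_const z _
  have he : HasDerivAt (fun w : ℂ => ex ((l + u) / 2) * ex (-(l ^ 2 * τ / 2) - l * w))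
      (ex ((l + u) / 2) * (2 * Real.pi * I * ex (-(l ^ 2 * τ / 2) - l * z) * (-(l : ℂ)))) z := by
    have h3 : HasDerivAt (fun w : ℂ => -((l : ℂ) ^ 2 * τ / 2) - l * w) (-(l : ℂ)) z := by
      simpa using ((hasDerivAt_id z).const_mul (l : ℂ)).const_sub (-((l : ℂ) ^ 2 * τ / 2))
    exact ((hasDerivAt_ex _).comp z h3).const_mul _
  have h2 := he.fun_mul (hasDerivAt_Theta τ z)
  have h4 := h1.unique (h2.congr_of_eventuallyEq (.of_forall fun w => theta_lattice τ l u w))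
  rw [h4, theta_lattice]
  have := Theta_ne_zero hz
  have := ex_ne_zero ((l + u) / 2)
  have := ex_ne_zero (-((l : ℂ) ^ 2 * τ / 2) - l * z)
  generalize ex (-((l : ℂ) ^ 2 * τ / 2) - l * z) = A at *
  field_simp
  ring

/-- Logarithmic derivative of `Theta_smul`; the Gaussian factor produces the term linear in z.
Differentiating once and twice more gives the laws for `E 2` and `E 3`. -/
theorem E_one_smul (γ : Matrix.SpecialLinearGroup (Fin 2) ℤ) {τ : ℍ} {z : ℂ}
    (hz : z ∉ lattice τ) : E 1 (γ • τ) (z / cocycle γ τ) =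
      cocycle γ τ * E 1 τ z + 2 * Real.pi * I * (γ.1 1 0 : ℤ) * z := by
  have hz' := mt (div_cocycle_mem_lattice_iff γ τ z).1 hz
  have h0 := cocycle_ne_zero γ τ
  rw [E_one_eq_logDeriv hz, E_one_eq_logDeriv hz', logDeriv_apply, logDeriv_apply]
  have h1 : HasDerivAt (fun w => Theta (γ • τ) (w / cocycle γ τ))
      (deriv (Theta (γ • τ)) (z / cocycle γ τ) * (1 / cocycle γ τ)) z :=
    (hasDerivAt_Theta (γ • τ) _).comp z ((hasDerivAt_id z).div_const _)
  have h3 : HasDerivAt (fun w : ℂ => -((γ.1 1 0 : ℤ) * w ^ 2 / (2 * cocycle γ τ)))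
      (-((γ.1 1 0 : ℤ) * (2 * z) / (2 * cocycle γ τ))) z := by
    have := (((hasDerivAt_pow 2 z).const_mul ((γ.1 1 0 : ℤ) : ℂ)).div_const
      (2 * cocycle γ τ)).neg
    norm_num at this
    exact this
  have h2 := ((hasDerivAt_ex _).comp z h3).fun_mul (h1.const_mul (cocycle γ τ))
  have h4 := (hasDerivAt_Theta τ z).unique
    (h2.congr_of_eventuallyEq (.of_forall fun w => (Theta_smul γ τ w).symm))
  simp only [Function.comp_apply] at h4
  rw [h4, ← Theta_smul γ τ z]
  have h5 := Theta_ne_zero hz'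
  have := ex_ne_zero (-((γ.1 1 0 : ℤ) * z ^ 2 / (2 * cocycle γ τ)))
  generalize ex (-((γ.1 1 0 : ℤ) * z ^ 2 / (2 * cocycle γ τ))) = A at *
  generalize Theta (γ • τ) (z / cocycle γ τ) = B at *
  generalize deriv (Theta (γ • τ)) (z / cocycle γ τ) = C at *
  field_simp
  ring

theorem E_two_lattice {τ : ℍ} {z : ℂ} (hz : z ∉ lattice τ) (l u : ℤ) :
    E 2 τ (z + (l * τ + u)) = E 2 τ z := by
  have hz' : z + (l * τ + u) ∉ lattice τ :=
    fun h => hz ((add_mem_lattice_iff (int_mem_lattice τ l u)).1 h)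
  have h1 := (hasDerivAt_E_one hz').comp_add_const z _
  have h2 := (hasDerivAt_E_one hz).sub_const (2 * Real.pi * I * l)
  have := h1.unique (h2.congr_of_eventuallyEq ?_)
  · exact neg_injective this
  filter_upwards [eventually_notMem_lattice_of_notMem hz] with w hw
  exact E_one_lattice hw l u

theorem E_three_lattice {τ : ℍ} {z : ℂ} (hz : z ∉ lattice τ) (l u : ℤ) :
    E 3 τ (z + (l * τ + u)) = E 3 τ z := by
  have hz' : z + (l * τ + u) ∉ lattice τ :=
    fun h => hz ((add_mem_lattice_iff (int_mem_lattice τ l u)).1 h)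
  have h1 := (hasDerivAt_E_two hz').comp_add_const z _
  have := h1.unique ((hasDerivAt_E_two hz).congr_of_eventuallyEq ?_)
  · exact mul_left_cancel₀ (by norm_num) this
  filter_upwards [eventually_notMem_lattice_of_notMem hz] with w hw
  exact E_two_lattice hw l u

theorem E_two_smul (γ : Matrix.SpecialLinearGroup (Fin 2) ℤ) {τ : ℍ} {z : ℂ}
    (hz : z ∉ lattice τ) : E 2 (γ • τ) (z / cocycle γ τ) =
      cocycle γ τ ^ 2 * E 2 τ z - 2 * Real.pi * I * (γ.1 1 0 : ℤ) * cocycle γ τ := by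
  have hz' := mt (div_cocycle_mem_lattice_iff γ τ z).1 hz
  have h0 := cocycle_ne_zero γ τ
  have h1 := (hasDerivAt_E_one hz').comp z ((hasDerivAt_id z).div_const (cocycle γ τ))
  have h2 := ((hasDerivAt_E_one hz).const_mul (cocycle γ τ)).fun_add
    ((hasDerivAt_id z).const_mul (2 * Real.pi * I * (γ.1 1 0 : ℤ)))
  have := h1.unique (h2.congr_of_eventuallyEq ?_)
  · field_simp at this
    linear_combination -this
  filter_upwards [eventually_notMem_lattice_of_notMem hz] with w hw
  exact E_one_smul γ hw

theorem E_three_smul (γ : Matrix.SpecialLinearGroup (Fin 2) ℤ) {τ : ℍ} {z : ℂ}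
    (hz : z ∉ lattice τ) : E 3 (γ • τ) (z / cocycle γ τ) = cocycle γ τ ^ 3 * E 3 τ z := by
  have hz' := mt (div_cocycle_mem_lattice_iff γ τ z).1 hz
  have h0 := cocycle_ne_zero γ τ
  have h1 := (hasDerivAt_E_two hz').comp z ((hasDerivAt_id z).div_const (cocycle γ τ))
  have h2 := ((hasDerivAt_E_two hz).const_mul (cocycle γ τ ^ 2)).sub_const
    (2 * Real.pi * I * (γ.1 1 0 : ℤ) * cocycle γ τ)
  have := h1.unique (h2.congr_of_eventuallyEq ?_)
  · field_simp at this
    linear_combination -this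
  filter_upwards [eventually_notMem_lattice_of_notMem hz] with w hw
  exact E_two_smul γ hw

/-! ### The Eisenstein series `e₂` and `e₄` -/

theorem eis_summand_eq (k : ℕ) (hk : k ≠ 0) (τ : ℍ) (a b : ℤ) :
    (if a = 0 ∧ b = 0 then 0 else 1 / ((a : ℂ) * (τ : ℂ) + b) ^ k) =
      EisensteinSeries.eisSummand k ![a, b] τ := by
  rw [EisensteinSeries.eisSummand]
  split_ifs with h
  · simp [h.1, h.2, hk]
  · simp

/-- The inner sums converge absolutely, so only the outer summation remains conditional, exactly as
in `G2`. -/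
theorem eis_two_eq (τ : ℍ) (z : ℂ) : eis 2 τ z = EisensteinSeries.G2 τ := by
  rw [eis, EisensteinSeries.G2]
  congr 1
  funext a
  rw [EisensteinSeries.e2Summand]
  simp_rw [eis_summand_eq 2 two_ne_zero τ a]
  exact tsum_eq_of_summable_unconditional (EisensteinSeries.e2Summand_summable a τ)

theorem eis_four_eq (τ : ℍ) (z : ℂ) : eis 4 τ z = 2 * riemannZeta 4 * ModularForm.E₄ τ := by
  have hs := summable_prod_eisSummand (k := 4) (by norm_num) τ
  have h1 : eis 4 τ z = ∑' v : Fin 2 → ℤ, EisensteinSeries.eisSummand 4 v τ := by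
    rw [eis]
    simp_rw [eis_summand_eq 4 four_ne_zero τ]
    have h2 : ∀ a : ℤ, ∑'[SummationFilter.symmetricIcc ℤ] b : ℤ,
        EisensteinSeries.eisSummand (4 : ℕ) ![a, b] τ =
        ∑' b : ℤ, EisensteinSeries.eisSummand (4 : ℕ) ![a, b] τ := fun a =>
      tsum_eq_of_summable_unconditional (hs.prod_factor a)
    simp_rw [h2]
    rw [tsum_eq_of_summable_unconditional hs.prod, ← hs.tsum_prod,
      ← (finTwoArrowEquiv ℤ).symm.tsum_eq]
    rfl
  have h3 := tsum_eisSummand_eq_riemannZeta_mul_eisensteinSeries (k := 4)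
    (by norm_num) τ
  have h4 : ModularForm.E₄ τ = (1 / 2 : ℂ) * eisensteinSeries (N := 1) 0 4 τ := rfl
  rw [h1, h4]
  push_cast at h3
  rw [h3]
  ring

theorem eis_two_smul (γ : Matrix.SpecialLinearGroup (Fin 2) ℤ) (τ : ℍ) (z w : ℂ) :
    eis 2 (γ • τ) z =
      cocycle γ τ ^ 2 * eis 2 τ w - 2 * Real.pi * I * (γ.1 1 0 : ℤ) * cocycle γ τ := by
  have h := congrFun (EisensteinSeries.G2_slash_action γ) τ
  rw [ModularForm.SL_slash_apply, ← cocycle_eq_denom, Pi.sub_apply, EisensteinSeries.D2,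
    ← cocycle_eq_denom] at h
  have h0 := cocycle_ne_zero γ τ
  rw [eis_two_eq, eis_two_eq]
  rw [zpow_neg, ← div_eq_mul_inv, div_eq_iff (zpow_ne_zero _ h0), zpow_ofNat] at h
  rw [h]
  field_simp

theorem E_four_smul (γ : Matrix.SpecialLinearGroup (Fin 2) ℤ) (τ : ℍ) :
    ModularForm.E₄ (γ • τ) = cocycle γ τ ^ 4 * ModularForm.E₄ τ := by
  rw [cocycle_eq_denom]
  exact SlashInvariantForm.slash_action_eqn'' (Γ := 𝒮ℒ) ModularForm.E₄ (Set.mem_range_self γ) τ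

theorem eis_four_smul (γ : Matrix.SpecialLinearGroup (Fin 2) ℤ) (τ : ℍ) (z w : ℂ) :
    eis 4 (γ • τ) z = cocycle γ τ ^ 4 * eis 4 τ w := by
  rw [eis_four_eq, eis_four_eq, E_four_smul]
  ring

theorem wp_lattice {τ : ℍ} {z : ℂ} (hz : z ∉ lattice τ) (l u : ℤ) :
    wp τ (z + (l * τ + u)) = wp τ z := by
  rw [wp, wp, E_two_lattice hz, eis_two_eq, eis_two_eq]

/-- The anomalies of `E 2` and `eis 2` coincide and cancel in the difference. -/
theorem wp_smul (γ : Matrix.SpecialLinearGroup (Fin 2) ℤ) {τ : ℍ} {z : ℂ}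
    (hz : z ∉ lattice τ) : wp (γ • τ) (z / cocycle γ τ) = cocycle γ τ ^ 2 * wp τ z := by
  rw [wp, wp, E_two_smul γ hz, eis_two_smul γ τ _ z]
  ring

/-! ### Holomorphy -/

theorem eventually_notMem_lattice₂ {τ : ℍ} {z : ℂ} (hz : z ∉ lattice τ) :
    ∀ᶠ p in 𝓝 ((τ : ℂ), z), p.2 ∉ lattice (ofComplex p.1) := by
  filter_upwards [isOpen_offLat.mem_nhds (mem_offLat.2 hz)] with p hp
  exact hp.2

theorem holAt_E_one {τ : ℍ} {z : ℂ} (hz : z ∉ lattice τ) : HolAt (E 1) τ z := by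
  refine ((HolAt.deriv (holAt_Theta τ z)).div (holAt_Theta τ z) (Theta_ne_zero hz)).congr ?_
  filter_upwards [eventually_notMem_lattice₂ hz] with p hp
  rw [E_one_eq_logDeriv hp, logDeriv_apply]

theorem holAt_E_two {τ : ℍ} {z : ℂ} (hz : z ∉ lattice τ) : HolAt (E 2) τ z := by
  refine (HolAt.deriv (holAt_E_one hz)).neg.congr ?_
  filter_upwards [eventually_notMem_lattice₂ hz] with p hp
  rw [(hasDerivAt_E_one hp).deriv, neg_neg]

theorem holAt_E_three {τ : ℍ} {z : ℂ} (hz : z ∉ lattice τ) : HolAt (E 3) τ z := by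
  refine ((HolAt.deriv (holAt_E_two hz)).mul (HolAt.const (-1 / 2) τ z)).congr ?_
  filter_upwards [eventually_notMem_lattice₂ hz] with p hp
  rw [(hasDerivAt_E_two hp).deriv]
  ring

theorem analyticAt_of_mdifferentiable {f : ℍ → ℂ} (hf : MDiff f) (τ : ℍ) :
    AnalyticAt ℂ (fun w : ℂ => f (ofComplex w)) τ := by
  have h := UpperHalfPlane.mdifferentiable_iff.1 hf
  exact h.analyticAt ((isOpen_lt continuous_const Complex.continuous_im).mem_nhds τ.im_pos)

theorem holAt_eis_two (τ : ℍ) (z : ℂ) : HolAt (eis 2) τ z := by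
  have h : AnalyticAt ℂ (fun w : ℂ => EisensteinSeries.G2 (ofComplex w)) τ := by
    have h1 := analyticAt_of_mdifferentiable E2_mdifferentiable τ
    have hz : riemannZeta 2 ≠ 0 := riemannZeta_ne_zero_of_one_lt_re (by norm_num)
    refine (h1.fun_mul (analyticAt_const (v := 2 * riemannZeta 2))).congr
      (.of_forall fun w => ?_)
    simp only [EisensteinSeries.E2, Pi.smul_apply, smul_eq_mul]
    field_simp
  refine (HolAt.of_fst h z).congr (.of_forall fun p => ?_)
  rw [eis_two_eq]

theorem holAt_eis_four (τ : ℍ) (z : ℂ) : HolAt (eis 4) τ z := by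
  have h := (analyticAt_const (v := 2 * riemannZeta 4)).fun_mul
    (analyticAt_of_mdifferentiable ModularForm.E₄.holo' τ)
  refine (HolAt.of_fst (f := fun τ => 2 * riemannZeta 4 * ModularForm.E₄ τ) h z).congr
    (.of_forall fun p => ?_)
  rw [eis_four_eq]

/-! ### Behaviour at the cusp `i∞` -/

/-- With a continuous limit, convergence along L × 𝓝 w for every w is locally uniform convergence,
and this passes to complex derivatives. -/
theorem tendsto_joint_deriv {F : ℍ → ℂ → ℂ} {g : ℂ → ℂ} {U : Set ℂ} {L : Filter ℍ} [L.NeBot]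
    (hU : IsOpen U) (hg : ContinuousOn g U) (hF : ∀ᶠ τ in L, DifferentiableOn ℂ (F τ) U)
    (h : ∀ w ∈ U, Tendsto (fun p : ℍ × ℂ => F p.1 p.2) (L ×ˢ 𝓝 w) (𝓝 (g w))) :
    ContinuousOn (deriv g) U ∧ ∀ w ∈ U,
      Tendsto (fun p : ℍ × ℂ => deriv (F p.1) p.2) (L ×ˢ 𝓝 w) (𝓝 (deriv g w)) := by
  have h1 : TendstoLocallyUniformlyOn F g L U := by
    rw [tendstoLocallyUniformlyOn_iff_forall_tendsto]
    intro w hw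
    rw [hU.nhdsWithin_eq hw]
    have h2 : Tendsto (fun p : ℍ × ℂ => g p.2) (L ×ˢ 𝓝 w) (𝓝 (g w)) :=
      (hg.continuousAt (hU.mem_nhds hw)).tendsto.comp tendsto_snd
    have := (h2.prodMk_nhds (h w hw)).mono_right (nhds_le_uniformity (g w))
    exact this
  have hgd := h1.differentiableOn hF hU
  have hc := (hgd.deriv hU).continuousOn
  refine ⟨hc, fun w hw => ?_⟩
  have h3 := tendstoLocallyUniformlyOn_iff_forall_tendsto.1 (h1.deriv hF hU) w hw
  rw [hU.nhdsWithin_eq hw] at h3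
  have h4 : Tendsto (fun p : ℍ × ℂ => deriv g p.2) (L ×ˢ 𝓝 w) (𝓝 (deriv g w)) :=
    (hc.continuousAt (hU.mem_nhds hw)).tendsto.comp tendsto_snd
  exact h4.congr_uniformity h3

theorem piCot_neg (w : ℂ) : piCot (-w) = -piCot w := by
  rw [piCot, piCot, mul_neg, Complex.cot_eq_cos_div_sin, Complex.cot_eq_cos_div_sin,
    Complex.cos_neg, Complex.sin_neg, div_neg, mul_neg]

theorem norm_piCot_add_le {w : ℂ} (h : ‖ex w‖ ≤ 1 / 2) :
    ‖piCot w + Real.pi * I‖ ≤ 4 * Real.pi * ‖ex w‖ := by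
  have h1 : 1 / 2 ≤ ‖1 - ex w‖ := by
    have := norm_sub_norm_le (1 : ℂ) (ex w)
    rw [norm_one] at this
    linarith
  have h0 : 1 - ex w ≠ 0 := fun h0 => by
    rw [h0, norm_zero] at h1
    linarith
  have e : piCot w + Real.pi * I = -(2 * Real.pi * I) * ex w / (1 - ex w) := by
    rw [piCot_eq]
    field_simp
    ring
  rw [e, norm_div, norm_mul, norm_neg, norm_mul, norm_mul, Complex.norm_I, Complex.norm_real,
    Real.norm_of_nonneg Real.pi_pos.le, div_le_iff₀ (by linarith)]
  norm_num
  nlinarith [mul_nonneg Real.pi_pos.le (norm_nonneg (ex w))]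

/-- Adding and subtracting πi in the terms at ±(n+1) makes each of them exponentially small. -/
theorem sum_piCot_eq (τ : ℍ) (z : ℂ) (N : ℕ) :
    ∑ a ∈ Finset.Icc (-(N : ℤ)) N, piCot (z + a * τ) = piCot z + ∑ n ∈ Finset.range N,
      ((piCot (((n + 1 : ℕ) : ℂ) * τ + z) + Real.pi * I) -
        (piCot (((n + 1 : ℕ) : ℂ) * τ - z) + Real.pi * I)) := by
  induction N with
  | zero => simp
  | succ N ih =>
    rw [sum_Icc_neg_succ, ih, Finset.sum_range_succ]
    have := piCot_neg (((N + 1 : ℕ) : ℂ) * τ - z)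
    rw [add_sub_add_right_eq_sub, sub_eq_add_neg (piCot _) (piCot _), ← this]
    rw [show -(((N + 1 : ℕ) : ℂ) * τ - z) = z + ((-((N : ℤ) + 1) : ℤ) : ℂ) * τ by push_cast; ring,
      show ((N + 1 : ℕ) : ℂ) * τ + z = z + (((N : ℤ) + 1 : ℤ) : ℂ) * τ by push_cast; ring]
    abel

/-- The paired terms are bounded by 4πε times a geometric sequence of ratio 1/2, whose sum is at
most 2. -/
theorem norm_E_one_sub_le {τ : ℍ} {z : ℂ} (hz : z ∉ lattice τ) (hτ : ‖ex τ‖ ≤ 1 / 2)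
    (h1 : ‖ex (τ + z)‖ + ‖ex (τ - z)‖ ≤ 1 / 2) :
    ‖E 1 τ z - piCot z‖ ≤ 8 * Real.pi * (‖ex (τ + z)‖ + ‖ex (τ - z)‖) := by
  set ε := ‖ex (τ + z)‖ + ‖ex (τ - z)‖ with hε
  have hlim : Tendsto (fun N : ℕ => ∑ a ∈ Finset.Icc (-(N : ℤ)) N, piCot (z + a * τ) - piCot z)
      atTop (𝓝 (E 1 τ z - piCot z)) := by
    rw [E_one_eq hz]
    exact ((tendstoLocallyUniformlyOn_sum_piCot τ).tendsto_at hz).sub_const _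
  refine le_of_tendsto hlim.norm (.of_forall fun N => ?_)
  rw [sum_piCot_eq, add_sub_cancel_left]
  have key : ∀ (n : ℕ) (v : ℂ), ‖ex (((n + 1 : ℕ) : ℂ) * τ + v)‖ ≤ (1 / 2) ^ n * ‖ex (τ + v)‖ := by
    intro n v
    rw [show ((n + 1 : ℕ) : ℂ) * τ + v = n * τ + (τ + v) by push_cast; ring, ex_add, ex_nat_mul,
      norm_mul, norm_pow]
    gcongr
  have hterm : ∀ n ∈ Finset.range N, ‖(piCot (((n + 1 : ℕ) : ℂ) * τ + z) + Real.pi * I) -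
        (piCot (((n + 1 : ℕ) : ℂ) * τ - z) + Real.pi * I)‖ ≤ 4 * Real.pi * ε * (1 / 2) ^ n := by
    intro n _
    have k1 := key n z
    have k2 := key n (-z)
    rw [← sub_eq_add_neg, ← sub_eq_add_neg] at k2
    have hp : (1 / 2 : ℝ) ^ n ≤ 1 := pow_le_one₀ (by norm_num) (by norm_num)
    have n1 := norm_nonneg (ex (τ + z))
    have n2 := norm_nonneg (ex (τ - z))
    have a1 := norm_piCot_add_le (w := ((n + 1 : ℕ) : ℂ) * τ + z) (by nlinarith)
    have a2 := norm_piCot_add_le (w := ((n + 1 : ℕ) : ℂ) * τ - z) (by nlinarith)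
    refine (norm_sub_le _ _).trans ?_
    have hpi := Real.pi_pos
    calc _ ≤ 4 * Real.pi * ((1 / 2) ^ n * ‖ex (τ + z)‖) +
          4 * Real.pi * ((1 / 2) ^ n * ‖ex (τ - z)‖) := by
            refine add_le_add (a1.trans ?_) (a2.trans ?_) <;> gcongr
      _ = _ := by rw [hε]; ring
  refine (norm_sum_le_of_le _ hterm).trans ?_
  rw [← Finset.mul_sum]
  have hgeom : ∑ n ∈ Finset.range N, (1 / 2 : ℝ) ^ n ≤ 2 := by
    have := summable_geometric_two.sum_le_tsum (Finset.range N) (fun n _ => by positivity)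
    rwa [tsum_geometric_two] at this
  have : 0 ≤ ε := by positivity
  nlinarith [mul_nonneg Real.pi_pos.le this]

theorem tendsto_norm_ex_joint {c : ℝ} (hc : 0 < c) (s : ℝ) (w₀ : ℂ) :
    Tendsto (fun p : ℍ × ℂ => ‖ex (c * (p.1 : ℂ) + s * p.2)‖) (atImInfty ×ˢ 𝓝 w₀) (𝓝 0) := by
  have h1 : Tendsto (fun p : ℍ × ℂ => p.1.im) (atImInfty ×ˢ 𝓝 w₀) atTop :=
    (tendsto_comap (f := UpperHalfPlane.im)).comp tendsto_fst
  have h2 : Tendsto (fun p : ℍ × ℂ => s * p.2.im) (atImInfty ×ˢ 𝓝 w₀) (𝓝 (s * w₀.im)) :=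
    ((Complex.continuous_im.tendsto w₀).comp tendsto_snd).const_mul s
  have h3 := (h1.const_mul_atTop hc).atTop_add h2
  have h4 := Real.tendsto_exp_atBot.comp (h3.const_mul_atTop_of_neg
    (by linarith [Real.pi_pos] : -(2 * Real.pi) < 0))
  refine h4.congr fun p => ?_
  rw [norm_ex]
  simp only [Function.comp_apply, Complex.add_im, Complex.im_ofReal_mul,
    UpperHalfPlane.coe_im]
  congr 1
  ring

instance : (atImInfty : Filter ℍ).NeBot := by
  rw [atImInfty_basis.neBot_iff]
  intro y _
  refine ⟨⟨⟨0, max y 1⟩, by simp⟩, ?_⟩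
  simp [UpperHalfPlane.im]

/-- The domain of `w` for which `lτ + w` stays off the lattice near `i∞`. -/
noncomputable def cuspDomain (l : ℝ) : Set ℂ := if l = 0 then Complex.integerComplement else Set.univ

/-- The limit of `E₁(τ, lτ + w)` at `i∞` for `0 ≤ l < 1`. -/
noncomputable def cuspLimit (l : ℝ) : ℂ → ℂ := if l = 0 then piCot else fun _ => -(Real.pi * I)

theorem isOpen_cuspDomain (l : ℝ) : IsOpen (cuspDomain l) := by
  rw [cuspDomain]
  split_ifs
  exacts [isOpen_integerComplement, isOpen_univ]

theorem continuousOn_cuspLimit (l : ℝ) : ContinuousOn (cuspLimit l) (cuspDomain l) := by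
  rw [cuspDomain, cuspLimit]
  split_ifs
  exacts [differentiableOn_piCot.continuousOn, continuousOn_const]

/-- If lτ + w = aτ + b, then Im w = (a - l) Im τ, which exceeds B for large Im τ unless a = l = 0;
in that case w is an integer. -/
theorem eventually_add_notMem_lattice {l : ℝ} (h0 : 0 ≤ l) (h1 : l < 1) (B : ℝ) :
    ∀ᶠ τ : ℍ in atImInfty, ∀ w ∈ cuspDomain l, |w.im| < B → (l * τ + w : ℂ) ∉ lattice τ := by
  -- The distance from `l` to the integers other than `l` itself.
  set δ := min (1 - l) (if l = 0 then 1 else l) with hδ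
  have hδ0 : 0 < δ := by
    rw [hδ, lt_min_iff]
    split_ifs with h
    · exact ⟨by linarith, one_pos⟩
    · exact ⟨by linarith, lt_of_le_of_ne h0 (Ne.symm h)⟩
  have hδ1 : δ ≤ 1 - l := min_le_left _ _
  filter_upwards [(tendsto_comap (f := UpperHalfPlane.im)).eventually_ge_atTop (B / δ)]
    with τ hτ w hw hB hmem
  rw [div_le_iff₀ hδ0] at hτ
  obtain ⟨a, b, hab⟩ := hmem
  have him := congrArg Complex.im hab
  simp only [Complex.add_im, Complex.im_ofReal_mul, UpperHalfPlane.coe_im, Complex.intCast_im,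
    add_zero] at him
  have him2 : ((a : ℂ) * τ).im = a * τ.im := by simp
  rw [him2] at him
  have hy := τ.im_pos
  have hw' : w.im = (a - l) * τ.im := by linarith
  rw [hw', abs_mul, abs_of_pos hy] at hB
  have hlt : |(a : ℝ) - l| < δ := by nlinarith
  have ha : a = 0 := by
    by_contra hne
    rcases lt_or_gt_of_ne hne with h | h
    · have : (a : ℝ) ≤ -1 := by exact_mod_cast (by omega : a ≤ -1)
      rw [abs_of_nonpos (by linarith)] at hlt
      linarith
    · have : (1 : ℝ) ≤ a := by exact_mod_cast h
      rw [abs_of_nonneg (by linarith)] at hlt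
      linarith
  rw [ha, Int.cast_zero, zero_sub, abs_neg, abs_of_nonneg h0] at hlt
  have hl : l = 0 := by
    by_contra hl
    have : δ ≤ l := by
      rw [hδ, if_neg hl]
      exact min_le_right _ _
    linarith
  rw [cuspDomain, if_pos hl] at hw
  rw [hl, ha] at hab
  simp only [Complex.ofReal_zero, zero_mul, zero_add, Int.cast_zero] at hab
  exact hw ⟨b, hab.symm⟩

/-- For 0 ≤ l < 1 both τ + z and τ - z go to i∞, so only the central cotangent contributes. For l >
0 its argument goes to i∞ as well, where it tends to -πi. -/
theorem tendsto_E_one_joint {l : ℝ} (h0 : 0 ≤ l) (h1 : l < 1) {w₀ : ℂ} (hw : w₀ ∈ cuspDomain l) :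
    Tendsto (fun p : ℍ × ℂ => E 1 p.1 (l * p.1 + p.2)) (atImInfty ×ˢ 𝓝 w₀)
      (𝓝 (cuspLimit l w₀)) := by
  have hε1 := tendsto_norm_ex_joint (c := 1 + l) (by linarith) 1 w₀
  have hε2 := tendsto_norm_ex_joint (c := 1 - l) (by linarith) (-1) w₀
  have hq := tendsto_norm_ex_joint (c := 1) one_pos 0 w₀
  have hε := hε1.add hε2
  rw [add_zero] at hε
  have hdiff : Tendsto (fun p : ℍ × ℂ => E 1 p.1 (l * p.1 + p.2) - piCot (l * p.1 + p.2))
      (atImInfty ×ˢ 𝓝 w₀) (𝓝 0) := by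
    have hε' := hε.const_mul (8 * Real.pi)
    rw [mul_zero] at hε'
    refine squeeze_zero_norm' ?_ hε'
    have hB : ∀ᶠ w in 𝓝 w₀, |w.im| < |w₀.im| + 1 :=
      (continuous_abs.comp Complex.continuous_im).tendsto w₀ |>.eventually_lt_const (by simp)
    have hoff := ((eventually_add_notMem_lattice h0 h1 (|w₀.im| + 1)).prod_mk
      (hB.and ((isOpen_cuspDomain l).mem_nhds hw)))
    filter_upwards [hoff, hε.eventually_le_const (by norm_num : (0 : ℝ) < 1 / 2),
      hq.eventually_le_const (by norm_num : (0 : ℝ) < 1 / 2)] with p hp1 hp2 hp3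
    have e1 : ((1 + l : ℝ) : ℂ) * (p.1 : ℂ) + (1 : ℝ) * p.2 = p.1 + (l * p.1 + p.2) := by
      push_cast; ring
    have e2 : ((1 - l : ℝ) : ℂ) * (p.1 : ℂ) + (-1 : ℝ) * p.2 = p.1 - (l * p.1 + p.2) := by
      push_cast; ring
    have e3 : ((1 : ℝ) : ℂ) * (p.1 : ℂ) + (0 : ℝ) * p.2 = p.1 := by push_cast; ring
    rw [e1, e2] at hp2 ⊢
    rw [e3] at hp3
    exact norm_E_one_sub_le (hp1.1 _ hp1.2.2 hp1.2.1) hp3 hp2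
  have hcot : Tendsto (fun p : ℍ × ℂ => piCot (l * p.1 + p.2)) (atImInfty ×ˢ 𝓝 w₀)
      (𝓝 (cuspLimit l w₀)) := by
    have hcl := cuspLimit
    rw [cuspLimit]
    split_ifs with hl
    · rw [cuspDomain, if_pos hl] at hw
      simp only [hl, Complex.ofReal_zero, zero_mul, zero_add]
      exact (differentiableOn_piCot.continuousOn.continuousAt
        (isOpen_integerComplement.mem_nhds hw)).tendsto.comp tendsto_snd
    · have h := tendsto_norm_ex_joint (c := l) (lt_of_le_of_ne h0 (Ne.symm hl)) 1 w₀
      have h' := h.const_mul (4 * Real.pi)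
      rw [mul_zero] at h'
      refine tendsto_iff_norm_sub_tendsto_zero.2 (squeeze_zero' (.of_forall fun p => norm_nonneg _)
        ?_ h')
      filter_upwards [h.eventually_le_const (by norm_num : (0 : ℝ) < 1 / 2)] with p hp
      rw [Complex.ofReal_one, one_mul] at hp ⊢
      rw [sub_neg_eq_add]
      exact norm_piCot_add_le hp
  simpa using hdiff.add hcot

theorem tendsto_E_joint {l : ℝ} (h0 : 0 ≤ l) (h1 : l < 1) {w₀ : ℂ} (hw : w₀ ∈ cuspDomain l) :
    Tendsto (fun p : ℍ × ℂ => E 2 p.1 (l * p.1 + p.2)) (atImInfty ×ˢ 𝓝 w₀)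
      (𝓝 (-deriv (cuspLimit l) w₀)) ∧
    Tendsto (fun p : ℍ × ℂ => E 3 p.1 (l * p.1 + p.2)) (atImInfty ×ˢ 𝓝 w₀)
      (𝓝 (deriv (deriv (cuspLimit l)) w₀ / 2)) := by
  -- With bounded imaginary part, a single neighbourhood of i∞ keeps lτ + w off the lattice for all
  -- w in `U` at once, so the limit may be differentiated twice.
  set B := |w₀.im| + 1
  set U := cuspDomain l ∩ {w : ℂ | |w.im| < B} with hU
  have hUo : IsOpen U := (isOpen_cuspDomain l).inter
    (isOpen_lt (continuous_abs.comp Complex.continuous_im) continuous_const)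
  have hwU : w₀ ∈ U := ⟨hw, by simp [B]⟩
  have hoff := eventually_add_notMem_lattice h0 h1 B
  have hd1 : ∀ {τ : ℍ} {w : ℂ}, (l * τ + w : ℂ) ∉ lattice τ →
      HasDerivAt (fun w => E 1 τ (l * τ + w)) (-E 2 τ (l * τ + w)) w := fun h =>
    (hasDerivAt_E_one h).comp_const_add _ _
  have hd2 : ∀ {τ : ℍ} {w : ℂ}, (l * τ + w : ℂ) ∉ lattice τ →
      HasDerivAt (fun w => -E 2 τ (l * τ + w)) (2 * E 3 τ (l * τ + w)) w := fun h => by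
    have := ((hasDerivAt_E_two h).comp_const_add _ _).fun_neg
    rwa [neg_mul, neg_neg] at this
  obtain ⟨hc, hE2⟩ := tendsto_joint_deriv (L := atImInfty) (F := fun τ w => E 1 τ (l * τ + w)) hUo
    ((continuousOn_cuspLimit l).mono Set.inter_subset_left)
    (hoff.mono fun τ hτ w hw => (hd1 (hτ w hw.1 hw.2)).differentiableAt.differentiableWithinAt)
    (fun w hw => tendsto_E_one_joint h0 h1 hw.1)
  have hev : ∀ w ∈ U, ∀ᶠ p : ℍ × ℂ in atImInfty ×ˢ 𝓝 w, (l * p.1 + p.2 : ℂ) ∉ lattice p.1 := by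
    intro w hw
    filter_upwards [hoff.prod_mk (hUo.mem_nhds hw)] with p hp
    exact hp.1 _ hp.2.1 hp.2.2
  have hE2' : ∀ w ∈ U, Tendsto (fun p : ℍ × ℂ => -E 2 p.1 (l * p.1 + p.2)) (atImInfty ×ˢ 𝓝 w)
      (𝓝 (deriv (cuspLimit l) w)) := fun w hw => (hE2 w hw).congr' (by
    filter_upwards [hev w hw] with p hp
    exact (hd1 hp).deriv)
  obtain ⟨-, hE3⟩ := tendsto_joint_deriv (L := atImInfty)
    (F := fun τ w => -E 2 τ (l * τ + w)) hUo hc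
    (hoff.mono fun τ hτ w hw => (hd2 (hτ w hw.1 hw.2)).differentiableAt.differentiableWithinAt) hE2'
  refine ⟨by simpa using (hE2' w₀ hwU).neg, ?_⟩
  refine ((hE3 w₀ hwU).div_const 2).congr' ?_
  filter_upwards [hev w₀ hwU] with p hp
  rw [(hd2 hp).deriv]
  ring

/-! ### The theta function at `i∞` -/

/-- As n(n+1) ≥ 0, the imaginary part of τ may be replaced by 1. This leaves a summable Gaussian
bound independent of τ and z. -/
theorem norm_theta_term_le {τ : ℍ} (hτ : 1 ≤ τ.im) {z : ℂ} {B : ℝ} (hz : |z.im| ≤ B) (n : ℤ) :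
    ‖(-1 : ℂ) ^ n * ex (((n : ℂ) + 1 / 2) * z) * ex ((n * (n + 1) / 2 : ℂ) * (τ : ℂ))‖ ≤
      Real.exp (Real.pi * B) *
        Real.exp (-Real.pi * (1 * (n : ℝ) ^ 2 - 2 * (B + 1 / 2) * |(n : ℝ)|)) := by
  rw [norm_mul, norm_mul, norm_zpow, norm_neg, norm_one, one_zpow, one_mul, norm_ex, norm_ex,
    ← Real.exp_add, ← Real.exp_add, Real.exp_le_exp]
  have e1 : (((n : ℂ) + 1 / 2) * z).im = ((n : ℝ) + 1 / 2) * z.im := by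
    have : ((n : ℂ) + 1 / 2) = (((n : ℝ) + 1 / 2 : ℝ) : ℂ) := by push_cast; ring
    rw [this, Complex.im_ofReal_mul]
  have e2 : ((n * (n + 1) / 2 : ℂ) * (τ : ℂ)).im = (n : ℝ) * (n + 1) / 2 * τ.im := by
    have : (n * (n + 1) / 2 : ℂ) = (((n : ℝ) * (n + 1) / 2 : ℝ) : ℂ) := by push_cast; ring
    rw [this, Complex.im_ofReal_mul, UpperHalfPlane.coe_im]
  rw [e1, e2]
  have hn : (0 : ℝ) ≤ (n : ℝ) * (n + 1) := by
    have : 0 ≤ n * (n + 1) := by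
      rcases le_or_gt 0 n with h | h
      · positivity
      · nlinarith
    exact_mod_cast this
  have h1 : (n : ℝ) * (n + 1) ≤ (n : ℝ) * (n + 1) * τ.im := le_mul_of_one_le_right hn hτ
  have h2 : -(((n : ℝ) + 1 / 2) * z.im) ≤ (|(n : ℝ)| + 1 / 2) * B := by
    have h3 : |((n : ℝ) + 1 / 2)| ≤ |(n : ℝ)| + 1 / 2 := by
      refine (abs_add_le _ _).trans (by norm_num)
    calc -(((n : ℝ) + 1 / 2) * z.im) ≤ |((n : ℝ) + 1 / 2) * z.im| := neg_le_abs _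
      _ = |((n : ℝ) + 1 / 2)| * |z.im| := abs_mul _ _
      _ ≤ _ := mul_le_mul h3 hz (abs_nonneg _) (by positivity)
  have h4 : -(n : ℝ) ≤ |(n : ℝ)| := neg_le_abs _
  have hpi := Real.pi_pos
  nlinarith [mul_le_mul_of_nonneg_left h1 hpi.le, mul_le_mul_of_nonneg_left h2 hpi.le,
    mul_le_mul_of_nonneg_left h4 hpi.le]

/-- `q^{-1/8} θ(τ, z)`. -/
noncomputable def thetaNormalized (τ : ℍ) (z : ℂ) : ℂ := ex (-(τ : ℂ) / 8) * theta τ z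

theorem thetaNormalized_eq (τ : ℍ) (z : ℂ) : thetaNormalized τ z = ∑' n : ℤ,
    (-1 : ℂ) ^ n * ex (((n : ℂ) + 1 / 2) * z) * ex ((n * (n + 1) / 2 : ℂ) * (τ : ℂ)) := by
  rw [thetaNormalized, theta, ← tsum_mul_left]
  refine tsum_congr fun n => ?_
  rw [mul_left_comm, ← ex_add]
  congr 2
  ring

/-- Dominated convergence. Only n = 0 and n = -1 have n(n+1) = 0, and their terms add up to e(w/2) -
e(-w/2). -/
theorem tendsto_thetaNormalized_joint (w₀ : ℂ) :
    Tendsto (fun p : ℍ × ℂ => thetaNormalized p.1 p.2) (atImInfty ×ˢ 𝓝 w₀)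
      (𝓝 (2 * I * Complex.sin (Real.pi * w₀))) := by
  set B := |w₀.im| + 1
  have hlim : (2 * I * Complex.sin (Real.pi * w₀)) = ∑' n : ℤ, (-1 : ℂ) ^ n *
      ex (((n : ℂ) + 1 / 2) * w₀) * (if n = 0 ∨ n = -1 then 1 else 0) := by
    rw [tsum_eq_sum (s := {0, -1})]
    · rw [Finset.sum_pair (by norm_num)]
      rw [sin_pi_eq, mul_sub, mul_one, ← ex_add]
      have := Complex.I_ne_zero
      field_simp
      simp
      ring_nf
    · intro n hn
      simp only [Finset.mem_insert, Finset.mem_singleton] at hn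
      rw [if_neg hn, mul_zero]
  rw [hlim]
  simp_rw [thetaNormalized_eq]
  have hB : ∀ᶠ w in 𝓝 w₀, |w.im| ≤ B :=
    (continuous_abs.comp Complex.continuous_im).tendsto w₀ |>.eventually_le_const (by simp [B])
  have hsum := ((summable_pow_mul_jacobiTheta₂_term_bound (B + 1 / 2) one_pos 0).mul_left
    (Real.exp (Real.pi * B)))
  simp only [pow_zero, one_mul] at hsum
  refine tendsto_tsum_of_dominated_convergence
    (bound := fun n : ℤ => Real.exp (Real.pi * B) *
        Real.exp (-Real.pi * (1 * (n : ℝ) ^ 2 - 2 * (B + 1 / 2) * |(n : ℝ)|)))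
    (by simpa using hsum) ?_ ?_
  · intro n
    refine Tendsto.mul ?_ ?_
    · have : Continuous fun w : ℂ => (-1 : ℂ) ^ n * ex (((n : ℂ) + 1 / 2) * w) :=
        continuous_const.mul (differentiable_ex.continuous.comp (by fun_prop))
      exact (this.tendsto w₀).comp tendsto_snd
    · split_ifs with hn
      · have : ((n : ℂ) * (n + 1) / 2) = 0 := by rcases hn with rfl | rfl <;> simp
        simp only [this, zero_mul, ex_zero]
        exact tendsto_const_nhds
      · have hpos : 0 < (n : ℝ) * (n + 1) / 2 := by
          have : 0 < n * (n + 1) := by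
            push Not at hn
            rcases lt_or_gt_of_ne hn.1 with h | h
            · have : n + 1 < 0 := by omega
              nlinarith
            · nlinarith
          have : (0 : ℝ) < n * (n + 1) := by exact_mod_cast this
          positivity
        have := tendsto_norm_ex_joint hpos 0 w₀
        rw [tendsto_zero_iff_norm_tendsto_zero]
        simpa using this
  · filter_upwards [((tendsto_comap (f := UpperHalfPlane.im)).eventually_ge_atTop 1).prod_mk hB]
      with p hp n
    exact norm_theta_term_le hp.1 hp.2 n

theorem Theta_eq_thetaNormalized (τ : ℍ) (z : ℂ) : Theta τ z =
    thetaNormalized τ z / ((2 * Real.pi * I)⁻¹ * deriv (thetaNormalized τ) 0) := by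
  have h : deriv (thetaNormalized τ) 0 = ex (-(τ : ℂ) / 8) * deriv (theta τ) 0 :=
    deriv_const_mul_field _
  rw [Theta, h, thetaNormalized, mul_left_comm, mul_div_mul_left _ _ (ex_ne_zero _)]

theorem tendsto_Theta_joint (w₀ : ℂ) :
    Tendsto (fun p : ℍ × ℂ => Theta p.1 p.2) (atImInfty ×ˢ 𝓝 w₀)
      (𝓝 (2 * I * Complex.sin (Real.pi * w₀))) := by
  have h := (tendsto_joint_deriv (L := atImInfty) (F := thetaNormalized)
    (g := fun w => 2 * I * Complex.sin (Real.pi * w)) isOpen_univ (by fun_prop)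
    (.of_forall fun τ => ((differentiable_theta τ).const_mul _).differentiableOn)
    (fun w _ => tendsto_thetaNormalized_joint w)).2 0 (Set.mem_univ _)
  have hd : deriv (fun w : ℂ => 2 * I * Complex.sin (Real.pi * w)) 0 = 2 * Real.pi * I := by
    have h1 : HasDerivAt (fun z => 2 * I * Complex.sin (Real.pi * z))
        (2 * I * (Complex.cos (Real.pi * 0) * (Real.pi * 1))) (0 : ℂ) :=
      (((hasDerivAt_id (0 : ℂ)).const_mul (Real.pi : ℂ)).csin).const_mul _
    rw [h1.deriv]
    simp
    ring
  rw [hd] at h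
  have h2 : Tendsto (fun p : ℍ × ℂ => deriv (thetaNormalized p.1) 0) (atImInfty ×ˢ 𝓝 w₀)
      (𝓝 (2 * Real.pi * I)) :=
    h.comp (tendsto_fst.prodMk (tendsto_const_nhds (x := (0 : ℂ))))
  have h3 := (tendsto_thetaNormalized_joint w₀).div (h2.const_mul (2 * Real.pi * I)⁻¹)
    (by simp [Real.pi_ne_zero])
  rw [inv_mul_cancel₀ Complex.two_pi_I_ne_zero, div_one] at h3
  exact h3.congr fun p => (Theta_eq_thetaNormalized p.1 p.2).symm

/-! ### Limits at real points -/

theorem tendsto_at_real {f : ℍ → ℂ → ℂ} {l : ℝ} {u c : ℂ}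
    (h : Tendsto (fun p : ℍ × ℂ => f p.1 (l * p.1 + p.2)) (atImInfty ×ˢ 𝓝 u) (𝓝 c)) :
    Tendsto (fun τ : ℍ => f τ (l * τ + u)) atImInfty (𝓝 c) :=
  h.comp (tendsto_id.prodMk (tendsto_const_nhds (x := u)))

/-! ### Constant terms of e₂ and E₄, and derivatives of the cotangent -/

/-- Near i∞ the series is dominated by its absolute values at τ = i. -/
theorem tendsto_of_hasSum_qExpansion {c : ℕ → ℂ} {f : ℍ → ℂ}
    (h : ∀ τ : ℍ, HasSum (fun m => c m * Function.Periodic.qParam 1 τ ^ m) (f τ)) :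
    Tendsto f atImInfty (𝓝 (c 0)) := by
  have hq := UpperHalfPlane.qParam_tendsto_atImInfty one_pos
  have h0 : c 0 = ∑' m, c m * (if m = 0 then 1 else 0) := by
    rw [tsum_eq_single 0 (fun m hm => by simp [hm])]
    simp
  rw [h0, funext fun τ => (h τ).tsum_eq.symm]
  refine tendsto_tsum_of_dominated_convergence
    (bound := fun m => ‖c m * Function.Periodic.qParam 1 UpperHalfPlane.I ^ m‖)
    (h UpperHalfPlane.I).summable.norm ?_ ?_
  · intro m
    refine Tendsto.const_mul _ ?_
    have := hq.pow m
    rwa [zero_pow_eq] at this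
  · have := hq.norm.eventually_le_const (u := ‖Function.Periodic.qParam 1 UpperHalfPlane.I‖)
      (by simpa using Function.Periodic.qParam_ne_zero _)
    filter_upwards [this] with τ hτ m
    rw [norm_mul, norm_mul, norm_pow, norm_pow]
    gcongr

theorem tendsto_G2 : Tendsto EisensteinSeries.G2 atImInfty (𝓝 (Real.pi ^ 2 / 3)) := by
  have h := tendsto_of_hasSum_qExpansion (f := EisensteinSeries.E2)
    (c := fun m : ℕ => if m = 0 then 1 else -24 * ArithmeticFunction.sigma 1 m) fun τ => by
      simpa [Function.Periodic.qParam] using EisensteinSeries.hasSum_qExpansion_E2 (z := τ)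
  have h2 := h.const_mul (2 * riemannZeta 2)
  have hz : riemannZeta 2 ≠ 0 := riemannZeta_ne_zero_of_one_lt_re (by norm_num)
  have e : 2 * riemannZeta 2 * 1 = Real.pi ^ 2 / 3 := by rw [riemannZeta_two]; ring
  simp only [if_true, e] at h2
  refine h2.congr fun τ => ?_
  simp only [EisensteinSeries.E2, Pi.smul_apply, smul_eq_mul]
  field_simp

theorem tendsto_E_four : Tendsto ModularForm.E₄ atImInfty (𝓝 1) := by
  have h := tendsto_of_hasSum_qExpansion (f := ModularForm.E₄) fun τ =>
    ModularForm.hasSum_qExpansion ModularForm.E₄ one_pos one_mem_strictPeriods_SL τ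
  rwa [EisensteinSeries.E_qExpansion_coeff_zero _ ⟨2, rfl⟩] at h

theorem hasDerivAt_piCot {w : ℂ} (hw : Complex.sin (Real.pi * w) ≠ 0) :
    HasDerivAt piCot (-(Real.pi ^ 2 / Complex.sin (Real.pi * w) ^ 2)) w := by
  have h1 : HasDerivAt (fun z => Complex.sin (Real.pi * z))
      (Complex.cos (Real.pi * w) * (Real.pi * 1)) w :=
    ((hasDerivAt_id w).const_mul (Real.pi : ℂ)).csin
  have h2 : HasDerivAt (fun z => Complex.cos (Real.pi * z))
      (-Complex.sin (Real.pi * w) * (Real.pi * 1)) w :=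
    ((hasDerivAt_id w).const_mul (Real.pi : ℂ)).ccos
  have h3 := (h2.fun_div h1 hw).const_mul (Real.pi : ℂ)
  have hf : piCot = fun z => Real.pi * (Complex.cos (Real.pi * z) / Complex.sin (Real.pi * z)) := by
    funext z
    rw [piCot, Complex.cot_eq_cos_div_sin]
  rw [hf]
  refine h3.congr_deriv ?_
  field_simp
  linear_combination -Complex.sin_sq_add_cos_sq (Real.pi * w)

theorem hasDerivAt_deriv_piCot {w : ℂ} (hw : w ∈ Complex.integerComplement) :
    HasDerivAt (deriv piCot)
      (2 * Real.pi ^ 3 * Complex.cos (Real.pi * w) / Complex.sin (Real.pi * w) ^ 3) w := by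
  have hs : ∀ w ∈ Complex.integerComplement, Complex.sin (Real.pi * w) ≠ 0 := fun w hw =>
    sin_pi_mul_ne_zero hw
  have h1 : HasDerivAt (fun z => Complex.sin (Real.pi * z))
      (Complex.cos (Real.pi * w) * (Real.pi * 1)) w :=
    ((hasDerivAt_id w).const_mul (Real.pi : ℂ)).csin
  have h2 := (((h1.fun_pow 2).fun_inv (pow_ne_zero 2 (hs w hw))).const_mul (-(Real.pi : ℂ) ^ 2))
  refine (h2.congr_deriv ?_).congr_of_eventuallyEq ?_
  · have := hs w hw
    field_simp
    norm_num
    try ring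
  · filter_upwards [isOpen_integerComplement.mem_nhds hw] with z hz
    rw [(hasDerivAt_piCot (hs z hz)).deriv]
    ring

/-! ### Modular forms of level one -/

/-- Holomorphic functions on `ℍ` transforming like modular forms of weight `k`. -/
structure WeaklyModular (k : ℤ) (f : ℍ → ℂ) : Prop where
  hol : HolOnH f
  smul : ∀ (γ : Matrix.SpecialLinearGroup (Fin 2) ℤ) (τ : ℍ), f (γ • τ) = cocycle γ τ ^ k * f τ

theorem WeaklyModular.periodic {k : ℤ} {f : ℍ → ℂ} (hf : WeaklyModular k f) :
    Function.Periodic (f ∘ ofComplex) (1 : ℝ) := by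
  intro w
  by_cases hw : 0 < w.im
  · have h := hf.smul ModularGroup.T ⟨w, hw⟩
    have e : cocycle ModularGroup.T ⟨w, hw⟩ = 1 := by simp [cocycle, ModularGroup.T]
    rw [e, one_zpow, one_mul] at h
    have h2 : ofComplex (w + (1 : ℝ)) = ModularGroup.T • (⟨w, hw⟩ : ℍ) := by
      rw [UpperHalfPlane.modular_T_smul, ofComplex_apply_of_im_pos (by simpa using hw)]
      ext
      simp [add_comm]
    rw [Function.comp_apply, Function.comp_apply, h2, h, ofComplex_apply_of_im_pos hw]
  -- Off the upper half plane `ofComplex` takes one default value.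
  · simp only [Function.comp_apply]
    rw [ofComplex_apply_of_im_nonpos (not_lt.1 hw),
      ofComplex_apply_of_im_nonpos (by simpa using hw)]

/-- As a function F of q, growth slower than |q|⁻¹ gives qF(q) → 0, so the singularity at q = 0 is
removable. -/
theorem WeaklyModular.isBoundedAtImInfty {k : ℤ} {f : ℍ → ℂ} (hf : WeaklyModular k f)
    (hm : ModerateAtInfty f) : IsBoundedAtImInfty f := by
  -- Any exponent below 2π suffices; the strip |x| ≤ 1 contains the fractional parts to which
  -- periodicity reduces.
  obtain ⟨K, Y, hK⟩ := hm 1 one_pos 1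
  have hper := hf.periodic
  have hbd : ∀ v : ℂ, Y ≤ v.im → ‖(f ∘ ofComplex) v‖ ≤ K * Real.exp v.im := by
    intro v hv
    have h1 := hper.int_mul (-⌊v.re⌋) v
    have h2 := hK (Int.fract v.re) v.im (by
      rw [abs_of_nonneg (Int.fract_nonneg _)]; exact (Int.fract_lt_one _).le) hv
    rw [one_mul] at h2
    rw [← h1]
    have e : v + ((-⌊v.re⌋ : ℤ) : ℂ) * ((1 : ℝ) : ℂ) =
        ((Int.fract v.re : ℝ) : ℂ) + (v.im : ℂ) * I := by
      apply Complex.ext <;> simp [Int.fract, sub_eq_add_neg]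
    rw [e]
    exact h2
  have hhol : ∀ v : ℂ, 0 < v.im → DifferentiableAt ℂ (f ∘ ofComplex) v := fun v hv =>
    hf.hol.differentiableAt ((isOpen_lt continuous_const Complex.continuous_im).mem_nhds hv)
  have hI : ∀ᶠ v : ℂ in comap Complex.im atTop, max Y 1 ≤ v.im :=
    tendsto_comap.eventually_ge_atTop _
  have hlim0 : Tendsto (fun v : ℂ => Function.Periodic.qParam 1 v * (f ∘ ofComplex) v)
      (comap Complex.im atTop) (𝓝 0) := by
    have h1 : Tendsto (fun v : ℂ => K * Real.exp (-(v.im))) (comap Complex.im atTop) (𝓝 0) := by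
      have := (Real.tendsto_exp_neg_atTop_nhds_zero.comp
        (tendsto_comap (f := Complex.im) (x := atTop))).const_mul K
      rwa [mul_zero] at this
    refine squeeze_zero_norm' ?_ h1
    filter_upwards [hI] with v hv
    have hv1 := le_trans (le_max_left _ _) hv
    have hv2 := le_trans (le_max_right _ _) hv
    rw [norm_mul, Function.Periodic.norm_qParam]
    have h3 := hbd v hv1
    have hK0 : 0 ≤ K := by
      by_contra hneg
      have := (norm_nonneg _).trans h3
      nlinarith [Real.exp_pos v.im]
    calc Real.exp (-2 * Real.pi * v.im / 1) * ‖(f ∘ ofComplex) v‖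
        ≤ Real.exp (-2 * v.im) * (K * Real.exp v.im) := by
          gcongr
          rw [div_one]
          nlinarith [Real.pi_gt_three]
      _ = K * Real.exp (-v.im) := by
          rw [mul_left_comm, ← Real.exp_add]
          ring_nf
  set F := Function.Periodic.cuspFunction 1 (f ∘ ofComplex) with hF
  have hd : ∀ᶠ q in 𝓝[≠] (0 : ℂ), DifferentiableAt ℂ F q :=
    Function.Periodic.eventually_differentiableAt_cuspFunction_nhds_ne_zero one_pos hper
      (hI.mono fun v hv => hhol v (by linarith [le_max_right Y 1]))
  have hqF : Tendsto (fun q => q * F q) (𝓝[≠] 0) (𝓝 0) := by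
    refine (hlim0.comp (Function.Periodic.invQParam_tendsto one_pos)).congr' ?_
    filter_upwards [self_mem_nhdsWithin] with q hq
    rw [Function.comp_apply, Function.Periodic.qParam_right_inv one_ne_zero hq, hF,
      Function.Periodic.cuspFunction_eq_of_nonzero _ _ hq]
  have hlo : (fun q => F q - F 0) =o[𝓝[≠] 0] fun q => (q - 0)⁻¹ := by
    simp only [sub_zero]
    rw [Asymptotics.isLittleO_iff_tendsto' (by
      filter_upwards [self_mem_nhdsWithin] with q hq h
      exact absurd (inv_eq_zero.1 h) hq)]
    have h1 : Tendsto (fun q : ℂ => q * F 0) (𝓝[≠] 0) (𝓝 0) := by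
      have : Continuous fun q : ℂ => q * F 0 := by fun_prop
      simpa using (this.tendsto 0).mono_left nhdsWithin_le_nhds
    have := hqF.sub h1
    rw [sub_zero] at this
    refine this.congr fun q => ?_
    rw [div_inv_eq_mul]
    ring
  have ht := Complex.tendsto_limUnder_of_differentiable_on_punctured_nhds_of_isLittleO hd hlo
  have ht2 := (ht.comp (Function.Periodic.qParam_tendsto one_pos)).comp tendsto_coe_atImInfty
  have ht3 := ht2.isBigO_one ℝ
  refine ht3.congr_left fun τ => ?_
  simp only [Function.comp_apply, hF]
  rw [Function.Periodic.eq_cuspFunction one_ne_zero hper]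
  simp

/-- A weakly modular function of moderate growth is a modular form. -/
theorem WeaklyModular.exists_modularForm {k : ℤ} {f : ℍ → ℂ} (hf : WeaklyModular k f)
    (hm : ModerateAtInfty f) : ∃ F : ModularForm 𝒮ℒ k, ⇑F = f := by
  have hslash : ∀ γ : Matrix.SpecialLinearGroup (Fin 2) ℤ, f ∣[k] γ = f := by
    intro γ
    funext τ
    rw [ModularForm.SL_slash_apply, hf.smul, ← cocycle_eq_denom, mul_right_comm,
      ← zpow_add₀ (cocycle_ne_zero γ τ), add_neg_cancel, zpow_zero, one_mul]
  refine ⟨{ toFun := f, slash_action_eq' := ?_, holo' := ?_, bdd_at_cusps' := ?_ }, rfl⟩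
  · rintro _ ⟨γ, rfl⟩
    exact hslash γ
  · rw [UpperHalfPlane.mdifferentiable_iff]
    exact hf.hol
  · intro c hc
    rw [Subgroup.IsArithmetic.isCusp_iff_isCusp_SL2Z] at hc
    rw [OnePoint.isBoundedAt_iff_forall_SL2Z hc]
    intro γ _
    rw [hslash]
    exact hf.isBoundedAtImInfty hm

/-! ### Generation of level one modular forms by E₄ and E₆ -/

/-- The monomial `E₄^a E₆^b`. -/
noncomputable def eisMonomial (a b : ℕ) : ModularForm 𝒮ℒ (a * 4 + b * 6) :=
  (ModularForm.E₄.pow a).mul (ModularForm.E₆.pow b)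

theorem eisMonomial_apply (a b : ℕ) (τ : ℍ) :
    eisMonomial a b τ = ModularForm.E₄ τ ^ a * ModularForm.E₆ τ ^ b := by
  simp [eisMonomial]

theorem eisMonomial_coeff_zero (a b : ℕ) : (qExpansion 1 (eisMonomial a b)).coeff 0 = 1 := by
  have h : qExpansion 1 (eisMonomial a b) =
      qExpansion 1 (ModularForm.E₄.pow a) * qExpansion 1 (ModularForm.E₆.pow b) := by
    rw [eisMonomial, ModularForm.qExpansion_mul one_pos one_mem_strictPeriods_SL]
  have h4 := EisensteinSeries.E_qExpansion_coeff_zero (k := 4) (by norm_num) ⟨2, rfl⟩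
  have h6 := EisensteinSeries.E_qExpansion_coeff_zero (k := 6) (by norm_num) ⟨3, rfl⟩
  rw [PowerSeries.coeff_zero_eq_constantCoeff] at h4 h6 ⊢
  rw [h, ModularForm.qExpansion_pow one_pos one_mem_strictPeriods_SL,
    ModularForm.qExpansion_pow one_pos one_mem_strictPeriods_SL, map_mul, map_pow, map_pow, h4, h6,
    one_pow, one_pow, one_mul]

/-- The ring of functions generated by `E₄` and `E₆`. -/
noncomputable def eisAlg : Subalgebra ℂ (ℍ → ℂ) :=
  Algebra.adjoin ℂ {⇑ModularForm.E₄, ⇑ModularForm.E₆}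

theorem exists_four_six {n : ℕ} (h2 : n ≠ 1) : ∃ a b : ℕ, n = 2 * a + 3 * b := by
  rcases Nat.even_or_odd' n with ⟨m, rfl | rfl⟩
  · exact ⟨m, 0, by ring⟩
  · exact ⟨m - 1, 1, by omega⟩

/-- Induction on the weight. A monomial in E₄ and E₆ of the same weight removes the constant term,
the remaining cusp form is divisible by the discriminant, and the quotient has weight k - 12.
Negative, odd and second weights carry only zero. -/
theorem mem_eisAlg_of_modularForm : ∀ (n : ℕ) (k : ℤ), k < n → ∀ F : ModularForm 𝒮ℒ k,
    ⇑F ∈ eisAlg := by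
  intro n
  induction n with
  | zero =>
    intro k hk F
    rw [ModularFormClass.levelOne_neg_weight_eq_zero (by simpa using hk) F]
    exact zero_mem _
  | succ n ih =>
    intro k hk F
    rcases lt_or_ge k 0 with hneg | hnonneg
    · rw [ModularFormClass.levelOne_neg_weight_eq_zero hneg F]
      exact zero_mem _
    rcases Int.even_or_odd' k with ⟨m, rfl | rfl⟩
    · by_cases hm : m = 1
      · subst hm
        have : F = 0 := by
          have := rank_zero_iff_forall_zero.1 ModularForm.levelOne_weight_two_rank_zero
          exact this F
        rw [this]
        exact zero_mem _
      · lift m to ℕ using by omega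
        obtain ⟨a, b, hab⟩ := exists_four_six (n := m) (by exact_mod_cast hm)
        have hk' : (a * 4 + b * 6 : ℤ) = 2 * m := by rw [hab]; push_cast; ring
        set G : ModularForm 𝒮ℒ (2 * m) := ModularForm.mcast hk' (eisMonomial a b) with hG
        have hG0 : (qExpansion 1 G).coeff 0 = 1 := eisMonomial_coeff_zero a b
        obtain ⟨C, hC⟩ := ModularForm.sub_smul_isCuspForm F G hG0
        set c := (qExpansion 1 F).coeff 0
        have hGm : ⇑G ∈ eisAlg := by
          have : ⇑G = ⇑ModularForm.E₄ ^ a * ⇑ModularForm.E₆ ^ b := by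
            funext τ
            exact eisMonomial_apply a b τ
          rw [this]
          exact mul_mem (pow_mem (Algebra.subset_adjoin (by simp)) _)
            (pow_mem (Algebra.subset_adjoin (by simp)) _)
        have hCm : ⇑C ∈ eisAlg := by
          have h1 := ih (2 * m - 12) (by omega) (CuspForm.discriminantEquiv C)
          have h2 : ⇑C = (fun τ => (1728 : ℂ)⁻¹ * (ModularForm.E₄ τ ^ 3 - ModularForm.E₆ τ ^ 2)) *
              ⇑(CuspForm.discriminantEquiv C) := by
            funext τ
            have h3 := ModularForm.discriminant_mul_discriminantEquiv_apply C τ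
            rw [Pi.mul_apply, ← h3, ModularForm.discriminant_eq_E₄_cube_sub_E₆_sq]
            ring
          rw [h2]
          refine mul_mem ?_ h1
          have : (fun τ => (1728 : ℂ)⁻¹ * (ModularForm.E₄ τ ^ 3 - ModularForm.E₆ τ ^ 2)) =
              (1728 : ℂ)⁻¹ • (⇑ModularForm.E₄ ^ 3 - ⇑ModularForm.E₆ ^ 2) := by
            funext τ; simp
          rw [this]
          exact Subalgebra.smul_mem _ (sub_mem (pow_mem (Algebra.subset_adjoin (by simp)) _)
            (pow_mem (Algebra.subset_adjoin (by simp)) _)) _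
        have hF : ⇑F = ⇑C + c • ⇑G := by
          funext τ
          have := DFunLike.congr_fun hC τ
          simp only [CuspForm.toModularFormₗ_apply] at this
          rw [Pi.add_apply, this]
          simp
        rw [hF]
        exact add_mem hCm (Subalgebra.smul_mem _ hGm _)
    · rw [ModularForm.levelOne_odd_weight_eq_zero ⟨m, rfl⟩ F]
      exact zero_mem _

/-- Weakly modular functions of weight two and moderate growth vanish. -/
theorem eq_zero_of_weight_two {f : ℍ → ℂ} (hf : WeaklyModular 2 f) (hm : ModerateAtInfty f) :
    f = 0 := by
  obtain ⟨F, rfl⟩ := hf.exists_modularForm hm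
  have : F = 0 := rank_zero_iff_forall_zero.1 ModularForm.levelOne_weight_two_rank_zero F
  rw [this]
  rfl

/-- Removing the constant term with `G` leaves a cusp form, and there are none below weight 12. -/
theorem exists_smul_of_weight {k : ℤ} (hk : k < 12) (G : ModularForm 𝒮ℒ k)
    (hG : (qExpansion 1 G).coeff 0 = 1) {f : ℍ → ℂ} (hf : WeaklyModular k f)
    (hm : ModerateAtInfty f) : ∃ c : ℂ, f = c • ⇑G := by
  obtain ⟨F, rfl⟩ := hf.exists_modularForm hm
  obtain ⟨C, hC⟩ := ModularForm.sub_smul_isCuspForm F G hG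
  have : C = 0 := rank_zero_iff_forall_zero.1 (CuspForm.rank_eq_zero_of_weight_lt_twelve hk) C
  rw [this, map_zero] at hC
  refine ⟨(qExpansion 1 F).coeff 0, ?_⟩
  funext τ
  have := DFunLike.congr_fun hC τ
  simp at this
  simp
  linear_combination -this

/-! ### Poles along `z = 0` -/

/-- `z^n ψ(τ, z)` extends holomorphically to `(τ, 0)`, with value `v` there. -/
def LeadAt (ψ : ℍ → ℂ → ℂ) (n : ℕ) (τ : ℍ) (v : ℂ) : Prop :=
  ∃ G : ℂ × ℂ → ℂ, AnalyticAt ℂ G (τ, 0) ∧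
    (∀ᶠ p in 𝓝 ((τ : ℂ), (0 : ℂ)), p.2 ≠ 0 → G p = p.2 ^ n * ψ (ofComplex p.1) p.2) ∧
    G (τ, 0) = v

section LeadAt

variable {φ ψ : ℍ → ℂ → ℂ} {m n : ℕ} {τ : ℍ} {v w : ℂ}

theorem eventually_offLat₂ (τ : ℍ) : ∀ᶠ p in 𝓝 ((τ : ℂ), (0 : ℂ)), p.2 ≠ 0 →
    0 < p.1.im ∧ p.2 ∉ lattice (ofComplex p.1) :=
  eventually_mem_offLat τ.im_pos

theorem LeadAt.congr (h : LeadAt φ n τ v) (he : ∀ τ z, z ∉ lattice τ → φ τ z = ψ τ z) :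
    LeadAt ψ n τ v := by
  obtain ⟨G, hG, h1, h2⟩ := h
  refine ⟨G, hG, ?_, h2⟩
  filter_upwards [h1, eventually_offLat₂ τ] with p hp hp2 h0
  rw [hp h0, he _ _ (hp2 h0).2]

theorem LeadAt.mul (h : LeadAt φ m τ v) (h' : LeadAt ψ n τ w) :
    LeadAt (fun τ z => φ τ z * ψ τ z) (m + n) τ (v * w) := by
  obtain ⟨G, hG, h1, rfl⟩ := h
  obtain ⟨G', hG', h1', rfl⟩ := h'
  refine ⟨fun p => G p * G' p, hG.fun_mul hG', ?_, rfl⟩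
  filter_upwards [h1, h1'] with p hp hp' h0
  rw [hp h0, hp' h0, pow_add]
  ring

theorem LeadAt.add (h : LeadAt φ n τ v) (h' : LeadAt ψ n τ w) :
    LeadAt (fun τ z => φ τ z + ψ τ z) n τ (v + w) := by
  obtain ⟨G, hG, h1, rfl⟩ := h
  obtain ⟨G', hG', h1', rfl⟩ := h'
  refine ⟨fun p => G p + G' p, hG.fun_add hG', ?_, rfl⟩
  filter_upwards [h1, h1'] with p hp hp' h0
  rw [hp h0, hp' h0]
  ring

theorem LeadAt.sub (h : LeadAt φ n τ v) (h' : LeadAt ψ n τ w) :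
    LeadAt (fun τ z => φ τ z - ψ τ z) n τ (v - w) := by
  obtain ⟨G, hG, h1, rfl⟩ := h
  obtain ⟨G', hG', h1', rfl⟩ := h'
  refine ⟨fun p => G p - G' p, hG.fun_sub hG', ?_, rfl⟩
  filter_upwards [h1, h1'] with p hp hp' h0
  rw [hp h0, hp' h0]
  ring

theorem LeadAt.of_holAt (h : HolAt φ τ 0) : LeadAt φ 0 τ (φ τ 0) :=
  ⟨uncurried φ, h, .of_forall fun p _ => by rw [pow_zero, one_mul, uncurried], uncurried_coe φ τ 0⟩

theorem LeadAt.pow (h : LeadAt φ m τ v) (j : ℕ) :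
    LeadAt (fun τ z => φ τ z ^ j) (m * j) τ (v ^ j) := by
  obtain ⟨G, hG, h1, rfl⟩ := h
  refine ⟨fun p => G p ^ j, hG.fun_pow j, ?_, rfl⟩
  filter_upwards [h1] with p hp h0
  rw [hp h0, mul_pow, pow_mul]

theorem LeadAt.succ (h : LeadAt φ n τ v) : LeadAt φ (n + 1) τ 0 := by
  obtain ⟨G, hG, h1, rfl⟩ := h
  refine ⟨fun p => p.2 * G p, analyticAt_snd.fun_mul hG, ?_, zero_mul _⟩
  filter_upwards [h1] with p hp h0
  rw [hp h0, pow_succ]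
  ring

theorem LeadAt.mono (h : ∃ v, LeadAt φ m τ v) (hmn : m ≤ n) : ∃ v, LeadAt φ n τ v := by
  induction n, hmn using Nat.le_induction with
  | base => exact h
  | succ n _ ih => exact ⟨0, ih.choose_spec.succ⟩

theorem LeadAt.tendsto (h : LeadAt φ n τ v) :
    Tendsto (fun z => z ^ n * φ τ z) (𝓝[≠] 0) (𝓝 v) := by
  obtain ⟨G, hG, h1, rfl⟩ := h
  have hc : Tendsto (fun z : ℂ => ((τ : ℂ), z)) (𝓝[≠] 0) (𝓝 ((τ : ℂ), (0 : ℂ))) :=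
    ((by fun_prop : Continuous fun z : ℂ => ((τ : ℂ), z)).tendsto 0).mono_left nhdsWithin_le_nhds
  refine (hG.continuousAt.tendsto.comp hc).congr' ?_
  filter_upwards [hc.eventually h1, self_mem_nhdsWithin] with z hz h0
  rw [Function.comp_apply, hz h0]
  simp

theorem LeadAt.unique (h : LeadAt φ n τ v) (h' : LeadAt φ n τ w) : v = w :=
  tendsto_nhds_unique h.tendsto h'.tendsto

/-- The extension `G` at one point serves all nearby parameters, with leading coefficient s ↦ G(s,
0). -/
theorem LeadAt.eventually (h : LeadAt φ n τ v) : ∃ c : ℂ → ℂ, AnalyticAt ℂ c τ ∧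
    ∀ᶠ s in 𝓝 (τ : ℂ), LeadAt φ n (ofComplex s) (c s) := by
  obtain ⟨G, hG, h1, rfl⟩ := h
  have hc : Tendsto (fun s : ℂ => (s, (0 : ℂ))) (𝓝 (τ : ℂ)) (𝓝 ((τ : ℂ), (0 : ℂ))) :=
    (by fun_prop : Continuous fun s : ℂ => (s, (0 : ℂ))).tendsto _
  refine ⟨fun s => G (s, 0), hG.along_fst, ?_⟩
  filter_upwards [hc.eventually (hG.eventually_analyticAt.and h1.eventually_nhds),
    (isOpen_lt continuous_const Complex.continuous_im).mem_nhds τ.im_pos] with s hs hs'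
  have e : ((ofComplex s : ℍ) : ℂ) = s := by rw [ofComplex_apply_of_im_pos hs']
  refine ⟨G, ?_, ?_, ?_⟩ <;> rw [e]
  · exact hs.1
  · exact hs.2

/-- Vanishing of the coefficient for all parameters means that `G` vanishes along z = 0, so it is
divisible by z. -/
theorem LeadAt.lower (h : ∀ τ, LeadAt φ (n + 1) τ 0) (τ : ℍ) : ∃ v, LeadAt φ n τ v := by
  obtain ⟨G, hG, h1, -⟩ := h τ
  have h0 : ∀ᶠ s in 𝓝 (τ : ℂ), G (s, 0) = 0 := by
    have hc : Tendsto (fun s : ℂ => (s, (0 : ℂ))) (𝓝 (τ : ℂ)) (𝓝 ((τ : ℂ), (0 : ℂ))) :=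
      (by fun_prop : Continuous fun s : ℂ => (s, (0 : ℂ))).tendsto _
    filter_upwards [hc.eventually (hG.eventually_analyticAt.and h1.eventually_nhds),
      (isOpen_lt continuous_const Complex.continuous_im).mem_nhds τ.im_pos] with s hs hs'
    have e : ((ofComplex s : ℍ) : ℂ) = s := by rw [ofComplex_apply_of_im_pos hs']
    refine LeadAt.unique (φ := φ) (n := n + 1) (τ := ofComplex s) ⟨G, ?_, ?_, ?_⟩ (h _) <;> rw [e]
    · exact hs.1
    · exact hs.2
  obtain ⟨g, hg, hg'⟩ := hG.exists_eq_snd_mul h0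
  refine ⟨g (τ, 0), g, hg, ?_, rfl⟩
  filter_upwards [h1, hg'] with p hp hp' hne
  refine mul_left_cancel₀ hne ?_
  rw [← hp', hp hne, pow_succ]
  ring

end LeadAt

/-! ### Expansions of the generators at `z = 0` -/

theorem exists_Theta_eq_mul (τ : ℍ) : ∃ g : ℂ × ℂ → ℂ, AnalyticAt ℂ g (τ, 0) ∧ g (τ, 0) ≠ 0 ∧
    ∀ᶠ p in 𝓝 ((τ : ℂ), (0 : ℂ)), Theta (ofComplex p.1) p.2 = p.2 * g p := by
  obtain ⟨g, hg, hg'⟩ := AnalyticAt.exists_eq_snd_mul (holAt_Theta τ 0)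
    (.of_forall fun s => Theta_zero _)
  refine ⟨g, hg, fun h0 => ?_, hg'⟩
  have hc : Tendsto (fun z : ℂ => ((τ : ℂ), z)) (𝓝 0) (𝓝 ((τ : ℂ), (0 : ℂ))) :=
    (by fun_prop : Continuous fun z : ℂ => ((τ : ℂ), z)).tendsto 0
  have h1 : HasDerivAt (fun z : ℂ => z * g (τ, z)) (1 * g (τ, 0) + 0 * deriv (fun z => g (τ, z)) 0)
      0 := (hasDerivAt_id (0 : ℂ)).fun_mul hg.along_snd.differentiableAt.hasDerivAt
  have h2 := (hasDerivAt_Theta τ 0).unique (h1.congr_of_eventuallyEq (by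
    filter_upwards [hc.eventually hg'] with z hz
    exact (uncurried_coe Theta τ z).symm.trans hz))
  rw [h0, deriv_Theta_zero] at h2
  simp at h2

theorem deriv_eq_near {f f' : ℍ → ℂ → ℂ} {R R' : ℂ × ℂ → ℂ} {τ : ℍ}
    (hf : ∀ τ z, z ∉ lattice τ → HasDerivAt (f τ) (f' τ z) z)
    (h : ∀ᶠ p in 𝓝 ((τ : ℂ), (0 : ℂ)), p.2 ≠ 0 → f (ofComplex p.1) p.2 = R p)
    (hR : ∀ᶠ p in 𝓝 ((τ : ℂ), (0 : ℂ)), p.2 ≠ 0 →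
      HasDerivAt (fun z => R (p.1, z)) (R' p) p.2) :
    ∀ᶠ p in 𝓝 ((τ : ℂ), (0 : ℂ)), p.2 ≠ 0 → f' (ofComplex p.1) p.2 = R' p := by
  filter_upwards [h.eventually_nhds, hR, eventually_offLat₂ τ] with p hp hp2 hp3 h0
  refine (hf _ _ (hp3 h0).2).unique ((hp2 h0).congr_of_eventuallyEq ?_)
  have hc : Tendsto (fun z : ℂ => (p.1, z)) (𝓝 p.2) (𝓝 p) :=
    (by fun_prop : Continuous fun z : ℂ => (p.1, z)).tendsto _
  filter_upwards [hc.eventually hp, isOpen_ne.mem_nhds h0] with z hz hz0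
  exact hz hz0

theorem AnalyticAt.hasDerivAt_snd {F : ℂ × ℂ → ℂ} {p : ℂ × ℂ} (h : AnalyticAt ℂ F p) :
    HasDerivAt (fun z => F (p.1, z)) (deriv (fun z => F (p.1, z)) p.2) p.2 :=
  (AnalyticAt.along_snd (p := p) h).differentiableAt.hasDerivAt

/-- Writing Θ = z g with g nonvanishing gives E₁ = 1/z + g'/g. The other expansions follow by
differentiating in z. -/
theorem leadAt_E (τ : ℍ) : LeadAt (E 1) 1 τ 1 ∧ LeadAt (E 2) 2 τ 1 ∧ LeadAt (E 3) 3 τ 1 := by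
  obtain ⟨g, hg, hg0, hg'⟩ := exists_Theta_eq_mul τ
  set h : ℂ × ℂ → ℂ := fun p => deriv (fun z => g (p.1, z)) p.2 / g p with hh
  have hha : AnalyticAt ℂ h (τ, 0) := hg.deriv_snd.fun_div hg hg0
  set h2 : ℂ × ℂ → ℂ := fun p => deriv (fun z => h (p.1, z)) p.2
  have hh2 : AnalyticAt ℂ h2 (τ, 0) := hha.deriv_snd
  set h3 : ℂ × ℂ → ℂ := fun p => deriv (fun z => h2 (p.1, z)) p.2
  have hh3 : AnalyticAt ℂ h3 (τ, 0) := hh2.deriv_snd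
  have hgne : ∀ᶠ p in 𝓝 ((τ : ℂ), (0 : ℂ)), g p ≠ 0 := hg.continuousAt.eventually_ne hg0
  have d0 : ∀ᶠ p in 𝓝 ((τ : ℂ), (0 : ℂ)), p.2 ≠ 0 → deriv (Theta (ofComplex p.1)) p.2 =
      1 * g p + p.2 * deriv (fun z => g (p.1, z)) p.2 := by
    refine deriv_eq_near (f := Theta) (R := fun p => p.2 * g p)
      (f' := fun τ z => deriv (Theta τ) z) (fun τ z _ => hasDerivAt_Theta τ z)
      (hg'.mono fun p hp _ => hp) ?_
    filter_upwards [hg.eventually_analyticAt] with p hp _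
    exact (hasDerivAt_id p.2).fun_mul hp.hasDerivAt_snd
  have e1 : ∀ᶠ p in 𝓝 ((τ : ℂ), (0 : ℂ)), p.2 ≠ 0 →
      E 1 (ofComplex p.1) p.2 = p.2⁻¹ + h p := by
    filter_upwards [d0, hg', hgne, eventually_offLat₂ τ] with p hp hp1 hp2 hp3 h0
    rw [E_one_eq_logDeriv (hp3 h0).2, logDeriv_apply, hp h0, hp1, hh]
    field_simp
  have e2 : ∀ᶠ p in 𝓝 ((τ : ℂ), (0 : ℂ)), p.2 ≠ 0 →
      -E 2 (ofComplex p.1) p.2 = -(p.2 ^ 2)⁻¹ + h2 p := by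
    refine deriv_eq_near (f := E 1) (f' := fun τ z => -E 2 τ z)
      (R' := fun p => -(p.2 ^ 2)⁻¹ + h2 p)
      (fun τ z hz => hasDerivAt_E_one hz) e1 ?_
    filter_upwards [hha.eventually_analyticAt] with p hp h0
    exact (hasDerivAt_inv h0).fun_add hp.hasDerivAt_snd
  have e3 : ∀ᶠ p in 𝓝 ((τ : ℂ), (0 : ℂ)), p.2 ≠ 0 →
      2 * E 3 (ofComplex p.1) p.2 = 2 * (p.2 ^ 3)⁻¹ + h3 p := by
    refine deriv_eq_near (f := fun τ z => -E 2 τ z) (f' := fun τ z => 2 * E 3 τ z)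
      (R' := fun p => 2 * (p.2 ^ 3)⁻¹ + h3 p)
      (fun τ z hz => by simpa using (hasDerivAt_E_two hz).fun_neg) e2 ?_
    filter_upwards [hh2.eventually_analyticAt] with p hp h0
    have := ((hasDerivAt_pow 2 p.2).fun_inv (pow_ne_zero 2 h0)).fun_neg.fun_add hp.hasDerivAt_snd
    refine this.congr_deriv ?_
    field_simp
    ring
  refine ⟨⟨fun p => 1 + p.2 * h p, ?_, ?_, by simp⟩, ⟨fun p => 1 - p.2 ^ 2 * h2 p, ?_, ?_, by simp⟩,
    ⟨fun p => 1 + p.2 ^ 3 * h3 p / 2, ?_, ?_, by simp⟩⟩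
  · exact analyticAt_const.fun_add (analyticAt_snd.fun_mul hha)
  · filter_upwards [e1] with p hp h0
    rw [hp h0]
    field_simp
  · exact analyticAt_const.fun_sub ((analyticAt_snd.fun_pow 2).fun_mul hh2)
  · filter_upwards [e2] with p hp h0
    rw [← neg_neg (E 2 _ _), hp h0]
    field_simp
    ring
  · exact analyticAt_const.fun_add (((analyticAt_snd.fun_pow 3).fun_mul hh3).fun_div
      analyticAt_const two_ne_zero)
  · filter_upwards [e3] with p hp h0
    have := hp h0
    rw [show E 3 (ofComplex p.1) p.2 = (2 * E 3 (ofComplex p.1) p.2) / 2 by ring, this]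
    field_simp

theorem leadAt_wp (τ : ℍ) : LeadAt wp 2 τ 1 := by
  have h := (leadAt_E τ).2.1.sub ((LeadAt.of_holAt (holAt_eis_two τ 0)).succ.succ)
  rwa [sub_zero] at h

theorem leadAt_Theta_inv (τ : ℍ) : ∃ v, LeadAt (fun τ z => (Theta τ z)⁻¹) 1 τ v := by
  obtain ⟨g, hg, hg0, hg'⟩ := exists_Theta_eq_mul τ
  refine ⟨(g (τ, 0))⁻¹, fun p => (g p)⁻¹, hg.fun_inv hg0, ?_, rfl⟩
  filter_upwards [hg'] with p hp h0
  rw [hp, mul_inv, pow_one, mul_inv_cancel_left₀ h0]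

/-! ### Elliptic functions with modular transformation behaviour -/

/-- Functions holomorphic off the lattice, elliptic in `z`, of weight `k` and index `0`. -/
structure IsEll (k : ℤ) (ψ : ℍ → ℂ → ℂ) : Prop where
  hol : ∀ τ z, z ∉ lattice τ → HolAt ψ τ z
  ell : ∀ (τ : ℍ) (z : ℂ) (l u : ℤ), z ∉ lattice τ → ψ τ (z + (l * τ + u)) = ψ τ z
  smul : ∀ (γ : Matrix.SpecialLinearGroup (Fin 2) ℤ) (τ : ℍ) (z : ℂ), z ∉ lattice τ →
    ψ (γ • τ) (z / cocycle γ τ) = cocycle γ τ ^ k * ψ τ z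

theorem isEll_wp : IsEll 2 wp where
  hol _ _ hz := (holAt_E_two hz).sub (holAt_eis_two _ _)
  ell _ _ l u hz := wp_lattice hz l u
  smul γ _ _ hz := wp_smul γ hz

theorem isEll_E_three : IsEll 3 (E 3) where
  hol _ _ hz := holAt_E_three hz
  ell _ _ l u hz := E_three_lattice hz l u
  smul γ _ _ hz := E_three_smul γ hz

section IsEll

variable {k k' : ℤ} {φ ψ : ℍ → ℂ → ℂ}

theorem IsEll.mul (h : IsEll k φ) (h' : IsEll k' ψ) :
    IsEll (k + k') (fun τ z => φ τ z * ψ τ z) where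
  hol τ z hz := (h.hol τ z hz).mul (h'.hol τ z hz)
  ell τ z l u hz := by rw [h.ell τ z l u hz, h'.ell τ z l u hz]
  smul γ τ z hz := by
    rw [h.smul γ τ z hz, h'.smul γ τ z hz, zpow_add₀ (cocycle_ne_zero γ τ)]
    ring

theorem IsEll.pow (h : IsEll k φ) (n : ℕ) : IsEll (n * k) (fun τ z => φ τ z ^ n) where
  hol τ z hz := (h.hol τ z hz).pow n
  ell τ z l u hz := by rw [h.ell τ z l u hz]
  smul γ τ z hz := by rw [h.smul γ τ z hz, mul_pow, mul_comm (n : ℤ), zpow_mul, zpow_natCast]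

theorem IsEll.sub (h : IsEll k φ) (h' : IsEll k ψ) : IsEll k (fun τ z => φ τ z - ψ τ z) where
  hol τ z hz := (h.hol τ z hz).sub (h'.hol τ z hz)
  ell τ z l u hz := by rw [h.ell τ z l u hz, h'.ell τ z l u hz]
  smul γ τ z hz := by rw [h.smul γ τ z hz, h'.smul γ τ z hz]; ring

theorem WeaklyModular.analyticAt {f : ℍ → ℂ} (h : WeaklyModular k f) (τ : ℍ) :
    AnalyticAt ℂ (fun w : ℂ => f (ofComplex w)) τ :=
  h.hol.analyticAt ((isOpen_lt continuous_const Complex.continuous_im).mem_nhds τ.im_pos)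

theorem WeaklyModular.isEll {f : ℍ → ℂ} (h : WeaklyModular k f) : IsEll k (fun τ _ => f τ) where
  hol τ z _ := HolAt.of_fst (h.analyticAt τ) z
  ell _ _ _ _ _ := rfl
  smul γ τ _ _ := h.smul γ τ

theorem WeaklyModular.zero : WeaklyModular k (0 : ℍ → ℂ) where
  hol := differentiableOn_const 0
  smul _ _ := by simp

theorem WeaklyModular.add {f g : ℍ → ℂ} (h : WeaklyModular k f) (h' : WeaklyModular k g) :
    WeaklyModular k (f + g) where
  hol := DifferentiableOn.add h.hol h'.hol
  smul γ τ := by rw [Pi.add_apply, Pi.add_apply, h.smul, h'.smul]; ring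

theorem tendsto_div_const_punctured {J : ℂ} (hJ : J ≠ 0) :
    Tendsto (fun z : ℂ => z / J) (𝓝[≠] 0) (𝓝[≠] 0) := by
  refine tendsto_nhdsWithin_of_tendsto_nhds_of_eventually_within _ ?_ ?_
  · have : Continuous fun z : ℂ => z / J := by fun_prop
    simpa using (this.tendsto 0).mono_left nhdsWithin_le_nhds
  · filter_upwards [self_mem_nhdsWithin] with z hz
    exact div_ne_zero hz hJ

/-- The leading coefficient at `z = 0` is weakly modular. -/
theorem IsEll.weaklyModular_lead (h : IsEll k ψ) {n : ℕ} {c : ℍ → ℂ}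
    (hc : ∀ τ, LeadAt ψ n τ (c τ)) : WeaklyModular (k - n) c where
  hol := by
    intro s hs
    obtain ⟨d, hd, hd'⟩ := (hc ⟨s, hs⟩).eventually
    refine (hd.differentiableAt.congr_of_eventuallyEq ?_).differentiableWithinAt
    filter_upwards [hd'] with t ht
    exact (hc _).unique ht
  smul γ τ := by
    have hJ := cocycle_ne_zero γ τ
    have h1 := (hc (γ • τ)).tendsto.comp (tendsto_div_const_punctured hJ)
    have h2 := (hc τ).tendsto.const_mul (cocycle γ τ ^ (k - n))
    refine tendsto_nhds_unique h1 (h2.congr' ?_)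
    filter_upwards [eventually_notMem_lattice τ] with z hz
    rw [Function.comp_apply, h.smul γ τ z hz, zpow_sub₀ hJ, zpow_natCast, div_pow]
    field_simp

theorem IsEll.eq_of_leadAt_zero (h : IsEll k ψ) {c : ℍ → ℂ} (hc : ∀ τ, LeadAt ψ 0 τ (c τ))
    {τ : ℍ} {z : ℂ} (hz : z ∉ lattice τ) : ψ τ z = c τ := by
  have hlim := (hc τ).tendsto
  simp only [pow_zero, one_mul] at hlim
  obtain ⟨a, ha⟩ := elliptic_const (τ := τ) (f := ψ τ)
    (fun z hz => (HolAt.along_snd (h.hol τ z hz)).differentiableAt)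
    (fun z hz => by simpa using h.ell τ z 0 1 hz)
    (fun z hz => by simpa using h.ell τ z 1 0 hz) (hlim.isBigO_one ℂ)
  rw [ha z hz]
  refine tendsto_nhds_unique (tendsto_const_nhds.congr' ?_) hlim
  filter_upwards [eventually_notMem_lattice τ] with w hw
  exact (ha w hw).symm

theorem isPreconnected_compl_lattice (τ : ℍ) : IsPreconnected (lattice τ)ᶜ := by
  have h : lattice τ = Set.range fun p : ℤ × ℤ => (p.1 * τ + p.2 : ℂ) := by
    ext z
    simp [lattice, eq_comm]
  have hc : (lattice τ).Countable := by
    rw [h]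
    exact Set.countable_range _
  exact (hc.isPathConnected_compl_of_one_lt_rank (by simp)).isConnected.isPreconnected

/-- An elliptic function has no simple pole. -/
theorem IsEll.lead_one_eq_zero (h : IsEll k ψ) {τ : ℍ} {c : ℂ} (hc : LeadAt ψ 1 τ c) : c = 0 := by
  obtain ⟨G, hG, hG1, hG2⟩ := hc
  obtain ⟨G', hG', hG1', hG2'⟩ := (leadAt_E τ).1
  -- Subtracting c E₁ removes the pole but introduces additive quasi-periods. Then f' is elliptic
  -- and bounded at 0, so f is affine with some slope a; the period 1 forces a = 0 and the period τ
  -- forces c = 0.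
  set f : ℂ → ℂ := fun z => ψ τ z - c * E 1 τ z with hf
  have hcont : Tendsto (fun z : ℂ => ((τ : ℂ), z)) (𝓝 0) (𝓝 ((τ : ℂ), (0 : ℂ))) :=
    (by fun_prop : Continuous fun z : ℂ => ((τ : ℂ), z)).tendsto 0
  have hF : AnalyticAt ℂ (fun z => G (τ, z) - c * G' (τ, z)) 0 :=
    (AnalyticAt.along_snd (p := ((τ : ℂ), (0 : ℂ))) hG).fun_sub
      (analyticAt_const.fun_mul (AnalyticAt.along_snd (p := ((τ : ℂ), (0 : ℂ))) hG'))
  obtain ⟨q, hq, hqF⟩ : ∃ q : ℂ → ℂ, AnalyticAt ℂ q 0 ∧ ∀ᶠ z in 𝓝[≠] (0 : ℂ), f z = q z := by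
    refine ⟨dslope (fun z => G (τ, z) - c * G' (τ, z)) 0, ?_, ?_⟩
    · obtain ⟨s, hs⟩ := hF
      exact hs.has_fpower_series_dslope_fslope.analyticAt
    · filter_upwards [(hcont.eventually hG1).filter_mono nhdsWithin_le_nhds,
        (hcont.eventually hG1').filter_mono nhdsWithin_le_nhds, self_mem_nhdsWithin]
        with z h1 h2 h0
      have h0' : z ≠ 0 := h0
      rw [dslope_of_ne _ h0', slope_def_field, h1 h0', h2 h0', hG2, hG2', ofComplex_apply, hf]
      field_simp
      ring
  have hd : ∀ z ∉ lattice τ, AnalyticAt ℂ f z := fun z hz =>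
    (HolAt.along_snd (h.hol τ z hz)).fun_sub
      (analyticAt_const.fun_mul (HolAt.along_snd (holAt_E_one hz)))
  have hshift : ∀ (l u : ℤ) z, z ∉ lattice τ →
      f (z + (l * τ + u)) = f z + 2 * Real.pi * I * l * c := by
    intro l u z hz
    rw [hf]
    simp only
    rw [h.ell τ z l u hz, E_one_lattice hz]
    ring
  have hderiv : ∀ (l u : ℤ) z, z ∉ lattice τ → deriv f (z + (l * τ + u)) = deriv f z := by
    intro l u z hz
    rw [← deriv_comp_add_const]
    have : (fun z => f (z + (l * τ + u))) =ᶠ[𝓝 z] fun z => f z + 2 * Real.pi * I * l * c := by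
      filter_upwards [eventually_notMem_lattice_of_notMem hz] with w hw
      exact hshift l u w hw
    rw [this.deriv_eq, deriv_add_const]
  obtain ⟨a, ha⟩ := elliptic_const (τ := τ) (f := deriv f)
    (fun z hz => (hd z hz).deriv.differentiableAt)
    (fun z hz => by simpa using hderiv 0 1 z hz)
    (fun z hz => by simpa using hderiv 1 0 z hz) (by
      have h1 : Tendsto (deriv q) (𝓝[≠] 0) (𝓝 (deriv q 0)) :=
        hq.deriv.continuousAt.tendsto.mono_left nhdsWithin_le_nhds
      refine (h1.congr' ?_).isBigO_one ℂ
      filter_upwards [(eventually_nhdsWithin_iff.1 hqF).eventually_nhds.filter_mono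
        nhdsWithin_le_nhds, self_mem_nhdsWithin] with z hz h0
      refine Filter.EventuallyEq.deriv_eq ?_
      filter_upwards [hz, isOpen_ne.mem_nhds h0] with w hw hw0
      exact (hw hw0).symm)
  have hcst : ∀ z ∉ lattice τ, ∀ w ∉ lattice τ, f z - a * z = f w - a * w := by
    intro z hz w hw
    refine (isOpen_compl_lattice τ).is_const_of_deriv_eq_zero (isPreconnected_compl_lattice τ)
      (f := fun z => f z - a * z) ?_ ?_ hz hw
    · intro z hz
      exact ((hd z hz).differentiableAt.sub (by fun_prop)).differentiableWithinAt
    · intro z hz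
      have h1 := (hd z hz).differentiableAt.hasDerivAt.fun_sub ((hasDerivAt_id z).const_mul a)
      simp only [id_eq] at h1
      rw [h1.deriv, ha z hz]
      simp
  obtain ⟨z, hz⟩ := (dense_compl_lattice τ).nonempty
  have key : ∀ l u : ℤ, 2 * Real.pi * I * l * c = a * (l * τ + u) := by
    intro l u
    have h1 := hcst (z + (l * τ + u))
      (fun h => hz ((add_mem_lattice_iff (int_mem_lattice τ l u)).1 h)) z hz
    rw [hshift l u z hz] at h1
    linear_combination h1
  have ha0 : a = 0 := by simpa using (key 0 1).symm
  have := key 1 0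
  rw [ha0] at this
  simpa [Real.pi_ne_zero] using this

/-- Weakly holomorphic elliptic functions of weight `k` are polynomials in `℘` and `℘'`
with weakly modular coefficients. -/
theorem IsEll.exists_repr : ∀ (n : ℕ) {ψ : ℍ → ℂ → ℂ}, IsEll k ψ →
    (∀ τ, ∃ v, LeadAt ψ n τ v) → ∃ A B : ℕ → ℍ → ℂ,
      (∀ j : ℕ, WeaklyModular (k - 2 * j) (A j)) ∧ (∀ j : ℕ, WeaklyModular (k - 3 - 2 * j) (B j)) ∧
      (∀ j > n, A j = 0 ∧ B j = 0) ∧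
      ∀ τ z, z ∉ lattice τ → ψ τ z = ∑ j ∈ Finset.range (n + 1), A j τ * wp τ z ^ j +
        E 3 τ z * ∑ j ∈ Finset.range (n + 1), B j τ * wp τ z ^ j := by
  intro n
  induction n with
  | zero =>
    intro ψ hψ hl
    choose c hc using hl
    have hcm := hψ.weaklyModular_lead hc
    refine ⟨fun j => if j = 0 then c else 0, 0, fun j => ?_, fun j => WeaklyModular.zero,
      fun j hj => ⟨if_neg (by omega), rfl⟩, fun τ z hz => ?_⟩
    · simp only
      split_ifs with hj
      · subst hj
        simpa using hcm
      · exact WeaklyModular.zero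
    · rw [hψ.eq_of_leadAt_zero hc hz]
      simp
  | succ n ih =>
    intro ψ hψ hl
    choose c hc using hl
    have hcm := hψ.weaklyModular_lead hc
    have hext : ∀ {A : ℕ → ℍ → ℂ} {τ z}, (∀ j > n, A j = 0) →
        ∑ j ∈ Finset.range (n + 1 + 1), A j τ * wp τ z ^ j =
        ∑ j ∈ Finset.range (n + 1), A j τ * wp τ z ^ j := by
      intro A τ z hA
      rw [Finset.sum_range_succ, hA (n + 1) (by omega)]
      simp
    -- A pole bound of one improves to zero because elliptic functions have no simple pole.
    by_cases hn : n = 0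
    · subst hn
      have h0 : ∀ τ, LeadAt ψ (0 + 1) τ 0 := fun τ => by
        have := hψ.lead_one_eq_zero (hc τ)
        rw [← this]
        exact hc τ
      obtain ⟨A, B, hA, hB, hAB, hrep⟩ := ih hψ (LeadAt.lower h0)
      refine ⟨A, B, hA, hB, fun j hj => hAB j (by omega), fun τ z hz => ?_⟩
      rw [hrep τ z hz, hext fun j hj => (hAB j hj).1, hext fun j hj => (hAB j hj).2]
    -- A pole of order 2j is cancelled by c ℘^j, one of order 2i + 3 by c E₃ ℘^i; both monomials
    -- have leading coefficient 1.
    · rcases Nat.even_or_odd' (n + 1) with ⟨j₀, hj₀ | hj₀⟩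
      · have hb : IsEll k (fun τ z => c τ * wp τ z ^ j₀) := by
          have := hcm.isEll.mul (isEll_wp.pow j₀)
          rw [hj₀] at this
          push_cast at this
          rwa [show k - 2 * (j₀ : ℤ) + j₀ * 2 = k by ring] at this
        have hlead : ∀ τ, LeadAt (fun τ z => c τ * wp τ z ^ j₀) (n + 1) τ (c τ) := fun τ => by
          have h1 := (LeadAt.of_holAt (HolAt.of_fst (hcm.analyticAt τ) 0)).mul
            ((leadAt_wp τ).pow j₀)
          rwa [one_pow, mul_one, zero_add, ← hj₀] at h1
        obtain ⟨A, B, hA, hB, hAB, hrep⟩ := ih (hψ.sub hb) (LeadAt.lower fun τ => by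
          have := (hc τ).sub (hlead τ)
          rwa [sub_self] at this)
        refine ⟨fun j => A j + if j = j₀ then c else 0, B, fun j => ?_, hB,
          fun j hj => ⟨?_, (hAB j (by omega)).2⟩, fun τ z hz => ?_⟩
        · refine (hA j).add ?_
          split_ifs with h
          · subst h
            rw [hj₀] at hcm
            simpa using hcm
          · exact WeaklyModular.zero
        · simp only
          rw [(hAB j (by omega)).1, if_neg (by omega), add_zero]
        · rw [← sub_add_cancel (ψ τ z) (c τ * wp τ z ^ j₀), hrep τ z hz,
            hext fun j hj => (hAB j hj).2]
          simp only [Pi.add_apply, add_mul, Finset.sum_add_distrib]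
          rw [hext fun j hj => (hAB j hj).1]
          have : ∑ j ∈ Finset.range (n + 1 + 1), (if j = j₀ then c else 0) τ * wp τ z ^ j =
              c τ * wp τ z ^ j₀ := by
            rw [Finset.sum_eq_single j₀ (fun j _ hj => by simp [hj]) (fun hj => by
              exact absurd (Finset.mem_range.2 (by omega)) hj)]
            simp
          rw [this]
          ring
      · obtain ⟨i, rfl⟩ : ∃ i, j₀ = i + 1 := ⟨j₀ - 1, by omega⟩
        have hb : IsEll k (fun τ z => c τ * (E 3 τ z * wp τ z ^ i)) := by
          have := hcm.isEll.mul (isEll_E_three.mul (isEll_wp.pow i))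
          rw [hj₀] at this
          push_cast at this
          rwa [show k - (2 * ((i : ℤ) + 1) + 1) + (3 + i * 2) = k by ring] at this
        have hlead : ∀ τ, LeadAt (fun τ z => c τ * (E 3 τ z * wp τ z ^ i)) (n + 1) τ (c τ) :=
          fun τ => by
          have h1 := (LeadAt.of_holAt (HolAt.of_fst (hcm.analyticAt τ) 0)).mul
            ((leadAt_E τ).2.2.mul ((leadAt_wp τ).pow i))
          rwa [one_pow, mul_one, mul_one, zero_add, show 3 + 2 * i = n + 1 by omega] at h1
        obtain ⟨A, B, hA, hB, hAB, hrep⟩ := ih (hψ.sub hb) (LeadAt.lower fun τ => by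
          have := (hc τ).sub (hlead τ)
          rwa [sub_self] at this)
        refine ⟨A, fun j => B j + if j = i then c else 0, hA, fun j => ?_,
          fun j hj => ⟨(hAB j (by omega)).1, ?_⟩, fun τ z hz => ?_⟩
        · refine (hB j).add ?_
          split_ifs with h
          · subst h
            rw [hj₀] at hcm
            push_cast at hcm
            rwa [show k - (2 * ((j : ℤ) + 1) + 1) = k - 3 - 2 * j by ring] at hcm
          · exact WeaklyModular.zero
        · simp only
          rw [(hAB j (by omega)).2, if_neg (by omega), add_zero]
        · rw [← sub_add_cancel (ψ τ z) (c τ * (E 3 τ z * wp τ z ^ i)), hrep τ z hz,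
            hext fun j hj => (hAB j hj).1]
          simp only [Pi.add_apply, add_mul, Finset.sum_add_distrib]
          rw [hext fun j hj => (hAB j hj).2]
          have : ∑ j ∈ Finset.range (n + 1 + 1), (if j = i then c else 0) τ * wp τ z ^ j =
              c τ * wp τ z ^ i := by
            rw [Finset.sum_eq_single i (fun j _ hj => by simp [hj]) (fun hj => by
              exact absurd (Finset.mem_range.2 (by omega)) hj)]
            simp
          rw [this]
          ring

end IsEll

/-! ### Moderate growth -/

/-- Moderate growth along a filter, with respect to a height function. -/
def ModerateAlong {X : Type*} (L : Filter X) (h : X → ℝ) (f : X → ℂ) : Prop :=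
  ∀ C > (0 : ℝ), f =O[L] fun x => Real.exp (C * h x)

section ModerateAlong

variable {X : Type*} {L : Filter X} {h : X → ℝ} {f g : X → ℂ}

theorem ModerateAlong.congr (hf : ModerateAlong L h f) (he : f =ᶠ[L] g) : ModerateAlong L h g :=
  fun C hC => (hf C hC).congr' he .rfl

theorem ModerateAlong.add (hf : ModerateAlong L h f) (hg : ModerateAlong L h g) :
    ModerateAlong L h (fun x => f x + g x) := fun C hC => (hf C hC).add (hg C hC)

theorem ModerateAlong.sub (hf : ModerateAlong L h f) (hg : ModerateAlong L h g) :
    ModerateAlong L h (fun x => f x - g x) := fun C hC => (hf C hC).sub (hg C hC)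

theorem ModerateAlong.mul (hf : ModerateAlong L h f) (hg : ModerateAlong L h g) :
    ModerateAlong L h (fun x => f x * g x) := fun C hC =>
  ((hf (C / 2) (by positivity)).mul (hg (C / 2) (by positivity))).congr_right fun x => by
    rw [← Real.exp_add]
    ring_nf

theorem ModerateAlong.of_isBigO_one (h0 : ∀ᶠ x in L, 0 ≤ h x) (hf : f =O[L] fun _ => (1 : ℝ)) :
    ModerateAlong L h f := fun C hC => hf.trans <| by
  refine Asymptotics.IsBigO.of_bound 1 ?_
  filter_upwards [h0] with x hx
  rw [one_mul, norm_one, Real.norm_eq_abs, Real.abs_exp]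
  exact Real.one_le_exp (by positivity)

theorem ModerateAlong.of_tendsto (h0 : ∀ᶠ x in L, 0 ≤ h x) {c : ℂ} (hf : Tendsto f L (𝓝 c)) :
    ModerateAlong L h f := .of_isBigO_one h0 (hf.isBigO_one ℝ)

theorem ModerateAlong.const (h0 : ∀ᶠ x in L, 0 ≤ h x) (c : ℂ) : ModerateAlong L h fun _ => c :=
  .of_tendsto h0 tendsto_const_nhds

theorem ModerateAlong.pow (h0 : ∀ᶠ x in L, 0 ≤ h x) (hf : ModerateAlong L h f) (n : ℕ) :
    ModerateAlong L h (fun x => f x ^ n) := by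
  induction n with
  | zero => simpa using ModerateAlong.const h0 1
  | succ n ih => simpa only [pow_succ] using ih.mul hf

theorem ModerateAlong.sum (h0 : ∀ᶠ x in L, 0 ≤ h x) {ι : Type*} {s : Finset ι} {F : ι → X → ℂ}
    (hF : ∀ i ∈ s, ModerateAlong L h (F i)) : ModerateAlong L h (fun x => ∑ i ∈ s, F i x) := by
  classical
  induction s using Finset.induction_on with
  | empty => simpa using ModerateAlong.const h0 0
  | insert i s hi ih =>
    simp only [Finset.sum_insert hi]
    exact (hF i (Finset.mem_insert_self i s)).add (ih fun j hj => hF j (Finset.mem_insert_of_mem hj))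

theorem ModerateAlong.comp (hf : ModerateAlong L h f) {Y : Type*} {L' : Filter Y} {k : Y → X}
    (hk : Tendsto k L' L) : ModerateAlong L' (h ∘ k) (f ∘ k) := fun C hC =>
  (hf C hC).comp_tendsto hk

end ModerateAlong

/-- The filter of `Im τ → ∞` with `|Re τ| ≤ A`. -/
def stripFilter (A : ℝ) : Filter ℍ := atImInfty ⊓ 𝓟 {τ | |τ.re| ≤ A}

theorem stripFilter_le (A : ℝ) : stripFilter A ≤ atImInfty := inf_le_left

theorem eventually_im_nonneg (A : ℝ) : ∀ᶠ τ in stripFilter A, 0 ≤ UpperHalfPlane.im τ :=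
  .of_forall fun τ => τ.im_pos.le

/-- Makes the calculus of asymptotic bounds available; the strips encode uniformity for bounded real
part. -/
theorem moderateAtInfty_iff {f : ℍ → ℂ} :
    ModerateAtInfty f ↔ ∀ A, ModerateAlong (stripFilter A) UpperHalfPlane.im f := by
  refine ⟨fun h A C hC => ?_, fun h C hC A => ?_⟩
  · obtain ⟨K, Y, hK⟩ := h C hC A
    refine Asymptotics.IsBigO.of_bound K (eventually_inf_principal.2 ?_)
    refine (UpperHalfPlane.atImInfty_mem _).2 ⟨Y, fun τ hτ hre => ?_⟩
    have h1 := hK τ.re τ.im hre hτ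
    have h2 : ((τ.re : ℂ) + (τ.im : ℂ) * I) = τ := Complex.re_add_im _
    rw [h2, ofComplex_apply] at h1
    simpa using h1
  · obtain ⟨K, hK⟩ := (h A C hC).bound
    obtain ⟨Y, hY⟩ := (UpperHalfPlane.atImInfty_mem _).1 (eventually_inf_principal.1 hK)
    -- The maximum with 1 keeps y positive, so that `ofComplex` is not at its default value.
    refine ⟨K, max Y 1, fun x y hx hy => ?_⟩
    have hy0 : 0 < ((x : ℂ) + (y : ℂ) * I).im := by
      simp only [Complex.add_im, Complex.ofReal_im, Complex.mul_im, Complex.ofReal_re, Complex.I_im,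
        Complex.I_re]
      linarith [le_max_right Y 1]
    have e1 : UpperHalfPlane.im (ofComplex ((x : ℂ) + (y : ℂ) * I)) = y := by
      rw [ofComplex_apply_of_im_pos hy0]
      show ((x : ℂ) + (y : ℂ) * I).im = y
      simp
    have e2 : UpperHalfPlane.re (ofComplex ((x : ℂ) + (y : ℂ) * I)) = x := by
      rw [ofComplex_apply_of_im_pos hy0]
      show ((x : ℂ) + (y : ℂ) * I).re = x
      simp
    have := hY (ofComplex ((x : ℂ) + (y : ℂ) * I)) (by
      rw [e1]
      exact (le_max_left _ _).trans hy) (by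
      show |UpperHalfPlane.re _| ≤ A
      rwa [e2])
    simpa [e1] using this

section ModerateAtInfty

variable {f g : ℍ → ℂ}

theorem JacobiForms.ModerateAtInfty.add (hf : ModerateAtInfty f) (hg : ModerateAtInfty g) :
    ModerateAtInfty (fun τ => f τ + g τ) := moderateAtInfty_iff.2 fun A =>
  (moderateAtInfty_iff.1 hf A).add (moderateAtInfty_iff.1 hg A)

theorem JacobiForms.ModerateAtInfty.sub (hf : ModerateAtInfty f) (hg : ModerateAtInfty g) :
    ModerateAtInfty (fun τ => f τ - g τ) := moderateAtInfty_iff.2 fun A =>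
  (moderateAtInfty_iff.1 hf A).sub (moderateAtInfty_iff.1 hg A)

theorem JacobiForms.ModerateAtInfty.mul (hf : ModerateAtInfty f) (hg : ModerateAtInfty g) :
    ModerateAtInfty (fun τ => f τ * g τ) := moderateAtInfty_iff.2 fun A =>
  (moderateAtInfty_iff.1 hf A).mul (moderateAtInfty_iff.1 hg A)

theorem JacobiForms.ModerateAtInfty.of_tendsto {c : ℂ} (hf : Tendsto f atImInfty (𝓝 c)) :
    ModerateAtInfty f := moderateAtInfty_iff.2 fun A =>
  .of_tendsto (eventually_im_nonneg A) (hf.mono_left (stripFilter_le A))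

theorem JacobiForms.ModerateAtInfty.congr (hf : ModerateAtInfty f) (h : f =ᶠ[atImInfty] g) :
    ModerateAtInfty g := moderateAtInfty_iff.2 fun A =>
  (moderateAtInfty_iff.1 hf A).congr (h.filter_mono (stripFilter_le A))

theorem JacobiForms.ModerateAtInfty.sum {ι : Type*} {s : Finset ι} {F : ι → ℍ → ℂ}
    (hF : ∀ i ∈ s, ModerateAtInfty (F i)) : ModerateAtInfty (fun τ => ∑ i ∈ s, F i τ) :=
  moderateAtInfty_iff.2 fun A => .sum (eventually_im_nonneg A) fun i hi =>
    moderateAtInfty_iff.1 (hF i hi) A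

/-- A polynomial of moderate growth at sufficiently many points has coefficients of moderate
growth. -/
theorem moderateAtInfty_coeff {n : ℕ} {x : Fin n → ℍ → ℂ} {y : Fin n → ℂ}
    (hy : Function.Injective y) (hx : ∀ i, Tendsto (x i) atImInfty (𝓝 (y i)))
    {A : ℕ → ℍ → ℂ}
    (h : ∀ i, ModerateAtInfty (fun τ => ∑ j ∈ Finset.range n, A j τ * x i τ ^ j)) :
    ∀ j < n, ModerateAtInfty (A j) := by
  intro j hj
  -- The Vandermonde system is inverted through its adjugate. The entries of the adjugate converge,
  -- and the determinant converges to a nonzero number since the limit nodes are distinct.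
  set M : ℍ → Matrix (Fin n) (Fin n) ℂ := fun τ => Matrix.vandermonde fun i => x i τ with hM
  have hlim : Tendsto M atImInfty (𝓝 (Matrix.vandermonde y)) :=
    tendsto_pi_nhds.2 fun a => tendsto_pi_nhds.2 fun b => (hx a).pow _
  have hdet : (Matrix.vandermonde y).det ≠ 0 := Matrix.det_vandermonde_ne_zero_iff.2 hy
  have h1 : Tendsto (fun τ => (M τ).det) atImInfty (𝓝 (Matrix.vandermonde y).det) :=
    ((continuous_id.matrix_det).tendsto _).comp hlim
  have h2 : ∀ a b, Tendsto (fun τ => (M τ).adjugate a b) atImInfty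
      (𝓝 ((Matrix.vandermonde y).adjugate a b)) := fun a b =>
    ((continuous_id.matrix_adjugate.matrix_elem a b).tendsto _).comp hlim
  have h3 : ModerateAtInfty fun τ => (M τ).det⁻¹ * ∑ i : Fin n, (M τ).adjugate ⟨j, hj⟩ i *
      ∑ j ∈ Finset.range n, A j τ * x i τ ^ j :=
    (ModerateAtInfty.of_tendsto (h1.inv₀ hdet)).mul (ModerateAtInfty.sum fun i _ =>
      (ModerateAtInfty.of_tendsto (h2 _ i)).mul (h i))
  refine h3.congr ?_
  filter_upwards [h1.eventually_ne hdet] with τ hτ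
  have h4 : (M τ).mulVec (fun i : Fin n => A i τ) =
      fun i => ∑ j ∈ Finset.range n, A j τ * x i τ ^ j := by
    funext i
    rw [Finset.sum_range]
    simp only [Matrix.mulVec, dotProduct, hM, Matrix.vandermonde_apply]
    exact Finset.sum_congr rfl fun _ _ => mul_comm _ _
  have h5 := congrArg ((M τ).adjugate.mulVec) h4
  rw [Matrix.mulVec_mulVec, Matrix.adjugate_mul, Matrix.smul_mulVec, Matrix.one_mulVec] at h5
  have h6 := congrFun h5 ⟨j, hj⟩
  simp only [Pi.smul_apply, smul_eq_mul] at h6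
  rw [inv_mul_eq_iff_eq_mul₀ hτ, h6]
  rfl

end ModerateAtInfty

/-! ### Values at real points -/

theorem ofReal_mem_integerComplement {u : ℝ} (h0 : 0 < u) (h1 : u < 1) :
    (u : ℂ) ∈ Complex.integerComplement := by
  rintro ⟨n, hn⟩
  have : (n : ℝ) = u := by exact_mod_cast hn
  have h2 : (0 : ℝ) < n := this ▸ h0
  have h3 : (n : ℝ) < 1 := this ▸ h1
  norm_cast at h2 h3
  omega

theorem cuspLimit_zero : cuspLimit 0 = piCot := by simp [cuspLimit]

theorem cuspDomain_zero : cuspDomain 0 = Complex.integerComplement := by simp [cuspDomain]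

theorem ofReal_notMem_lattice {u : ℝ} (h0 : 0 < u) (h1 : u < 1) (τ : ℍ) :
    (u : ℂ) ∉ lattice τ := by
  have := (real_mem_lattice_iff (τ := τ) (l := 0) (u := u)).not
  simp only [Complex.ofReal_zero, zero_mul, zero_add] at this
  rw [this]
  rintro ⟨-, n, hn⟩
  exact ofReal_mem_integerComplement h0 h1 ⟨n, by rw [← hn]; simp⟩

theorem tendsto_E_real {u : ℝ} (h0 : 0 < u) (h1 : u < 1) :
    Tendsto (fun τ => E 2 τ u) atImInfty (𝓝 (Real.pi ^ 2 / Complex.sin (Real.pi * u) ^ 2)) ∧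
    Tendsto (fun τ => E 3 τ u) atImInfty
      (𝓝 (Real.pi ^ 3 * Complex.cos (Real.pi * u) / Complex.sin (Real.pi * u) ^ 3)) := by
  have hu := ofReal_mem_integerComplement h0 h1
  have h := tendsto_E_joint le_rfl one_pos (w₀ := u) (by rwa [cuspDomain_zero])
  rw [cuspLimit_zero] at h
  have e2 := tendsto_at_real h.1
  have e3 := tendsto_at_real h.2
  rw [(hasDerivAt_piCot (sin_pi_mul_ne_zero hu)).deriv, neg_neg] at e2
  rw [(hasDerivAt_deriv_piCot hu).deriv] at e3
  simp only [Complex.ofReal_zero, zero_mul, zero_add] at e2 e3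
  refine ⟨e2, ?_⟩
  convert e3 using 2
  ring

theorem tendsto_wp_real {u : ℝ} (h0 : 0 < u) (h1 : u < 1) : Tendsto (fun τ => wp τ u) atImInfty
    (𝓝 (Real.pi ^ 2 / Complex.sin (Real.pi * u) ^ 2 - Real.pi ^ 2 / 3)) := by
  refine ((tendsto_E_real h0 h1).1.sub tendsto_G2).congr fun τ => ?_
  rw [wp, eis_two_eq]

/-- On (0, 1/2) the function sin(πu) is positive and injective. -/
theorem wp_limit_injOn : Set.InjOn
    (fun u : ℝ => (Real.pi ^ 2 / Complex.sin (Real.pi * u) ^ 2 - Real.pi ^ 2 / 3 : ℂ))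
    (Set.Ioo 0 (1 / 2)) := by
  intro u hu v hv h
  have hs : ∀ u ∈ Set.Ioo (0 : ℝ) (1 / 2), 0 < Real.sin (Real.pi * u) := fun u hu =>
    Real.sin_pos_of_pos_of_lt_pi (mul_pos Real.pi_pos hu.1) (by nlinarith [Real.pi_pos, hu.2])
  have h' : Real.pi ^ 2 / Real.sin (Real.pi * u) ^ 2 = Real.pi ^ 2 / Real.sin (Real.pi * v) ^ 2 := by
    exact_mod_cast sub_left_inj.1 h
  have hpi : Real.pi ^ 2 ≠ 0 := pow_ne_zero 2 Real.pi_ne_zero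
  rw [div_eq_mul_inv, div_eq_mul_inv, mul_right_inj' hpi, inv_inj, sq_eq_sq₀ (hs u hu).le (hs v hv).le] at h'
  have := Real.injOn_sin (by constructor <;> nlinarith [Real.pi_pos, hu.1, hu.2])
    (by constructor <;> nlinarith [Real.pi_pos, hv.1, hv.2]) h'
  exact mul_left_cancel₀ Real.pi_ne_zero this

/-- The matrix -1 fixes τ and sends z to -z. -/
theorem IsEll.neg {k : ℤ} {ψ : ℍ → ℂ → ℂ} (h : IsEll k ψ) {τ : ℍ} {z : ℂ} (hz : z ∉ lattice τ) :
    ψ τ (-z) = (-1) ^ k * ψ τ z := by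
  have h1 := h.smul (-1) τ z hz
  have e : cocycle (-1) τ = -1 := by simp [cocycle]
  rw [e, div_neg, div_one, ModularGroup.SL_neg_smul, one_smul] at h1
  exact h1

/-- The coefficients in `IsEll.exists_repr` have moderate growth if the function has moderate
growth at real points. -/
theorem moderateAtInfty_repr {n : ℕ} {ψ : ℍ → ℂ → ℂ} {A B : ℕ → ℍ → ℂ}
    (hrep : ∀ τ z, z ∉ lattice τ → ψ τ z = ∑ j ∈ Finset.range n, A j τ * wp τ z ^ j +
        E 3 τ z * ∑ j ∈ Finset.range n, B j τ * wp τ z ^ j)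
    (hm : ∀ u : ℝ, 0 < u → u < 1 → ModerateAtInfty fun τ => ψ τ u) :
    (∀ j < n, ModerateAtInfty (A j)) ∧ ∀ j < n, ModerateAtInfty (B j) := by
  -- Distinct points of (0, 1/2), where the limits of ℘ differ and the limit of E₃ is nonzero.
  set u : Fin n → ℝ := fun i => 1 / ((i : ℝ) + 3)
  have hu : ∀ i, u i ∈ Set.Ioo (0 : ℝ) (1 / 2) := fun i => by
    refine ⟨by positivity, ?_⟩
    rw [div_lt_div_iff₀ (by positivity) (by norm_num)]
    have : (0 : ℝ) ≤ i := by positivity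
    linarith
  have hu0 : ∀ i, 0 < u i := fun i => (hu i).1
  have hu1 : ∀ i, u i < 1 := fun i => (hu i).2.trans (by norm_num)
  have huinj : Function.Injective u := fun i j hij => by
    have h1 : ((i : ℝ) + 3) = (j : ℝ) + 3 := by
      have := congrArg (fun x : ℝ => 1 / x) hij
      simpa [u] using this
    exact Fin.ext (by exact_mod_cast add_right_cancel h1)
  have hinj : Function.Injective fun i : Fin n =>
      (Real.pi ^ 2 / Complex.sin (Real.pi * u i) ^ 2 - Real.pi ^ 2 / 3 : ℂ) :=
    fun i j hij => huinj (wp_limit_injOn (hu i) (hu j) hij)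
  have hx := fun i => tendsto_wp_real (hu0 i) (hu1 i)
  -- The point 1 - u is equivalent to -u. As ℘ is even and E₃ is odd, half the sum and half the
  -- difference of the two values isolate the A-part and the B-part.
  have hrep' : ∀ i τ, ψ τ ((1 - u i : ℝ) : ℂ) =
      ∑ j ∈ Finset.range n, A j τ * wp τ (u i) ^ j -
        E 3 τ (u i) * ∑ j ∈ Finset.range n, B j τ * wp τ (u i) ^ j := by
    intro i τ
    have hl := ofReal_notMem_lattice (hu0 i) (hu1 i) τ
    have hl' : -(u i : ℂ) ∉ lattice τ := neg_mem_lattice_iff.not.2 hl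
    have e : ((1 - u i : ℝ) : ℂ) = -(u i : ℂ) + ((0 : ℤ) * τ + (1 : ℤ)) := by
      push_cast
      ring
    rw [hrep τ _ (ofReal_notMem_lattice (by linarith [hu1 i]) (by linarith [hu0 i]) τ), e,
      wp_lattice hl', E_three_lattice hl', isEll_wp.neg hl, isEll_E_three.neg hl]
    norm_num
    ring
  have hm1 := fun i => hm (u i) (hu0 i) (hu1 i)
  have hm2 := fun i => hm (1 - u i) (by linarith [hu1 i]) (by linarith [hu0 i])
  have hc : ∀ c : ℂ, ModerateAtInfty fun _ => c := fun c => .of_tendsto tendsto_const_nhds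
  refine ⟨moderateAtInfty_coeff hinj hx fun i => ?_, moderateAtInfty_coeff hinj hx fun i => ?_⟩
  · refine ((hc (1 / 2)).mul ((hm1 i).add (hm2 i))).congr (.of_forall fun τ => ?_)
    simp only
    rw [hrep', hrep τ _ (ofReal_notMem_lattice (hu0 i) (hu1 i) τ)]
    ring
  · have h3 := (tendsto_E_real (hu0 i) (hu1 i)).2
    have hne : (Real.pi ^ 3 * Complex.cos (Real.pi * u i) / Complex.sin (Real.pi * u i) ^ 3 : ℂ) ≠
        0 := by
      have h1 := sin_pi_mul_ne_zero (ofReal_mem_integerComplement (hu0 i) (hu1 i))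
      have h2 : Real.cos (Real.pi * u i) ≠ 0 := (Real.cos_pos_of_mem_Ioo
        (by constructor <;> nlinarith [Real.pi_pos, (hu i).1, (hu i).2])).ne'
      have h2' : Complex.cos (Real.pi * u i) ≠ 0 := by exact_mod_cast h2
      have hpi : (Real.pi : ℂ) ≠ 0 := by exact_mod_cast Real.pi_ne_zero
      exact div_ne_zero (mul_ne_zero (pow_ne_zero 3 hpi) h2') (pow_ne_zero 3 h1)
    refine (((hc (1 / 2)).mul ((hm1 i).sub (hm2 i))).mul
      (ModerateAtInfty.of_tendsto (h3.inv₀ hne))).congr ?_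
    filter_upwards [h3.eventually_ne hne] with τ hτ
    rw [hrep', hrep τ _ (ofReal_notMem_lattice (hu0 i) (hu1 i) τ)]
    field_simp
    ring

/-! ### Slash operators off the lattice -/

/-- Invariance under the Jacobi group at all points off the lattice. -/
def SlashInv (k : ℤ) (m : ℚ) (φ : ℍ → ℂ → ℂ) : Prop :=
  ∀ (γ : Matrix.SpecialLinearGroup (Fin 2) ℤ) (l u : ℤ) (τ : ℍ) (z : ℂ), z ∉ lattice τ →
    slash k m γ l u φ τ z = φ τ z

section Slash

variable {k k' : ℤ} {m m' : ℚ} {φ ψ : ℍ → ℂ → ℂ}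

theorem slash_apply (k : ℤ) (m : ℚ) (γ : Matrix.SpecialLinearGroup (Fin 2) ℤ) (l u : ℤ)
    (φ : ℍ → ℂ → ℂ) (τ : ℍ) (z : ℂ) : slash k m γ l u φ τ z =
      ex (m * (l + u) ^ 2) * ex (m * (l * (l * τ + 2 * z))) *
        (cocycle γ τ ^ (-k) *
          ex (-((γ.1 1 0 : ℤ) : ℂ) * (m * (z + l * τ + u) ^ 2) / cocycle γ τ) *
          φ (γ • τ) ((z + l * τ + u) / cocycle γ τ)) := by
  simp only [slash, slashEll, slashMod, Complex.ofReal_intCast]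

theorem slash_mul (γ : Matrix.SpecialLinearGroup (Fin 2) ℤ) (l u : ℤ) (τ : ℍ) (z : ℂ) :
    slash (k + k') (m + m') γ l u (fun τ z => φ τ z * ψ τ z) τ z =
      slash k m γ l u φ τ z * slash k' m' γ l u ψ τ z := by
  simp only [slash_apply]
  have h : ∀ x : ℂ, ex (((m + m' : ℚ) : ℂ) * x) = ex (m * x) * ex (m' * x) := fun x => by
    rw [← ex_add]
    push_cast
    ring_nf
  have h' : ∀ c x y : ℂ, ex (c * (((m + m' : ℚ) : ℂ) * x) / y) =
      ex (c * (m * x) / y) * ex (c * (m' * x) / y) := fun c x y => by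
    rw [← ex_add]
    push_cast
    ring_nf
  rw [neg_add, zpow_add₀ (cocycle_ne_zero γ τ), h, h, h']
  ring

theorem slash_weight_zero_one (γ : Matrix.SpecialLinearGroup (Fin 2) ℤ) (l u : ℤ) (τ : ℍ)
    (z : ℂ) (c : ℂ) : slash 0 0 γ l u (fun _ _ => c) τ z = c := by
  simp [slash_apply, ex]

theorem slash_index_zero (k : ℤ) (γ : Matrix.SpecialLinearGroup (Fin 2) ℤ) (l u : ℤ)
    (φ : ℍ → ℂ → ℂ) (τ : ℍ) (z : ℂ) : slash k 0 γ l u φ τ z =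
      cocycle γ τ ^ (-k) * φ (γ • τ) ((z + (l * τ + u)) / cocycle γ τ) := by
  simp [slash_apply, ex, add_assoc]

theorem slash_inv (γ : Matrix.SpecialLinearGroup (Fin 2) ℤ) (l u : ℤ) (τ : ℍ) (z : ℂ) :
    slash (-k) (-m) γ l u (fun τ z => (φ τ z)⁻¹) τ z = (slash k m γ l u φ τ z)⁻¹ := by
  have h : ∀ x, ex (-x) = (ex x)⁻¹ := ex_neg
  simp only [slash_apply]
  push_cast
  rw [mul_inv, mul_inv, mul_inv, mul_inv, ← h, ← h, ← h, zpow_neg]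
  ring_nf

theorem SlashInv.mul (h : SlashInv k m φ) (h' : SlashInv k' m' ψ) :
    SlashInv (k + k') (m + m') (fun τ z => φ τ z * ψ τ z) := fun γ l u τ z hz => by
  rw [slash_mul, h γ l u τ z hz, h' γ l u τ z hz]

theorem SlashInv.inv (h : SlashInv k m φ) : SlashInv (-k) (-m) (fun τ z => (φ τ z)⁻¹) :=
  fun γ l u τ z hz => by rw [slash_inv, h γ l u τ z hz]

theorem SlashInv.const (c : ℂ) : SlashInv 0 0 (fun _ _ => c) :=
  fun γ l u τ z _ => slash_weight_zero_one γ l u τ z c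

theorem SlashInv.pow (h : SlashInv k m φ) (n : ℕ) :
    SlashInv (n * k) (n * m) (fun τ z => φ τ z ^ n) := by
  induction n with
  | zero => simpa using SlashInv.const 1
  | succ n ih =>
    have := ih.mul h
    simp only [← pow_succ] at this
    convert this using 1 <;> push_cast <;> ring

theorem notMem_lattice_transform {γ : Matrix.SpecialLinearGroup (Fin 2) ℤ} {l u : ℤ} {τ : ℍ}
    {z : ℂ} : (z + (l * τ + u)) / cocycle γ τ ∈ lattice (γ • τ) ↔ z ∈ lattice τ := by
  rw [div_cocycle_mem_lattice_iff, add_mem_lattice_iff (int_mem_lattice τ l u)]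

theorem SlashInv.of_smul_ell
    (ell : ∀ (τ : ℍ) (z : ℂ) (l u : ℤ), z ∉ lattice τ → ψ τ (z + (l * τ + u)) = ψ τ z)
    (smul : ∀ (γ : Matrix.SpecialLinearGroup (Fin 2) ℤ) (τ : ℍ) (z : ℂ), z ∉ lattice τ →
      ψ (γ • τ) (z / cocycle γ τ) = cocycle γ τ ^ k * ψ τ z) : SlashInv k 0 ψ := by
  intro γ l u τ z hz
  have hz' := (add_mem_lattice_iff (int_mem_lattice τ l u)).not.2 hz
  rw [slash_index_zero, smul γ τ _ hz', ell τ z l u hz, ← mul_assoc,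
    ← zpow_add₀ (cocycle_ne_zero γ τ), neg_add_cancel, zpow_zero, one_mul]

theorem SlashInv.isEll (h : SlashInv k 0 φ) (hol : PolesInLattice φ) : IsEll k φ where
  hol := hol
  ell τ z l u hz := by
    have := h 1 l u τ z hz
    rw [slash_index_zero] at this
    simpa [cocycle] using this
  smul γ τ z hz := by
    have := h γ 0 0 τ z hz
    rw [slash_index_zero] at this
    simp only [Int.cast_zero, zero_mul, add_zero] at this
    rw [← this, ← mul_assoc, ← zpow_add₀ (cocycle_ne_zero γ τ), add_neg_cancel, zpow_zero, one_mul]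

theorem slashInv_wp : SlashInv 2 0 wp := .of_smul_ell isEll_wp.ell isEll_wp.smul

theorem slashInv_E_three : SlashInv 3 0 (E 3) := .of_smul_ell isEll_E_three.ell isEll_E_three.smul

theorem slashInv_eis_four : SlashInv 4 0 (eis 4) :=
  .of_smul_ell (fun τ z l u _ => by rw [eis_four_eq, eis_four_eq])
    (fun γ τ z _ => eis_four_smul γ τ _ z)

theorem slash_Theta (γ : Matrix.SpecialLinearGroup (Fin 2) ℤ) (l u : ℤ) (τ : ℍ) (z : ℂ) :
    slash (-1) (1 / 2) γ l u Theta τ z = Theta τ z := by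
  have h1 := Theta_smul γ τ (z + (l * τ + u))
  have h2 := theta_lattice τ l u z
  -- The factor e(m(λ+μ)²) of the elliptic action exactly absorbs the sign (-1)^(l+u), because
  -- (l+u)(l+u+1) is even.
  have h3 : ex (((l : ℂ) + u) ^ 2 / 2 + (l + u) / 2) = 1 := by
    obtain ⟨n, hn⟩ := Int.even_mul_succ_self (l + u)
    refine ex_eq_one_iff.2 ⟨n, ?_⟩
    have : ((l : ℂ) + u) * (l + u + 1) = n + n := by exact_mod_cast hn
    linear_combination this / 2
  have h4 : ex ((l : ℂ) * (l * τ + 2 * z) / 2) * ex (-((l : ℂ) ^ 2 * τ / 2) - l * z) = 1 := by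
    rw [← ex_add]
    exact ex_eq_one_iff.2 ⟨0, by push_cast; ring⟩
  rw [slash_apply]
  rw [ex_add] at h3
  rw [h2] at h1
  have e1 : (((1 / 2 : ℚ) : ℂ) * (l + u) ^ 2) = ((l : ℂ) + u) ^ 2 / 2 := by push_cast; ring
  have e2 : (((1 / 2 : ℚ) : ℂ) * (l * (l * τ + 2 * z))) = (l : ℂ) * (l * τ + 2 * z) / 2 := by
    push_cast; ring
  have e3 : -((γ.1 1 0 : ℤ) : ℂ) * (((1 / 2 : ℚ) : ℂ) * (z + l * τ + u) ^ 2) / cocycle γ τ =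
      -((γ.1 1 0 : ℤ) * (z + (l * τ + u)) ^ 2 / (2 * cocycle γ τ)) := by
    have := cocycle_ne_zero γ τ
    push_cast
    field_simp
    ring
  rw [e1, e2, e3, add_assoc z, neg_neg, zpow_one]
  calc _ = ex (((l : ℂ) + u) ^ 2 / 2) * ex ((l : ℂ) * (l * τ + 2 * z) / 2) *
        (ex (-((γ.1 1 0 : ℤ) * (z + (l * τ + u)) ^ 2 / (2 * cocycle γ τ))) *
          (cocycle γ τ * Theta (γ • τ) ((z + (l * τ + u)) / cocycle γ τ))) := by ring
    _ = (ex (((l : ℂ) + u) ^ 2 / 2) * ex ((l + u) / 2)) * (ex ((l : ℂ) * (l * τ + 2 * z) / 2) *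
        ex (-((l : ℂ) ^ 2 * τ / 2) - l * z)) * Theta τ z := by rw [h1]; ring
    _ = _ := by rw [h3, h4, one_mul, one_mul]

theorem slashInv_Theta : SlashInv (-1) (1 / 2) Theta := fun γ l u τ z _ => slash_Theta γ l u τ z

end Slash

/-! ### Structure of Jacobi forms with poles in the lattice -/

/-- The order of the pole along `z = 0` is bounded. -/
theorem exists_leadAt {φ : ℍ → ℂ → ℂ} (hφ : IsMeromorphic φ) (hp : PolesInLattice φ) :
    ∃ n, ∀ τ, ∃ v, LeadAt φ n τ v := by
  -- The base point i is arbitrary. Near it the denominator is generically z^N times a unit, which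
  -- bounds the pole order at one parameter; connectedness of ℍ spreads the bound.
  obtain ⟨g, h, hg, hh, hne, he⟩ := hφ.quotient UpperHalfPlane.I 0
  have hc : Tendsto (fun s : ℂ => (s, (0 : ℂ))) (𝓝 ((UpperHalfPlane.I : ℍ) : ℂ))
      (𝓝 (((UpperHalfPlane.I : ℍ) : ℂ), (0 : ℂ))) :=
    (by fun_prop : Continuous fun s : ℂ => (s, (0 : ℂ))).tendsto _
  have hpos : ∀ᶠ s in 𝓝 ((UpperHalfPlane.I : ℍ) : ℂ), 0 < s.im :=
    (isOpen_lt continuous_const Complex.continuous_im).mem_nhds UpperHalfPlane.I.im_pos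
  obtain ⟨s, ⟨N, u, hu, hu0, hhu⟩, hs0, hs1, hs2⟩ := ((exists_eq_snd_pow_mul hh hne).and_eventually
    (hpos.and ((hc.eventually hg.eventually_analyticAt).and
      (hc.eventually he.eventually_nhds)))).exists
  refine ⟨N, fun τ => ?_⟩
  have hV : IsPreconnected {s : ℂ | 0 < s.im} := (convex_halfSpace_im_gt 0).isPreconnected
  have hV0 : ∀ s ∈ {s : ℂ | 0 < s.im}, ∀ᶠ p in 𝓝 (s, (0 : ℂ)), p.2 ≠ 0 →
      AnalyticAt ℂ (fun p => p.2 ^ N * uncurried φ p) p := by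
    intro s hs
    filter_upwards [eventually_mem_offLat hs] with p hp1 h0
    obtain ⟨h2, h3⟩ := hp1 h0
    have := hp (ofComplex p.1) p.2 h3
    rw [HolAt, ofComplex_apply_of_im_pos h2] at this
    exact (analyticAt_snd.fun_pow N).fun_mul this
  have hs : ExtendsAt (fun p => p.2 ^ N * uncurried φ p) s := by
    refine ⟨fun p => g p / u p, hs1.fun_div hu hu0, ?_⟩
    filter_upwards [hs2, hhu, hu.continuousAt.eventually_ne hu0] with p h1 h2 h3 h0
    have h4 := pow_ne_zero N h0
    rw [h1 (by rw [h2]; exact mul_ne_zero h4 h3), h2]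
    field_simp
  obtain ⟨G, hG, hG'⟩ := ExtendsAt.of_isPreconnected hV hV0 hs0 hs τ τ.im_pos
  exact ⟨G (τ, 0), G, hG, hG', rfl⟩

theorem not_genericPole {φ : ℍ → ℂ → ℂ} {l u : ℝ}
    (h : ∀ τ : ℍ, AnalyticAt ℂ (φ τ) (l * (τ : ℂ) + u)) : ¬ GenericPole φ l u := by
  intro hg
  have h1 := mem_codiscrete.1 hg UpperHalfPlane.I
  rw [disjoint_principal_right, compl_compl] at h1
  obtain ⟨τ, hτ⟩ := (Filter.nonempty_of_mem h1)
  exact absurd (h τ).meromorphicOrderAt_nonneg (not_le.2 hτ)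

/-! ### The algebra ℂ[℘, ℘', e₄] contains all level one modular forms -/

/-- The algebra generated by `℘`, `℘'` and `e₄`. -/
def wpAlg : Subalgebra ℂ (OffLattice → ℂ) := genAlg {res wp, res wp', res (eis 4)}

theorem res_wp_mem : res wp ∈ wpAlg := Algebra.subset_adjoin (by simp)

theorem res_eis_four_mem : res (eis 4) ∈ wpAlg := Algebra.subset_adjoin (by simp)

theorem res_E_three_eq : res (E 3) = (-1 / 2 : ℂ) • res wp' := by
  funext p
  rw [Pi.smul_apply, res, res, wp'_eq p.2, smul_eq_mul]
  ring

theorem res_E_three_mem : res (E 3) ∈ wpAlg := by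
  rw [res_E_three_eq]
  exact Subalgebra.smul_mem _ (Algebra.subset_adjoin (by simp)) _

theorem res_E_four_eq : res (fun τ _ => ModularForm.E₄ τ) =
    (2 * riemannZeta 4)⁻¹ • res (eis 4) := by
  have : riemannZeta 4 ≠ 0 := riemannZeta_ne_zero_of_one_lt_re (by norm_num)
  funext p
  rw [Pi.smul_apply, res, res, eis_four_eq, smul_eq_mul, inv_mul_cancel_left₀ (by simpa)]

theorem res_E_four_mem : res (fun τ _ => ModularForm.E₄ τ) ∈ wpAlg := by
  rw [res_E_four_eq]
  exact Subalgebra.smul_mem _ res_eis_four_mem _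

theorem WeaklyModular.eq_zero_of_odd {k : ℤ} {f : ℍ → ℂ} (hf : WeaklyModular k f) (hk : Odd k) :
    f = 0 := by
  funext τ
  have h := hf.smul (-1) τ
  have e : cocycle (-1) τ = -1 := by simp [cocycle]
  rw [e, ModularGroup.SL_neg_smul, one_smul, hk.neg_one_zpow, neg_one_mul] at h
  exact self_eq_neg.1 h

theorem WeaklyModular.eq_zero_of_neg {k : ℤ} {f : ℍ → ℂ} (hf : WeaklyModular k f) (hk : k < 0)
    (hm : ModerateAtInfty f) : f = 0 := by
  obtain ⟨F, rfl⟩ := hf.exists_modularForm hm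
  exact ModularFormClass.levelOne_neg_weight_eq_zero hk F

theorem WeaklyModular.eq_const_of_weight_zero {f : ℍ → ℂ} (hf : WeaklyModular 0 f)
    (hm : ModerateAtInfty f) : ∃ c : ℂ, f = fun _ => c := by
  obtain ⟨F, rfl⟩ := hf.exists_modularForm hm
  obtain ⟨c, hc⟩ := ModularFormClass.levelOne_weight_zero_const F
  exact ⟨c, hc⟩

/-- This would be the limit at i∞ of the Weierstrass cubic without its E₆ term, with y = 1/sin²(πu);
three values of y already contradict it. -/
theorem cubic_values_absurd (a b : ℂ)
    (h : ∀ y : ℝ, y = 1 ∨ y = 2 ∨ y = 4 →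
      (y : ℂ) ^ 3 - y ^ 2 = a * (y - 1 / 3) + b * (y - 1 / 3) ^ 3) : False := by
  have h1 := h 1 (by simp)
  have h2 := h 2 (by simp)
  have h4 := h 4 (by simp)
  push_cast at h1 h2 h4
  have : (1 : ℂ) = 0 := by linear_combination (-220 / 9 : ℂ) * h1 + (429 / 36 : ℂ) * h2 - (35 / 36 : ℂ) * h4
  exact one_ne_zero this

/-- The cubic equation expresses `E₆` through `℘`, `℘'` and `E₄`. -/
theorem exists_E_six : ∃ a b c : ℂ, c ≠ 0 ∧ ∀ τ z, z ∉ lattice τ →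
    c * ModularForm.E₆ τ = E 3 τ z ^ 2 - a * ModularForm.E₄ τ * wp τ z - b * wp τ z ^ 3 := by
  have hlead : ∀ τ, ∃ v, LeadAt (fun τ z => E 3 τ z ^ 2) 6 τ v :=
    fun τ => ⟨_, (leadAt_E τ).2.2.pow 2⟩
  have hm : ∀ u : ℝ, 0 < u → u < 1 → ModerateAtInfty fun τ => E 3 τ u ^ 2 := fun u h0 h1 =>
    .of_tendsto ((tendsto_E_real h0 h1).2.pow 2)
  -- The coefficients have weights 6 - 2j and 3 - 2j. The odd ones, the weight two one and the
  -- negative ones vanish, so only E₆, E₄ ℘ and ℘³ remain.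
  obtain ⟨A, B, hA, hB, -, hrep⟩ := (isEll_E_three.pow 2).exists_repr 6 hlead
  obtain ⟨hAm, hBm⟩ := moderateAtInfty_repr hrep hm
  have hA0 : WeaklyModular 6 (A 0) := by simpa using hA 0
  have hA1 : WeaklyModular 4 (A 1) := by simpa using hA 1
  have hA2 : WeaklyModular 2 (A 2) := by simpa using hA 2
  have hA3 : WeaklyModular 0 (A 3) := by simpa using hA 3
  have hB0 : ∀ j, B j = 0 := fun j => (hB j).eq_zero_of_odd ⟨1 - j, by push_cast; ring⟩
  have hA4 : ∀ j ∈ ({4, 5, 6} : Finset ℕ), A j = 0 := fun j hj => by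
    have hj : j = 4 ∨ j = 5 ∨ j = 6 := by simpa using hj
    exact (hA j).eq_zero_of_neg (by push_cast; omega) (hAm j (by omega))
  obtain ⟨c, hc⟩ := exists_smul_of_weight (by norm_num) ModularForm.E₆
    (EisensteinSeries.E_qExpansion_coeff_zero (by norm_num) ⟨3, rfl⟩) hA0 (hAm 0 (by norm_num))
  obtain ⟨a, ha⟩ := exists_smul_of_weight (by norm_num) ModularForm.E₄
    (EisensteinSeries.E_qExpansion_coeff_zero (by norm_num) ⟨2, rfl⟩) hA1 (hAm 1 (by norm_num))
  obtain ⟨b, hb⟩ := hA3.eq_const_of_weight_zero (hAm 3 (by norm_num))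
  have h2 := eq_zero_of_weight_two hA2 (hAm 2 (by norm_num))
  have hfin : ∀ τ z, z ∉ lattice τ → c * ModularForm.E₆ τ =
      E 3 τ z ^ 2 - a * ModularForm.E₄ τ * wp τ z - b * wp τ z ^ 3 := by
    intro τ z hz
    have h := hrep τ z hz
    simp only [Finset.sum_range_succ, Finset.sum_range_zero, hB0, hA4 4 (by simp), hA4 5 (by simp),
      hA4 6 (by simp), h2, hc, ha, hb, Pi.smul_apply, Pi.zero_apply, smul_eq_mul] at h
    rw [h]
    ring
  refine ⟨a, b, c, ?_, hfin⟩
  -- The coefficient of E₆ is nonzero: otherwise the limits at u = 1/2, 1/4, 1/6, where 1/sin²(πu)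
  -- is 1, 2, 4, are contradictory.
  rintro rfl
  have hpi : (Real.pi : ℂ) ≠ 0 := by exact_mod_cast Real.pi_ne_zero
  refine cubic_values_absurd (a / Real.pi ^ 4) b fun y hy => ?_
  obtain ⟨u, hu0, hu1, hs0, hsin⟩ : ∃ u : ℝ, 0 < u ∧ u < 1 ∧ Real.sin (Real.pi * u) ≠ 0 ∧
      y * Real.sin (Real.pi * u) ^ 2 = 1 := by
    rcases hy with rfl | rfl | rfl
    · refine ⟨1 / 2, by norm_num, by norm_num, ?_⟩
      rw [mul_one_div, Real.sin_pi_div_two]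
      norm_num
    · refine ⟨1 / 4, by norm_num, by norm_num, ?_⟩
      rw [mul_one_div, Real.sin_pi_div_four, div_pow, Real.sq_sqrt (by norm_num)]
      norm_num
    · refine ⟨1 / 6, by norm_num, by norm_num, ?_⟩
      rw [mul_one_div, Real.sin_pi_div_six]
      norm_num
  have hs0' : Complex.sin (Real.pi * u) ≠ 0 := by exact_mod_cast hs0
  have hsin' : (y : ℂ) * Complex.sin (Real.pi * u) ^ 2 = 1 := by exact_mod_cast hsin
  have hcos := Complex.sin_sq_add_cos_sq (Real.pi * u : ℂ)
  have hw := tendsto_wp_real hu0 hu1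
  have hlim := (((tendsto_E_real hu0 hu1).2.pow 2).sub ((tendsto_E_four.const_mul a).mul hw)).sub
    ((hw.pow 3).const_mul b)
  have h0 := tendsto_nhds_unique hlim ((tendsto_const_nhds (x := (0 : ℂ))).congr fun τ => by
    rw [← hfin τ u (ofReal_notMem_lattice hu0 hu1 τ), zero_mul])
  set s := Complex.sin (Real.pi * u)
  set t := Complex.cos (Real.pi * u)
  have hy' : (y : ℂ) = 1 / s ^ 2 := by field_simp; exact hsin'
  have ht : t ^ 2 = 1 - s ^ 2 := by linear_combination hcos
  have e1 : (Real.pi ^ 3 * t / s ^ 3 : ℂ) ^ 2 = Real.pi ^ 6 * ((1 / s ^ 2) ^ 3 - (1 / s ^ 2) ^ 2) := by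
    rw [div_pow, mul_pow, ht]
    field_simp
  rw [e1, ← hy'] at h0
  have e2 : (Real.pi ^ 2 / s ^ 2 - Real.pi ^ 2 / 3 : ℂ) = Real.pi ^ 2 * (y - 1 / 3) := by
    rw [hy']
    ring
  rw [e2] at h0
  have h6 : (Real.pi : ℂ) ^ 6 ≠ 0 := pow_ne_zero 6 hpi
  refine mul_left_cancel₀ h6 ?_
  have ea : a = a / Real.pi ^ 4 * Real.pi ^ 4 := by field_simp
  linear_combination h0 + (y - 1 / 3) * Real.pi ^ 2 * ea

theorem res_E_six_mem : res (fun τ _ => ModularForm.E₆ τ) ∈ wpAlg := by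
  obtain ⟨a, b, c, hc, h⟩ := exists_E_six
  have : res (fun τ _ => ModularForm.E₆ τ) = c⁻¹ • (res (E 3) ^ 2 -
      a • (res (fun τ _ => ModularForm.E₄ τ) * res wp) - b • res wp ^ 3) := by
    funext p
    have := h p.1.1 p.1.2 p.2
    simp only [Pi.smul_apply, Pi.sub_apply, Pi.mul_apply, Pi.pow_apply, smul_eq_mul, res]
    rw [eq_inv_mul_iff_mul_eq₀ hc, this]
    ring
  rw [this]
  exact Subalgebra.smul_mem _ (sub_mem (sub_mem (pow_mem res_E_three_mem 2)
    (Subalgebra.smul_mem _ (mul_mem res_E_four_mem res_wp_mem) _))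
    (Subalgebra.smul_mem _ (pow_mem res_wp_mem 3) _)) _

theorem res_mem_of_eisAlg {f : ℍ → ℂ} (hf : f ∈ eisAlg) : res (fun τ _ => f τ) ∈ wpAlg := by
  induction hf using Algebra.adjoin_induction with
  | mem f hf =>
    rcases hf with rfl | rfl
    · exact res_E_four_mem
    · exact res_E_six_mem
  | algebraMap c => exact Subalgebra.algebraMap_mem wpAlg c
  | add f g _ _ hf hg => exact add_mem hf hg
  | mul f g _ _ hf hg => exact mul_mem hf hg

theorem res_mem_of_weaklyModular {k : ℤ} {f : ℍ → ℂ} (hf : WeaklyModular k f)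
    (hm : ModerateAtInfty f) : res (fun τ _ => f τ) ∈ wpAlg := by
  obtain ⟨F, rfl⟩ := hf.exists_modularForm hm
  exact res_mem_of_eisAlg (mem_eisAlg_of_modularForm (k.toNat + 1) k (by omega) F)

/-- Elliptic functions of moderate growth with poles in the lattice. -/
theorem IsEll.res_mem {k : ℤ} {ψ : ℍ → ℂ → ℂ} (h : IsEll k ψ) {n : ℕ}
    (hl : ∀ τ, ∃ v, LeadAt ψ n τ v)
    (hm : ∀ u : ℝ, 0 < u → u < 1 → ModerateAtInfty fun τ => ψ τ u) : res ψ ∈ wpAlg := by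
  obtain ⟨A, B, hA, hB, -, hrep⟩ := h.exists_repr n hl
  obtain ⟨hAm, hBm⟩ := moderateAtInfty_repr hrep hm
  have : res ψ = ∑ j ∈ Finset.range (n + 1), res (fun τ _ => A j τ) * res wp ^ j +
      res (E 3) * ∑ j ∈ Finset.range (n + 1), res (fun τ _ => B j τ) * res wp ^ j := by
    funext p
    simp only [Pi.add_apply, Pi.mul_apply, Finset.sum_apply, Pi.pow_apply, res]
    exact hrep p.1.1 p.1.2 p.2
  rw [this]
  exact add_mem (sum_mem fun j hj => mul_mem (res_mem_of_weaklyModular (hA j)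
      (hAm j (Finset.mem_range.1 hj))) (pow_mem res_wp_mem j))
    (mul_mem res_E_three_mem (sum_mem fun j hj => mul_mem (res_mem_of_weaklyModular (hB j)
      (hBm j (Finset.mem_range.1 hj))) (pow_mem res_wp_mem j)))

/-- Jacobi forms of index `N / 2` with poles in the lattice. -/
theorem exists_eq_mul_Theta_pow {N : ℕ} {k : ℤ} {φ : ℍ → ℂ → ℂ}
    (hl : ∃ n, ∀ τ, ∃ v, LeadAt φ n τ v)
    (hp : PolesInLattice φ) (hs : SlashInv k ((N : ℚ) / 2) φ)
    (hm : ∀ u : ℝ, 0 < u → u < 1 → ModerateAtInfty fun τ => φ τ u) :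
    ∃ P ∈ wpAlg, res φ = P * res Theta ^ N := by
  set ψ : ℍ → ℂ → ℂ := fun τ z => φ τ z * (Theta τ z)⁻¹ ^ N with hψ
  have hinv : SlashInv (k + N) 0 ψ := by
    have := hs.mul (slashInv_Theta.inv.pow N)
    convert this using 1 <;> push_cast <;> ring
  have hhol : PolesInLattice ψ := fun τ z hz => (hp τ z hz).mul <| HolAt.pow (φ := fun τ z => (Theta τ z)⁻¹)
    (AnalyticAt.fun_inv (holAt_Theta τ z) (by simpa using Theta_ne_zero hz)) N
  obtain ⟨n, hn⟩ := hl
  refine ⟨res ψ, (hinv.isEll hhol).res_mem (n := n + 1 * N) (fun τ => ?_) fun u h0 h1 => ?_, ?_⟩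
  · obtain ⟨v, hv⟩ := hn τ
    obtain ⟨w, hw⟩ := leadAt_Theta_inv τ
    exact ⟨_, hv.mul (hw.pow N)⟩
  · have hsin := sin_pi_mul_ne_zero (ofReal_mem_integerComplement h0 h1)
    have h2 := tendsto_at_real (l := 0) (u := u) (by simpa using tendsto_Theta_joint (u : ℂ))
    simp only [Complex.ofReal_zero, zero_mul, zero_add] at h2
    exact (hm u h0 h1).mul (.of_tendsto ((h2.inv₀ (by simpa using hsin)).pow N))
  · funext p
    have := pow_ne_zero N (Theta_ne_zero p.2)
    simp only [Pi.mul_apply, Pi.pow_apply, res, hψ]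
    rw [mul_assoc, inv_pow, inv_mul_cancel₀ this, mul_one]

theorem JacobiForms.IsJacobi.slashInv {T : (ℍ → ℂ → ℂ) → Prop} {k : ℤ} {m : ℚ} {φ : ℍ → ℂ → ℂ}
    (h : IsJacobi T k m φ) : SlashInv k m φ := fun γ l u τ z _ => by rw [h.2]

theorem WeakStrictlyMer.moderateAtInfty {φ : ℍ → ℂ → ℂ} (h : WeakStrictlyMer φ)
    (hp : PolesInLattice φ) (u : ℝ) (h0 : 0 < u) (h1 : u < 1) :
    ModerateAtInfty fun τ => φ τ u := by
  refine (h.2.2 u).resolve_left (not_genericPole fun τ => ?_)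
  simpa using HolAt.along_snd (hp τ u (ofReal_notMem_lattice h0 h1 τ))

/-! ### Functions with tame singularities and growth -/

/-- The shift of `φ` by `lτ + u`. -/
def shift (l u : ℤ) (φ : ℍ → ℂ → ℂ) : ℍ → ℂ → ℂ := fun τ z => φ τ (z + (l * τ + u))

/-- Moderate growth of `φ(γτ, (lτ + w) / (cτ + d))` for `w` near `w₀`. -/
def GrowthAt (γ : Matrix.SpecialLinearGroup (Fin 2) ℤ) (l : ℝ) (w₀ : ℂ) (φ : ℍ → ℂ → ℂ) : Prop :=
  ∀ A, ModerateAlong (stripFilter A ×ˢ 𝓝 w₀) (fun p => p.1.im)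
    (fun p => φ (γ • p.1) ((l * p.1 + p.2) / cocycle γ p.1))

/-- Functions holomorphic off the lattice, with poles of bounded order at the lattice points, of
moderate growth at the cusps and along the lines given by `S`. -/
structure Tame (S : Set (Matrix.SpecialLinearGroup (Fin 2) ℤ × ℝ)) (φ : ℍ → ℂ → ℂ) : Prop where
  hol : PolesInLattice φ
  lead : ∀ l u : ℤ, ∃ n, ∀ τ, ∃ v, LeadAt (shift l u φ) n τ v
  growth : ∀ γ l, (γ, l) ∈ S → ∀ w₀ ∈ cuspDomain (Int.fract l), GrowthAt γ l w₀ φ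

section Tame

variable {S : Set (Matrix.SpecialLinearGroup (Fin 2) ℤ × ℝ)} {φ ψ : ℍ → ℂ → ℂ}

theorem eventually_fst_im_nonneg {A : ℝ} {w₀ : ℂ} :
    ∀ᶠ p : ℍ × ℂ in stripFilter A ×ˢ 𝓝 w₀, 0 ≤ p.1.im := .of_forall fun p => p.1.im_pos.le

theorem Tame.mul (h : Tame S φ) (h' : Tame S ψ) : Tame S (fun τ z => φ τ z * ψ τ z) where
  hol τ z hz := (h.hol τ z hz).mul (h'.hol τ z hz)
  lead l u := by
    obtain ⟨n, hn⟩ := h.lead l u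
    obtain ⟨m, hm⟩ := h'.lead l u
    exact ⟨n + m, fun τ => ⟨_, (hn τ).choose_spec.mul (hm τ).choose_spec⟩⟩
  growth γ l hS w₀ hw A := (h.growth γ l hS w₀ hw A).mul (h'.growth γ l hS w₀ hw A)

theorem Tame.add (h : Tame S φ) (h' : Tame S ψ) : Tame S (fun τ z => φ τ z + ψ τ z) where
  hol τ z hz := (h.hol τ z hz).add (h'.hol τ z hz)
  lead l u := by
    obtain ⟨n, hn⟩ := h.lead l u
    obtain ⟨m, hm⟩ := h'.lead l u
    exact ⟨max n m, fun τ => ⟨_, (LeadAt.mono (hn τ) (le_max_left n m)).choose_spec.add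
      (LeadAt.mono (hm τ) (le_max_right n m)).choose_spec⟩⟩
  growth γ l hS w₀ hw A := (h.growth γ l hS w₀ hw A).add (h'.growth γ l hS w₀ hw A)

theorem Tame.const (c : ℂ) : Tame S (fun _ _ => c) where
  hol _ _ _ := HolAt.const c _ _
  lead _ _ := ⟨0, fun τ => ⟨_, LeadAt.of_holAt (HolAt.const c τ 0)⟩⟩
  growth _ _ _ _ _ _ := .const eventually_fst_im_nonneg c

theorem Tame.sub (h : Tame S φ) (h' : Tame S ψ) : Tame S (fun τ z => φ τ z - ψ τ z) := by
  have := h.add ((Tame.const (-1)).mul h')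
  simpa only [neg_one_mul, ← sub_eq_add_neg] using this

/-- In a strip |τ| grows only linearly in Im τ. Powers of cτ + d and the anomalies in the
transformation laws are therefore harmless. -/
theorem moderateAlong_coe (A : ℝ) (w₀ : ℂ) :
    ModerateAlong (stripFilter A ×ˢ 𝓝 w₀) (fun p => p.1.im) (fun p => (p.1 : ℂ)) := by
  intro C hC
  refine Asymptotics.IsBigO.of_bound (|A| + C⁻¹) ?_
  have h1 : ∀ᶠ p : ℍ × ℂ in stripFilter A ×ˢ 𝓝 w₀, |p.1.re| ≤ A :=
    tendsto_fst.eventually (eventually_inf_principal.2 (.of_forall fun _ h => h))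
  filter_upwards [h1] with p hp
  have h2 := Complex.norm_le_abs_re_add_abs_im (p.1 : ℂ)
  have h3 := Real.add_one_le_exp (C * p.1.im)
  have h4 := p.1.im_pos
  have h5 : 1 ≤ Real.exp (C * p.1.im) := Real.one_le_exp (by positivity)
  have h6 : p.1.im ≤ C⁻¹ * Real.exp (C * p.1.im) := by
    rw [← div_eq_inv_mul, le_div_iff₀ hC]
    linarith
  have h7 : |(p.1 : ℂ).im| = p.1.im := abs_of_pos h4
  have h8 : |(p.1 : ℂ).re| ≤ A := hp
  rw [Real.norm_eq_abs, Real.abs_exp]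
  calc ‖(p.1 : ℂ)‖ ≤ A + p.1.im := by linarith
    _ ≤ |A| * Real.exp (C * p.1.im) + C⁻¹ * Real.exp (C * p.1.im) :=
        add_le_add ((le_abs_self A).trans (le_mul_of_one_le_right (abs_nonneg A) h5)) h6
    _ = _ := by ring

theorem moderateAlong_cocycle (γ : Matrix.SpecialLinearGroup (Fin 2) ℤ) (A : ℝ) (w₀ : ℂ) :
    ModerateAlong (stripFilter A ×ˢ 𝓝 w₀) (fun p => p.1.im) (fun p => cocycle γ p.1) :=
  ((ModerateAlong.const eventually_fst_im_nonneg _).mul (moderateAlong_coe A w₀)).add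
    (.const eventually_fst_im_nonneg _)

theorem moderateAlong_snd (A : ℝ) (w₀ : ℂ) :
    ModerateAlong (stripFilter A ×ˢ 𝓝 w₀) (fun p => p.1.im) (fun p => p.2) :=
  .of_tendsto eventually_fst_im_nonneg tendsto_snd

theorem eventually_notMem_lattice_cusp {l : ℝ} {w₀ : ℂ} (hw : w₀ ∈ cuspDomain (Int.fract l)) :
    ∀ᶠ p : ℍ × ℂ in atImInfty ×ˢ 𝓝 w₀, (Int.fract l * p.1 + p.2 : ℂ) ∉ lattice p.1 := by
  have h1 := eventually_add_notMem_lattice (Int.fract_nonneg l) (Int.fract_lt_one l) (|w₀.im| + 1)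
  have h2 : ∀ᶠ w in 𝓝 w₀, |w.im| < |w₀.im| + 1 :=
    (Complex.continuous_im.abs.tendsto w₀).eventually_lt_const (by linarith)
  filter_upwards [(h1.prod_inl (𝓝 w₀)), ((h2.and ((isOpen_cuspDomain _).mem_nhds hw)).prod_inr
    atImInfty)] with p hp hp2
  exact hp _ hp2.2 hp2.1

theorem strip_prod_le (A : ℝ) (w₀ : ℂ) : stripFilter A ×ˢ 𝓝 w₀ ≤ atImInfty ×ˢ 𝓝 w₀ :=
  Filter.prod_mono (stripFilter_le A) le_rfl

/-- Reduces an arbitrary real slope to the range [0, 1) covered by the limit formulas. -/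
theorem coe_fract_add_floor (l : ℝ) (τ : ℍ) (w : ℂ) :
    (l * τ + w : ℂ) = Int.fract l * τ + w + (⌊l⌋ * τ + (0 : ℤ)) := by
  have : (l : ℂ) = (⌊l⌋ : ℂ) + ((Int.fract l : ℝ) : ℂ) := by
    exact_mod_cast (Int.floor_add_fract l).symm
  rw [this]
  push_cast
  ring

theorem tame_E_one : Tame S (E 1) where
  hol _ _ hz := holAt_E_one hz
  lead l u := ⟨1, fun τ => ⟨_, ((leadAt_E τ).1.add (LeadAt.of_holAt
    (HolAt.const (-(2 * Real.pi * I * l)) τ 0)).succ).congr fun τ z hz => by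
      rw [shift, E_one_lattice hz, sub_eq_add_neg]⟩⟩
  growth γ l _ w₀ hw A := by
    have h1 := ModerateAlong.of_tendsto (eventually_fst_im_nonneg (A := A)) <|
      (tendsto_E_one_joint (Int.fract_nonneg l) (Int.fract_lt_one l) hw).mono_left
        (strip_prod_le A w₀)
    have hc := fun c => ModerateAlong.const (eventually_fst_im_nonneg (A := A) (w₀ := w₀)) c
    refine (((moderateAlong_cocycle γ A w₀).mul (h1.sub (hc (2 * Real.pi * I * ⌊l⌋)))).add
      ((hc (2 * Real.pi * I * (γ.1 1 0 : ℤ))).mul (((hc l).mul (moderateAlong_coe A w₀)).add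
        (moderateAlong_snd A w₀)))).congr ?_
    filter_upwards [(eventually_notMem_lattice_cusp hw).filter_mono (strip_prod_le A w₀)] with p hp
    have hp' := (add_mem_lattice_iff (int_mem_lattice p.1 ⌊l⌋ 0)).not.2 hp
    rw [← coe_fract_add_floor] at hp'
    have h2 := E_one_lattice hp ⌊l⌋ 0
    rw [← coe_fract_add_floor] at h2
    rw [E_one_smul γ hp', h2]

theorem tame_E_two : Tame S (E 2) where
  hol _ _ hz := holAt_E_two hz
  lead l u := ⟨2, fun τ => ⟨_, (leadAt_E τ).2.1.congr fun τ z hz => by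
      rw [shift, E_two_lattice hz]⟩⟩
  growth γ l _ w₀ hw A := by
    have h1 := ModerateAlong.of_tendsto (eventually_fst_im_nonneg (A := A)) <|
      (tendsto_E_joint (Int.fract_nonneg l) (Int.fract_lt_one l) hw).1.mono_left
        (strip_prod_le A w₀)
    have hc := fun c => ModerateAlong.const (eventually_fst_im_nonneg (A := A) (w₀ := w₀)) c
    have hJ := moderateAlong_cocycle γ A w₀
    refine (((hJ.pow eventually_fst_im_nonneg 2).mul h1).sub
      ((hc (2 * Real.pi * I * (γ.1 1 0 : ℤ))).mul hJ)).congr ?_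
    filter_upwards [(eventually_notMem_lattice_cusp hw).filter_mono (strip_prod_le A w₀)] with p hp
    have hp' := (add_mem_lattice_iff (int_mem_lattice p.1 ⌊l⌋ 0)).not.2 hp
    rw [← coe_fract_add_floor] at hp'
    rw [E_two_smul γ hp', coe_fract_add_floor l p.1 p.2, E_two_lattice hp]

theorem tame_E_three : Tame S (E 3) where
  hol _ _ hz := holAt_E_three hz
  lead l u := ⟨3, fun τ => ⟨_, (leadAt_E τ).2.2.congr fun τ z hz => by
      rw [shift, E_three_lattice hz]⟩⟩
  growth γ l _ w₀ hw A := by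
    have h1 := ModerateAlong.of_tendsto (eventually_fst_im_nonneg (A := A)) <|
      (tendsto_E_joint (Int.fract_nonneg l) (Int.fract_lt_one l) hw).2.mono_left
        (strip_prod_le A w₀)
    have hJ := moderateAlong_cocycle γ A w₀
    refine ((hJ.pow eventually_fst_im_nonneg 3).mul h1).congr ?_
    filter_upwards [(eventually_notMem_lattice_cusp hw).filter_mono (strip_prod_le A w₀)] with p hp
    have hp' := (add_mem_lattice_iff (int_mem_lattice p.1 ⌊l⌋ 0)).not.2 hp
    rw [← coe_fract_add_floor] at hp'
    rw [E_three_smul γ hp', coe_fract_add_floor l p.1 p.2, E_three_lattice hp]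

theorem tame_eis_two : Tame S (eis 2) where
  hol τ z _ := holAt_eis_two τ z
  lead l u := ⟨0, fun τ => ⟨_, (LeadAt.of_holAt (holAt_eis_two τ 0)).congr fun τ z hz => by
      rw [shift, eis_two_eq, eis_two_eq]⟩⟩
  growth γ l _ w₀ hw A := by
    have h1 := ModerateAlong.of_tendsto (eventually_fst_im_nonneg (A := A) (w₀ := w₀)) <|
      (tendsto_G2.comp tendsto_fst).mono_left (strip_prod_le A w₀)
    have hc := fun c => ModerateAlong.const (eventually_fst_im_nonneg (A := A) (w₀ := w₀)) c
    have hJ := moderateAlong_cocycle γ A w₀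
    refine (((hJ.pow eventually_fst_im_nonneg 2).mul h1).sub
      ((hc (2 * Real.pi * I * (γ.1 1 0 : ℤ))).mul hJ)).congr (.of_forall fun p => ?_)
    simp only [Function.comp_apply]
    rw [eis_two_smul γ p.1 _ 0, eis_two_eq]

theorem tame_eis_four : Tame S (eis 4) where
  hol τ z _ := holAt_eis_four τ z
  lead l u := ⟨0, fun τ => ⟨_, (LeadAt.of_holAt (holAt_eis_four τ 0)).congr fun τ z hz => by
      rw [shift, eis_four_eq, eis_four_eq]⟩⟩
  growth γ l _ w₀ hw A := by
    have h1 := ModerateAlong.of_tendsto (eventually_fst_im_nonneg (A := A) (w₀ := w₀)) <|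
      ((tendsto_E_four.const_mul (2 * riemannZeta 4)).comp tendsto_fst).mono_left
        (strip_prod_le A w₀)
    have hJ := moderateAlong_cocycle γ A w₀
    refine ((hJ.pow eventually_fst_im_nonneg 4).mul h1).congr (.of_forall fun p => ?_)
    simp only [Function.comp_apply]
    rw [eis_four_smul γ p.1 _ 0, eis_four_eq]

/-- Along lines of slope l ≠ 0 the function Θ grows exponentially, so growth is only claimed for the
pair that the weak condition uses. -/
theorem tame_Theta : Tame {(1, 0)} Theta where
  hol τ z _ := holAt_Theta τ z
  lead l u := ⟨0, fun τ => ⟨_, LeadAt.of_holAt (φ := shift l u Theta) (by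
    have h1 : ∀ z, shift l u Theta τ z = Theta τ (z + (l * τ + u)) := fun z => rfl
    have h2 : HolAt (fun τ z => ex ((l + u) / 2) * ex (-((l : ℂ) ^ 2 * τ / 2) - l * z) * Theta τ z)
        τ 0 := by
      refine ((HolAt.const _ τ 0).mul (HolAt.comp differentiable_ex ?_)).mul (holAt_Theta τ 0)
      exact (((HolAt.const _ τ 0).mul (HolAt.fst τ 0)).div (HolAt.const 2 τ 0) two_ne_zero).neg.sub
        ((HolAt.const _ τ 0).mul (HolAt.snd τ 0))
    refine h2.congr (.of_forall fun p => ?_)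
    simp only [shift]
    rw [theta_lattice])⟩⟩
  growth γ l hS w₀ hw A := by
    obtain ⟨rfl, rfl⟩ : γ = 1 ∧ l = 0 := by simpa using hS
    refine (ModerateAlong.of_tendsto (eventually_fst_im_nonneg (A := A) (w₀ := w₀)) <|
      (tendsto_Theta_joint w₀).mono_left (strip_prod_le A w₀)).congr (.of_forall fun p => ?_)
    simp [cocycle]

end Tame

/-! ### Holomorphic extension across the lattice -/

/-- `φ`, restricted to the complement of the lattice, extends holomorphically to `(τ, z)`. -/
def HolExt (φ : ℍ → ℂ → ℂ) (τ : ℍ) (z : ℂ) : Prop :=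
  ∃ G : ℂ × ℂ → ℂ, AnalyticAt ℂ G ((τ : ℂ), z) ∧
    ∀ᶠ p in 𝓝 ((τ : ℂ), z), p.2 ∉ lattice (ofComplex p.1) → G p = φ (ofComplex p.1) p.2

open Classical in
/-- The normalized representative of a function given off the lattice: the value of the holomorphic
extension where it exists, and zero elsewhere. -/
noncomputable def holExtend (φ : ℍ → ℂ → ℂ) : ℍ → ℂ → ℂ := fun τ z =>
  if h : HolExt φ τ z then h.choose ((τ : ℂ), z) else 0

section HolExt

variable {φ ψ : ℍ → ℂ → ℂ} {τ : ℍ} {z : ℂ}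

theorem frequently_notMem_lattice₂ (τ : ℍ) (z : ℂ) :
    ∃ᶠ p in 𝓝 ((τ : ℂ), z), p.2 ∉ lattice (ofComplex p.1) := by
  have h1 : ∃ᶠ w in 𝓝 z, w ∉ lattice τ := mem_closure_iff_frequently.1 (dense_compl_lattice τ z)
  have h2 : Tendsto (fun w : ℂ => ((τ : ℂ), w)) (𝓝 z) (𝓝 ((τ : ℂ), z)) :=
    (by fun_prop : Continuous fun w : ℂ => ((τ : ℂ), w)).tendsto z
  refine h2.frequently (h1.mono fun w hw => ?_)
  simpa using hw

theorem eq_of_eventually_offLattice {F G : ℂ × ℂ → ℂ} (hF : ContinuousAt F ((τ : ℂ), z))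
    (hG : ContinuousAt G ((τ : ℂ), z))
    (h : ∀ᶠ p in 𝓝 ((τ : ℂ), z), p.2 ∉ lattice (ofComplex p.1) → F p = G p) :
    F ((τ : ℂ), z) = G ((τ : ℂ), z) := by
  have : (𝓝 ((τ : ℂ), z) ⊓ 𝓟 {p : ℂ × ℂ | p.2 ∉ lattice (ofComplex p.1)}).NeBot :=
    frequently_iff_neBot.1 (frequently_notMem_lattice₂ τ z)
  have key : F =ᶠ[𝓝 ((τ : ℂ), z) ⊓ 𝓟 {p : ℂ × ℂ | p.2 ∉ lattice (ofComplex p.1)}] G :=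
    eventually_inf_principal.2 h
  exact tendsto_nhds_unique_of_eventuallyEq (hF.mono_left inf_le_left) (hG.mono_left inf_le_left)
    key

/-- The chosen extension is irrelevant, since any two agree on the complement of the lattice, which
is dense. -/
theorem holExtend_eq {G : ℂ × ℂ → ℂ} (hG : AnalyticAt ℂ G ((τ : ℂ), z))
    (h : ∀ᶠ p in 𝓝 ((τ : ℂ), z), p.2 ∉ lattice (ofComplex p.1) → G p = φ (ofComplex p.1) p.2) :
    holExtend φ τ z = G ((τ : ℂ), z) := by
  have hext : HolExt φ τ z := ⟨G, hG, h⟩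
  rw [holExtend, dif_pos hext]
  refine eq_of_eventually_offLattice hext.choose_spec.1.continuousAt hG.continuousAt ?_
  filter_upwards [h, hext.choose_spec.2] with p hp hp' hl
  rw [hp hl, hp' hl]

theorem holExtend_of_notMem (hφ : PolesInLattice φ) (hz : z ∉ lattice τ) :
    holExtend φ τ z = φ τ z := by
  rw [holExtend_eq (hφ τ z hz) (.of_forall fun p _ => rfl), uncurried_coe]

theorem HolExt.holAt (h : HolExt φ τ z) : HolAt (holExtend φ) τ z := by
  obtain ⟨G, hG, he⟩ := h
  refine hG.congr ?_
  filter_upwards [hG.eventually_analyticAt, he.eventually_nhds, eventually_imPos] with p hp hp' h0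
  have e : ((ofComplex p.1 : ℍ) : ℂ) = p.1 := by rw [ofComplex_apply_of_im_pos h0]
  rw [uncurried, holExtend_eq (G := G)] <;> rw [e]
  · exact hp
  · exact hp'

theorem holAt_holExtend_iff (hφ : PolesInLattice φ) : HolAt (holExtend φ) τ z ↔ HolExt φ τ z := by
  refine ⟨fun h => ⟨_, h, .of_forall fun p hp => ?_⟩, HolExt.holAt⟩
  exact holExtend_of_notMem hφ hp

theorem HolExt.of_notMem (hφ : PolesInLattice φ) (hz : z ∉ lattice τ) : HolExt φ τ z :=
  ⟨_, hφ τ z hz, .of_forall fun _ _ => rfl⟩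

theorem polesInLattice_holExtend (hφ : PolesInLattice φ) : PolesInLattice (holExtend φ) :=
  fun _ _ hz => (HolExt.of_notMem hφ hz).holAt

theorem res_holExtend (hφ : PolesInLattice φ) : res (holExtend φ) = res φ := by
  funext p
  exact holExtend_of_notMem hφ p.2

theorem tendsto_sub_lattice (τ : ℍ) (l u : ℤ) :
    Tendsto (fun p : ℂ × ℂ => (p.1, p.2 - (l * p.1 + u))) (𝓝 ((τ : ℂ), l * τ + u))
      (𝓝 ((τ : ℂ), (0 : ℂ))) := by
  have : Continuous fun p : ℂ × ℂ => (p.1, p.2 - (l * p.1 + u)) := by fun_prop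
  simpa using this.tendsto ((τ : ℂ), l * τ + u)

theorem LeadAt.exists_mul_eq {n : ℕ} {v : ℂ} {l u : ℤ} (h : LeadAt (shift l u φ) n τ v) :
    ∃ G : ℂ × ℂ → ℂ, AnalyticAt ℂ G ((τ : ℂ), l * τ + u) ∧ G ((τ : ℂ), l * τ + u) = v ∧
      ∀ᶠ p : ℂ × ℂ in 𝓝 ((τ : ℂ), (l * τ + u : ℂ)), p.2 ≠ l * p.1 + u →
        G p = (p.2 - (l * p.1 + u)) ^ n * φ (ofComplex p.1) p.2 := by
  obtain ⟨G, hG, h1, h2⟩ := h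
  refine ⟨fun p => G (p.1, p.2 - (l * p.1 + u)), ?_, by simpa using h2, ?_⟩
  · refine AnalyticAt.fun_comp_of_eq (f := fun p : ℂ × ℂ => (p.1, p.2 - (l * p.1 + u))) hG ?_ (by simp)
    exact analyticAt_fst.prod (analyticAt_snd.fun_sub
      ((analyticAt_const.fun_mul analyticAt_fst).fun_add analyticAt_const))
  · filter_upwards [(tendsto_sub_lattice τ l u).eventually h1, eventually_imPos] with p hp h0 hne
    have e : ((ofComplex p.1 : ℍ) : ℂ) = p.1 := by rw [ofComplex_apply_of_im_pos h0]
    rw [hp (sub_ne_zero.2 hne), shift, e, sub_add_cancel]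

theorem LeadAt.holExt {v : ℂ} {l u : ℤ} (h : LeadAt (shift l u φ) 0 τ v) :
    HolExt φ τ (l * τ + u) := by
  obtain ⟨G, hG, -, h1⟩ := h.exists_mul_eq
  refine ⟨G, hG, ?_⟩
  filter_upwards [h1, eventually_imPos] with p hp h0 hl
  rw [hp, pow_zero, one_mul]
  rintro h
  refine hl ⟨l, u, ?_⟩
  rw [h, ofComplex_apply_of_im_pos h0]

theorem eventually_eq_lattice {τ : ℍ} (l u : ℤ) :
    ∀ᶠ p : ℂ × ℂ in 𝓝 ((τ : ℂ), (l * τ + u : ℂ)), p.2 ≠ l * p.1 + u → p.2 ∉ lattice (ofComplex p.1) := by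
  filter_upwards [(tendsto_sub_lattice τ l u).eventually (eventually_offLat₂ τ), eventually_imPos]
    with p hp h0 hne
  have h1 := (hp (sub_ne_zero.2 hne)).2
  have e : ((ofComplex p.1 : ℍ) : ℂ) = p.1 := by rw [ofComplex_apply_of_im_pos h0]
  have h2 := int_mem_lattice (ofComplex p.1) l u
  rw [e] at h2
  rwa [← add_mem_lattice_iff h2, sub_add_cancel] at h1

theorem isMeromorphic_holExtend (hφ : PolesInLattice φ)
    (hl : ∀ l u : ℤ, ∃ n, ∀ τ, ∃ v, LeadAt (shift l u φ) n τ v) :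
    IsMeromorphic (holExtend φ) where
  quotient τ z := by
    by_cases hz : z ∈ lattice τ
    · obtain ⟨l, u, rfl⟩ := hz
      obtain ⟨n, hn⟩ := hl l u
      -- The exponent is raised by one so that the denominator vanishes on the polar line even when
      -- n = 0; no value there has to be compared.
      obtain ⟨G, hG, -, h1⟩ := (hn τ).choose_spec.succ.exists_mul_eq
      have hh : AnalyticAt ℂ (fun p : ℂ × ℂ => (p.2 - (l * p.1 + u)) ^ (n + 1))
          ((τ : ℂ), l * τ + u) := (analyticAt_snd.fun_sub
            ((analyticAt_const.fun_mul analyticAt_fst).fun_add analyticAt_const)).fun_pow _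
      refine ⟨G, _, hG, hh, ?_, ?_⟩
      · refine ((frequently_notMem_lattice₂ τ (l * τ + u)).and_eventually
          eventually_imPos).mono ?_
        rintro p ⟨hp, h0⟩
        refine pow_ne_zero _ (sub_ne_zero.2 fun h => hp ⟨l, u, ?_⟩)
        rw [h, ofComplex_apply_of_im_pos h0]
      · filter_upwards [h1, eventually_eq_lattice l u] with p hp hp2 hne
        have hne' : p.2 ≠ l * p.1 + u := fun h => hne (by rw [h, sub_self, zero_pow n.succ_ne_zero])
        rw [hp hne', uncurried, holExtend_of_notMem hφ (hp2 hne'), mul_div_cancel_left₀ _ hne]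
    · exact ⟨_, 1, polesInLattice_holExtend hφ τ z hz, analyticAt_const,
        (Filter.Eventually.of_forall fun p => one_ne_zero).frequently,
        .of_forall fun p _ => by simp⟩
  removable τ z := by
    rintro ⟨g, h, hg, hh, hne, he⟩
    refine (holAt_holExtend_iff hφ).2 ⟨g, hg, ?_⟩
    obtain ⟨U, hU, hUo, hUτ⟩ := eventually_nhds_iff.1 (hg.eventually_analyticAt.and
      (hh.eventually_analyticAt.and (he.and eventually_imPos)))
    obtain ⟨ε, hε, hball⟩ := Metric.isOpen_iff.1 hUo _ hUτ
    filter_upwards [Metric.ball_mem_nhds _ hε] with p hp hl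
    have hp' := hU p (hball hp)
    -- By the identity theorem the denominator is not locally zero anywhere in the ball, so `g` and
    -- φ can be compared by continuity.
    have hfreq : ∃ᶠ q in 𝓝 p, h q ≠ 0 := by
      intro hev
      refine hne ?_
      have hev' : h =ᶠ[𝓝 p] 0 := hev.mono fun q hq => not_not.1 hq
      have := AnalyticOnNhd.eqOn_zero_of_preconnected_of_eventuallyEq_zero
        (f := h) (U := Metric.ball ((τ : ℂ), z) ε) (fun q hq => (hU q (hball hq)).2.1)
        (convex_ball _ _).isPreconnected hp hev'
      filter_upwards [Metric.ball_mem_nhds _ hε] with q hq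
      exact not_not.2 (this hq)
    have hφp : AnalyticAt ℂ (uncurried φ) p := by
      have := hφ _ _ hl
      rwa [HolAt, ofComplex_apply_of_im_pos hp'.2.2.2] at this
    have : (𝓝 p ⊓ 𝓟 {q | h q ≠ 0}).NeBot := frequently_iff_neBot.1 hfreq
    suffices key : g =ᶠ[𝓝 p ⊓ 𝓟 {q | h q ≠ 0}] uncurried φ by
      exact tendsto_nhds_unique_of_eventuallyEq (hp'.1.continuousAt.mono_left inf_le_left)
        (hφp.continuousAt.mono_left inf_le_left) key
    refine eventually_inf_principal.2 ?_
    have hoff : ∀ᶠ q in 𝓝 p, q.2 ∉ lattice (ofComplex q.1) := by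
      have := eventually_notMem_lattice₂ hl
      rwa [ofComplex_apply_of_im_pos hp'.2.2.2] at this
    filter_upwards [Metric.isOpen_ball.mem_nhds hp, hoff] with q hq hql hq0
    rw [← (hU q (hball hq)).2.2.1 hq0]
    exact holExtend_of_notMem hφ hql
  zero_of_not_hol τ z h := by
    rw [holAt_holExtend_iff hφ] at h
    rw [holExtend, dif_neg h]

/-! ### Poles at the lattice points -/

theorem eventually_codiscrete_ne_zero {c : ℍ → ℂ} (hc : HolOnH c) {τ₀ : ℍ} (h0 : c τ₀ ≠ 0) :
    ∀ᶠ τ in codiscrete ℍ, c τ ≠ 0 := by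
  have ha : AnalyticOnNhd ℂ (fun w : ℂ => c (ofComplex w)) {w : ℂ | 0 < w.im} :=
    hc.analyticOnNhd (isOpen_lt continuous_const Complex.continuous_im)
  refine mem_codiscrete.2 fun τ => ?_
  rw [disjoint_principal_right, compl_compl]
  have h1 : ∀ᶠ w in 𝓝[≠] (τ : ℂ), c (ofComplex w) ≠ 0 := by
    refine (ha τ τ.im_pos).eventually_eq_zero_or_eventually_ne_zero.resolve_left fun h => h0 ?_
    have := ha.eqOn_zero_of_preconnected_of_eventuallyEq_zero
      (convex_halfSpace_im_gt 0).isPreconnected τ.im_pos h τ₀.im_pos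
    simpa using this
  have h2 : Tendsto ((↑) : ℍ → ℂ) (𝓝[≠] τ) (𝓝[≠] (τ : ℂ)) :=
    tendsto_nhdsWithin_of_tendsto_nhds_of_eventually_within _
      ((UpperHalfPlane.continuous_coe.tendsto τ).mono_left nhdsWithin_le_nhds) (by
        filter_upwards [self_mem_nhdsWithin] with s hs h
        exact hs (UpperHalfPlane.ext h))
  filter_upwards [h2.eventually h1] with s hs
  simpa using hs

theorem meromorphicOrderAt_lt_zero {f g : ℂ → ℂ} {z₀ : ℂ} {n : ℕ} (hn : n ≠ 0)
    (hg : AnalyticAt ℂ g z₀) (h0 : g z₀ ≠ 0)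
    (h : ∀ᶠ z in 𝓝[≠] z₀, g z = (z - z₀) ^ n * f z) : meromorphicOrderAt f z₀ < 0 := by
  have h1 : ∀ᶠ z in 𝓝[≠] z₀, f z = (z - z₀) ^ (-(n : ℤ)) • g z := by
    filter_upwards [h, self_mem_nhdsWithin] with z hz hne
    rw [hz, zpow_neg, zpow_natCast, smul_eq_mul,
      inv_mul_cancel_left₀ (pow_ne_zero n (sub_ne_zero.2 hne))]
  have hf : MeromorphicAt f z₀ := by
    refine MeromorphicAt.congr ?_ (EventuallyEq.symm h1)
    exact (((MeromorphicAt.id z₀).sub (MeromorphicAt.const z₀ z₀)).zpow _).smul hg.meromorphicAt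
  rw [(meromorphicOrderAt_eq_int_iff hf).2 ⟨g, hg, h0, h1⟩]
  exact_mod_cast (by omega : -(n : ℤ) < 0)

/-- At a lattice point, `φ` has a generic pole or is holomorphic. -/
theorem genericPole_or_holExt (hφ : PolesInLattice φ) {l u : ℤ}
    (hl : ∃ n, ∀ τ, ∃ v, LeadAt (shift l u φ) n τ v) :
    GenericPole (holExtend φ) l u ∨ ∀ τ : ℍ, HolExt φ τ (l * τ + u) := by
  classical
  have hn := Nat.find_spec hl
  -- The least bound valid for all τ. If it is 0 the function extends everywhere; otherwise the
  -- leading coefficient is not identically zero, by minimality and `LeadAt.lower`, and its zeros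
  -- are discrete.
  set n := Nat.find hl with hn'
  rcases Nat.eq_zero_or_pos n with h0 | hpos
  · right
    intro τ
    rw [h0] at hn
    exact (hn τ).choose_spec.holExt
  left
  choose c hc using hn
  have hhol : HolOnH c := by
    intro s hs
    obtain ⟨d, hd, hd'⟩ := (hc ⟨s, hs⟩).eventually
    refine (hd.differentiableAt.congr_of_eventuallyEq ?_).differentiableWithinAt
    filter_upwards [hd'] with t ht
    exact (hc _).unique ht
  obtain ⟨τ₀, hτ₀⟩ : ∃ τ₀, c τ₀ ≠ 0 := by
    by_contra! h
    obtain ⟨m, hm⟩ : ∃ m, n = m + 1 := ⟨n - 1, by omega⟩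
    have : n ≤ m := Nat.find_min' hl (LeadAt.lower fun τ => by
      rw [← hm, ← h τ]
      exact hc τ)
    omega
  filter_upwards [eventually_codiscrete_ne_zero hhol hτ₀] with τ hτ
  obtain ⟨G, hG, hG0, hG1⟩ := (hc τ).exists_mul_eq
  have hcont : Tendsto (fun w : ℂ => ((τ : ℂ), w)) (𝓝 (l * τ + u : ℂ))
      (𝓝 ((τ : ℂ), (l * τ + u : ℂ))) :=
    (by fun_prop : Continuous fun w : ℂ => ((τ : ℂ), w)).tendsto _
  push_cast
  refine meromorphicOrderAt_lt_zero (g := fun w => G ((τ : ℂ), w)) hpos.ne' hG.along_snd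
    (by rwa [hG0]) ?_
  filter_upwards [(hcont.eventually hG1).filter_mono nhdsWithin_le_nhds,
    (hcont.eventually (eventually_eq_lattice l u)).filter_mono nhdsWithin_le_nhds,
    self_mem_nhdsWithin] with w h1 h2 h3
  have h4 := h2 h3
  simp only [ofComplex_apply] at h4
  rw [h1 h3, holExtend_of_notMem hφ h4]
  simp

end HolExt

/-! ### Growth of the normalized representative -/

section Growth

variable {φ : ℍ → ℂ → ℂ} {S : Set (Matrix.SpecialLinearGroup (Fin 2) ℤ × ℝ)}

/-- The local bounds are patched over a finite cover of `K`. -/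
theorem ModerateAlong.uniform {L : Filter ℍ} {F : ℍ → ℂ → ℂ} {K : Set ℂ} (hK : IsCompact K)
    (h : ∀ w ∈ K, ModerateAlong (L ×ˢ 𝓝 w) (fun p => p.1.im) (fun p => F p.1 p.2)) {C : ℝ}
    (hC : 0 < C) :
    ∃ M : ℝ, ∀ᶠ τ : ℍ in L, ∀ w ∈ K, ‖F τ w‖ ≤ M * Real.exp (C * τ.im) := by
  refine hK.induction_on (p := fun s => ∃ M : ℝ, ∀ᶠ τ : ℍ in L, ∀ w ∈ s,
    ‖F τ w‖ ≤ M * Real.exp (C * τ.im)) ⟨0, by simp⟩ ?_ ?_ ?_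
  · rintro s t hst ⟨M, hM⟩
    exact ⟨M, hM.mono fun τ h w hw => h w (hst hw)⟩
  · rintro s t ⟨M, hM⟩ ⟨M', hM'⟩
    refine ⟨max M M', ?_⟩
    filter_upwards [hM, hM'] with τ h1 h2 w hw
    rcases hw with hw | hw
    · exact (h1 w hw).trans (by gcongr; exact le_max_left M M')
    · exact (h2 w hw).trans (by gcongr; exact le_max_right M M')
  · intro w hw
    obtain ⟨M, hM⟩ := (h w hw C hC).bound
    obtain ⟨p, hp, q, hq, hpq⟩ := eventually_prod_iff.1 hM
    refine ⟨{w | q w}, mem_nhdsWithin_of_mem_nhds hq, M, hp.mono fun τ hτ w hw => ?_⟩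
    simpa using hpq hτ hw

theorem mem_integerComplement_of_norm_sub {n : ℤ} {w : ℂ} (h : ‖w - n‖ ≤ 1 / 2) (hne : w ≠ n) :
    w ∈ Complex.integerComplement := by
  rintro ⟨m, rfl⟩
  rw [← Int.cast_sub, Complex.norm_intCast] at h
  have h1 : |((m - n : ℤ) : ℝ)| < 1 := by linarith
  have h2 : m - n = 0 := by
    have : |m - n| < 1 := by exact_mod_cast h1
    exact Int.abs_lt_one_iff.1 this
  exact hne (by rw [sub_eq_zero.1 h2])

/-- Growth at lattice points where the function is holomorphic, by the maximum principle. -/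
theorem Tame.moderate_lattice (h : Tame S φ) {γ : Matrix.SpecialLinearGroup (Fin 2) ℤ} {l u : ℤ}
    (hS : (γ, (l : ℝ)) ∈ S)
    (hext : ∀ τ, HolExt φ (γ • τ) ((l * τ + u) / cocycle γ τ)) :
    ModerateAtInfty fun τ => holExtend φ (γ • τ) ((l * τ + u) / cocycle γ τ) := by
  refine moderateAtInfty_iff.2 fun A C hC => ?_
  have hfr : Int.fract (l : ℝ) = 0 := Int.fract_intCast l
  -- The circle of radius 1/2 about the integer u contains no integer, so growth is known uniformly
  -- on it and the maximum principle transfers it to the centre.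
  obtain ⟨M, hM⟩ := ModerateAlong.uniform (L := stripFilter A)
    (F := fun τ w => φ (γ • τ) (((l : ℝ) * τ + w) / cocycle γ τ))
    (isCompact_sphere (u : ℂ) (1 / 2)) (fun w hw => h.growth γ l hS w (by
      rw [hfr, cuspDomain_zero]
      have hw' : ‖w - u‖ = 1 / 2 := by simpa [dist_eq_norm] using hw
      refine mem_integerComplement_of_norm_sub (n := u) hw'.le fun h => ?_
      rw [h] at hw'
      norm_num at hw') A) hC
  refine Asymptotics.IsBigO.of_bound M ?_
  have hlat := (eventually_add_notMem_lattice le_rfl one_pos 1).filter_mono (stripFilter_le A)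
  filter_upwards [hM, hlat] with τ h1 h2
  rw [Real.norm_eq_abs, Real.abs_exp]
  have hJ := cocycle_ne_zero γ τ
  have hoff : ∀ w : ℂ, ‖w - u‖ ≤ 1 / 2 → w ≠ u → ((l : ℂ) * (τ : ℂ) + w) / cocycle γ τ ∉ lattice (γ • τ) := by
    intro w hw hne
    rw [div_cocycle_mem_lattice_iff, add_comm]
    have e := add_mem_lattice_iff (z := w) (int_mem_lattice τ l 0)
    simp only [Int.cast_zero, add_zero] at e
    rw [e]
    have h3 := h2 w (by
      rw [cuspDomain_zero]
      exact mem_integerComplement_of_norm_sub hw hne) (by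
      have := Complex.abs_im_le_norm (w - u)
      simp only [Complex.sub_im, Complex.intCast_im, sub_zero] at this
      linarith)
    simpa using h3
  have hd : DifferentiableOn ℂ (fun w : ℂ => holExtend φ (γ • τ) ((l * τ + w) / cocycle γ τ))
      (Metric.closedBall (u : ℂ) (1 / 2)) := by
    intro w hw
    have hw' : ‖w - u‖ ≤ 1 / 2 := by simpa [dist_eq_norm] using hw
    have hx : HolAt (holExtend φ) (γ • τ) ((l * τ + w) / cocycle γ τ) := by
      by_cases hne : w = u
      · rw [hne]
        exact (hext τ).holAt
      · exact polesInLattice_holExtend h.hol _ _ (hoff w hw' hne)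
    have := (HolAt.along_snd hx).differentiableAt
    exact (DifferentiableAt.fun_comp' w this (by fun_prop)).differentiableWithinAt
  have hdc : DiffContOnCl ℂ (fun w : ℂ => holExtend φ (γ • τ) ((l * τ + w) / cocycle γ τ))
      (Metric.ball (u : ℂ) (1 / 2)) := by
    refine DifferentiableOn.diffContOnCl ?_
    rwa [closure_ball _ (by norm_num)]
  refine Complex.norm_le_of_forall_mem_frontier_norm_le Metric.isBounded_ball hdc (fun w hw => ?_)
    (subset_closure (Metric.mem_ball_self (by norm_num)))
  rw [frontier_ball _ (by norm_num)] at hw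
  have hw' : ‖w - u‖ = 1 / 2 := by simpa [dist_eq_norm] using hw
  rw [holExtend_of_notMem h.hol (hoff w hw'.le fun h => by rw [h] at hw'; norm_num at hw')]
  simpa using h1 w hw

theorem Tame.moderate_off (h : Tame S φ) {γ : Matrix.SpecialLinearGroup (Fin 2) ℤ} {l u : ℝ}
    (hS : (γ, l) ∈ S)
    (hlu : ¬ (l ∈ Set.range ((↑) : ℤ → ℝ) ∧ u ∈ Set.range ((↑) : ℤ → ℝ))) :
    ModerateAtInfty fun τ => holExtend φ (γ • τ) ((l * τ + u) / cocycle γ τ) := by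
  have hu : (u : ℂ) ∈ cuspDomain (Int.fract l) := by
    by_cases hl : Int.fract l = 0
    · rw [hl, cuspDomain_zero]
      rintro ⟨n, hn⟩
      exact hlu ⟨Int.fract_eq_zero_iff.1 hl, n, by exact_mod_cast hn⟩
    · simp [cuspDomain, hl]
  refine moderateAtInfty_iff.2 fun A => ?_
  have h1 := (h.growth γ l hS u hu A).comp
    (tendsto_id.prodMk (tendsto_const_nhds (x := (u : ℂ))) : Tendsto (fun τ : ℍ => (τ, (u : ℂ)))
      (stripFilter A) (stripFilter A ×ˢ 𝓝 (u : ℂ)))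
  refine h1.congr (.of_forall fun τ => ?_)
  simp only [Function.comp_apply]
  rw [holExtend_of_notMem h.hol, id]
  rwa [div_cocycle_mem_lattice_iff, real_mem_lattice_iff]

theorem holOnH_holExtend {l u : ℝ} (h : ∀ τ : ℍ, HolExt φ τ (l * τ + u)) :
    HolOnH fun τ => holExtend φ τ (l * τ + u) := by
  intro s hs
  have h1 := (h ⟨s, hs⟩).holAt
  have h2 : AnalyticAt ℂ (fun w : ℂ => uncurried (holExtend φ) (w, l * w + u)) s := by
    refine AnalyticAt.fun_comp_of_eq (f := fun w : ℂ => (w, (l * w + u : ℂ))) h1 ?_ rfl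
    exact analyticAt_id.prod ((analyticAt_const.fun_mul analyticAt_id).fun_add analyticAt_const)
  refine (h2.differentiableAt.congr_of_eventuallyEq ?_).differentiableWithinAt
  filter_upwards [(isOpen_lt continuous_const Complex.continuous_im).mem_nhds hs] with w hw
  simp only [uncurried]
  rw [ofComplex_apply_of_im_pos hw]

/-- Real coordinates transform by the row vector (l, u)γ, which explains the slope appearing in
`Tame.moderate`. -/
theorem real_transform (γ : Matrix.SpecialLinearGroup (Fin 2) ℤ) (l u : ℝ) (τ : ℍ) :
    (l * ((γ • τ : ℍ) : ℂ) + u : ℂ) =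
      (((l * γ.1 0 0 + u * γ.1 1 0 : ℝ) : ℂ) * τ + ((l * γ.1 0 1 + u * γ.1 1 1 : ℝ) : ℂ)) /
        cocycle γ τ := by
  rw [eq_div_iff (cocycle_ne_zero γ τ), add_mul, mul_assoc, smul_coe_mul_cocycle, cocycle]
  push_cast
  ring

theorem Tame.genericPole_or (h : Tame S φ) (l u : ℝ) :
    GenericPole (holExtend φ) l u ∨ ∀ τ : ℍ, HolExt φ τ (l * τ + u) := by
  by_cases hlu : l ∈ Set.range ((↑) : ℤ → ℝ) ∧ u ∈ Set.range ((↑) : ℤ → ℝ)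
  · obtain ⟨⟨a, rfl⟩, b, rfl⟩ := hlu
    have := genericPole_or_holExt h.hol (h.lead a b)
    simpa using this
  · exact Or.inr fun τ => HolExt.of_notMem h.hol (by rwa [real_mem_lattice_iff])

theorem Tame.moderate (h : Tame S φ) (γ : Matrix.SpecialLinearGroup (Fin 2) ℤ) {l u : ℝ}
    (hS : (γ, l * γ.1 0 0 + u * γ.1 1 0) ∈ S) (hext : ∀ τ : ℍ, HolExt φ τ (l * τ + u)) :
    ModerateAtInfty fun τ => holExtend φ (γ • τ) (l * ((γ • τ : ℍ) : ℂ) + u) := by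
  simp only [real_transform]
  have hext' := fun τ : ℍ => hext (γ • τ)
  simp only [real_transform] at hext'
  by_cases hlu : l * γ.1 0 0 + u * γ.1 1 0 ∈ Set.range ((↑) : ℤ → ℝ) ∧
      l * γ.1 0 1 + u * γ.1 1 1 ∈ Set.range ((↑) : ℤ → ℝ)
  · obtain ⟨⟨a, ha⟩, b, hb⟩ := hlu
    rw [← ha] at hS
    simp only [← ha, ← hb, Complex.ofReal_intCast] at hext' ⊢
    exact h.moderate_lattice hS hext'
  · exact h.moderate_off hS hlu

theorem Tame.weakStrictlyMer (h : Tame S φ) (hS : ((1 : Matrix.SpecialLinearGroup (Fin 2) ℤ), (0 : ℝ)) ∈ S) :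
    WeakStrictlyMer (holExtend φ) := by
  refine ⟨isMeromorphic_holExtend h.hol h.lead, fun l u => ?_, fun u => ?_⟩
  · exact (h.genericPole_or l u).imp_right holOnH_holExtend
  · refine (h.genericPole_or 0 u).imp_right fun hext => ?_
    have := h.moderate 1 (l := 0) (u := u) (by simpa using hS) hext
    simpa using this

theorem Tame.strictlyMer_zero (h : Tame Set.univ φ) : StrictlyMer 0 (holExtend φ) := by
  refine ⟨isMeromorphic_holExtend h.hol h.lead, fun l u => ?_⟩
  refine (h.genericPole_or l u).imp_right fun hext => ?_
  have e : (fun τ => slashEll 0 l u (holExtend φ) τ 0) = fun τ => holExtend φ τ (l * τ + u) := by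
    funext τ
    simp [slashEll, ex]
  rw [e]
  exact ⟨holOnH_holExtend hext, fun γ => h.moderate γ (Set.mem_univ _) hext⟩

end Growth

/-! ### Invariance of the normalized representative -/

section Invariance

variable {φ : ℍ → ℂ → ℂ} {k : ℤ} {m : ℚ}

theorem holAt_smul (γ : Matrix.SpecialLinearGroup (Fin 2) ℤ) (l u : ℤ) (τ : ℍ) (z : ℂ) :
    HolAt (fun τ _ => ((γ • τ : ℍ) : ℂ)) τ z ∧ HolAt (fun τ _ => cocycle γ τ) τ z ∧
      HolAt (fun τ z => (z + l * τ + u) / cocycle γ τ) τ z := by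
  have h1 : HolAt (fun τ _ => cocycle γ τ) τ z :=
    ((HolAt.const _ τ z).mul (HolAt.fst τ z)).add (HolAt.const _ τ z)
  refine ⟨?_, h1, (((HolAt.snd τ z).add ((HolAt.const _ τ z).mul (HolAt.fst τ z))).add
    (HolAt.const _ τ z)).div h1 (cocycle_ne_zero γ τ)⟩
  refine ((((HolAt.const (γ.1 0 0 : ℤ) τ z).mul (HolAt.fst τ z)).add
    (HolAt.const (γ.1 0 1 : ℤ) τ z)).div h1 (cocycle_ne_zero γ τ)).congr (.of_forall fun p => ?_)
  rw [← smul_coe_mul_cocycle, mul_div_cancel_right₀ _ (cocycle_ne_zero _ _)]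

theorem JacobiForms.HolAt.slash {γ : Matrix.SpecialLinearGroup (Fin 2) ℤ} {l u : ℤ} {τ : ℍ} {z : ℂ}
    (h : HolAt φ (γ • τ) ((z + l * τ + u) / cocycle γ τ)) : HolAt (slash k m γ l u φ) τ z := by
  obtain ⟨h1, h2, h3⟩ := holAt_smul γ l u τ z
  have h4 : HolAt (fun τ z => φ (γ • τ) ((z + l * τ + u) / cocycle γ τ)) τ z := by
    have := AnalyticAt.fun_comp_of_eq (f := fun p : ℂ × ℂ =>
      (((γ • ofComplex p.1 : ℍ) : ℂ), (p.2 + l * (ofComplex p.1 : ℂ) + u) / cocycle γ (ofComplex p.1)))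
      (y := (((γ • τ : ℍ) : ℂ), (z + l * τ + u) / cocycle γ τ)) h (h1.prod h3) (by simp)
    refine this.congr (.of_forall fun p => ?_)
    simp [uncurried]
  have h5 : HolAt (fun τ _ => cocycle γ τ ^ (-k)) τ z :=
    AnalyticAt.fun_zpow h2 (cocycle_ne_zero γ _)
  have hz := (((HolAt.snd τ z).add ((HolAt.const l τ z).mul (HolAt.fst τ z))).add
    (HolAt.const u τ z)).pow 2
  have h6 := HolAt.comp differentiable_ex ((((HolAt.const (-((γ.1 1 0 : ℤ) : ℂ)) τ z).mul
    ((HolAt.const (m : ℂ) τ z).mul hz))).div h2 (cocycle_ne_zero γ τ))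
  have h7 := HolAt.comp differentiable_ex ((HolAt.const (m : ℂ) τ z).mul ((HolAt.const (l : ℂ) τ z).mul
    (((HolAt.const (l : ℂ) τ z).mul (HolAt.fst τ z)).add ((HolAt.const 2 τ z).mul (HolAt.snd τ z)))))
  refine (((HolAt.const (ex (m * (l + u) ^ 2)) τ z).mul h7).mul ((h5.mul h6).mul h4)).congr
    (.of_forall fun p => ?_)
  rw [slash_apply]

theorem cocycle_inv (γ : Matrix.SpecialLinearGroup (Fin 2) ℤ) (τ : ℍ) :
    cocycle γ⁻¹ (γ • τ) * cocycle γ τ = 1 := by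
  have h := smul_coe_mul_cocycle γ τ
  have h2 := det_eq' γ
  have e : cocycle γ⁻¹ (γ • τ) = -(γ.1 1 0 : ℤ) * ((γ • τ : ℍ) : ℂ) + (γ.1 0 0 : ℤ) := by
    rw [cocycle, Matrix.SpecialLinearGroup.SL2_inv_expl]
    simp
  rw [e, add_mul, mul_assoc, h, cocycle]
  linear_combination h2

theorem transform_inv (γ : Matrix.SpecialLinearGroup (Fin 2) ℤ) (l u : ℤ) (τ : ℍ) (z : ℂ) :
    ((z + l * τ + u) / cocycle γ τ + (-(l * γ.1 1 1 - u * γ.1 1 0) : ℤ) * ((γ • τ : ℍ) : ℂ) +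
      (-(-l * γ.1 0 1 + u * γ.1 0 0) : ℤ)) / cocycle γ⁻¹ (γ • τ) = z := by
  have hJ := cocycle_ne_zero γ τ
  have h := smul_coe_mul_cocycle γ τ
  have h2 := det_eq' γ
  rw [eq_inv_of_mul_eq_one_left (cocycle_inv γ τ), div_inv_eq_mul, add_mul, add_mul,
    div_mul_cancel₀ _ hJ, mul_assoc, h, cocycle]
  push_cast
  linear_combination (-l * τ - u) * h2

/-- The slash of the extension at the transformed point is itself an extension at the original
point, by invariance off the lattice. -/
theorem HolExt.of_transform (hφ : PolesInLattice φ) (hs : SlashInv k m φ)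
    {γ : Matrix.SpecialLinearGroup (Fin 2) ℤ} {l u : ℤ} {τ : ℍ} {z : ℂ}
    (h : HolExt φ (γ • τ) ((z + l * τ + u) / cocycle γ τ)) :
    HolExt φ τ z ∧ slash k m γ l u (holExtend φ) τ z = holExtend φ τ z := by
  have h1 : HolAt (slash k m γ l u (holExtend φ)) τ z := HolAt.slash h.holAt
  have h2 : ∀ᶠ p in 𝓝 ((τ : ℂ), z), p.2 ∉ lattice (ofComplex p.1) →
      uncurried (slash k m γ l u (holExtend φ)) p = φ (ofComplex p.1) p.2 := by
    refine .of_forall fun p hp => ?_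
    rw [← hs γ l u _ _ hp, uncurried, slash_apply, slash_apply, holExtend_of_notMem hφ]
    rwa [add_assoc, notMem_lattice_transform]
  exact ⟨⟨_, h1, h2⟩, by rw [holExtend_eq h1 h2, uncurried_coe]⟩

theorem HolExt.transform (hφ : PolesInLattice φ) (hs : SlashInv k m φ)
    {γ : Matrix.SpecialLinearGroup (Fin 2) ℤ} {l u : ℤ} {τ : ℍ} {z : ℂ}
    (h : HolExt φ τ z) : HolExt φ (γ • τ) ((z + l * τ + u) / cocycle γ τ) := by
  refine (HolExt.of_transform hφ hs (γ := γ⁻¹) (l := -(l * γ.1 1 1 - u * γ.1 1 0))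
    (u := -(-l * γ.1 0 1 + u * γ.1 0 0)) ?_).1
  rwa [transform_inv, inv_smul_smul]

/-- Extendability is invariant under the group. Where it fails, both sides take the default value 0.
-/
theorem slash_holExtend (hφ : PolesInLattice φ) (hs : SlashInv k m φ)
    (γ : Matrix.SpecialLinearGroup (Fin 2) ℤ) (l u : ℤ) :
    slash k m γ l u (holExtend φ) = holExtend φ := by
  funext τ z
  by_cases h : HolExt φ (γ • τ) ((z + l * τ + u) / cocycle γ τ)
  · exact (HolExt.of_transform hφ hs h).2
  · have h' : ¬ HolExt φ τ z := fun h' => h (h'.transform hφ hs)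
    rw [slash_apply, holExtend, dif_neg h, mul_zero, mul_zero, holExtend, dif_neg h']

end Invariance

/-! ### The algebra of Jacobi forms -/

section JacobiAlgebra

variable {φ : ℍ → ℂ → ℂ} {k : ℤ} {m : ℚ}

theorem Tame.isJacobi_weak (h : Tame {(1, 0)} φ) (hs : SlashInv k m φ) :
    IsJacobi WeakStrictlyMer k m (holExtend φ) :=
  ⟨h.weakStrictlyMer rfl, slash_holExtend h.hol hs⟩

theorem Tame.isJacobi_strict (h : Tame Set.univ φ) (hs : SlashInv k 0 φ) :
    IsJacobi (StrictlyMer 0) k 0 (holExtend φ) :=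
  ⟨h.strictlyMer_zero, slash_holExtend h.hol hs⟩

/-- Restrictions of tame Jacobi forms with index in `M`. -/
def tameForms (S : Set (Matrix.SpecialLinearGroup (Fin 2) ℤ × ℝ)) (M : AddSubmonoid ℚ) :
    Submonoid (OffLattice → ℂ) where
  carrier := {f | ∃ (k : ℤ) (m : ℚ) (φ : ℍ → ℂ → ℂ), m ∈ M ∧ Tame S φ ∧ SlashInv k m φ ∧ f = res φ}
  one_mem' := ⟨0, 0, fun _ _ => 1, M.zero_mem, .const 1, .const 1, rfl⟩
  mul_mem' := by
    rintro _ _ ⟨k, m, φ, hm, h, hs, rfl⟩ ⟨k', m', φ', hm', h', hs', rfl⟩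
    exact ⟨k + k', m + m', _, M.add_mem hm hm', h.mul h', hs.mul hs', rfl⟩

theorem toSubmodule_genAlg_le {s : Set (OffLattice → ℂ)} {T : Submonoid (OffLattice → ℂ)}
    {V : Submodule ℂ (OffLattice → ℂ)} (hs : s ⊆ T) (hT : (T : Set (OffLattice → ℂ)) ⊆ V) :
    Subalgebra.toSubmodule (genAlg s) ≤ V := by
  rw [genAlg, Algebra.adjoin_eq_span, Submodule.span_le]
  exact fun x hx => hT (Submonoid.closure_le.2 hs hx)

theorem genAlg_eq_wpAlg : genAlg {res (E 2 - eis 2), res (E 3), res (eis 4)} = wpAlg := by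
  refine le_antisymm (Algebra.adjoin_le ?_) (Algebra.adjoin_le ?_)
  · rintro x (rfl | rfl | rfl)
    · exact res_wp_mem
    · exact res_E_three_mem
    · exact res_eis_four_mem
  · rintro x (rfl | rfl | rfl)
    · exact Algebra.subset_adjoin (by left; rfl)
    · have : res wp' = (-2 : ℂ) • res (E 3) := by
        rw [res_E_three_eq, smul_smul]
        norm_num
      rw [this]
      exact Subalgebra.smul_mem _ (Algebra.subset_adjoin (by simp)) _
    · exact Algebra.subset_adjoin (by simp)

theorem slashInv_zero_smul {u : ℤ} (hs : SlashInv k m φ) {τ : ℍ} {z : ℂ} (hz : z ∉ lattice τ) :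
    φ τ (z + u) = ex (-(m * u ^ 2)) * φ τ z := by
  have h := hs 1 0 u τ z hz
  rw [slash_apply] at h
  have e : cocycle 1 τ = 1 := by simp [cocycle]
  simp only [e] at h
  rw [← h, ex_neg]
  have := ex_ne_zero (m * (u : ℂ) ^ 2)
  simp [ex] at this ⊢

theorem slashInv_one_zero (hs : SlashInv k m φ) {τ : ℍ} {z : ℂ} (hz : z ∉ lattice τ) :
    φ τ (z + τ) = ex (-m) * ex (-(m * (τ + 2 * z))) * φ τ z := by
  have h := hs 1 1 0 τ z hz
  rw [slash_apply] at h
  have e : cocycle 1 τ = 1 := by simp [cocycle]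
  simp only [e] at h
  rw [← h, ex_neg, ex_neg]
  have h1 := ex_ne_zero (m : ℂ)
  have h2 := ex_ne_zero (m * (τ + 2 * z))
  have h0 : ex 0 = 1 := by simp [ex]
  simp [h0]
  rw [mul_comm (ex (m : ℂ)), mul_assoc, mul_assoc, inv_mul_cancel_left₀ h2,
    inv_mul_cancel_left₀ h1]

/-- There are no Jacobi forms with `2m` not an integer. -/
theorem SlashInv.eq_zero (hs : SlashInv k m φ) (hm : ∀ n : ℤ, m ≠ n / 2) {τ : ℍ} {z : ℂ}
    (hz : z ∉ lattice τ) : φ τ z = 0 := by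
  have hz1 : z + (1 : ℤ) ∉ lattice τ := by
    have := (add_mem_lattice_iff (int_mem_lattice τ 0 1)).not.2 hz
    simpa using this
  have hzτ : z + τ ∉ lattice τ := (add_mem_lattice_iff (coe_mem_lattice τ)).not.2 hz
  have h1 := slashInv_one_zero hs hz1
  have h2 := slashInv_zero_smul (u := 1) hs hzτ
  rw [slashInv_zero_smul hs hz] at h1
  rw [slashInv_one_zero hs hz] at h2
  -- Translating by 1 and τ in the two orders gives factors differing by e(-2m). A nonzero value
  -- forces this to be 1, so 2m is an integer.
  have e : z + (1 : ℤ) + τ = z + τ + (1 : ℤ) := by ring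
  rw [e, h2] at h1
  have h3 : ex (-(m * (τ + 2 * (z + (1 : ℤ))))) = ex (-(m * (τ + 2 * z))) * ex (-(2 * m)) := by
    rw [← ex_add]
    congr 1
    push_cast
    ring
  rw [h3] at h1
  by_contra h0
  have h4 : ex (-(2 * m)) = 1 := by
    have ha := ex_ne_zero (-(m * (τ + 2 * z)))
    have hb := ex_ne_zero (-(m : ℂ))
    have hc := ex_ne_zero (-(m * ((1 : ℤ) : ℂ) ^ 2))
    have hd : ex (-(m * ((1 : ℤ) : ℂ) ^ 2)) * (ex (-m) * ex (-(m * (τ + 2 * z))) * φ τ z) ≠ 0 :=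
      mul_ne_zero hc (mul_ne_zero (mul_ne_zero hb ha) h0)
    refine mul_left_cancel₀ hd ?_
    linear_combination -h1
  obtain ⟨n, hn⟩ := ex_eq_one_iff.1 h4
  refine hm (-n) ?_
  have h5 : -(2 * m) = n := by exact_mod_cast hn
  push_cast
  linarith

theorem JacobiForms.StrictlyMer.moderateAtInfty (h : StrictlyMer m φ) (hp : PolesInLattice φ)
    (u : ℝ) (h0 : 0 < u) (h1 : u < 1) : ModerateAtInfty fun τ => φ τ u := by
  have h2 := (h.2 0 u).resolve_left (not_genericPole fun τ => by
    simpa using HolAt.along_snd (hp τ u (ofReal_notMem_lattice h0 h1 τ)))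
  have h3 := (JacobiForms.ModerateAtInfty.of_tendsto
    (tendsto_const_nhds (x := (ex (m * (u : ℂ) ^ 2))⁻¹))).mul (h2.2 1)
  refine h3.congr (.of_forall fun τ => ?_)
  have e : ex 0 = 1 := by simp [ex]
  simp [slashEll, e, ex_ne_zero]

theorem res_mem_of_slashInv {A : Subalgebra ℂ (OffLattice → ℂ)} (hA : wpAlg ≤ A)
    (hT : res Theta ∈ A) (hl : ∃ n, ∀ τ, ∃ v, LeadAt φ n τ v) (hp : PolesInLattice φ) (hs : SlashInv k m φ)
    (hm : ∀ u : ℝ, 0 < u → u < 1 → ModerateAtInfty fun τ => φ τ u) (hm0 : 0 ≤ m) : res φ ∈ A := by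
  by_cases h2 : ∃ n : ℤ, m = n / 2
  · obtain ⟨n, rfl⟩ := h2
    obtain ⟨N, rfl⟩ := Int.eq_ofNat_of_zero_le (a := n) (by
      have : (0 : ℚ) ≤ n := by linarith
      exact_mod_cast this)
    obtain ⟨P, hP, h⟩ := exists_eq_mul_Theta_pow hl hp (by simpa using hs) hm
    rw [h]
    exact mul_mem (hA hP) (pow_mem hT N)
  · push Not at h2
    have : res φ = 0 := by
      funext p
      exact hs.eq_zero h2 p.2
    rw [this]
    exact zero_mem _

theorem res_mem_wpAlg_of_slashInv (hl : ∃ n, ∀ τ, ∃ v, LeadAt φ n τ v) (hp : PolesInLattice φ)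
    (hs : SlashInv k 0 φ) (hm : ∀ u : ℝ, 0 < u → u < 1 → ModerateAtInfty fun τ => φ τ u) :
    res φ ∈ wpAlg := by
  obtain ⟨P, hP, h⟩ := exists_eq_mul_Theta_pow (N := 0) hl hp (by simpa using hs) hm
  rw [h, pow_zero, mul_one]
  exact hP

/-- One inclusion is the structure theorem. For the other, the algebra is spanned by products of
generators, and each product is a tame invariant function with a normalized representative. -/
theorem latticeForms_jacobi_weak : latticeForms (IsJacobi WeakStrictlyMer) {m | 0 ≤ m} =
    Subalgebra.toSubmodule (genAlg {res (E 2 - eis 2), res (E 3), res (eis 4), res Theta}) := by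
  refine le_antisymm (Submodule.span_le.2 ?_) ?_
  · rintro _ ⟨k, m, φ, hm, hJ, hp, rfl⟩
    refine res_mem_of_slashInv ?_ (Algebra.subset_adjoin (by simp)) (exists_leadAt hJ.1.1 hp) hp hJ.slashInv
      (WeakStrictlyMer.moderateAtInfty hJ.1 hp) hm
    rw [← genAlg_eq_wpAlg]
    exact Algebra.adjoin_mono (by
      rintro x (rfl | rfl | rfl) <;> simp)
  · refine toSubmodule_genAlg_le (T := tameForms {(1, 0)} (AddSubmonoid.nonneg ℚ)) ?_ ?_
    · rintro x (rfl | rfl | rfl | rfl)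
      · exact ⟨2, 0, wp, zero_mem _, tame_E_two.sub tame_eis_two, slashInv_wp, rfl⟩
      · exact ⟨3, 0, E 3, zero_mem _, tame_E_three, slashInv_E_three, rfl⟩
      · exact ⟨4, 0, eis 4, zero_mem _, tame_eis_four, slashInv_eis_four, rfl⟩
      · exact ⟨-1, 1 / 2, Theta, by simp, tame_Theta, slashInv_Theta, rfl⟩
    · rintro _ ⟨k, m, φ, hm, h, hs, rfl⟩
      exact Submodule.subset_span ⟨k, m, holExtend φ, hm, h.isJacobi_weak hs,
        polesInLattice_holExtend h.hol, (res_holExtend h.hol).symm⟩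

theorem latticeForms_jacobi_strict :
    latticeForms (fun k m => IsJacobi (StrictlyMer m) k m) {0} =
      Subalgebra.toSubmodule (genAlg {res (E 2 - eis 2), res (E 3), res (eis 4)}) := by
  refine le_antisymm (Submodule.span_le.2 ?_) ?_
  · rintro _ ⟨k, m, φ, hm, hJ, hp, rfl⟩
    obtain rfl : m = 0 := hm
    rw [genAlg_eq_wpAlg]
    exact res_mem_wpAlg_of_slashInv (exists_leadAt hJ.1.1 hp) hp hJ.slashInv (hJ.1.moderateAtInfty hp)
  · refine toSubmodule_genAlg_le (T := tameForms Set.univ ⊥) ?_ ?_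
    · rintro x (rfl | rfl | rfl)
      · exact ⟨2, 0, wp, zero_mem _, tame_E_two.sub tame_eis_two, slashInv_wp, rfl⟩
      · exact ⟨3, 0, E 3, zero_mem _, tame_E_three, slashInv_E_three, rfl⟩
      · exact ⟨4, 0, eis 4, zero_mem _, tame_eis_four, slashInv_eis_four, rfl⟩
    · rintro _ ⟨k, m, φ, hm, h, hs, rfl⟩
      obtain rfl : m = 0 := hm
      exact Submodule.subset_span ⟨k, 0, holExtend φ, rfl, h.isJacobi_strict hs,
        polesInLattice_holExtend h.hol, (res_holExtend h.hol).symm⟩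

end JacobiAlgebra

/-! ### Almost holomorphic functions -/

section Almost

variable {k k' : ℤ} {m m' : ℚ}

theorem two_I_im (τ : ℍ) : 2 * I * (τ.im : ℂ) = τ - (starRingEnd ℂ) (τ : ℂ) := by
  rw [Complex.sub_conj]
  push_cast
  rw [UpperHalfPlane.coe_im]
  ring

theorem conj_cocycle (γ : Matrix.SpecialLinearGroup (Fin 2) ℤ) (τ : ℍ) :
    (starRingEnd ℂ) (cocycle γ τ) =
      (γ.1 1 0 : ℤ) * (starRingEnd ℂ) (τ : ℂ) + (γ.1 1 1 : ℤ) := by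
  simp [cocycle]

theorem ofReal_im_smul (γ : Matrix.SpecialLinearGroup (Fin 2) ℤ) (τ : ℍ) :
    (((γ • τ).im : ℝ) : ℂ) * (cocycle γ τ * (starRingEnd ℂ) (cocycle γ τ)) = τ.im := by
  rw [Complex.mul_conj, ModularGroup.im_smul_eq_div_normSq, ← cocycle_eq_denom]
  have : Complex.normSq (cocycle γ τ) ≠ 0 := by simpa using cocycle_ne_zero γ τ
  rw [← Complex.ofReal_mul, div_mul_cancel₀ _ this]

/-- With J = cτ + d, everything follows from Im(γτ) |J|² = Im τ and J - J̄ = 2ic Im τ. -/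
theorem nu_smul (γ : Matrix.SpecialLinearGroup (Fin 2) ℤ) (τ : ℍ) :
    nu (γ • τ) = cocycle γ τ ^ 2 * nu τ - (γ.1 1 0 : ℤ) * cocycle γ τ := by
  have h1 := ofReal_im_smul γ τ
  have h2 := two_I_im τ
  have h3 := conj_cocycle γ τ
  have hy : ((τ.im : ℝ) : ℂ) ≠ 0 := by exact_mod_cast τ.im_pos.ne'
  have hy' : (((γ • τ).im : ℝ) : ℂ) ≠ 0 := by exact_mod_cast (γ • τ).im_pos.ne'
  have hI : (2 * I : ℂ) ≠ 0 := by simp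
  rw [nu, nu, div_eq_iff (mul_ne_zero hI hy')]
  have h4 : 2 * I * (τ.im : ℂ) * (γ.1 1 0 : ℤ) =
      cocycle γ τ - (starRingEnd ℂ) (cocycle γ τ) := by
    rw [h2, h3, cocycle]
    ring
  field_simp
  have h5 : cocycle γ τ - (γ.1 1 0 : ℤ) * 2 * I * τ.im = (starRingEnd ℂ) (cocycle γ τ) := by
    linear_combination -h4
  linear_combination -h1 - (((γ • τ).im : ℝ) : ℂ) * cocycle γ τ * h5

theorem xi_smul (γ : Matrix.SpecialLinearGroup (Fin 2) ℤ) (τ : ℍ) (z : ℂ) :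
    xi (γ • τ) (z / cocycle γ τ) = cocycle γ τ * xi τ z - (γ.1 1 0 : ℤ) * z := by
  have h1 := ofReal_im_smul γ τ
  have h2 := two_I_im τ
  have h3 := conj_cocycle γ τ
  have hJ := cocycle_ne_zero γ τ
  have hJ' : (starRingEnd ℂ) (cocycle γ τ) ≠ 0 := by simpa using hJ
  have hy : ((τ.im : ℝ) : ℂ) ≠ 0 := by exact_mod_cast τ.im_pos.ne'
  have hy' : (((γ • τ).im : ℝ) : ℂ) ≠ 0 := by exact_mod_cast (γ • τ).im_pos.ne'
  have him : ∀ w : ℂ, (w.im : ℂ) = (w - (starRingEnd ℂ) w) / (2 * I) := fun w => by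
    rw [Complex.sub_conj]
    push_cast
    field_simp
  rw [xi, xi, him z, him (z / _), map_div₀, div_eq_iff hy']
  have h4 : 2 * I * (τ.im : ℂ) * (γ.1 1 0 : ℤ) =
      cocycle γ τ - (starRingEnd ℂ) (cocycle γ τ) := by
    rw [h2, h3, cocycle]
    ring
  set J := cocycle γ τ
  set J' := (starRingEnd ℂ) J
  set z' := (starRingEnd ℂ) z
  rw [← h1] at h4 ⊢
  field_simp
  linear_combination z * h4

theorem xi_add (τ : ℍ) (z : ℂ) (l u : ℤ) : xi τ (z + (l * τ + u)) = xi τ z + l := by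
  have hy : ((τ.im : ℝ) : ℂ) ≠ 0 := by exact_mod_cast τ.im_pos.ne'
  rw [xi, xi, div_add' _ _ _ hy]
  simp

/-! ### Invariant completions of E₁, E₂ and e₂, and their products -/

/-- The shift and the modular anomaly of 2πiξ are opposite to those of E₁. The zero term in ν fits
the shape g + αξ + βν required by `QuasiTame.mul`. -/
theorem slashInv_E_one_hat :
    SlashInv 1 0 (fun τ z => E 1 τ z + 2 * Real.pi * I * xi τ z + 0 * nu τ) := by
  refine .of_smul_ell (fun τ z l u hz => ?_) (fun γ τ z hz => ?_)
  · rw [E_one_lattice hz, xi_add]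
    ring
  · rw [E_one_smul γ hz, xi_smul, zpow_one]
    ring

theorem slashInv_eis_two_hat :
    SlashInv 2 0 (fun τ z => eis 2 τ z + 0 * xi τ z + -(2 * Real.pi * I) * nu τ) := by
  refine .of_smul_ell (fun τ z l u hz => ?_) (fun γ τ z hz => ?_)
  · rw [eis_two_eq, eis_two_eq]
    ring
  · rw [eis_two_smul γ τ _ z, nu_smul, show (2 : ℤ) = (2 : ℕ) by rfl, zpow_natCast]
    ring

theorem slashInv_E_two_hat :
    SlashInv 2 0 (fun τ z => E 2 τ z + 0 * xi τ z + -(2 * Real.pi * I) * nu τ) := by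
  refine .of_smul_ell (fun τ z l u hz => ?_) (fun γ τ z hz => ?_)
  · rw [E_two_lattice hz]
    ring
  · rw [E_two_smul γ hz, nu_smul, show (2 : ℤ) = (2 : ℕ) by rfl, zpow_natCast]
    ring

/-- Multiplication of `∑ a_{ij} ν^i ξ^j` by `g + αξ + βν`, on the level of coefficients. -/
def almostMul (a : ℕ → ℕ → ℍ → ℂ → ℂ) (g : ℍ → ℂ → ℂ) (α β : ℂ) : ℕ → ℕ → ℍ → ℂ → ℂ :=
  fun i j τ z => a i j τ z * g τ z + α * (if j = 0 then 0 else a i (j - 1) τ z) +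
    β * (if i = 0 then 0 else a (i - 1) j τ z)

/-- Vanishing of the coefficients beyond d ensures that the index shifts lose and add no terms when
the bound is raised to d + 1. -/
theorem almostSum_almostMul {d : ℕ} {a : ℕ → ℕ → ℍ → ℂ → ℂ}
    (ha : ∀ i j, d < i ∨ d < j → a i j = 0) (g : ℍ → ℂ → ℂ) (α β : ℂ) (τ : ℍ) (z : ℂ) :
    almostSum (d + 1) (almostMul a g α β) τ z =
      almostSum d a τ z * (g τ z + α * xi τ z + β * nu τ) := by
  have h1 : almostSum (d + 1) a τ z = almostSum d a τ z := by
    rw [almostSum, almostSum, Finset.sum_range_succ]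
    simp only [ha (d + 1) _ (Or.inl (Nat.lt_succ_self d))]
    simp only [Pi.zero_apply, zero_mul, Finset.sum_const_zero, add_zero]
    refine Finset.sum_congr rfl fun i _ => ?_
    rw [Finset.sum_range_succ, ha _ (d + 1) (Or.inr (Nat.lt_succ_self d))]
    simp
  have h2 : almostSum (d + 1) (fun i j τ z => if j = 0 then 0 else a i (j - 1) τ z) τ z =
      almostSum d a τ z * xi τ z := by
    rw [almostSum, almostSum, Finset.sum_range_succ]
    have h0 : ∑ j ∈ Finset.range (d + 1 + 1), (if j = 0 then 0 else a (d + 1) (j - 1) τ z) *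
        nu τ ^ (d + 1) * xi τ z ^ j = 0 := Finset.sum_eq_zero fun j _ => by
      rw [ha (d + 1) _ (Or.inl (Nat.lt_succ_self d))]
      simp
    rw [h0, add_zero, Finset.sum_mul]
    refine Finset.sum_congr rfl fun i _ => ?_
    rw [Finset.sum_range_succ', Finset.sum_mul]
    simp only [Nat.add_eq_zero_iff, one_ne_zero, and_false, if_false, if_true, zero_mul, add_zero,
      Nat.add_sub_cancel]
    exact Finset.sum_congr rfl fun j _ => by ring
  have h3 : almostSum (d + 1) (fun i j τ z => if i = 0 then 0 else a (i - 1) j τ z) τ z =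
      almostSum d a τ z * nu τ := by
    rw [almostSum, almostSum, Finset.sum_range_succ', Finset.sum_mul]
    simp only [Nat.add_eq_zero_iff, one_ne_zero, and_false, if_false, if_true, zero_mul, add_zero,
      Nat.add_sub_cancel, Finset.sum_const_zero]
    refine Finset.sum_congr rfl fun i _ => ?_
    rw [Finset.sum_range_succ, ha _ (d + 1) (Or.inr (Nat.lt_succ_self d)), Finset.sum_mul]
    simp only [Pi.zero_apply, zero_mul, add_zero]
    exact Finset.sum_congr rfl fun j _ => by ring
  calc _ = almostSum (d + 1) a τ z * g τ z +
      α * almostSum (d + 1) (fun i j τ z => if j = 0 then 0 else a i (j - 1) τ z) τ z +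
      β * almostSum (d + 1) (fun i j τ z => if i = 0 then 0 else a (i - 1) j τ z) τ z := by
        simp only [almostSum, almostMul, Finset.mul_sum, Finset.sum_mul, ← Finset.sum_add_distrib]
        exact Finset.sum_congr rfl fun i _ => Finset.sum_congr rfl fun j _ => by ring
    _ = _ := by
        rw [h1, h2, h3]
        ring

/-- Constant terms of almost Jacobi forms with tame coefficients. -/
def QuasiTame (S : Set (Matrix.SpecialLinearGroup (Fin 2) ℤ × ℝ)) (k : ℤ) (m : ℚ)
    (φ : ℍ → ℂ → ℂ) : Prop :=
  ∃ (d : ℕ) (a : ℕ → ℕ → ℍ → ℂ → ℂ), (∀ i j, Tame S (a i j)) ∧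
    (∀ i j, d < i ∨ d < j → a i j = 0) ∧ SlashInv k m (almostSum d a) ∧ a 0 0 = φ

variable {S : Set (Matrix.SpecialLinearGroup (Fin 2) ℤ × ℝ)} {φ g : ℍ → ℂ → ℂ} {α β : ℂ}

theorem QuasiTame.one : QuasiTame S 0 0 (fun _ _ => 1) := by
  refine ⟨0, fun i j => if i = 0 ∧ j = 0 then fun _ _ => 1 else 0, fun i j => ?_, fun i j hij => ?_,
    ?_, by simp⟩
  · show Tame S (if i = 0 ∧ j = 0 then _ else _)
    split_ifs
    · exact Tame.const 1
    · exact Tame.const 0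
  · exact if_neg (by omega)
  · have := SlashInv.const 1
    convert this using 3
    simp [almostSum]

theorem QuasiTame.mul (h : QuasiTame S k m φ) (hg : Tame S g)
    (hs : SlashInv k' m' (fun τ z => g τ z + α * xi τ z + β * nu τ)) :
    QuasiTame S (k + k') (m + m') (fun τ z => φ τ z * g τ z) := by
  obtain ⟨d, a, ha, ha0, hsa, rfl⟩ := h
  refine ⟨d + 1, almostMul a g α β, fun i j => ?_, fun i j hij => ?_, ?_, ?_⟩
  · refine (((ha i j).mul hg).add ((Tame.const α).mul ?_)).add ((Tame.const β).mul ?_)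
    · split_ifs
      · exact Tame.const 0
      · exact ha i (j - 1)
    · split_ifs
      · exact Tame.const 0
      · exact ha (i - 1) j
  · funext τ z
    simp only [almostMul]
    rw [ha0 i j (by omega)]
    have h1 : (if j = 0 then 0 else a i (j - 1) τ z) = 0 := by
      split_ifs with h
      · rfl
      · rw [ha0 i (j - 1) (by omega)]
        rfl
    have h2 : (if i = 0 then 0 else a (i - 1) j τ z) = 0 := by
      split_ifs with h
      · rfl
      · rw [ha0 (i - 1) j (by omega)]
        rfl
    rw [h1, h2]
    simp
  · have := hsa.mul hs
    have e : almostSum (d + 1) (almostMul a g α β) =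
        fun τ z => almostSum d a τ z * (g τ z + α * xi τ z + β * nu τ) := by
      funext τ z
      exact almostSum_almostMul ha0 g α β τ z
    rwa [e]
  · funext τ z
    simp [almostMul]

/-- Products are built one generator at a time, since every generator has a completion linear in ν
and ξ. -/
theorem exists_quasiTame {s : Set (OffLattice → ℂ)} {M : AddSubmonoid ℚ}
    (hs : ∀ x ∈ s, ∃ (k : ℤ) (m : ℚ) (g : ℍ → ℂ → ℂ) (α β : ℂ), m ∈ M ∧ Tame S g ∧
      SlashInv k m (fun τ z => g τ z + α * xi τ z + β * nu τ) ∧ x = res g) :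
    ∀ x ∈ Submonoid.closure s, ∃ (k : ℤ) (m : ℚ) (φ : ℍ → ℂ → ℂ), m ∈ M ∧ QuasiTame S k m φ ∧
      x = res φ := by
  intro x hx
  induction hx using Submonoid.closure_induction_right with
  | one => exact ⟨0, 0, _, M.zero_mem, QuasiTame.one, rfl⟩
  | mul_right x _ y hy ih =>
    obtain ⟨k, m, φ, hm, h, rfl⟩ := ih
    obtain ⟨k', m', g, α, β, hm', hg, hsg, rfl⟩ := hs y hy
    exact ⟨_, _, _, M.add_mem hm hm', h.mul hg hsg, rfl⟩

/-! ### Continuity of almost holomorphic sums and construction of quasi-Jacobi forms -/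

theorem continuousAt_ofComplex_im (τ : ℍ) (z : ℂ) :
    ContinuousAt (fun p : ℂ × ℂ => (((ofComplex p.1).im : ℝ) : ℂ)) ((τ : ℂ), z) := by
  have h : ContinuousAt (fun p : ℂ × ℂ => ((p.1.im : ℝ) : ℂ)) ((τ : ℂ), z) := by fun_prop
  refine h.congr ?_
  filter_upwards [eventually_imPos] with p hp
  rw [ofComplex_apply_of_im_pos hp]
  rfl

theorem continuousAt_almostSum {d : ℕ} {a : ℕ → ℕ → ℍ → ℂ → ℂ} {τ : ℍ} {z : ℂ}
    (h : AllHolAt d a τ z) : ContinuousAt (uncurried (almostSum d a)) ((τ : ℂ), z) := by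
  have him := continuousAt_ofComplex_im τ z
  have hy : ((τ.im : ℝ) : ℂ) ≠ 0 := by exact_mod_cast τ.im_pos.ne'
  have h1 : ContinuousAt (fun p : ℂ × ℂ => nu (ofComplex p.1)) ((τ : ℂ), z) :=
    continuousAt_const.div (continuousAt_const.mul him) (by simp [τ.im_pos.ne'])
  have h2 : ContinuousAt (fun p : ℂ × ℂ => xi (ofComplex p.1) p.2) ((τ : ℂ), z) :=
    ContinuousAt.div (by fun_prop) him (by simp [τ.im_pos.ne'])
  have : uncurried (almostSum d a) = fun p : ℂ × ℂ => ∑ i ∈ Finset.range (d + 1),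
      ∑ j ∈ Finset.range (d + 1), uncurried (a i j) p * nu (ofComplex p.1) ^ i *
        xi (ofComplex p.1) p.2 ^ j := rfl
  rw [this]
  refine tendsto_finsetSum (Finset.range (d + 1)) fun i hi =>
    tendsto_finsetSum (Finset.range (d + 1)) fun j hj => ?_
  exact (((h i (by simpa [Nat.lt_succ_iff] using hi) j
    (by simpa [Nat.lt_succ_iff] using hj)).continuousAt).mul (h1.pow i)).mul (h2.pow j)

theorem continuousAt_slash {Φ : ℍ → ℂ → ℂ} {γ : Matrix.SpecialLinearGroup (Fin 2) ℤ} {l u : ℤ}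
    {τ : ℍ} {z : ℂ}
    (h : ContinuousAt (uncurried Φ) (((γ • τ : ℍ) : ℂ), (z + l * τ + u) / cocycle γ τ)) :
    ContinuousAt (uncurried (slash k m γ l u Φ)) ((τ : ℂ), z) := by
  obtain ⟨h1, -, h3⟩ := holAt_smul γ l u τ z
  have h4 : ContinuousAt (fun p : ℂ × ℂ =>
      Φ (γ • ofComplex p.1) ((p.2 + l * (ofComplex p.1 : ℂ) + u) / cocycle γ (ofComplex p.1)))
      ((τ : ℂ), z) := by
    have := ContinuousAt.comp_of_eq (f := fun p : ℂ × ℂ =>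
      (((γ • ofComplex p.1 : ℍ) : ℂ), (p.2 + l * (ofComplex p.1 : ℂ) + u) / cocycle γ (ofComplex p.1)))
      (y := (((γ • τ : ℍ) : ℂ), (z + l * τ + u) / cocycle γ τ)) h
      (h1.continuousAt.prodMk h3.continuousAt) (by simp)
    refine this.congr (.of_forall fun p => ?_)
    simp [uncurried]
  have h5 : HolAt (slash k m γ l u (fun _ _ => 1)) τ z := HolAt.slash (HolAt.const 1 _ _)
  refine (h5.continuousAt.mul h4).congr (.of_forall fun p => ?_)
  simp only [uncurried, Pi.mul_apply, slash_apply]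
  ring

/-- The invariance, known off the lattice, extends by continuity and density to the lattice points
at which all coefficients are holomorphic on both sides. -/
theorem QuasiTame.isQuasiJacobi (h : QuasiTame S k m φ) {T : (ℍ → ℂ → ℂ) → Prop}
    (hT : ∀ ψ, Tame S ψ → T (holExtend ψ)) : IsQuasiJacobi T k m (holExtend φ) := by
  obtain ⟨d, a, ha, -, hs, rfl⟩ := h
  refine ⟨d, fun i j => holExtend (a i j), fun i _ j _ => hT _ (ha i j), ?_, rfl⟩
  intro γ l u τ z h1 h2
  have he : ∀ τ z, z ∉ lattice τ →
      almostSum d (fun i j => holExtend (a i j)) τ z = almostSum d a τ z := by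
    intro τ z hz
    refine Finset.sum_congr rfl fun i _ => Finset.sum_congr rfl fun j _ => ?_
    simp only [holExtend_of_notMem (ha i j).hol hz]
  have := eq_of_eventually_offLattice (continuousAt_slash (k := k) (m := m)
    (continuousAt_almostSum h2)) (continuousAt_almostSum h1) (.of_forall fun p hp => ?_)
  · simpa only [uncurried_coe] using this
  · rw [uncurried, uncurried, he _ _ hp, ← hs γ l u _ _ hp, slash_apply, slash_apply, he]
    rwa [add_assoc, notMem_lattice_transform]

theorem QuasiTame.polesInLattice (h : QuasiTame S k m φ) : PolesInLattice φ := by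
  obtain ⟨d, a, ha, -, -, rfl⟩ := h
  exact (ha 0 0).hol

theorem add_zero_mul_xi_nu (g : ℍ → ℂ → ℂ) :
    (fun τ z => g τ z + 0 * xi τ z + 0 * nu τ) = g := by
  funext τ z
  ring

theorem le_latticeForms_quasi_weak :
    Subalgebra.toSubmodule (genAlg {res (E 1), res (E 2), res (E 3), res (eis 2), res (eis 4),
      res Theta}) ≤ latticeForms (IsQuasiJacobi WeakStrictlyMer) {m | 0 ≤ m} := by
  rw [genAlg, Algebra.adjoin_eq_span, Submodule.span_le]
  intro x hx
  obtain ⟨k, m, φ, hm, h, rfl⟩ := exists_quasiTame (S := {(1, 0)}) (M := AddSubmonoid.nonneg ℚ) (by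
    rintro x (rfl | rfl | rfl | rfl | rfl | rfl)
    · exact ⟨1, 0, E 1, _, _, zero_mem _, tame_E_one, slashInv_E_one_hat, rfl⟩
    · exact ⟨2, 0, E 2, _, _, zero_mem _, tame_E_two, slashInv_E_two_hat, rfl⟩
    · exact ⟨3, 0, E 3, 0, 0, zero_mem _, tame_E_three, by
        rw [add_zero_mul_xi_nu]; exact slashInv_E_three, rfl⟩
    · exact ⟨2, 0, eis 2, _, _, zero_mem _, tame_eis_two, slashInv_eis_two_hat, rfl⟩
    · exact ⟨4, 0, eis 4, 0, 0, zero_mem _, tame_eis_four, by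
        rw [add_zero_mul_xi_nu]; exact slashInv_eis_four, rfl⟩
    · exact ⟨-1, 1 / 2, Theta, 0, 0, by simp, tame_Theta, by
        rw [add_zero_mul_xi_nu]; exact slashInv_Theta, rfl⟩) x hx
  exact Submodule.subset_span ⟨k, m, holExtend φ, hm,
    h.isQuasiJacobi fun ψ hψ => hψ.weakStrictlyMer rfl,
    polesInLattice_holExtend h.polesInLattice, (res_holExtend h.polesInLattice).symm⟩

theorem le_latticeForms_quasi_strict :
    Subalgebra.toSubmodule (genAlg {res (E 1), res (E 2), res (E 3), res (eis 2), res (eis 4)}) ≤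
      latticeForms (fun k m => IsQuasiJacobi (StrictlyMer m) k m) {0} := by
  rw [genAlg, Algebra.adjoin_eq_span, Submodule.span_le]
  intro x hx
  obtain ⟨k, m, φ, hm, h, rfl⟩ := exists_quasiTame (S := Set.univ) (M := ⊥) (by
    rintro x (rfl | rfl | rfl | rfl | rfl)
    · exact ⟨1, 0, E 1, _, _, zero_mem _, tame_E_one, slashInv_E_one_hat, rfl⟩
    · exact ⟨2, 0, E 2, _, _, zero_mem _, tame_E_two, slashInv_E_two_hat, rfl⟩
    · exact ⟨3, 0, E 3, 0, 0, zero_mem _, tame_E_three, by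
        rw [add_zero_mul_xi_nu]; exact slashInv_E_three, rfl⟩
    · exact ⟨2, 0, eis 2, _, _, zero_mem _, tame_eis_two, slashInv_eis_two_hat, rfl⟩
    · exact ⟨4, 0, eis 4, 0, 0, zero_mem _, tame_eis_four, by
        rw [add_zero_mul_xi_nu]; exact slashInv_eis_four, rfl⟩) x hx
  obtain rfl : m = 0 := hm
  exact Submodule.subset_span ⟨k, 0, holExtend φ, rfl,
    h.isQuasiJacobi fun ψ hψ => hψ.strictlyMer_zero,
    polesInLattice_holExtend h.polesInLattice, (res_holExtend h.polesInLattice).symm⟩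

end Almost

/-! ### Independence of `ν` and `ξ` over holomorphic functions -/

section Independence

/-- For fixed y the holomorphic function z ↦ G(ρ(y), z) vanishes on the line Im z = y, hence near
z₀. So X ↦ G(X, z₀) vanishes at the points ρ(y), which accumulate at ρ(Im z₀), and is zero. -/
theorem eq_zero_of_im {G : ℂ → ℂ → ℂ} {ρ : ℝ → ℂ} {z₀ : ℂ}
    (hX : Differentiable ℂ fun X => G X z₀)
    (hρ : Tendsto ρ (𝓝[≠] z₀.im) (𝓝[≠] ρ z₀.im))
    (hz : ∀ᶠ z in 𝓝 z₀, (∀ X, AnalyticAt ℂ (G X) z) ∧ G (ρ z.im) z = 0) (X : ℂ) :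
    G X z₀ = 0 := by
  obtain ⟨r, hr, hb⟩ := Metric.eventually_nhds_iff_ball.1 hz
  have h1 : ∀ y ∈ Metric.ball z₀.im r, G (ρ y) z₀ = 0 := by
    intro y hy
    set w : ℂ := ⟨z₀.re, y⟩
    have hw : w ∈ Metric.ball z₀ r := by
      rw [Metric.mem_ball, Complex.dist_of_re_eq (z := w) (w := z₀) rfl]
      exact hy
    have ht : Tendsto (fun t : ℝ => w + t) (𝓝[≠] 0) (𝓝[≠] w) := by
      refine tendsto_nhdsWithin_of_tendsto_nhds_of_eventually_within _ ?_ ?_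
      · have : ContinuousAt (fun t : ℝ => w + t) 0 := by fun_prop
        simpa using this.tendsto.mono_left (nhdsWithin_le_nhds (s := {0}ᶜ))
      · filter_upwards [self_mem_nhdsWithin] with t ht
        simpa using ht
    refine AnalyticOnNhd.eqOn_zero_of_preconnected_of_frequently_eq_zero
      (fun z hz => (hb z hz).1 (ρ y)) (convex_ball z₀ r).isPreconnected hw
      (ht.frequently (Eventually.frequently ?_)) (Metric.mem_ball_self hr)
    filter_upwards [(ht.mono_right nhdsWithin_le_nhds).eventually
      (Metric.isOpen_ball.mem_nhds hw)] with t ht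
    have := (hb _ ht).2
    simpa [w] using this
  have h2 : AnalyticOnNhd ℂ (fun X => G X z₀) Set.univ := fun X _ => hX.analyticAt X
  refine h2.eqOn_zero_of_preconnected_of_frequently_eq_zero isPreconnected_univ
    (Set.mem_univ (ρ z₀.im)) (hρ.frequently (Eventually.frequently ?_)) (Set.mem_univ X)
  filter_upwards [nhdsWithin_le_nhds (Metric.ball_mem_nhds z₀.im hr)] with y hy
  exact h1 y hy

theorem tendsto_punctured {ρ : ℝ → ℂ} {y : ℝ} (hc : ContinuousAt ρ y)
    (hi : ∀ᶠ t in 𝓝[≠] y, ρ t ≠ ρ y) : Tendsto ρ (𝓝[≠] y) (𝓝[≠] ρ y) :=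
  tendsto_nhdsWithin_of_tendsto_nhds_of_eventually_within _
    (hc.tendsto.mono_left nhdsWithin_le_nhds) hi

/-- `eq_zero_of_im` is used twice: in z with τ fixed, to free the value of ξ, and then in τ with z
fixed, to free the value of ν. -/
theorem eq_zero_of_nu_xi {F : ℂ → ℂ → ℂ × ℂ → ℂ} {τ : ℍ} {z : ℂ}
    (hX : ∀ Y p, Differentiable ℂ fun X => F X Y p) (hY : ∀ X p, Differentiable ℂ fun Y => F X Y p)
    (h : ∀ᶠ p in 𝓝 ((τ : ℂ), z), (∀ X Y, AnalyticAt ℂ (F X Y) p) ∧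
      F (nu (ofComplex p.1)) (xi (ofComplex p.1) p.2) p = 0) (X Y : ℂ) :
    F X Y ((τ : ℂ), z) = 0 := by
  have h1 : ∀ᶠ p in 𝓝 ((τ : ℂ), z), (∀ X Y, AnalyticAt ℂ (F X Y) p) ∧
      ∀ Y, F (nu (ofComplex p.1)) Y p = 0 := by
    filter_upwards [h.eventually_nhds, h] with p hp hp'
    refine ⟨hp'.1, fun Y => ?_⟩
    have hy : (ofComplex p.1).im ≠ 0 := (ofComplex p.1).im_pos.ne'
    have hs : Tendsto (fun w : ℂ => (p.1, w)) (𝓝 p.2) (𝓝 p) :=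
      (by fun_prop : Continuous fun w : ℂ => (p.1, w)).tendsto _
    refine eq_zero_of_im (G := fun Y w => F (nu (ofComplex p.1)) Y (p.1, w))
      (ρ := fun y => (y : ℂ) / ((ofComplex p.1).im : ℂ)) (hY _ _) (tendsto_punctured ?_ ?_) ?_ Y
    · fun_prop (disch := exact_mod_cast hy)
    · filter_upwards [self_mem_nhdsWithin] with t ht he
      have hy' : ((ofComplex p.1).im : ℂ) ≠ 0 := by exact_mod_cast hy
      rw [div_left_inj' hy'] at he
      exact ht (by exact_mod_cast he)
    · filter_upwards [hs.eventually hp] with w hw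
      exact ⟨fun X => (hw.1 _ _).along_snd, hw.2⟩
  have hs : Tendsto (fun s : ℂ => (s, z)) (𝓝 (τ : ℂ)) (𝓝 ((τ : ℂ), z)) :=
    (by fun_prop : Continuous fun s : ℂ => (s, z)).tendsto _
  have hy : ((τ : ℂ)).im ≠ 0 := τ.im_pos.ne'
  refine eq_zero_of_im (G := fun X s => F X Y (s, z)) (ρ := fun y => 1 / (2 * I * (y : ℂ)))
    (hX _ _) (tendsto_punctured ?_ ?_) ?_ X
  · have : (2 * I * ((τ : ℂ).im : ℂ)) ≠ 0 :=
      mul_ne_zero (by simp) (by exact_mod_cast hy)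
    fun_prop (disch := assumption)
  · filter_upwards [self_mem_nhdsWithin] with t ht he
    rw [one_div, one_div, inv_inj, mul_right_inj' (by simp)] at he
    exact ht (by exact_mod_cast he)
  · filter_upwards [hs.eventually h1, (isOpen_lt continuous_const Complex.continuous_im).mem_nhds
      τ.im_pos] with s hs1 hs2
    refine ⟨fun X => (hs1.1 _ _).along_fst, ?_⟩
    have := hs1.2 Y
    rw [nu, ofComplex_apply_of_im_pos hs2] at this
    exact this

end Independence

/-! ### Generic properties -/

/-- A property holding near `p₀` off the zero set of a nonzero analytic function. -/
def Generic (P : ℂ × ℂ → Prop) (p₀ : ℂ × ℂ) : Prop :=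
  ∃ h : ℂ × ℂ → ℂ, AnalyticAt ℂ h p₀ ∧ (∃ᶠ p in 𝓝 p₀, h p ≠ 0) ∧ ∀ᶠ p in 𝓝 p₀, h p ≠ 0 → P p

section Generic

variable {P Q : ℂ × ℂ → Prop} {p₀ : ℂ × ℂ}

/-- Germs of analytic functions form a domain: near a point with f ≠ 0 the factor g would vanish,
hence on a whole ball by the identity theorem. -/
theorem frequently_mul_ne_zero {f g : ℂ × ℂ → ℂ} (hf : AnalyticAt ℂ f p₀) (hg : AnalyticAt ℂ g p₀)
    (hf0 : ∃ᶠ p in 𝓝 p₀, f p ≠ 0) (hg0 : ∃ᶠ p in 𝓝 p₀, g p ≠ 0) :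
    ∃ᶠ p in 𝓝 p₀, f p * g p ≠ 0 := by
  intro hn
  obtain ⟨r, hr, hb⟩ := Metric.eventually_nhds_iff_ball.1
    (hn.and (hf.eventually_analyticAt.and hg.eventually_analyticAt))
  obtain ⟨p₁, h1, hp₁⟩ := (hf0.and_eventually (Metric.ball_mem_nhds p₀ hr)).exists
  have h2 : g =ᶠ[𝓝 p₁] 0 := by
    filter_upwards [(hb p₁ hp₁).2.1.continuousAt.eventually_ne h1,
      Metric.isOpen_ball.mem_nhds hp₁] with p hp hp'
    exact (mul_eq_zero.1 (not_not.1 (hb p hp').1)).resolve_left hp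
  have h3 := AnalyticOnNhd.eqOn_zero_of_preconnected_of_eventuallyEq_zero
    (fun p hp => (hb p hp).2.2) (convex_ball p₀ r).isPreconnected hp₁ h2
  refine hg0 ?_
  filter_upwards [Metric.ball_mem_nhds p₀ hr] with p hp
  exact not_not.2 (h3 hp)

theorem Generic.true : Generic (fun _ => True) p₀ :=
  ⟨fun _ => 1, analyticAt_const, (Eventually.of_forall fun _ => one_ne_zero).frequently,
    .of_forall fun _ _ => trivial⟩

theorem Generic.and (hP : Generic P p₀) (hQ : Generic Q p₀) : Generic (fun p => P p ∧ Q p) p₀ := by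
  obtain ⟨f, hf, hf0, hfP⟩ := hP
  obtain ⟨g, hg, hg0, hgQ⟩ := hQ
  refine ⟨fun p => f p * g p, hf.fun_mul hg, frequently_mul_ne_zero hf hg hf0 hg0, ?_⟩
  filter_upwards [hfP, hgQ] with p h1 h2 h
  exact ⟨h1 (left_ne_zero_of_mul h), h2 (right_ne_zero_of_mul h)⟩

theorem Generic.mono (hP : Generic P p₀) (h : ∀ p, P p → Q p) : Generic Q p₀ := by
  obtain ⟨f, hf, hf0, hfP⟩ := hP
  exact ⟨f, hf, hf0, hfP.mono fun p hp h0 => h p (hp h0)⟩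

theorem Generic.forall_mem {ι : Type*} {P : ι → ℂ × ℂ → Prop} (s : Finset ι)
    (h : ∀ i ∈ s, Generic (P i) p₀) : Generic (fun p => ∀ i ∈ s, P i p) p₀ := by
  classical
  induction s using Finset.induction_on with
  | empty => exact Generic.true.mono fun p _ i hi => absurd hi (Finset.notMem_empty i)
  | insert j s _ ih =>
    refine ((h j (Finset.mem_insert_self j s)).and
      (ih fun i hi => h i (Finset.mem_insert_of_mem hi))).mono fun p hp i hi => ?_
    rcases Finset.mem_insert.1 hi with rfl | hi
    · exact hp.1
    · exact hp.2 i hi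

theorem JacobiForms.IsMeromorphic.generic_analyticAt {φ : ℍ → ℂ → ℂ} (hφ : IsMeromorphic φ)
    (τ : ℍ) (z : ℂ) : Generic (fun p => 0 < p.1.im ∧ HolAt φ (ofComplex p.1) p.2) ((τ : ℂ), z) := by
  obtain ⟨g, h, hg, hh, h0, he⟩ := hφ.quotient τ z
  refine ⟨h, hh, h0, ?_⟩
  filter_upwards [hg.eventually_analyticAt, hh.eventually_analyticAt, he.eventually_nhds,
    eventually_imPos] with p hgp hhp hep hp hne
  refine ⟨hp, ?_⟩
  rw [HolAt, ofComplex_apply_of_im_pos hp]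
  refine (hgp.fun_div hhp hne).congr ?_
  filter_upwards [hep, hhp.continuousAt.eventually_ne hne] with q h1 h2
  exact (h1 h2).symm

theorem JacobiForms.IsMeromorphic.holAt_of_generic {φ : ℍ → ℂ → ℂ} (hφ : IsMeromorphic φ) {τ : ℍ} {z : ℂ}
    {g : ℂ × ℂ → ℂ} (hg : AnalyticAt ℂ g ((τ : ℂ), z))
    (h : Generic (fun p => uncurried φ p = g p) ((τ : ℂ), z)) : HolAt φ τ z := by
  obtain ⟨f, hf, hf0, hfP⟩ := h
  exact hφ.removable τ z ⟨g, f, hg, hf, hf0, hfP⟩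

theorem transform_inv' (γ : Matrix.SpecialLinearGroup (Fin 2) ℤ) (l u : ℤ) (τ : ℍ) (z : ℂ) :
    (((z + (-(l * γ.1 1 1 - u * γ.1 1 0) : ℤ) * (τ : ℂ) + (-(-l * γ.1 0 1 + u * γ.1 0 0) : ℤ)) /
      cocycle γ⁻¹ τ) + l * ((γ⁻¹ • τ : ℍ) : ℂ) + u) / cocycle γ (γ⁻¹ • τ) = z := by
  have h := transform_inv γ⁻¹ (-(l * γ.1 1 1 - u * γ.1 1 0)) (-(-l * γ.1 0 1 + u * γ.1 0 0)) τ z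
  have h2 := Matrix.SpecialLinearGroup.det_coe γ
  rw [Matrix.det_fin_two] at h2
  have e1 : (-(-(l * γ.1 1 1 - u * γ.1 1 0) * γ⁻¹.1 1 1 - -(-l * γ.1 0 1 + u * γ.1 0 0) * γ⁻¹.1 1 0) : ℤ) = l := by
    rw [Matrix.SpecialLinearGroup.SL2_inv_expl]
    simp
    linear_combination l * h2
  have e2 : (-(- -(l * γ.1 1 1 - u * γ.1 1 0) * γ⁻¹.1 0 1 + -(-l * γ.1 0 1 + u * γ.1 0 0) * γ⁻¹.1 0 0) : ℤ) = u := by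
    rw [Matrix.SpecialLinearGroup.SL2_inv_expl]
    simp
    linear_combination u * h2
  rwa [e1, e2, inv_inv] at h

/-- The action of `(γ, (λ, μ))` on `ℍ × ℂ`. -/
noncomputable def jacobiMap (γ : Matrix.SpecialLinearGroup (Fin 2) ℤ) (l u : ℤ) (p : ℂ × ℂ) : ℂ × ℂ :=
  (((γ • ofComplex p.1 : ℍ) : ℂ),
    (p.2 + l * (ofComplex p.1 : ℂ) + u) / cocycle γ (ofComplex p.1))

theorem analyticAt_jacobiMap (γ : Matrix.SpecialLinearGroup (Fin 2) ℤ) (l u : ℤ) (τ : ℍ) (z : ℂ) :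
    AnalyticAt ℂ (jacobiMap γ l u) ((τ : ℂ), z) :=
  AnalyticAt.prod (holAt_smul γ l u τ z).1 (holAt_smul γ l u τ z).2.2

theorem jacobiMap_coe (γ : Matrix.SpecialLinearGroup (Fin 2) ℤ) (l u : ℤ) (τ : ℍ) (z : ℂ) :
    jacobiMap γ l u ((τ : ℂ), z) = (((γ • τ : ℍ) : ℂ), (z + l * τ + u) / cocycle γ τ) := by
  simp [jacobiMap]

/-- The exceptional function is pulled back; it stays nonzero because the group element has a
continuous inverse. -/
theorem Generic.comp_jacobiMap {γ : Matrix.SpecialLinearGroup (Fin 2) ℤ} {l u : ℤ} {τ : ℍ} {z : ℂ}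
    (h : Generic P (((γ • τ : ℍ) : ℂ), (z + l * τ + u) / cocycle γ τ)) :
    Generic (fun p => P (jacobiMap γ l u p)) ((τ : ℂ), z) := by
  obtain ⟨f, hf, hf0, hfP⟩ := h
  have hT := analyticAt_jacobiMap γ l u τ z
  have e := jacobiMap_coe γ l u τ z
  refine ⟨fun p => f (jacobiMap γ l u p), AnalyticAt.fun_comp_of_eq hf hT e, ?_, ?_⟩
  · set S := jacobiMap γ⁻¹ (-(l * γ.1 1 1 - u * γ.1 1 0)) (-(-l * γ.1 0 1 + u * γ.1 0 0)) with hS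
    have hSc : Tendsto S (𝓝 (((γ • τ : ℍ) : ℂ), (z + l * τ + u) / cocycle γ τ)) (𝓝 ((τ : ℂ), z)) := by
      have := (analyticAt_jacobiMap γ⁻¹ (-(l * γ.1 1 1 - u * γ.1 1 0)) (-(-l * γ.1 0 1 + u * γ.1 0 0))
        (γ • τ) ((z + l * τ + u) / cocycle γ τ)).continuousAt.tendsto
      rwa [jacobiMap_coe, transform_inv, inv_smul_smul] at this
    refine hSc.frequently ((hf0.and_eventually eventually_imPos).mono fun p hp => ?_)
    have : jacobiMap γ l u (S p) = p := by
      rw [hS, jacobiMap, jacobiMap, ofComplex_apply, transform_inv', smul_inv_smul,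
        ofComplex_apply_of_im_pos hp.2]
    simp only [this]
    exact hp.1
  · have := hT.continuousAt.tendsto
    rw [e] at this
    exact this.eventually hfP

end Generic

/-! ### Linear systems with analytic coefficients -/

theorem AnalyticAt.det {n : ℕ} {E : Type*} [NormedAddCommGroup E] [NormedSpace ℂ E]
    {M : E → Matrix (Fin n) (Fin n) ℂ} {p₀ : E} (h : ∀ i j, AnalyticAt ℂ (fun p => M p i j) p₀) :
    AnalyticAt ℂ (fun p => (M p).det) p₀ := by
  simp only [Matrix.det_apply']
  exact Finset.analyticAt_fun_sum _ fun σ _ => analyticAt_const.fun_mul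
    (Finset.analyticAt_fun_prod _ fun i _ => h _ _)

/-- Cramer's rule for a Vandermonde system with distinct nodes at p₀. The solution formula is fixed
before the unknowns are given, so it applies to coefficients not yet known to be analytic. -/
theorem exists_analytic_solution {n : ℕ} {p₀ : ℂ × ℂ} {x H : Fin n → ℂ × ℂ → ℂ}
    (hx : ∀ i, AnalyticAt ℂ (x i) p₀) (hH : ∀ i, AnalyticAt ℂ (H i) p₀)
    (hi : Function.Injective fun i => x i p₀) : ∃ C : Fin n → ℂ × ℂ → ℂ,
      (∀ i, AnalyticAt ℂ (C i) p₀) ∧ ∀ᶠ p in 𝓝 p₀, ∀ c : Fin n → ℂ,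
        (∀ i, ∑ j, c j * x i p ^ (j : ℕ) = H i p) → ∀ j, c j = C j p := by
  set V : ℂ × ℂ → Matrix (Fin n) (Fin n) ℂ := fun p => Matrix.vandermonde fun i => x i p
  have hV : ∀ i j, AnalyticAt ℂ (fun p => V p i j) p₀ := fun i j => (hx i).fun_pow j
  have hdet := AnalyticAt.det hV
  have h0 : (V p₀).det ≠ 0 := Matrix.det_vandermonde_ne_zero_iff.2 hi
  refine ⟨fun j p => ((V p).updateCol j fun i => H i p).det / (V p).det, fun j => ?_, ?_⟩
  · refine (AnalyticAt.det fun i i' => ?_).fun_div hdet h0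
    simp only [Matrix.updateCol_apply]
    split_ifs
    · exact hH i
    · exact hV i i'
  · filter_upwards [hdet.continuousAt.eventually_ne h0] with p hp c hc j
    have h1 : (V p).mulVec c = fun i => H i p := by
      funext i
      rw [← hc i]
      simp only [Matrix.mulVec, dotProduct, V, Matrix.vandermonde_apply, mul_comm]
    rw [← Matrix.cramer_apply, Matrix.cramer_eq_adjugate_mulVec, ← h1, Matrix.mulVec_mulVec,
      Matrix.adjugate_mul, Matrix.smul_mulVec, Matrix.one_mulVec, Pi.smul_apply, smul_eq_mul,
      mul_div_cancel_left₀ _ hp]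

/-! ### The coefficients of almost Jacobi forms -/

/-- The polynomial `∑_{i,j ≤ d} a_{ij} X^i Y^j`. -/
def polySum (d : ℕ) (a : ℕ → ℕ → ℍ → ℂ → ℂ) (X Y : ℂ) : ℍ → ℂ → ℂ := fun τ z =>
  ∑ i ∈ Finset.range (d + 1), ∑ j ∈ Finset.range (d + 1), a i j τ z * X ^ i * Y ^ j

/-- Invariance of `∑ a_{ij} ν^i ξ^j` wherever both sides are defined. -/
def AlmostInv (k : ℤ) (m : ℚ) (d : ℕ) (a : ℕ → ℕ → ℍ → ℂ → ℂ) : Prop :=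
  ∀ (γ : Matrix.SpecialLinearGroup (Fin 2) ℤ) (l u : ℤ) (τ : ℍ) (z : ℂ), AllHolAt d a τ z →
    AllHolAt d a (γ • τ) ((z + l * (τ : ℂ) + u) / cocycle γ τ) →
    slash k m γ l u (almostSum d a) τ z = almostSum d a τ z

section Coefficients

variable {k : ℤ} {m : ℚ} {d : ℕ} {a : ℕ → ℕ → ℍ → ℂ → ℂ}

theorem slash_polySum (γ : Matrix.SpecialLinearGroup (Fin 2) ℤ) (l u : ℤ) (X Y : ℂ) (τ : ℍ) (z : ℂ) :
    slash k m γ l u (polySum d a X Y) τ z =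
      polySum d (fun i j => slash k m γ l u (a i j)) X Y τ z := by
  simp only [slash_apply, polySum, Finset.mul_sum]
  exact Finset.sum_congr rfl fun i _ => Finset.sum_congr rfl fun j _ => by ring

theorem polySum_zero : polySum d a 0 0 = a 0 0 := by
  funext τ z
  rw [polySum, Finset.sum_eq_single 0, Finset.sum_eq_single 0]
  · simp
  · intro j _ hj
    simp [hj]
  · simp
  · intro i _ hi
    simp [hi]
  · simp

theorem holAt_polySum {f g : ℍ → ℂ → ℂ} {τ : ℍ} {z : ℂ} (ha : AllHolAt d a τ z)
    (hf : HolAt f τ z) (hg : HolAt g τ z) :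
    HolAt (fun τ z => polySum d a (f τ z) (g τ z) τ z) τ z := by
  have : uncurried (fun τ z => polySum d a (f τ z) (g τ z) τ z) = fun p =>
      ∑ i ∈ Finset.range (d + 1), ∑ j ∈ Finset.range (d + 1),
        uncurried (a i j) p * uncurried f p ^ i * uncurried g p ^ j := rfl
  rw [HolAt, this]
  refine Finset.analyticAt_fun_sum _ fun i hi => Finset.analyticAt_fun_sum _ fun j hj => ?_
  exact (AnalyticAt.fun_mul (ha i (Finset.mem_range_succ_iff.1 hi) j (Finset.mem_range_succ_iff.1 hj))
    (hf.fun_pow i)).fun_mul (hg.fun_pow j)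

theorem AllHolAt.eventually {τ : ℍ} {z : ℂ} (h : AllHolAt d a τ z) :
    ∀ᶠ p in 𝓝 ((τ : ℂ), z), AllHolAt d a (ofComplex p.1) p.2 := by
  have : ∀ᶠ p in 𝓝 ((τ : ℂ), z), ∀ i ∈ Finset.range (d + 1), ∀ j ∈ Finset.range (d + 1),
      HolAt (a i j) (ofComplex p.1) p.2 :=
    (Filter.eventually_all_finset _).2 fun i hi => (Filter.eventually_all_finset _).2 fun j hj =>
      (h i (Finset.mem_range_succ_iff.1 hi) j (Finset.mem_range_succ_iff.1 hj)).eventually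
  exact this.mono fun p hp i hi j hj =>
    hp i (Finset.mem_range_succ_iff.2 hi) j (Finset.mem_range_succ_iff.2 hj)

/-- The invariance is an identity of polynomials in `ν` and `ξ`. -/
theorem AlmostInv.slash_polySum_eq (hinv : AlmostInv k m d a)
    {γ : Matrix.SpecialLinearGroup (Fin 2) ℤ} {l u : ℤ} {τ : ℍ} {z : ℂ} (h1 : AllHolAt d a τ z)
    (h2 : AllHolAt d a (γ • τ) ((z + l * (τ : ℂ) + u) / cocycle γ τ)) (X Y : ℂ) :
    slash k m γ l u (polySum d a (cocycle γ τ ^ 2 * X - (γ.1 1 0 : ℤ) * cocycle γ τ)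
      (cocycle γ τ * (Y + l) - (γ.1 1 0 : ℤ) * (z + l * τ + u))) τ z = polySum d a X Y τ z := by
  -- The invariance says that F vanishes at X = ν, Y = ξ; independence of ν and ξ makes it vanish
  -- for all X and Y.
  set F : ℂ → ℂ → ℂ × ℂ → ℂ := fun X Y => uncurried fun τ z =>
    polySum d (fun i j => slash k m γ l u (a i j))
      (cocycle γ τ ^ 2 * X - (γ.1 1 0 : ℤ) * cocycle γ τ)
      (cocycle γ τ * (Y + l) - (γ.1 1 0 : ℤ) * (z + l * τ + u)) τ z - polySum d a X Y τ z with hF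
  have key : ∀ X Y, F X Y ((τ : ℂ), z) = 0 := by
    refine eq_zero_of_nu_xi (fun Y p => ?_) (fun X p => ?_) ?_
    · simp only [hF, uncurried, polySum]
      fun_prop
    · simp only [hF, uncurried, polySum]
      fun_prop
    have h3 : ∀ᶠ p in 𝓝 ((τ : ℂ), z), AllHolAt d a (γ • ofComplex p.1)
        ((p.2 + l * (ofComplex p.1 : ℂ) + u) / cocycle γ (ofComplex p.1)) := by
      have h4 := (analyticAt_jacobiMap γ l u τ z).continuousAt.tendsto
      rw [jacobiMap_coe] at h4
      filter_upwards [h4.eventually (AllHolAt.eventually h2)] with p hp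
      rwa [jacobiMap, ofComplex_apply] at hp
    filter_upwards [AllHolAt.eventually h1, h3, eventually_imPos] with p hp1 hp2 hp
    have e : ((ofComplex p.1 : ℍ) : ℂ) = p.1 := by rw [ofComplex_apply_of_im_pos hp]
    set σ := ofComplex p.1
    constructor
    · intro X Y
      obtain ⟨-, hJ, -⟩ := holAt_smul γ l u σ p.2
      have hw := ((HolAt.snd σ p.2).add ((HolAt.const l σ p.2).mul (HolAt.fst σ p.2))).add
        (HolAt.const u σ p.2)
      have hc := HolAt.const (γ.1 1 0 : ℤ) σ p.2
      have := (holAt_polySum (d := d) (a := fun i j => slash k m γ l u (a i j))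
        (fun i hi j hj => HolAt.slash (hp2 i hi j hj))
        (((hJ.pow 2).mul (HolAt.const X σ p.2)).sub (hc.mul hJ))
        ((hJ.mul (HolAt.const (Y + l) σ p.2)).sub (hc.mul hw))).sub
        (holAt_polySum hp1 (HolAt.const X σ p.2) (HolAt.const Y σ p.2))
      rw [HolAt, e] at this
      exact this
    · have h5 := hinv γ l u σ p.2 hp1 hp2
      have h6 : xi (γ • σ) ((p.2 + l * σ + u) / cocycle γ σ) =
          cocycle γ σ * (xi σ p.2 + l) - (γ.1 1 0 : ℤ) * (p.2 + l * σ + u) := by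
        rw [xi_smul, add_assoc p.2, xi_add]
      have h7 : slash k m γ l u (almostSum d a) σ p.2 = slash k m γ l u (polySum d a (nu (γ • σ))
          (xi (γ • σ) ((p.2 + l * σ + u) / cocycle γ σ))) σ p.2 := by
        rw [slash_apply, slash_apply]
        rfl
      rw [h7, slash_polySum, h6, nu_smul] at h5
      exact sub_eq_zero.2 h5
  have := key X Y
  simp only [hF, uncurried_coe, sub_eq_zero] at this
  rw [slash_polySum, this]

/-- The matrix `(0, -1; 1, s)`. -/
def nodeMatrix (s : ℤ) : Matrix.SpecialLinearGroup (Fin 2) ℤ :=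
  ⟨!![0, -1; 1, s], by simp [Matrix.det_fin_two]⟩

theorem cocycle_nodeMatrix (s : ℤ) (τ : ℍ) : cocycle (nodeMatrix s) τ = τ + s := by
  simp [cocycle, nodeMatrix]

theorem coe_add_int_ne_zero (s : ℤ) (τ : ℍ) : (τ : ℂ) + s ≠ 0 := by
  rw [← cocycle_nodeMatrix]
  exact cocycle_ne_zero _ _

/-- X and Y are the values at which the transformed variables J²X - cJ and J(Y + l) - c(z + lτ) are
zero for c = 1, J = τ + s; on the transformed side only the constant term survives. -/
theorem AlmostInv.slash_node (hinv : AlmostInv k m d a) {s l : ℤ} {τ : ℍ} {z : ℂ}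
    (h1 : AllHolAt d a τ z)
    (h2 : AllHolAt d a (nodeMatrix s • τ) ((z + l * (τ : ℂ) + (0 : ℤ)) / cocycle (nodeMatrix s) τ)) :
    polySum d a (1 / (τ + s)) ((z - l * s) / (τ + s)) τ z =
      slash k m (nodeMatrix s) l 0 (a 0 0) τ z := by
  rw [← hinv.slash_polySum_eq h1 h2, cocycle_nodeMatrix]
  have h := coe_add_int_ne_zero s τ
  have e : ((nodeMatrix s).1 1 0 : ℤ) = 1 := by simp [nodeMatrix]
  have e1 : ((τ : ℂ) + s) ^ 2 * (1 / (τ + s)) - ((nodeMatrix s).1 1 0 : ℤ) * (τ + s) = 0 := by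
    rw [e]
    field_simp
    simp
  have e2 : ((τ : ℂ) + s) * ((z - l * s) / (τ + s) + l) -
      ((nodeMatrix s).1 1 0 : ℤ) * (z + l * τ + (0 : ℤ)) = 0 := by
    rw [e, mul_add, mul_div_cancel₀ _ h]
    push_cast
    ring
  rw [e1, e2, polySum_zero]

theorem Generic.of_eventually {P : ℂ × ℂ → Prop} {p₀ : ℂ × ℂ} (h : ∀ᶠ p in 𝓝 p₀, P p) :
    Generic P p₀ :=
  ⟨fun _ => 1, analyticAt_const, (Eventually.of_forall fun _ => one_ne_zero).frequently,
    h.mono fun _ hp _ => hp⟩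

theorem generic_allHolAt (hmer : ∀ i ≤ d, ∀ j ≤ d, IsMeromorphic (a i j)) (τ : ℍ) (z : ℂ) :
    Generic (fun p => AllHolAt d a (ofComplex p.1) p.2) ((τ : ℂ), z) := by
  have := Generic.forall_mem (p₀ := ((τ : ℂ), z)) (Finset.range (d + 1)) fun i hi =>
    Generic.forall_mem (Finset.range (d + 1)) fun j hj =>
      (hmer i (Finset.mem_range_succ_iff.1 hi) j
        (Finset.mem_range_succ_iff.1 hj)).generic_analyticAt τ z
  exact this.mono fun p hp i hi j hj =>
    (hp i (Finset.mem_range_succ_iff.2 hi) j (Finset.mem_range_succ_iff.2 hj)).2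

/-- The coefficients of an almost Jacobi form have poles only in the lattice if the constant term
does. -/
theorem AlmostInv.polesInLattice (hinv : AlmostInv k m d a)
    (hmer : ∀ i ≤ d, ∀ j ≤ d, IsMeromorphic (a i j)) (h0 : PolesInLattice (a 0 0)) :
    ∀ i ≤ d, ∀ j ≤ d, PolesInLattice (a i j) := by
  intro i₀ hi₀ j₀ hj₀ τ z hz
  set p₀ : ℂ × ℂ := ((τ : ℂ), z) with hp₀
  have hden : ∀ s : ℤ, (p₀.1 + s : ℂ) ≠ 0 := fun s => coe_add_int_ne_zero s τ
  have hH : ∀ s l : ℤ, AnalyticAt ℂ (uncurried (slash k m (nodeMatrix s) l 0 (a 0 0))) p₀ := by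
    intro s l
    refine HolAt.slash (h0 _ _ ?_)
    rwa [add_assoc, notMem_lattice_transform]
  have hx : ∀ s : ℤ, AnalyticAt ℂ (fun p : ℂ × ℂ => 1 / (p.1 + s)) p₀ := fun s =>
    analyticAt_const.fun_div (analyticAt_fst.fun_add analyticAt_const) (hden s)
  have hy : ∀ s l : ℤ, AnalyticAt ℂ (fun p : ℂ × ℂ => (p.2 - l * s) / (p.1 + s)) p₀ := fun s l =>
    (analyticAt_snd.fun_sub analyticAt_const).fun_div (analyticAt_fst.fun_add analyticAt_const)
      (hden s)
  -- Interpolation in Y: for fixed s = i + 1 the nodes (z - ls)/(τ + s), l = 0, …, d, are distinct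
  -- because s ≠ 0.
  choose D hD hD' using fun i : Fin (d + 1) => exists_analytic_solution
    (n := d + 1) (fun j => hy (i + 1 : ℤ) j) (fun j => hH (i + 1 : ℤ) j) (fun j j' h => by
      simp only at h
      rw [div_left_inj' (hden _), sub_right_inj] at h
      have hs : (((i : ℤ) + 1 : ℤ) : ℂ) ≠ 0 := by
        exact_mod_cast (by omega : ((i : ℤ) + 1 : ℤ) ≠ 0)
      have := mul_right_cancel₀ hs h
      exact Fin.ext (by exact_mod_cast this))
  -- Interpolation in X at the distinct nodes 1/(τ + s), s = 1, …, d + 1, applied to the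
  -- coefficients of the first interpolation.
  choose C hC hC' using fun j : Fin (d + 1) => exists_analytic_solution
    (n := d + 1) (fun i => hx ((i : ℕ) + 1 : ℤ)) (fun i => hD i j) (fun i i' h => by
      simp only [one_div, inv_inj, add_right_inj] at h
      have : ((i : ℕ) + 1 : ℤ) = (i' : ℕ) + 1 := by exact_mod_cast h
      exact Fin.ext (by omega))
  have hg2 : ∀ s l : ℤ, Generic (fun p => AllHolAt d a (ofComplex (jacobiMap (nodeMatrix s) l 0 p).1)
      (jacobiMap (nodeMatrix s) l 0 p).2) p₀ := fun s l =>
    Generic.comp_jacobiMap (P := fun p => AllHolAt d a (ofComplex p.1) p.2) (generic_allHolAt hmer _ _)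
  have hg3 := Generic.forall_mem (p₀ := p₀) (Finset.univ : Finset (Fin (d + 1))) fun i _ =>
    Generic.forall_mem (Finset.univ : Finset (Fin (d + 1))) fun j _ => hg2 ((i : ℕ) + 1) (j : ℕ)
  have hev : ∀ᶠ p in 𝓝 p₀, 0 < p.1.im := eventually_imPos
  have hgen := ((generic_allHolAt hmer τ z).and hg3).and
    (Generic.of_eventually ((eventually_all.2 hD').and ((eventually_all.2 hC').and hev)))
  -- At generic points all finitely many evaluations are legitimate, so the coefficient agrees there
  -- with an analytic function; being meromorphic, it is then holomorphic at the point.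
  refine (hmer i₀ hi₀ j₀ hj₀).holAt_of_generic (hC ⟨j₀, by omega⟩ ⟨i₀, by omega⟩)
    (hgen.mono ?_)
  rintro p ⟨⟨h1, h2⟩, hDp, hCp, hp⟩
  have e : ((ofComplex p.1 : ℍ) : ℂ) = p.1 := by rw [ofComplex_apply_of_im_pos hp]
  refine hCp ⟨j₀, by omega⟩ (fun i => a i j₀ (ofComplex p.1) p.2) (fun i => ?_) ⟨i₀, by omega⟩
  refine hDp i (fun j => ∑ i' : Fin (d + 1), a i' j (ofComplex p.1) p.2 *
    (1 / (p.1 + ((i : ℕ) + 1 : ℤ))) ^ (i' : ℕ)) (fun j => ?_) ⟨j₀, by omega⟩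
  have h3 := h2 i (Finset.mem_univ i) j (Finset.mem_univ j)
  rw [jacobiMap, ofComplex_apply] at h3
  have h4 := hinv.slash_node h1 h3
  rw [e] at h4
  rw [uncurried, ← h4, polySum, Finset.sum_comm, Finset.sum_range]
  refine Finset.sum_congr rfl fun j' _ => ?_
  rw [Finset.sum_mul, Finset.sum_range]

end Coefficients

/-! ### The structure of quasi-Jacobi forms -/

section ShiftCoeff

variable {R : Type*} [CommRing R]

/-- The coefficients of `∑ c_i (X + t)^i`. -/
def shiftCoeff (d : ℕ) (c : ℕ → R) (t : R) (n : ℕ) : R :=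
  ∑ i ∈ Finset.range (d + 1), c i * (i.choose n : R) * t ^ (i - n)

theorem sum_shiftCoeff (d : ℕ) (c : ℕ → R) (t X : R) :
    ∑ n ∈ Finset.range (d + 1), shiftCoeff d c t n * X ^ n =
      ∑ i ∈ Finset.range (d + 1), c i * (X + t) ^ i := by
  simp only [shiftCoeff, Finset.sum_mul]
  rw [Finset.sum_comm]
  refine Finset.sum_congr rfl fun i hi => ?_
  rw [add_pow, Finset.mul_sum]
  have hi' := Finset.mem_range.1 hi
  rw [← Finset.sum_subset (Finset.range_subset_range.2 (by omega : i + 1 ≤ d + 1))]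
  · exact Finset.sum_congr rfl fun n _ => by ring
  · intro n _ hn
    rw [Nat.choose_eq_zero_of_lt (by simpa using hn)]
    simp

theorem sum_sum_shiftCoeff (d : ℕ) (c : ℕ → ℕ → R) (s t X Y : R) :
    ∑ i ∈ Finset.range (d + 1), ∑ j ∈ Finset.range (d + 1),
      shiftCoeff d (fun i => shiftCoeff d (c i) t j) s i * X ^ i * Y ^ j =
    ∑ i ∈ Finset.range (d + 1), ∑ j ∈ Finset.range (d + 1),
      c i j * (X + s) ^ i * (Y + t) ^ j := by
  rw [Finset.sum_comm]
  simp only [← Finset.sum_mul, sum_shiftCoeff]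
  simp only [Finset.sum_mul]
  rw [Finset.sum_comm]
  refine Finset.sum_congr rfl fun i _ => ?_
  have h := congrArg (· * (X + s) ^ i) (sum_shiftCoeff d (c i) t Y)
  simp only [Finset.sum_mul] at h
  refine Eq.trans (Finset.sum_congr rfl fun j _ => ?_) (h.trans (Finset.sum_congr rfl fun j _ => ?_))
  · ring
  · ring

end ShiftCoeff

theorem eq_of_sum_pow_eq {n : ℕ} {c c' : ℕ → ℂ} (h : ∀ X : ℂ,
    ∑ i ∈ Finset.range n, c i * X ^ i = ∑ i ∈ Finset.range n, c' i * X ^ i) {i : ℕ} (hi : i < n) :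
    c i = c' i := by
  have h1 : ∑ i ∈ Finset.range n, Polynomial.C (c i) * Polynomial.X ^ i =
      ∑ i ∈ Finset.range n, Polynomial.C (c' i) * Polynomial.X ^ i :=
    Polynomial.funext fun X => by simpa [Polynomial.eval_finsetSum] using h X
  have h2 := congrArg (fun p => Polynomial.coeff p i) h1
  simpa [Polynomial.finsetSum_coeff, Polynomial.coeff_X_pow, hi] using h2

theorem eq_of_sum_sum_pow_eq {n : ℕ} {c c' : ℕ → ℕ → ℂ} (h : ∀ X Y : ℂ,
    ∑ i ∈ Finset.range n, ∑ j ∈ Finset.range n, c i j * X ^ i * Y ^ j =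
      ∑ i ∈ Finset.range n, ∑ j ∈ Finset.range n, c' i j * X ^ i * Y ^ j) {i j : ℕ} (hi : i < n)
    (hj : j < n) : c i j = c' i j := by
  refine eq_of_sum_pow_eq (c := c i) (c' := c' i) (fun Y => ?_) hj
  refine eq_of_sum_pow_eq (c := fun i => ∑ j ∈ Finset.range n, c i j * Y ^ j)
    (c' := fun i => ∑ j ∈ Finset.range n, c' i j * Y ^ j) (fun X => ?_) hi
  simp only [Finset.sum_mul]
  refine Eq.trans ?_ ((h X Y).trans ?_) <;>
    exact Finset.sum_congr rfl fun i _ => Finset.sum_congr rfl fun j _ => by ring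

section Quasi

variable {k : ℤ} {m : ℚ} {d : ℕ} {a : ℕ → ℕ → ℍ → ℂ → ℂ}

/-- The coefficients of `∑ a_{ij} ν^i ξ^j` as a polynomial in `e₂ - 2πiν` and `E₁ + 2πiξ`. -/
noncomputable def jacobiCoeff (d : ℕ) (a : ℕ → ℕ → ℍ → ℂ → ℂ) (i j : ℕ) : ℍ → ℂ → ℂ :=
  shiftCoeff d (fun i => shiftCoeff d
    (fun j => ((-(2 * Real.pi * I) : ℂ)⁻¹ ^ i * (2 * Real.pi * I : ℂ)⁻¹ ^ j) • a i j) (-E 1) j)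
    (-eis 2) i

theorem shiftCoeff_apply (c : ℕ → ℍ → ℂ → ℂ) (t : ℍ → ℂ → ℂ) (n : ℕ) (τ : ℍ) (z : ℂ) :
    shiftCoeff d c t n τ z = shiftCoeff d (fun i => c i τ z) (t τ z) n := by
  simp [shiftCoeff, Finset.sum_apply]

theorem polySum_jacobiCoeff (X Y : ℂ) (τ : ℍ) (z : ℂ) : polySum d (jacobiCoeff d a) X Y τ z =
    polySum d a ((-(2 * Real.pi * I))⁻¹ * (X - eis 2 τ z)) ((2 * Real.pi * I)⁻¹ * (Y - E 1 τ z))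
      τ z := by
  simp only [polySum, jacobiCoeff, shiftCoeff_apply]
  rw [sum_sum_shiftCoeff]
  refine Finset.sum_congr rfl fun i _ => Finset.sum_congr rfl fun j _ => ?_
  simp only [Pi.smul_apply, Pi.neg_apply, smul_eq_mul, mul_pow, ← sub_eq_add_neg]
  ring

/-- Setting X = e₂ and Y = E₁ amounts to ν = ξ = 0. -/
theorem constantTerm_eq : a 0 0 = ∑ i ∈ Finset.range (d + 1), ∑ j ∈ Finset.range (d + 1),
    jacobiCoeff d a i j * eis 2 ^ i * E 1 ^ j := by
  funext τ z
  have h := polySum_jacobiCoeff (d := d) (a := a) (eis 2 τ z) (E 1 τ z) τ z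
  rw [sub_self, sub_self, mul_zero, mul_zero, polySum_zero] at h
  rw [← h, polySum]
  simp [Finset.sum_apply]

theorem slash_weight_sub (γ : Matrix.SpecialLinearGroup (Fin 2) ℤ) (l u : ℤ) (i j : ℕ)
    (ψ : ℍ → ℂ → ℂ) (τ : ℍ) (z : ℂ) : slash (k - 2 * i - j) m γ l u ψ τ z =
      slash k m γ l u ψ τ z * (cocycle γ τ ^ 2) ^ i * cocycle γ τ ^ j := by
  have h : cocycle γ τ ^ (-(k - 2 * i - j : ℤ)) =
      cocycle γ τ ^ (-k) * (cocycle γ τ ^ 2) ^ i * cocycle γ τ ^ j := by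
    rw [← pow_mul, ← zpow_natCast, ← zpow_natCast, ← zpow_add₀ (cocycle_ne_zero γ τ),
      ← zpow_add₀ (cocycle_ne_zero γ τ)]
    congr 1
    push_cast
    ring
  rw [slash_apply, slash_apply, h]
  ring

/-- In the variables X = e₂ - 2πiν and Y = E₁ + 2πiξ the group acts by the scalings J²X and JY, with
no anomaly. Comparing coefficients of X^i Y^j makes each coefficient separately invariant, of weight
lowered by 2i + j. -/
theorem AlmostInv.slashInv_jacobiCoeff (hinv : AlmostInv k m d a)
    (hp : ∀ i ≤ d, ∀ j ≤ d, PolesInLattice (a i j)) {i j : ℕ} (hi : i ≤ d) (hj : j ≤ d) :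
    SlashInv (k - 2 * i - j) m (jacobiCoeff d a i j) := by
  intro γ l u τ z hz
  have hz' : (z + l * τ + u) / cocycle γ τ ∉ lattice (γ • τ) := by
    rwa [add_assoc, notMem_lattice_transform]
  refine eq_of_sum_sum_pow_eq (n := d + 1)
    (c := fun i j => slash (k - 2 * i - j) m γ l u (jacobiCoeff d a i j) τ z)
    (c' := fun i j => jacobiCoeff d a i j τ z) (fun X Y => ?_) (by omega) (by omega)
  have hpi : (2 * Real.pi * I : ℂ) ≠ 0 := by simp [Real.pi_ne_zero]
  have h1 := hinv.slash_polySum_eq (γ := γ) (l := l) (u := u) (fun i hi j hj => hp i hi j hj τ z hz)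
    (fun i hi j hj => hp i hi j hj _ _ hz') ((-(2 * Real.pi * I))⁻¹ * (X - eis 2 τ z))
    ((2 * Real.pi * I)⁻¹ * (Y - E 1 τ z))
  rw [← polySum_jacobiCoeff] at h1
  have h2 : slash k m γ l u (polySum d (jacobiCoeff d a) (cocycle γ τ ^ 2 * X) (cocycle γ τ * Y)) τ z =
      polySum d (jacobiCoeff d a) X Y τ z := by
    rw [← h1, slash_apply, slash_apply, polySum_jacobiCoeff]
    have hE : E 1 (γ • τ) ((z + l * τ + u) / cocycle γ τ) = cocycle γ τ *
        (E 1 τ z - 2 * Real.pi * I * l) + 2 * Real.pi * I * (γ.1 1 0 : ℤ) * (z + l * τ + u) := by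
      rw [add_assoc, E_one_smul γ ((add_mem_lattice_iff (int_mem_lattice τ l u)).not.2 hz),
        E_one_lattice hz]
    rw [hE, eis_two_smul γ τ _ z]
    congr 4
    · field_simp
      ring
    · field_simp
      ring
  rw [slash_polySum] at h2
  rw [polySum, polySum] at h2
  rw [← h2]
  refine Finset.sum_congr rfl fun i _ => Finset.sum_congr rfl fun j _ => ?_
  rw [slash_weight_sub, mul_pow, mul_pow]
  ring

/-- Functions holomorphic off the lattice with poles of bounded order at `z = 0`, of moderate
growth at all real points. -/
def moderateForms : Subalgebra ℂ (ℍ → ℂ → ℂ) where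
  carrier := {φ | PolesInLattice φ ∧ (∃ n, ∀ τ, ∃ v, LeadAt φ n τ v) ∧
    ∀ u : ℝ, 0 < u → u < 1 → ModerateAtInfty fun τ => φ τ u}
  mul_mem' := by
    rintro φ ψ ⟨h1, ⟨n, h2⟩, h3⟩ ⟨h1', ⟨n', h2'⟩, h3'⟩
    refine ⟨fun τ z hz => (h1 τ z hz).mul (h1' τ z hz), ⟨n + n', fun τ => ?_⟩,
      fun u h0 h1 => (h3 u h0 h1).mul (h3' u h0 h1)⟩
    obtain ⟨v, hv⟩ := h2 τ
    obtain ⟨w, hw⟩ := h2' τ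
    exact ⟨_, hv.mul hw⟩
  add_mem' := by
    rintro φ ψ ⟨h1, ⟨n, h2⟩, h3⟩ ⟨h1', ⟨n', h2'⟩, h3'⟩
    refine ⟨fun τ z hz => (h1 τ z hz).add (h1' τ z hz), ⟨max n n', fun τ => ?_⟩,
      fun u h0 h1 => (h3 u h0 h1).add (h3' u h0 h1)⟩
    obtain ⟨v, hv⟩ := LeadAt.mono (h2 τ) (le_max_left n n')
    obtain ⟨w, hw⟩ := LeadAt.mono (h2' τ) (le_max_right n n')
    exact ⟨_, hv.add hw⟩
  algebraMap_mem' c := ⟨fun τ z _ => HolAt.const c τ z,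
    ⟨0, fun τ => ⟨_, LeadAt.of_holAt (HolAt.const c τ 0)⟩⟩,
    fun u _ _ => .of_tendsto (tendsto_const_nhds (x := c))⟩

theorem Tame.mem_moderateForms {φ : ℍ → ℂ → ℂ} (h : Tame {(1, 0)} φ) : φ ∈ moderateForms := by
  have h1 := h.weakStrictlyMer rfl
  refine ⟨h.hol, ?_, fun u h0 h2 => ?_⟩
  · obtain ⟨n, hn⟩ := h.lead 0 0
    have e : shift 0 0 φ = φ := by
      funext τ z
      simp [shift]
    rw [e] at hn
    exact ⟨n, hn⟩
  · refine (WeakStrictlyMer.moderateAtInfty h1 (polesInLattice_holExtend h.hol) u h0 h2).congr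
      (.of_forall fun τ => ?_)
    simp only [holExtend_of_notMem h.hol (ofReal_notMem_lattice h0 h2 τ)]

theorem jacobiCoeff_mem (ha : ∀ i ≤ d, ∀ j ≤ d, a i j ∈ moderateForms) (i j : ℕ) :
    jacobiCoeff d a i j ∈ moderateForms := by
  simp only [jacobiCoeff, shiftCoeff]
  refine sum_mem fun i' hi' => mul_mem (mul_mem (sum_mem fun j' hj' => ?_) (natCast_mem _ _))
    (pow_mem (neg_mem tame_eis_two.mem_moderateForms) _)
  exact mul_mem (mul_mem (Subalgebra.smul_mem _ (ha i' (Finset.mem_range_succ_iff.1 hi') j'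
    (Finset.mem_range_succ_iff.1 hj')) _) (natCast_mem _ _))
    (pow_mem (neg_mem tame_E_one.mem_moderateForms) _)

/-! ### Quasi-Jacobi forms as polynomials in E₁ and e₂ over Jacobi forms -/

/-- Only holomorphy off the lattice, a pole bound at z = 0 and growth at real points pass through
the change of variables. This is all the structure theorem needs, so the new coefficients never have
to be shown of type `T`. -/
theorem JacobiForms.IsQuasiJacobi.res_mem {T : (ℍ → ℂ → ℂ) → Prop} {φ : ℍ → ℂ → ℂ}
    (h : IsQuasiJacobi T k m φ) (hp : PolesInLattice φ)
    (hT : ∀ ψ, T ψ → IsMeromorphic ψ ∧ (PolesInLattice ψ →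
      ∀ u : ℝ, 0 < u → u < 1 → ModerateAtInfty fun τ => ψ τ u))
    {A : Subalgebra ℂ (OffLattice → ℂ)} (hE : res (E 1) ∈ A) (he : res (eis 2) ∈ A)
    (hA : ∀ (k : ℤ) (ψ : ℍ → ℂ → ℂ), ψ ∈ moderateForms → SlashInv k m ψ → res ψ ∈ A) :
    res φ ∈ A := by
  obtain ⟨d, a, ha, hinv, rfl⟩ := h
  have hinv : AlmostInv k m d a := hinv
  have hpa := hinv.polesInLattice (fun i hi j hj => (hT _ (ha i hi j hj)).1) hp
  have hmem : ∀ i ≤ d, ∀ j ≤ d, a i j ∈ moderateForms := fun i hi j hj =>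
    ⟨hpa i hi j hj, exists_leadAt (hT _ (ha i hi j hj)).1 (hpa i hi j hj),
      (hT _ (ha i hi j hj)).2 (hpa i hi j hj)⟩
  have e : res (a 0 0) = ∑ i ∈ Finset.range (d + 1), ∑ j ∈ Finset.range (d + 1),
      res (jacobiCoeff d a i j) * res (eis 2) ^ i * res (E 1) ^ j := by
    funext p
    have := congrFun (congrFun (constantTerm_eq (d := d) (a := a)) p.1.1) p.1.2
    simp only [Finset.sum_apply, Pi.mul_apply, Pi.pow_apply] at this ⊢
    exact this
  rw [e]
  exact sum_mem fun i hi => sum_mem fun j hj => mul_mem (mul_mem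
    (hA _ _ (jacobiCoeff_mem hmem i j) (hinv.slashInv_jacobiCoeff hpa (Finset.mem_range_succ_iff.1 hi)
      (Finset.mem_range_succ_iff.1 hj))) (pow_mem he i)) (pow_mem hE j)

theorem wpAlg_le {A : Subalgebra ℂ (OffLattice → ℂ)} (h2 : res (E 2) ∈ A) (h3 : res (E 3) ∈ A)
    (he : res (eis 2) ∈ A) (h4 : res (eis 4) ∈ A) : wpAlg ≤ A := by
  rw [← genAlg_eq_wpAlg]
  refine Algebra.adjoin_le ?_
  rintro x (rfl | rfl | rfl)
  · exact sub_mem h2 he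
  · exact h3
  · exact h4

theorem latticeForms_quasi_weak : latticeForms (IsQuasiJacobi WeakStrictlyMer) {m | 0 ≤ m} =
    Subalgebra.toSubmodule (genAlg {res (E 1), res (E 2), res (E 3), res (eis 2), res (eis 4),
      res Theta}) := by
  refine le_antisymm (Submodule.span_le.2 ?_) le_latticeForms_quasi_weak
  rintro _ ⟨k, m, φ, hm, h, hp, rfl⟩
  refine h.res_mem hp (fun ψ hψ => ⟨hψ.1, WeakStrictlyMer.moderateAtInfty hψ⟩)
    (Algebra.subset_adjoin (by simp)) (Algebra.subset_adjoin (by simp)) fun k ψ hψ hs =>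
    res_mem_of_slashInv (wpAlg_le ?_ ?_ ?_ ?_) (Algebra.subset_adjoin (by simp)) hψ.2.1 hψ.1 hs hψ.2.2 hm
  all_goals exact Algebra.subset_adjoin (by simp)

theorem latticeForms_quasi_strict :
    latticeForms (fun k m => IsQuasiJacobi (StrictlyMer m) k m) {0} =
      Subalgebra.toSubmodule
        (genAlg {res (E 1), res (E 2), res (E 3), res (eis 2), res (eis 4)}) := by
  refine le_antisymm (Submodule.span_le.2 ?_) le_latticeForms_quasi_strict
  rintro _ ⟨k, m, φ, hm, h, hp, rfl⟩
  obtain rfl : m = 0 := hm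
  refine IsQuasiJacobi.res_mem h hp (fun ψ hψ => ⟨hψ.1, hψ.moderateAtInfty⟩)
    (Algebra.subset_adjoin (by simp)) (Algebra.subset_adjoin (by simp)) fun k ψ hψ hs =>
    wpAlg_le ?_ ?_ ?_ ?_ (res_mem_wpAlg_of_slashInv hψ.2.1 hψ.1 hs hψ.2.2)
  all_goals exact Algebra.subset_adjoin (by simp)

end Quasi

theorem mainTheorem11 :
    -- strictly meromorphic Jacobi forms of index `N / 2` with poles in the lattice
    (∀ (N : ℕ) (k : ℤ) (φ : ℍ → ℂ → ℂ),
      IsJacobi (StrictlyMer ((N : ℚ) / 2)) k ((N : ℚ) / 2) φ →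
      PolesInLattice φ →
      ∃ P ∈ genAlg {res wp, res wp',
          res (eis 4)},
        res φ = P * res Theta ^ N) ∧
    -- the same under the growth condition of weak Jacobi forms
    (∀ (N : ℕ) (k : ℤ) (φ : ℍ → ℂ → ℂ),
      IsJacobi WeakStrictlyMer k ((N : ℚ) / 2) φ →
      PolesInLattice φ →
      ∃ P ∈ genAlg {res wp, res wp',
          res (eis 4)},
        res φ = P * res Theta ^ N) ∧
    -- the algebras of Jacobi and quasi-Jacobi forms of non-negative index
    latticeForms (IsJacobi WeakStrictlyMer) {m | 0 ≤ m} =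
      Subalgebra.toSubmodule (genAlg
        {res (E 2 - eis 2), res (E 3),
          res (eis 4), res Theta}) ∧
    latticeForms (IsQuasiJacobi WeakStrictlyMer) {m | 0 ≤ m} =
      Subalgebra.toSubmodule (genAlg
        {res (E 1), res (E 2),
          res (E 3), res (eis 2),
          res (eis 4), res Theta}) ∧
    -- index zero, with moderate growth at all cusps and all real points
    latticeForms (fun k m => IsJacobi (StrictlyMer m) k m) {0} =
      Subalgebra.toSubmodule (genAlg
        {res (E 2 - eis 2), res (E 3),
          res (eis 4)}) ∧
    latticeForms
        (fun k m => IsQuasiJacobi (StrictlyMer m) k m) {0} =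
      Subalgebra.toSubmodule (genAlg
        {res (E 1), res (E 2),
          res (E 3), res (eis 2),
          res (eis 4)}) := by
  refine ⟨fun N k φ h hp => ?_, fun N k φ h hp => ?_, latticeForms_jacobi_weak,
    latticeForms_quasi_weak, latticeForms_jacobi_strict, latticeForms_quasi_strict⟩
  · exact exists_eq_mul_Theta_pow (exists_leadAt h.1.1 hp) hp h.slashInv (h.1.moderateAtInfty hp)
  · exact exists_eq_mul_Theta_pow (exists_leadAt h.1.1 hp) hp h.slashInv
      (WeakStrictlyMer.moderateAtInfty h.1 hp)
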